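/- Let $M$ be a connected smooth manifold (possibly with boundary; Hausdorff, second countable), let $\omega$ be a volume form on $M$ whose induced measure (also denoted $\omega$) is finite, and let $*\in M$ be a basepoint such that $\pi_1(M,*)$ has trivial centre. The product $\gamma\delta$ in $\pi_1(M,*)$ means first $\gamma$, then $\delta$. Let $\mathrm{Homeo}_0(M,\omega)$ be the group of $\omega$-preserving homeomorphisms of $M$ that are isotopic to the identity through $\omega$-preserving homeomorphisms, with product $(fg)(x)=g(f(x))$, regarded as a discrete group. For a discrete group $G$, $H_b^n(G)$ is the bounded cohomology of $G$ with real coefficients, i.e. the cohomology of the complex of bounded $G$-invariant functions $G^{n+1}\to\mathbb{R}$, and $\|C\|$ is the infimum of the supremum norms of the bounded cocycles representing $C\in H_b^n(G)$. A measurable system of paths $S$ assigns to every $x\in M$ the homotopy class, relative to the endpoints, of a path from $*$ to $x$, such that the image of $S$ in the universal cover $\widetilde M$ is measurable for (the completion of) the pulled back measure. For $f\in\mathrm{Homeo}_0(M,\omega)$ and $x\in M$ let $\gamma(f,x)\in\pi_1(M,*)$ be the class of the concatenation of $S(x)$, the trajectory $f_t(x)$ of $x$ under an isotopy $f_t$ through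 $\omega$-preserving homeomorphisms from $\mathrm{id}_M$ to $f$, and the reverse of $S(f(x))$; since the centre is trivial, this does not depend on the isotopy. Let $$\Gamma_b\colon H_b^n(\pi_1(M,*))\to H_b^n(\mathrm{Homeo}_0(M,\omega))$$ be induced by $$\Gamma_b(c)(f_0,\dots,f_n)=\int_M c(\gamma(f_0,x),\dots,\gamma(f_n,x))\,d\omega(x),$$ for any measurable system of paths $S$. Let $i\colon F\to\pi_1(M,*)$ be an injective homomorphism from a non-abelian free group $F$. Then every neighbourhood of $*$ contains a closed coordinate ball $B$ around $*$ (if $*\in\partial M$: the part in $M$ of a closed ball in a boundary chart) such that, with $\Lambda=\omega(B)$, for every $\varepsilon>0$ there is a homomorphism $\rho\colon F\to\mathrm{Homeo}_0(M,\omega)$ with $$\|\rho^*\Gamma_b(C)-\Lambda\, i^*(C)\|\le\varepsilon\|C\|\qquad\text{for all } n\ge 1 \text{ and all } C\in H_b^n(\pi_1(M,*)).$$ -/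

import Mathlib

open Set Filter Topology MeasureTheory
open scoped Manifold ContDiff

noncomputable section

namespace BoundedCohomology

/-! ### Bounded cohomology of a discrete group -/

/-- A bounded `G`-invariant homogeneous `n`-cochain `c : G^{n+1} → ℝ`. -/
@[ext]
structure Cochain (G : Type*) [Group G] (n : ℕ) where
  /-- The underlying function on `(n+1)`-tuples. -/
  toFun : (Fin (n + 1) → G) → ℝ
  bounded : ∃ K : ℝ, ∀ g, |toFun g| ≤ K
  invariant : ∀ (h : G) (g : Fin (n + 1) → G), toFun (fun j => h * g j) = toFun g

namespace Cochain

variable {G : Type*} [Group G] {n : ℕ}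

instance : CoeFun (Cochain G n) fun _ => (Fin (n + 1) → G) → ℝ := ⟨toFun⟩

theorem toFun_injective : Function.Injective (toFun : Cochain G n → _) := fun _ _ h => Cochain.ext h

instance : Zero (Cochain G n) := ⟨⟨fun _ => 0, ⟨0, fun _ => by simp⟩, fun _ _ => rfl⟩⟩

instance : Add (Cochain G n) := ⟨fun a b => ⟨fun g => a g + b g, by
    obtain ⟨K, hK⟩ := a.bounded
    obtain ⟨L, hL⟩ := b.bounded
    exact ⟨K + L, fun g => (abs_add_le _ _).trans (add_le_add (hK g) (hL g))⟩,
  fun h g => by rw [a.invariant h g, b.invariant h g]⟩⟩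

/-- Multiplication of a cochain by a real number. -/
def smulReal (r : ℝ) (a : Cochain G n) : Cochain G n := ⟨fun g => r * a g, by
    obtain ⟨K, hK⟩ := a.bounded
    exact ⟨|r| * K, fun g => (abs_mul r _).trans_le
      (mul_le_mul_of_nonneg_left (hK g) (abs_nonneg r))⟩,
  fun h g => by rw [a.invariant h g]⟩

instance : SMul ℝ (Cochain G n) := ⟨smulReal⟩

instance : SMul ℕ (Cochain G n) := ⟨fun k => smulReal k⟩

instance : SMul ℤ (Cochain G n) := ⟨fun k => smulReal k⟩

instance : Neg (Cochain G n) := ⟨smulReal (-1)⟩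

instance : Sub (Cochain G n) := ⟨fun a b => a + -b⟩

instance : AddCommGroup (Cochain G n) :=
  toFun_injective.addCommGroup _ rfl (fun _ _ => rfl)
    (fun _ => funext fun _ => neg_one_mul _)
    (fun a b => funext fun g => by
      change a g + -1 * b g = a g - b g
      ring)
    (fun a k => funext fun g => (nsmul_eq_mul k (a g)).symm)
    (fun a k => funext fun g => (zsmul_eq_mul (a g) k).symm)

/-- The underlying function, as an additive homomorphism. -/
def toFunHom : Cochain G n →+ ((Fin (n + 1) → G) → ℝ) where
  toFun := toFun
  map_zero' := rfl
  map_add' _ _ := rfl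

instance : Module ℝ (Cochain G n) :=
  toFun_injective.module ℝ toFunHom fun _ _ => rfl

@[simp] theorem add_apply (a b : Cochain G n) (g : Fin (n + 1) → G) : (a + b) g = a g + b g := rfl

@[simp] theorem smul_apply (r : ℝ) (a : Cochain G n) (g : Fin (n + 1) → G) :
    (r • a) g = r * a g := rfl

end Cochain

variable {G : Type*} [Group G] {G' : Type*} [Group G']

/-- The supremum norm of a bounded cochain. -/
def Cochain.supNorm {n : ℕ} (c : Cochain G n) : ℝ := ⨆ g, |c g|

/-- The coboundary
`(d c)(g₀, …, g_{n+1}) = ∑ i, (-1)^i c(g₀, …, ĝ_i, …, g_{n+1})`. -/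
def coboundary (G : Type*) [Group G] (n : ℕ) : Cochain G n →ₗ[ℝ] Cochain G (n + 1) where
  toFun c := ⟨fun g => ∑ i : Fin (n + 2), (-1 : ℝ) ^ (i : ℕ) * c (fun j => g (i.succAbove j)), by
    obtain ⟨K, hK⟩ := c.bounded
    refine ⟨∑ i : Fin (n + 2), K, fun g => ?_⟩
    refine (Finset.abs_sum_le_sum_abs _ _).trans (Finset.sum_le_sum fun i _ => ?_)
    rw [abs_mul, abs_pow, abs_neg, abs_one, one_pow, one_mul]
    exact hK _, fun h g => Finset.sum_congr rfl fun i _ => by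
      rw [c.invariant h (fun j => g (i.succAbove j))]⟩
  map_add' a b := Cochain.ext <| funext fun g => by
    simp only [Cochain.add_apply, mul_add, Finset.sum_add_distrib]
  map_smul' r a := Cochain.ext <| funext fun g => by
    simp only [Cochain.smul_apply, RingHom.id_apply, Finset.mul_sum]
    exact Finset.sum_congr rfl fun i _ => by ring

/-- Bounded `n`-cocycles. -/
abbrev Cocycle (G : Type*) [Group G] (n : ℕ) : Submodule ℝ (Cochain G n) :=
  LinearMap.ker (coboundary G n)

/-- Coboundaries of bounded cochains; there are none in degree `0`. -/
def Boundary (G : Type*) [Group G] : (n : ℕ) → Submodule ℝ (Cochain G n)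
  | 0 => ⊥
  | n + 1 => LinearMap.range (coboundary G n)

/-- Bounded cohomology `H_b^n(G)` with real coefficients: bounded cocycles modulo
coboundaries of bounded cochains. -/
abbrev Hb (n : ℕ) (G : Type*) [Group G] : Type _ :=
  Cocycle G n ⧸ (Boundary G n).comap (Cocycle G n).subtype

/-- The class of a bounded cocycle. -/
abbrev Hb.mk {n : ℕ} (c : Cocycle G n) : Hb n G := Submodule.Quotient.mk c

/-- The canonical seminorm on bounded cohomology: the infimum of the supremum norms of the
bounded cocycles representing a class. -/
def Hb.seminorm {n : ℕ} (C : Hb n G) : ℝ :=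
  sInf {r : ℝ | ∃ c : Cocycle G n, Hb.mk c = C ∧ r = c.1.supNorm}

/-- The map on bounded cohomology induced by a morphism of the complexes of bounded
invariant cochains. -/
def Hb.map (φ : ∀ n, Cochain G n →ₗ[ℝ] Cochain G' n)
    (hφ : ∀ n c, φ (n + 1) (coboundary G n c) = coboundary G' n (φ n c)) (n : ℕ) :
    Hb n G →ₗ[ℝ] Hb n G' :=
  Submodule.mapQ _ _
    ((φ n).restrict (p := Cocycle G n) (q := Cocycle G' n) (fun c hc => by
      rw [LinearMap.mem_ker] at hc ⊢
      rw [← hφ, hc, map_zero]))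
    (by
      rintro ⟨c, hc⟩ hb
      rw [Submodule.mem_comap, Submodule.mem_comap]
      rw [Submodule.mem_comap] at hb
      change c ∈ Boundary G n at hb
      change φ n c ∈ Boundary G' n
      cases n with
      | zero =>
        change c = 0 at hb
        change φ 0 c = 0
        rw [hb, map_zero]
      | succ n =>
        obtain ⟨b, rfl⟩ := hb
        exact ⟨φ n b, (hφ n b).symm⟩)

/-- Pull-back of bounded cochains along a group homomorphism. -/
def Cochain.pullback (f : G' →* G) (n : ℕ) : Cochain G n →ₗ[ℝ] Cochain G' n where
  toFun c := ⟨fun g => c (fun j => f (g j)), by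
    obtain ⟨K, hK⟩ := c.bounded
    exact ⟨K, fun g => hK _⟩, fun h g => by
      simp only [map_mul]
      exact c.invariant (f h) (fun j => f (g j))⟩
  map_add' _ _ := rfl
  map_smul' _ _ := rfl

/-- The map `f^* : H_b^n(G) → H_b^n(G')` induced by a group homomorphism `f : G' → G`. -/
def Hb.pullback (f : G' →* G) (n : ℕ) : Hb n G →ₗ[ℝ] Hb n G' :=
  Hb.map (Cochain.pullback f) (fun _ _ => rfl) n

end BoundedCohomology

namespace GambaudoGhys

open BoundedCohomology
open Path (Homotopic)

/-! ### Paths, systems of paths and the universal cover -/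

section Paths

variable {X : Type*} [TopologicalSpace X]

/-- The fundamental group with the product `γ δ` = "first `γ`, then `δ`" (the multiplication of
`FundamentalGroup` is the opposite one). -/
abbrev Pi1 (X : Type*) [TopologicalSpace X] (x₀ : X) : Type _ := (FundamentalGroup X x₀)ᵐᵒᵖ

/-- The homotopy class of a loop, as an element of the fundamental group. -/
def Pi1.of {x₀ : X} (p : Homotopic.Quotient x₀ x₀) : Pi1 X x₀ := MulOpposite.op (FundamentalGroup.fromPath p)

theorem Pi1.of_trans {x₀ : X} (p q : Homotopic.Quotient x₀ x₀) :
    Pi1.of (p.trans q) = Pi1.of p * Pi1.of q := rfl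

theorem Pi1.of_symm {x₀ : X} (p : Homotopic.Quotient x₀ x₀) : Pi1.of p.symm = (Pi1.of p)⁻¹ := rfl

theorem Pi1.of_injective {x₀ : X} : Function.Injective (Pi1.of (x₀ := x₀)) :=
  MulOpposite.op_injective

theorem Pi1.of_surjective {x₀ : X} : Function.Surjective (Pi1.of (x₀ := x₀)) :=
  MulOpposite.op_surjective

/-- A system of paths: for every point `x` the homotopy class, relative to the endpoints,
of a path from the base point to `x`. Equivalently, a section of the universal cover. -/
abbrev PathSystem (x₀ : X) : Type _ := ∀ x : X, Homotopic.Quotient x₀ x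

/-- The universal cover as a set: homotopy classes relative to endpoints of paths starting
at the base point. -/
abbrev UniversalCover (x₀ : X) : Type _ := Σ x : X, Homotopic.Quotient x₀ x

/-- The basic open subsets of the universal cover: all classes obtained from the point `q`
over `x ∈ U` by continuing along paths inside the open set `U`. -/
def sheet {x₀ : X} (U : Set X) (x : X) (q : Homotopic.Quotient x₀ x) : Set (UniversalCover x₀) :=
  {z | ∃ p : Path x z.1, (∀ t, p t ∈ U) ∧ z.2 = q.trans (Homotopic.Quotient.mk p)}

/-- A system of paths `S` is measurable if its image in the universal cover is measurable for
(the completion of) the pulled back measure. The basic open sets `sheet U x q` which are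
mapped homeomorphically to `U` carry the measure `μ` restricted to `U`, and countably many of them
cover the universal cover, so this means that the image of `S` intersected with every
basic open set projects to a `μ`-measurable subset. -/
def PathSystem.IsMeasurable [MeasurableSpace X] {x₀ : X} (S : PathSystem x₀) (μ : Measure X) :
    Prop :=
  ∀ U : Set X, IsOpen U → ∀ x ∈ U, ∀ q : Homotopic.Quotient x₀ x,
    NullMeasurableSet
      ((Sigma.fst : UniversalCover x₀ → X) ''
        (range (fun y => (⟨y, S y⟩ : UniversalCover x₀)) ∩ sheet U x q)) μ

theorem image_range_inter_sheet {x₀ : X} (S : PathSystem x₀) (U : Set X) (x : X)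
    (q : Homotopic.Quotient x₀ x) :
    (Sigma.fst : UniversalCover x₀ → X) ''
        (range (fun y => (⟨y, S y⟩ : UniversalCover x₀)) ∩ sheet U x q) =
      {y | ∃ p : Path x y, (∀ t, p t ∈ U) ∧ S y = q.trans (Homotopic.Quotient.mk p)} := by
  ext y
  constructor
  · rintro ⟨z, ⟨⟨w, rfl⟩, p, hp, hq⟩, rfl⟩
    exact ⟨p, hp, hq⟩
  · rintro ⟨p, hp, hq⟩
    exact ⟨⟨y, S y⟩, ⟨⟨y, rfl⟩, p, hp, hq⟩, rfl⟩

/-- Every point has arbitrarily small simply connected open neighbourhoods. -/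
def LocallySimplyConnected (X : Type*) [TopologicalSpace X] : Prop :=
  ∀ x : X, ∀ U ∈ 𝓝 x, ∃ V ⊆ U, IsOpen V ∧ x ∈ V ∧ IsSimplyConnected V

theorem mk_eq_of_isSimplyConnected {V : Set X} (hV : IsSimplyConnected V) {x y : X}
    (p p' : Path x y) (hp : ∀ t, p t ∈ V) (hp' : ∀ t, p' t ∈ V) :
    Homotopic.Quotient.mk p = Homotopic.Quotient.mk p' := by
  have := hV.simplyConnectedSpace
  have hx : x ∈ V := by simpa using hp 0
  have hy : y ∈ V := by simpa using hp 1
  let r : Path (⟨x, hx⟩ : V) ⟨y, hy⟩ :=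
    { toFun := fun t => ⟨p t, hp t⟩, source' := by simp, target' := by simp }
  let r' : Path (⟨x, hx⟩ : V) ⟨y, hy⟩ :=
    { toFun := fun t => ⟨p' t, hp' t⟩, source' := by simp, target' := by simp }
  exact Homotopic.Quotient.eq.2 ((SimplyConnectedSpace.paths_homotopic r r').map ⟨_, continuous_subtype_val⟩)

theorem exists_path_of_isSimplyConnected {V : Set X} (hV : IsSimplyConnected V) {x y : X}
    (hx : x ∈ V) (hy : y ∈ V) : ∃ p : Path x y, ∀ t, p t ∈ V := by
  obtain ⟨p, hp⟩ := hV.isPathConnected.joinedIn x hx y hy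
  exact ⟨p, hp⟩

theorem trans_mem {V : Set X} {x y z : X} {p : Path x y} {q : Path y z} (hp : ∀ t, p t ∈ V)
    (hq : ∀ t, q t ∈ V) : ∀ t, p.trans q t ∈ V := by
  intro t
  have h : p.trans q t ∈ range (p.trans q) := mem_range_self t
  rw [Path.trans_range] at h
  rcases h with ⟨s, hs⟩ | ⟨s, hs⟩
  · rw [← hs]; exact hp s
  · rw [← hs]; exact hq s

theorem mk_trans_cast {x y z x' y' z' : X} (p : Path x y) (q : Path y z) (hx : x' = x)
    (hy : y' = y) (hz : z' = z) :
    (p.trans q).cast hx hz = (p.cast hx hy).trans (q.cast hy hz) := by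
  subst hx hy hz
  rfl

open Classical in
/-- One step of the enumeration of homotopy classes. -/
def enumStep {x₀ : X} {s : Type*} (V : s → Set X) {D : Set X} (z : UniversalCover x₀) (a : s × D) :
    UniversalCover x₀ :=
  if h : ∃ r : Path z.1 a.2.1, ∀ t, r t ∈ V a.1 then ⟨a.2.1, z.2.trans (Homotopic.Quotient.mk h.choose)⟩
  else z

theorem countable_quotient [SecondCountableTopology X] (hX : LocallySimplyConnected X)
    (x₀ y : X) : Countable (Homotopic.Quotient x₀ y) := by
  choose W hWU hWo hWx hWs using fun x : X => hX x univ univ_mem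
  obtain ⟨s, hs, hcov⟩ := TopologicalSpace.countable_cover_nhds fun x => (hWo x).mem_nhds (hWx x)
  obtain ⟨D, hD, hDd⟩ := TopologicalSpace.exists_countable_dense X
  have : Countable s := hs
  have : Countable D := hD
  let V : s → Set X := fun j => W j
  have hVs : ∀ j, IsSimplyConnected (V j) := fun j => hWs j
  have hVo : ∀ j, IsOpen (V j) := fun j => hWo j
  have hVc : ∀ x, ∃ j, x ∈ V j := fun x => by
    have : x ∈ ⋃ x ∈ s, W x := hcov ▸ mem_univ x
    simp only [mem_iUnion] at this
    obtain ⟨j, hj, hx⟩ := this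
    exact ⟨⟨j, hj⟩, hx⟩
  let K : List (s × D) → UniversalCover x₀ := fun l => l.foldr (fun a z => enumStep V z a)
    ⟨x₀, Homotopic.Quotient.refl x₀⟩
  have key : ∀ p : Path x₀ y, ∃ l : List (s × D), ∃ j, ∃ r : Path (K l).1 y,
      (∀ t, r t ∈ V j) ∧ Homotopic.Quotient.mk p = (K l).2.trans (Homotopic.Quotient.mk r) := by
    intro p
    let C : ∀ t, Homotopic.Quotient x₀ (p t) := fun t =>
      Homotopic.Quotient.mk ((p.subpath 0 t).cast p.source.symm rfl)
    have hC : ∀ t t', C t' = (C t).trans (Homotopic.Quotient.mk (p.subpath t t')) := by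
      intro t t'
      have h := (Path.Homotopic.pathCast
        (p := (p.subpath 0 t).trans (p.subpath t t')) (q := p.subpath 0 t')
        ⟨Path.Homotopy.subpathTransSubpath p 0 t t'⟩ p.source.symm rfl)
      rw [← Homotopic.Quotient.eq] at h
      exact h.symm
    let T : unitInterval → Prop := fun t => ∃ l : List (s × D), ∃ j, ∃ r : Path (K l).1 (p t),
      (∀ u, r u ∈ V j) ∧ C t = (K l).2.trans (Homotopic.Quotient.mk r)
    have hstep : ∀ (i : s) (t t' : unitInterval), (∀ u ∈ uIcc t t', p u ∈ V i) → T t → T t' := by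
      rintro i t t' hi ⟨l, j, r, hr, hCt⟩
      have hti : p t ∈ V i := hi t left_mem_uIcc
      have htj : p t ∈ V j := by simpa using hr 1
      obtain ⟨V', hV', hVo', htV', hVs'⟩ := hX (p t) (V i ∩ V j)
        (((hVo i).inter (hVo j)).mem_nhds ⟨hti, htj⟩)
      obtain ⟨d, hdV, hdD⟩ := hDd.inter_open_nonempty V' hVo' ⟨_, htV'⟩
      obtain ⟨e, he⟩ := exists_path_of_isSimplyConnected hVs' htV' hdV
      have hex : ∃ r : Path (K l).1 d, ∀ t, r t ∈ V j :=
        ⟨r.trans e, trans_mem hr fun t => (hV' (he t)).2⟩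
      have hK : K ((j, ⟨d, hdD⟩) :: l) = ⟨d, (K l).2.trans (Homotopic.Quotient.mk hex.choose)⟩ := by
        change enumStep V (K l) (j, ⟨d, hdD⟩) = _
        unfold enumStep
        exact dif_pos hex
      have hch : Homotopic.Quotient.mk hex.choose = (Homotopic.Quotient.mk r).trans (Homotopic.Quotient.mk e) :=
        mk_eq_of_isSimplyConnected (hVs j) _ (r.trans e) hex.choose_spec
          (trans_mem hr fun t => (hV' (he t)).2)
      refine ⟨(j, ⟨d, hdD⟩) :: l, i, ?_⟩
      rw [hK]
      refine ⟨e.symm.trans (p.subpath t t'), trans_mem (fun u => ?_) (fun u => ?_), ?_⟩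
      · exact (hV' (he _)).1
      · have : p.subpath t t' u ∈ range (p.subpath t t') := mem_range_self u
        rw [Path.range_subpath] at this
        obtain ⟨v, hv, hv'⟩ := this
        rw [← hv']
        exact hi v hv
      · rw [hC t t', hCt, hch, Homotopic.Quotient.mk_trans, Homotopic.Quotient.mk_symm]
        simp only [Homotopic.Quotient.trans_assoc]
        rw [← Homotopic.Quotient.trans_assoc (Homotopic.Quotient.mk e), Homotopic.Quotient.trans_symm, Homotopic.Quotient.refl_trans]
    have hloc : IsLocallyConstant T := by
      rw [IsLocallyConstant.iff_eventually_eq]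
      intro t
      obtain ⟨i, hi⟩ := hVc (p t)
      have hn : p ⁻¹' (V i) ∈ 𝓝 t := p.continuous.continuousAt ((hVo i).mem_nhds hi)
      obtain ⟨ε, hε, hb⟩ := Metric.mem_nhds_iff.1 hn
      filter_upwards [Metric.ball_mem_nhds t hε] with t' ht'
      have hu : ∀ u ∈ uIcc t t', p u ∈ V i := fun u hu => hb <| by
        rw [Metric.mem_ball, Subtype.dist_eq, Real.dist_eq] at ht' ⊢
        have h1 : (u : ℝ) ∈ uIcc (t : ℝ) t' := by
          rcases le_total t t' with h | h
          · rw [uIcc_of_le h] at hu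
            rw [uIcc_of_le (show (t : ℝ) ≤ t' from h)]
            exact hu
          · rw [uIcc_of_ge h] at hu
            rw [uIcc_of_ge (show (t' : ℝ) ≤ t from h)]
            exact hu
        exact (abs_sub_left_of_mem_uIcc h1).trans_lt ht'
      refine propext ⟨hstep i t' t fun u hu' => hu u (by rwa [uIcc_comm]), hstep i t t' hu⟩
    have h0 : T 0 := by
      obtain ⟨j, hj⟩ := hVc x₀
      refine ⟨[], j, (Path.refl x₀).cast rfl p.source, fun u => hj, ?_⟩
      have hr : ((p.subpath 0 0).cast p.source.symm rfl) = (Path.refl x₀).cast rfl p.source := by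
        ext u
        simp
      change Homotopic.Quotient.mk ((p.subpath 0 0).cast p.source.symm rfl) = _
      rw [hr]
      exact (Homotopic.Quotient.refl_trans _).symm
    have h1 : T 1 := by
      have := hloc.apply_eq_of_isPreconnected isPreconnected_univ (mem_univ 0) (mem_univ 1)
      rwa [← this]
    obtain ⟨l, j, r, hr, hCr⟩ := h1
    refine ⟨l, j, r.cast rfl p.target.symm, hr, ?_⟩
    have hp : p = (((p.subpath 0 1).cast p.source.symm rfl).cast rfl p.target.symm) := by
      ext u
      simp
    have h2 := congrArg (fun c : Homotopic.Quotient x₀ (p 1) => c.cast rfl p.target.symm) hCr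
    have hp' : Homotopic.Quotient.mk p = (C 1).cast rfl p.target.symm :=
      congrArg Homotopic.Quotient.mk hp
    have hcast : ∀ {z : X} (hz : z = p 1) (a : Homotopic.Quotient x₀ (K l).1)
        (b : Homotopic.Quotient (K l).1 (p 1)),
        (a.trans b).cast rfl hz = a.trans (b.cast rfl hz) := by
      rintro z rfl a b
      simp
    exact hp'.trans (h2.trans (hcast _ _ _))
  rw [← Set.countable_univ_iff]
  refine (Set.countable_iUnion fun l : List (s × D) => Set.countable_iUnion fun j : s =>
    Set.Subsingleton.countable (s := {q : Homotopic.Quotient x₀ y | ∃ r : Path (K l).1 y,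
      (∀ t, r t ∈ V j) ∧ q = (K l).2.trans (Homotopic.Quotient.mk r)}) ?_).mono ?_
  · rintro _ ⟨r, hr, rfl⟩ _ ⟨r', hr', rfl⟩
    rw [mk_eq_of_isSimplyConnected (hVs j) r r' hr hr']
  · intro q _
    obtain ⟨p, rfl⟩ := Homotopic.Quotient.mk_surjective q
    obtain ⟨l, j, r, hr, h⟩ := key p
    exact mem_iUnion.2 ⟨l, mem_iUnion.2 ⟨j, r, hr, h⟩⟩

end Paths

/-! ### The group `Homeo₀(X, μ)` and the cocycle `γ` -/

section Homeo

variable {X : Type*} [TopologicalSpace X] [MeasurableSpace X]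

/-- `H` is an isotopy from the identity to `f` through `μ`-preserving homeomorphisms. -/
structure IsIsotopy (μ : Measure X) (H : unitInterval → X ≃ₜ X) (f : X ≃ₜ X) : Prop where
  zero : H 0 = Homeomorph.refl X
  one : H 1 = f
  continuous : Continuous fun p : unitInterval × X => H p.1 p.2
  measurePreserving : ∀ t, MeasurePreserving (H t) μ μ

variable {μ : Measure X}

/-- The trajectory `t ↦ H t x` of a point under an isotopy from the identity to `f`. -/
def IsIsotopy.trajectory {H : unitInterval → X ≃ₜ X} {f : X ≃ₜ X} (h : IsIsotopy μ H f) (x : X) :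
    Path x (f x) where
  toFun t := H t x
  continuous_toFun := h.continuous.comp (continuous_id.prodMk continuous_const)
  source' := by rw [h.zero]; rfl
  target' := by rw [h.one]

theorem IsIsotopy.square {H : unitInterval → X ≃ₜ X} {f : X ≃ₜ X} (h : IsIsotopy μ H f) {x y : X}
    (p : Path x y) :
    (Homotopic.Quotient.mk p).trans (Homotopic.Quotient.mk (h.trajectory y)) =
      (Homotopic.Quotient.mk (h.trajectory x)).trans
        (Homotopic.Quotient.mk (p.map f.continuous)) := by
  let F : ContinuousMap.Homotopy (ContinuousMap.id X) (f : C(X, X)) :=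
    { toFun := fun p => H p.1 p.2
      continuous_toFun := h.continuous
      map_zero_left := fun x => by rw [h.zero]; rfl
      map_one_left := fun x => by rw [h.one]; rfl }
  exact Homotopic.Quotient.eq.2 (Path.Homotopic.map_trans_evalAt F p)

/-- Since the fundamental group has trivial centre, the homotopy class of the trajectory does not
depend on the isotopy. -/
theorem IsIsotopy.trajectory_unique {x₀ : X} (hZ : Subgroup.center (Pi1 X x₀) = ⊥)
    (S : PathSystem x₀) {H H' : unitInterval → X ≃ₜ X} {f : X ≃ₜ X} (h : IsIsotopy μ H f)
    (h' : IsIsotopy μ H' f) (x : X) :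
    Homotopic.Quotient.mk (h.trajectory x) = Homotopic.Quotient.mk (h'.trajectory x) := by
  have h0 : Homotopic.Quotient.mk (h.trajectory x₀) = Homotopic.Quotient.mk (h'.trajectory x₀) := by
    set a := Homotopic.Quotient.mk (h.trajectory x₀) with ha
    set b := Homotopic.Quotient.mk (h'.trajectory x₀) with hb
    have hc : Pi1.of (a.trans b.symm) ∈ Subgroup.center (Pi1 X x₀) := by
      rw [Subgroup.mem_center_iff]
      intro g
      obtain ⟨q, rfl⟩ := Pi1.of_surjective g
      obtain ⟨p, rfl⟩ := Homotopic.Quotient.mk_surjective q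
      rw [← Pi1.of_trans, ← Pi1.of_trans]
      congr 1
      have e1 := h.square p
      have e2 := h'.square p
      rw [← ha] at e1
      rw [← hb] at e2
      have e3 : Homotopic.Quotient.mk (p.map f.continuous) =
          b.symm.trans ((Homotopic.Quotient.mk p).trans b) := by
        rw [e2, ← Homotopic.Quotient.trans_assoc, Homotopic.Quotient.symm_trans,
          Homotopic.Quotient.refl_trans]
      rw [← Homotopic.Quotient.trans_assoc, e1, e3]
      simp only [Homotopic.Quotient.trans_assoc, Homotopic.Quotient.trans_symm,
        Homotopic.Quotient.trans_refl]
    rw [hZ, Subgroup.mem_bot] at hc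
    have hc' : a.trans b.symm = Homotopic.Quotient.refl x₀ := Pi1.of_injective hc
    calc a = (a.trans b.symm).trans b := by
          rw [Homotopic.Quotient.trans_assoc, Homotopic.Quotient.symm_trans,
            Homotopic.Quotient.trans_refl]
      _ = b := by rw [hc', Homotopic.Quotient.refl_trans]
  obtain ⟨p, -⟩ := Homotopic.Quotient.mk_surjective (S x)
  have e1 := h.square p
  have e2 := h'.square p
  rw [h0, ← e2] at e1
  have e3 := congrArg (fun c => (Homotopic.Quotient.mk p).symm.trans c) e1
  simpa only [← Homotopic.Quotient.trans_assoc, Homotopic.Quotient.symm_trans,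
    Homotopic.Quotient.refl_trans] using e3

theorem trajectory_mul {H K : unitInterval → X ≃ₜ X} {f g k : X ≃ₜ X} (hf : IsIsotopy μ H f)
    (hg : IsIsotopy μ K g) (hk : IsIsotopy μ (fun t => (H t).trans (K t)) k)
    (hfg : ∀ x, k x = g (f x)) (x : X) :
    Homotopic.Quotient.mk ((hk.trajectory x).cast rfl (hfg x).symm) =
      (Homotopic.Quotient.mk (hf.trajectory x)).trans
        (Homotopic.Quotient.mk (hg.trajectory (f x))) := by
  let G : C(unitInterval × unitInterval, X) := ⟨fun u => K u.1 (H u.2 x),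
    hg.continuous.comp (continuous_fst.prodMk
      (hf.continuous.comp (continuous_snd.prodMk continuous_const)))⟩
  let d : Path ((0, 0) : unitInterval × unitInterval) (1, 1) :=
    { toFun := fun t => (t, t), source' := rfl, target' := rfl }
  let a : Path ((0, 0) : unitInterval × unitInterval) (0, 1) :=
    { toFun := fun t => (0, t), source' := rfl, target' := rfl }
  let b : Path ((0, 1) : unitInterval × unitInterval) (1, 1) :=
    { toFun := fun t => (t, 1), source' := rfl, target' := rfl }
  have : ContractibleSpace unitInterval := (convex_Icc (0 : ℝ) 1).contractibleSpace ⟨0, by simp⟩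
  have hd : d.Homotopic (a.trans b) := SimplyConnectedSpace.paths_homotopic d (a.trans b)
  have h00 : x = G (0, 0) := by simp [G, hf.zero, hg.zero]
  have h01 : f x = G (0, 1) := by simp [G, hf.one, hg.zero]
  have h11 : g (f x) = G (1, 1) := by simp [G, hf.one, hg.one]
  have h := Path.Homotopic.pathCast (hd.map G) h00 h11
  rw [Path.map_trans, mk_trans_cast _ _ h00 h01 h11] at h
  have e1 : (hk.trajectory x).cast rfl (hfg x).symm = (d.map G.continuous).cast h00 h11 := by
    ext t; rfl
  have e2 : hf.trajectory x = (a.map G.continuous).cast h00 h01 := by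
    ext t
    change H t x = K 0 (H t x)
    rw [hg.zero]; rfl
  have e3 : hg.trajectory (f x) = (b.map G.continuous).cast h01 h11 := by
    ext t
    change K t (f x) = K t (H 1 x)
    rw [hf.one]
  rw [e1, e2, e3, ← Homotopic.Quotient.mk_trans]
  exact Homotopic.Quotient.eq.2 h

variable [BorelSpace X]

variable (μ) in
/-- `Homeo₀(X, μ)`: the `μ`-preserving homeomorphisms which are isotopic to the identity through
`μ`-preserving homeomorphisms. The product `f g` is "first `f`, then `g`". -/
def homeo0 : Subgroup (X ≃ₜ X)ᵐᵒᵖ where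
  carrier := {f | ∃ H, IsIsotopy μ H f.unop}
  one_mem' := ⟨fun _ => Homeomorph.refl X, rfl, rfl, continuous_snd, fun _ => .id μ⟩
  mul_mem' := by
    rintro f g ⟨H, hH⟩ ⟨K, hK⟩
    refine ⟨fun t => (H t).trans (K t), ?_, ?_, ?_, fun t => ?_⟩
    · simp only [hH.zero, hK.zero]; rfl
    · simp only [hH.one, hK.one]; rfl
    · exact hK.continuous.comp (continuous_fst.prodMk hH.continuous)
    · exact (hK.measurePreserving t).comp (hH.measurePreserving t)
  inv_mem' := by
    rintro f ⟨H, hH⟩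
    have hf : MeasurePreserving f.unop μ μ := hH.one ▸ hH.measurePreserving 1
    refine ⟨fun t => f.unop.symm.trans (H (unitInterval.symm t)), ?_, ?_, ?_, fun t => ?_⟩
    · simp only [unitInterval.symm_zero, hH.one]
      exact f.unop.symm_trans_self
    · simp only [unitInterval.symm_one, hH.zero]; rfl
    · exact hH.continuous.comp ((unitInterval.continuous_symm.comp continuous_fst).prodMk
        (f.unop.symm.continuous.comp continuous_snd))
    · exact (hH.measurePreserving _).comp
        (MeasurePreserving.symm f.unop.toMeasurableEquiv hf)

variable (μ) in
/-- The group `Homeo₀(X, μ)`, considered as a discrete group. -/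
def Homeo0 : Type _ := homeo0 μ

instance : Group (Homeo0 μ) := inferInstanceAs (Group (homeo0 μ))

/-- The homeomorphism underlying an element of `Homeo₀(X, μ)`. -/
def Homeo0.toHomeo (f : Homeo0 μ) : X ≃ₜ X := f.1.unop

theorem Homeo0.mul_toHomeo (f g : Homeo0 μ) (x : X) :
    (f * g).toHomeo x = g.toHomeo (f.toHomeo x) := rfl

/-- A choice of an isotopy from the identity to `f`. -/
def Homeo0.isotopy (f : Homeo0 μ) : unitInterval → X ≃ₜ X := Classical.choose f.2

theorem Homeo0.isIsotopy (f : Homeo0 μ) : IsIsotopy μ f.isotopy f.toHomeo :=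
  Classical.choose_spec f.2

theorem Homeo0.measurePreserving (f : Homeo0 μ) : MeasurePreserving f.toHomeo μ μ :=
  f.isIsotopy.one ▸ f.isIsotopy.measurePreserving 1

/-- The homotopy class of the loop obtained by concatenating `S x`, the trajectory from `x` to `f x`
under an isotopy from the identity to `f`, and the reverse of `S (f x)`. -/
def cocycleGamma {x₀ : X} (S : PathSystem x₀) (f : Homeo0 μ) (x : X) : Pi1 X x₀ :=
  Pi1.of (((S x).trans (Homotopic.Quotient.mk (f.isIsotopy.trajectory x))).trans
    (S (f.toHomeo x)).symm)

/-- The cocycle identity `γ(fg, x) = γ(f, x) γ(g, f(x))`. -/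
theorem cocycleGamma_mul {x₀ : X} (hZ : Subgroup.center (Pi1 X x₀) = ⊥) (S : PathSystem x₀)
    (f g : Homeo0 μ) (x : X) :
    cocycleGamma S (f * g) x = cocycleGamma S f x * cocycleGamma S g (f.toHomeo x) := by
  have hk : IsIsotopy μ (fun t => (f.isotopy t).trans (g.isotopy t)) (f * g).toHomeo := by
    refine ⟨?_, ?_, ?_, fun t => ?_⟩
    · simp only [f.isIsotopy.zero, g.isIsotopy.zero]; rfl
    · simp only [f.isIsotopy.one, g.isIsotopy.one]; rfl
    · exact g.isIsotopy.continuous.comp (continuous_fst.prodMk f.isIsotopy.continuous)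
    · exact (g.isIsotopy.measurePreserving t).comp (f.isIsotopy.measurePreserving t)
  have h1 := IsIsotopy.trajectory_unique hZ S (f * g).isIsotopy hk x
  have h2 : Homotopic.Quotient.mk (hk.trajectory x) = _ :=
    trajectory_mul f.isIsotopy g.isIsotopy hk (fun _ => rfl) x
  unfold cocycleGamma
  rw [h1, h2, ← Pi1.of_trans]
  congr 1
  simp only [Homotopic.Quotient.trans_assoc]
  rw [← Homotopic.Quotient.trans_assoc (S (f.toHomeo x)).symm, Homotopic.Quotient.symm_trans,
    Homotopic.Quotient.refl_trans]
  refine (Homotopic.Quotient.trans_assoc _ _ _).trans ?_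
  exact congrArg (fun c => (S x).trans c) (Homotopic.Quotient.trans_assoc _ _ _)

theorem nullMeasurableSet_cocycleGamma [SecondCountableTopology X]
    (hX : LocallySimplyConnected X) {x₀ : X} {S : PathSystem x₀} (hS : S.IsMeasurable μ)
    (f : Homeo0 μ) (g : Pi1 X x₀) : NullMeasurableSet {x | cocycleGamma S f x = g} μ := by
  choose W hWU hWo hWx hWs using fun x : X => hX x univ univ_mem
  obtain ⟨s, hs, hcov⟩ := TopologicalSpace.countable_cover_nhds fun x => (hWo x).mem_nhds (hWx x)
  have hloc : ∀ x₁, NullMeasurableSet (W x₁ ∩ {x | cocycleGamma S f x = g}) μ := by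
    intro x₁
    obtain ⟨g', rfl⟩ := Pi1.of_surjective g
    have := countable_quotient hX x₀ x₁
    let T : ∀ x, Homotopic.Quotient x (f.toHomeo x) := fun x =>
      Homotopic.Quotient.mk (f.isIsotopy.trajectory x)
    let r : Homotopic.Quotient x₀ x₁ → Homotopic.Quotient x₀ (f.toHomeo x₁) := fun q =>
      g'.symm.trans (q.trans (T x₁))
    have heq : W x₁ ∩ {x | cocycleGamma S f x = Pi1.of g'} = ⋃ q : Homotopic.Quotient x₀ x₁,
        {y | ∃ p : Path x₁ y, (∀ t, p t ∈ W x₁) ∧ S y = q.trans (Homotopic.Quotient.mk p)} ∩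
        f.toHomeo ⁻¹' {y | ∃ p : Path (f.toHomeo x₁) y, (∀ t, p t ∈ f.toHomeo '' W x₁) ∧
          S y = (r q).trans (Homotopic.Quotient.mk p)} := by
      ext y
      simp only [mem_inter_iff, mem_iUnion, mem_preimage, mem_ofPred_eq]
      constructor
      · rintro ⟨hy, hg⟩
        have hg' := Pi1.of_injective hg
        obtain ⟨p, hp⟩ := exists_path_of_isSimplyConnected (hWs x₁) (hWx x₁) hy
        refine ⟨(S y).trans (Homotopic.Quotient.mk p).symm, ⟨p, hp, ?_⟩,
          p.map f.toHomeo.continuous, fun t => ⟨p t, hp t, rfl⟩, ?_⟩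
        · rw [Homotopic.Quotient.trans_assoc, Homotopic.Quotient.symm_trans,
            Homotopic.Quotient.trans_refl]
        · have e := f.isIsotopy.square p
          simp only [r, T, Homotopic.Quotient.trans_assoc]
          rw [← e, ← Homotopic.Quotient.trans_assoc (Homotopic.Quotient.mk p).symm,
            Homotopic.Quotient.symm_trans, Homotopic.Quotient.refl_trans]
          have : (S y).trans (Homotopic.Quotient.mk (f.isIsotopy.trajectory y)) =
              g'.trans (S (f.toHomeo y)) := by
            rw [← hg', Homotopic.Quotient.trans_assoc, Homotopic.Quotient.symm_trans,
              Homotopic.Quotient.trans_refl]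
          rw [this, ← Homotopic.Quotient.trans_assoc, Homotopic.Quotient.symm_trans,
            Homotopic.Quotient.refl_trans]
      · rintro ⟨q, ⟨p, hp, hq⟩, p', hp', hq'⟩
        refine ⟨by simpa using hp 1, ?_⟩
        have e := f.isIsotopy.square p
        have hpp : Homotopic.Quotient.mk p' =
            Homotopic.Quotient.mk (p.map f.toHomeo.continuous) :=
          mk_eq_of_isSimplyConnected ((f.toHomeo.isSimplyConnected_image).2 (hWs x₁)) _ _ hp'
            fun t => ⟨p t, hp t, rfl⟩
        change Pi1.of _ = _
        congr 1
        have e2 : (S y).trans (Homotopic.Quotient.mk (f.isIsotopy.trajectory y)) =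
            g'.trans (S (f.toHomeo y)) := by
          rw [hq, hq', hpp, Homotopic.Quotient.trans_assoc, e]
          simp only [r, T, ← Homotopic.Quotient.trans_assoc]
          rw [Homotopic.Quotient.trans_symm, Homotopic.Quotient.refl_trans]
        rw [e2, Homotopic.Quotient.trans_assoc, Homotopic.Quotient.trans_symm,
          Homotopic.Quotient.trans_refl]
    rw [heq]
    refine NullMeasurableSet.iUnion fun q => NullMeasurableSet.inter ?_ ?_
    · have := hS (W x₁) (hWo x₁) x₁ (hWx x₁) q
      rwa [image_range_inter_sheet] at this
    · have := hS (f.toHomeo '' W x₁) (f.toHomeo.isOpenMap _ (hWo x₁)) (f.toHomeo x₁)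
        ⟨x₁, hWx x₁, rfl⟩ (r q)
      rw [image_range_inter_sheet] at this
      exact this.preimage f.measurePreserving.quasiMeasurePreserving
  have hU : {x | cocycleGamma S f x = g} = ⋃ x₁ ∈ s, W x₁ ∩ {x | cocycleGamma S f x = g} := by
    rw [← iUnion₂_inter, hcov, univ_inter]
  rw [hU]
  exact NullMeasurableSet.biUnion hs fun x₁ _ => hloc x₁

theorem integrable_cocycleGamma [SecondCountableTopology X] [IsFiniteMeasure μ]
    (hX : LocallySimplyConnected X) {x₀ : X} {S : PathSystem x₀} (hS : S.IsMeasurable μ) {n : ℕ}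
    (c : Cochain (Pi1 X x₀) n) (f : Fin (n + 1) → Homeo0 μ) :
    Integrable (fun x => c (fun j => cocycleGamma S (f j) x)) μ := by
  obtain ⟨K, hK⟩ := c.bounded
  refine Integrable.of_bound (C := K) ?_ (Filter.Eventually.of_forall fun x =>
    (Real.norm_eq_abs _).trans_le (hK _))
  have hc : Countable (Pi1 X x₀) := by
    have := countable_quotient hX x₀ x₀
    exact Pi1.of_surjective.countable
  have hN : ∀ g : Fin (n + 1) → Pi1 X x₀,
      NullMeasurableSet {x | (fun j => cocycleGamma S (f j) x) = g} μ := by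
    intro g
    have : {x | (fun j => cocycleGamma S (f j) x) = g} =
        ⋂ j, {x | cocycleGamma S (f j) x = g j} := by
      ext x
      simp only [mem_ofPred_eq, mem_iInter, funext_iff]
    rw [this]
    exact NullMeasurableSet.iInter fun j => nullMeasurableSet_cocycleGamma hX hS (f j) (g j)
  have hU : (⋃ g : Fin (n + 1) → Pi1 X x₀, {x | (fun j => cocycleGamma S (f j) x) = g}) = univ := by
    ext x
    simp
  suffices h : AEStronglyMeasurable (fun x => c (fun j => cocycleGamma S (f j) x))
      (μ.restrict (⋃ g : Fin (n + 1) → Pi1 X x₀, {x | (fun j => cocycleGamma S (f j) x) = g})) by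
    rwa [hU, Measure.restrict_univ] at h
  rw [aestronglyMeasurable_iUnion_iff]
  intro g
  refine AEStronglyMeasurable.congr (f := fun _ => c g) aestronglyMeasurable_const ?_
  filter_upwards [ae_restrict_mem₀ (hN g)] with x hx
  rw [show _ = g from hx]

/-! ### The map `Γ_b` -/

/-- `Γ_b` on cochains: `Γ_b(c)(f₀, …, f_n) = ∫ c(γ(f₀, x), …, γ(f_n, x)) dμ(x)`. -/
def gammaCochain [SecondCountableTopology X] [IsFiniteMeasure μ]
    (hX : LocallySimplyConnected X) {x₀ : X} (hZ : Subgroup.center (Pi1 X x₀) = ⊥)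
    {S : PathSystem x₀} (hS : S.IsMeasurable μ) (n : ℕ) :
    Cochain (Pi1 X x₀) n →ₗ[ℝ] Cochain (Homeo0 μ) n where
  toFun c := ⟨fun f => ∫ x, c (fun j => cocycleGamma S (f j) x) ∂μ, by
    obtain ⟨K, hK⟩ := c.bounded
    exact ⟨K * μ.real univ, fun f => norm_integral_le_of_norm_le_const
      (Filter.Eventually.of_forall fun x => (Real.norm_eq_abs _).trans_le (hK _))⟩, fun h f => by
      have h1 : ∀ x, c (fun j => cocycleGamma S (h * f j) x) =
          (fun y => c (fun j => cocycleGamma S (f j) y)) (h.toHomeo x) := fun x => by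
        simp only [cocycleGamma_mul hZ]
        exact c.invariant _ _
      simp only [h1]
      exact h.measurePreserving.integral_comp h.toHomeo.measurableEmbedding
        (fun y => c (fun j => cocycleGamma S (f j) y))⟩
  map_add' a b := Cochain.ext <| funext fun f =>
    integral_add (integrable_cocycleGamma hX hS a f) (integrable_cocycleGamma hX hS b f)
  map_smul' r a := Cochain.ext <| funext fun f => integral_const_mul r _

/-- The map `Γ_b : H_b^n(π₁(X, x₀)) → H_b^n(Homeo₀(X, μ))` defined by a measurable system
of paths, for a finite measure `μ` and a fundamental group with trivial centre. -/
def gammaB [SecondCountableTopology X] [IsFiniteMeasure μ]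
    (hX : LocallySimplyConnected X) {x₀ : X} (hZ : Subgroup.center (Pi1 X x₀) = ⊥)
    {S : PathSystem x₀} (hS : S.IsMeasurable μ) (n : ℕ) :
    Hb n (Pi1 X x₀) →ₗ[ℝ] Hb n (Homeo0 μ) :=
  Hb.map (gammaCochain hX hZ hS) (fun n c => Cochain.ext <| funext fun f => by
    change ∫ x, ∑ i : Fin (n + 2), (-1 : ℝ) ^ (i : ℕ) *
        c (fun j => cocycleGamma S (f (i.succAbove j)) x) ∂μ =
      ∑ i : Fin (n + 2), (-1 : ℝ) ^ (i : ℕ) *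
        ∫ x, c (fun j => cocycleGamma S (f (i.succAbove j)) x) ∂μ
    rw [integral_finsetSum _ fun i _ =>
      (integrable_cocycleGamma hX hS c fun j => f (i.succAbove j)).const_mul _]
    exact Finset.sum_congr rfl fun i _ => integral_const_mul _ _) n

end Homeo

/-! ### Volume forms and coordinate balls on manifolds -/

section Manifold

variable {m : ℕ} {H : Type*} [TopologicalSpace H]

/-- Manifolds (possibly with boundary) are locally simply connected. -/
theorem locallySimplyConnected_of_manifold (I : ModelWithCorners ℝ (EuclideanSpace ℝ (Fin m)) H)
    (M : Type*) [TopologicalSpace M] [ChartedSpace H M] : LocallySimplyConnected M := by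
  intro x U hU
  let φ := extChartAt I x
  have h1 : φ.target ∈ 𝓝[range I] (φ x) := extChartAt_target_mem_nhdsWithin x
  have h2 : φ.symm ⁻¹' U ∈ 𝓝[range I] (φ x) := by
    refine (continuousAt_extChartAt_symm x).continuousWithinAt.preimage_mem_nhdsWithin ?_
    rw [extChartAt_to_inv x]
    exact hU
  obtain ⟨r, hr, hrs⟩ := Metric.mem_nhdsWithin_iff.1 (inter_mem h1 h2)
  let A := Metric.ball (φ x) r ∩ range I
  have hA : Convex ℝ A := (convex_ball _ _).inter I.convex_range
  have hAne : A.Nonempty := ⟨φ x, Metric.mem_ball_self hr, mem_range_self _⟩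
  let V := φ.source ∩ φ ⁻¹' Metric.ball (φ x) r
  have hVo : IsOpen V := isOpen_extChartAt_preimage' x Metric.isOpen_ball
  have hVA : ∀ y ∈ V, φ y ∈ A := fun y hy => ⟨hy.2, mem_range_self _⟩
  have hAV : ∀ z ∈ A, φ.symm z ∈ V := fun z hz =>
    ⟨φ.map_target (hrs hz).1, by rw [mem_preimage, φ.right_inv (hrs hz).1]; exact hz.1⟩
  refine ⟨V, fun y hy => ?_, hVo, ⟨mem_extChartAt_source x, Metric.mem_ball_self hr⟩, ?_⟩
  · have := (hrs (hVA y hy)).2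
    rwa [mem_preimage, φ.left_inv hy.1] at this
  · let e : V ≃ₜ A :=
      { toFun := fun y => ⟨φ y.1, hVA _ y.2⟩
        invFun := fun z => ⟨φ.symm z.1, hAV _ z.2⟩
        left_inv := fun y => Subtype.ext (φ.left_inv y.2.1)
        right_inv := fun z => Subtype.ext (φ.right_inv (hrs z.2).1)
        continuous_toFun := ((continuousOn_extChartAt x).comp_continuous continuous_subtype_val
          fun y => y.2.1).subtype_mk _
        continuous_invFun := ((continuousOn_extChartAt_symm x).comp_continuous
          continuous_subtype_val fun z => (hrs z.2).1).subtype_mk _ }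
    have : ContractibleSpace A := hA.contractibleSpace hAne
    have : ContractibleSpace V := e.contractibleSpace
    exact SimplyConnectedSpace.ofContractible V

/-- The value of a field `Ω` of alternating forms of top degree on the coordinate frame of the
chart around `x₀`, at the point with coordinates `y`: if `Ω = g dx₁ ∧ ⋯ ∧ dx_m` in this chart,
then this is `g y`. -/
def chartCoefficient {I : ModelWithCorners ℝ (EuclideanSpace ℝ (Fin m)) H} {M : Type*}
    [TopologicalSpace M] [ChartedSpace H M]
    (Ω : ∀ x : M, (TangentSpace I x) [⋀^Fin m]→ₗ[ℝ] ℝ) (x₀ : M) (y : EuclideanSpace ℝ (Fin m)) :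
    ℝ :=
  Ω ((extChartAt I x₀).symm y) fun j =>
    mfderivWithin 𝓘(ℝ, EuclideanSpace ℝ (Fin m)) I (extChartAt I x₀).symm (range I) y
      (EuclideanSpace.single j (1 : ℝ))

variable (I : ModelWithCorners ℝ (EuclideanSpace ℝ (Fin m)) H)
  (M : Type*) [TopologicalSpace M] [ChartedSpace H M]

/-- A volume form on an `m`-dimensional manifold: a nowhere vanishing smooth differential
`m`-form. -/
structure VolumeForm where
  /-- The alternating form on each tangent space. -/
  form : ∀ x : M, (TangentSpace I x) [⋀^Fin m]→ₗ[ℝ] ℝ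
  ne_zero : ∀ x, form x ≠ 0
  smooth : ∀ x₀ : M, ContDiffOn ℝ ∞ (chartCoefficient form x₀) (extChartAt I x₀).target

variable {I M}

/-- `μ` is the measure induced by the volume form `Ω`: in every chart, where
`Ω = g dx₁ ∧ ⋯ ∧ dx_m`, it is given by the density `|g|` with respect to Lebesgue measure. -/
def VolumeForm.Induces [MeasurableSpace M] (Ω : VolumeForm I M) (μ : Measure M) : Prop :=
  ∀ x₀ : M, ∀ s ⊆ (extChartAt I x₀).source, MeasurableSet s →
    μ s = ∫⁻ y in extChartAt I x₀ '' s, ENNReal.ofReal |chartCoefficient Ω.form x₀ y|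

variable (I) in
/-- `B` is a closed ball around `x` in some smooth chart of the manifold (if `x` is a boundary
point, the part of such a ball lying in the model domain). -/
def IsClosedCoordinateBall (x : M) (B : Set M) : Prop :=
  ∃ e ∈ IsManifold.maximalAtlas I ∞ M, x ∈ e.source ∧ ∃ r > 0,
    Metric.closedBall (e.extend I x) r ∩ range I ⊆ (e.extend I).target ∧
    B = (e.extend I).symm '' (Metric.closedBall (e.extend I x) r ∩ range I)

end Manifold

end GambaudoGhys

end

open BoundedCohomology GambaudoGhys

set_option linter.unusedSectionVars false

noncomputable section

namespace GambaudoGhys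

open BoundedCohomology
open Path (Homotopic)

/-! ### The group of measure preserving isotopies -/

/-! In dimension at least two everything rests on one construction. Fix a coordinate ball `B` around
the basepoint, the simply connected coordinate neighbourhood given by its open version, and an
auxiliary system of paths `c` which stays inside this neighbourhood over its points. For every `g`
in the fundamental group there are measure preserving isotopies which, off a set of arbitrarily
small measure, fix every point at time one, with holonomy `g` over `B` and trivial holonomy
elsewhere (`realisesOn_source`). Choose one for each free generator, with summable errors. Freeness
turns the choice into a homomorphism, and because points off the union of the error sets are fixed
by all generators, this one small set serves for all words (`exists_hom_hol`). On the rest of `B`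
the element `γ(ρ w, x)` is `i w` conjugated by an element `d x` comparing `S` with `c`. Left
invariance of a cocycle removes one factor; right multiplication by the other is homotopic to the
identity through a prism operator with a bound independent of `x`, so integrating over `B` gives a
bounded primitive. Points outside `B` contribute a constant cocycle, which is a coboundary in
positive degree, and the error set contributes at most twice its measure times the norm
(`exists_hom_seminorm_le`).

The isotopies are made of homeomorphisms, without flows. Replacing one coordinate by the primitive
of a continuous density turns that density into Lebesgue measure, and the straightenings of one
density in two directions differ by a volume preserving homeomorphism. This device turns a disc into
a rectangle, so that a cut-off rotation by `π` becomes an isotopy reflecting two coordinates on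
almost all of a box (`exists_isotopy_flip`). Two reflections make a translation, so points can be
pushed through connected open sets with support of small volume (`pushIn_of_isPreconnected`). The
same device shows that shears, then linear maps of determinant one, then all orientation preserving
changes of Lebesgue charts agree near a point, up to a translation, with endpoints of compactly
supported isotopies (`germ_shear`, `germ_linear`, `germ_chart_change`). Hence a neighbourhood of a
point can be carried around any loop and brought back pointwise (`exists_isotopy_hol`).

That gives holonomy `g` near one point only, with no control on the remaining support. The
commutator with a reflection supported in a cube, off that support, erases everything outside the
cube and leaves `g` on a small cube and `g⁻¹` on another one (`realisesOn_pairFun`). The cubes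
carrying `g` are moved so that they fill the large cube while those carrying `g⁻¹` all stay in one
thin slab (`realisesOn_cube`); finally the ball is filled with cubes.

In dimension at most one the fundamental group is commutative, contradicting the non-abelian free
subgroup. In dimension one the volume form gives coordinates unique up to translation, and a
homotopy class of paths from the basepoint is determined by its endpoint and one real parameter,
which adds up under concatenation (`pi1_comm_of_translationAtlas`). -/

/-- An isotopy through measure preserving homeomorphisms starting at the identity, continuous
together with its inverse. -/
@[ext]
structure Isotopy {X : Type*} [TopologicalSpace X] [MeasurableSpace X] (μ : Measure X) where
  /-- The homeomorphism at time `t`. -/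
  toFun : unitInterval → X ≃ₜ X
  zero : toFun 0 = Homeomorph.refl X
  cont : Continuous fun p : unitInterval × X => toFun p.1 p.2
  cont_symm : Continuous fun p : unitInterval × X => (toFun p.1).symm p.2
  mp : ∀ t, MeasurePreserving (toFun t) μ μ

namespace Isotopy

variable {X : Type*} [TopologicalSpace X] [MeasurableSpace X] {μ : Measure X}

instance : CoeFun (Isotopy μ) fun _ => unitInterval → X ≃ₜ X := ⟨toFun⟩

theorem isIsotopy (H : Isotopy μ) : IsIsotopy μ H (H 1) := ⟨H.zero, rfl, H.cont, H.mp⟩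

@[simp] theorem zero_apply (H : Isotopy μ) (x : X) : H 0 x = x := by rw [H.zero]; rfl

variable [BorelSpace X]

instance : One (Isotopy μ) :=
  ⟨⟨fun _ => Homeomorph.refl X, rfl, continuous_snd, continuous_snd, fun _ => .id μ⟩⟩

instance : Mul (Isotopy μ) := ⟨fun H K =>
  ⟨fun t => (H t).trans (K t), by rw [H.zero, K.zero]; rfl,
    K.cont.comp (continuous_fst.prodMk H.cont),
    H.cont_symm.comp (continuous_fst.prodMk K.cont_symm),
    fun t => (K.mp t).comp (H.mp t)⟩⟩

instance : Inv (Isotopy μ) := ⟨fun H =>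
  ⟨fun t => (H t).symm, by rw [H.zero]; rfl, H.cont_symm, H.cont,
    fun t => MeasurePreserving.symm (H t).toMeasurableEquiv (H.mp t)⟩⟩

@[simp] theorem one_apply (t : unitInterval) (x : X) : (1 : Isotopy μ) t x = x := rfl

@[simp] theorem mul_apply (H K : Isotopy μ) (t : unitInterval) (x : X) :
    (H * K) t x = K t (H t x) := rfl

@[simp] theorem inv_apply (H : Isotopy μ) (t : unitInterval) (x : X) :
    H⁻¹ t x = (H t).symm x := rfl

instance : Group (Isotopy μ) where
  mul_assoc _ _ _ := rfl
  one_mul _ := rfl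
  mul_one _ := rfl
  inv_mul_cancel H := by
    ext t x
    exact (H t).apply_symm_apply x

/-- The element of `Homeo₀` which is the endpoint of an isotopy. -/
def toHomeo0 (H : Isotopy μ) : Homeo0 μ := ⟨MulOpposite.op (H 1), H, H.isIsotopy⟩

/-- The isotopy is constant outside `K`. -/
def SuppIn (H : Isotopy μ) (K : Set X) : Prop := ∀ t, ∀ x ∉ K, H t x = x

theorem SuppIn.mono {H : Isotopy μ} {K K' : Set X} (h : H.SuppIn K) (hK : K ⊆ K') : H.SuppIn K' :=
  fun t x hx => h t x fun h' => hx (hK h')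

theorem suppIn_one (K : Set X) : (1 : Isotopy μ).SuppIn K := fun _ _ _ => rfl

theorem SuppIn.mul {H H' : Isotopy μ} {K K' : Set X} (h : H.SuppIn K) (h' : H'.SuppIn K') :
    (H * H').SuppIn (K ∪ K') := fun t x hx => by
  rw [mul_apply, h t x fun e => hx (Or.inl e), h' t x fun e => hx (Or.inr e)]

theorem SuppIn.inv {H : Isotopy μ} {K : Set X} (h : H.SuppIn K) : (H⁻¹).SuppIn K :=
  fun t x hx => by
    rw [inv_apply, Homeomorph.symm_apply_eq, h t x hx]

/-- An image outside `V` would lie outside `K`, so the inverse would fix it, and the point would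
have been outside `V` already. -/
theorem SuppIn.mem {H : Isotopy μ} {K V : Set X} (h : H.SuppIn K) (hK : K ⊆ V) (t : unitInterval)
    {x : X} (hx : x ∈ V) : H t x ∈ V := by
  by_contra hc
  have h1 := h.inv t (H t x) fun e => hc (hK e)
  rw [inv_apply, Homeomorph.symm_apply_apply] at h1
  exact hc (h1 ▸ hx)

theorem SuppIn.mem_iff {H : Isotopy μ} {K V : Set X} (h : H.SuppIn K) (hK : K ⊆ V)
    (t : unitInterval) {x : X} : H t x ∈ V ↔ x ∈ V :=
  ⟨fun hx => by simpa using h.inv.mem hK t hx, h.mem hK t⟩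

/-! ### Trajectories -/

/-- The isotopy moves `x` to `y` along a path of class `q`. -/
def Moves (H : Isotopy μ) {x y : X} (q : Homotopic.Quotient x y) : Prop :=
  ∃ p : Path x y, (∀ t, p t = H t x) ∧ Homotopic.Quotient.mk p = q

theorem moves_trajectory (H : Isotopy μ) (x : X) :
    H.Moves (Homotopic.Quotient.mk (H.isIsotopy.trajectory x)) := ⟨_, fun _ => rfl, rfl⟩

theorem Moves.apply_one {H : Isotopy μ} {x y : X} {q : Homotopic.Quotient x y} (h : H.Moves q) :
    H 1 x = y := by
  obtain ⟨p, hp, -⟩ := h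
  rw [← hp, p.target]

theorem Moves.unique {H : Isotopy μ} {x y : X} {q q' : Homotopic.Quotient x y} (h : H.Moves q)
    (h' : H.Moves q') : q = q' := by
  obtain ⟨p, hp, rfl⟩ := h
  obtain ⟨p', hp', rfl⟩ := h'
  congr 1
  ext t
  rw [hp, hp']

theorem exists_moves {H : Isotopy μ} {x y : X} (h : H 1 x = y) :
    ∃ q : Homotopic.Quotient x y, H.Moves q := by
  subst h
  exact ⟨_, H.moves_trajectory x⟩

theorem Moves.mul {H K : Isotopy μ} {x y z : X} {q : Homotopic.Quotient x y}
    {r : Homotopic.Quotient y z} (h : H.Moves q) (h' : K.Moves r) : (H * K).Moves (q.trans r) := by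
  obtain rfl := h.apply_one
  obtain rfl := h'.apply_one
  rw [h.unique (H.moves_trajectory x), h'.unique (K.moves_trajectory _)]
  have := trajectory_mul H.isIsotopy K.isIsotopy (H * K).isIsotopy (fun _ => rfl) x
  rw [← this]
  exact ⟨_, fun _ => rfl, rfl⟩

theorem moves_of_forall {H : Isotopy μ} {x : X} (h : ∀ t, H t x = x) :
    H.Moves (Homotopic.Quotient.refl x) :=
  ⟨Path.refl x, fun t => (h t).symm, rfl⟩

/-- Trajectories of the points of a path. -/
theorem Moves.square {H : Isotopy μ} {x y x' y' : X} {q : Homotopic.Quotient x y}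
    (h : H.Moves q) (p : Path x x') (p' : Path y y') (hp : ∀ t, p' t = H 1 (p t)) :
    H.Moves (((Homotopic.Quotient.mk p).symm.trans q).trans (Homotopic.Quotient.mk p')) := by
  obtain rfl := h.apply_one
  have e : H 1 x' = y' := by
    have := hp 1
    simpa using this.symm
  subst e
  have h1 := H.isIsotopy.square p
  have h2 : p' = p.map (H 1).continuous := by ext t; exact hp t
  rw [h.unique (H.moves_trajectory x), h2, Homotopic.Quotient.trans_assoc, ← h1,
    ← Homotopic.Quotient.trans_assoc, Homotopic.Quotient.symm_trans,
    Homotopic.Quotient.refl_trans]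
  exact H.moves_trajectory x'

/-- The holonomy of an isotopy at a point with respect to a system of paths `c`. -/
def hol {x₀ : X} (c : PathSystem x₀) (H : Isotopy μ) (x : X) : Pi1 X x₀ :=
  Pi1.of (((c x).trans (Homotopic.Quotient.mk (H.isIsotopy.trajectory x))).trans (c (H 1 x)).symm)

variable {x₀ : X} (c : PathSystem x₀)

theorem Moves.hol_eq {H : Isotopy μ} {x y : X} {q : Homotopic.Quotient x y} (h : H.Moves q) :
    H.hol c x = Pi1.of (((c x).trans q).trans (c y).symm) := by
  obtain rfl := h.apply_one
  rw [h.unique (H.moves_trajectory x)]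
  rfl

/-- The cocycle identity needs no hypothesis on the centre here, because an isotopy carries its own
trajectories. This is why the construction is made in `Isotopy μ` and projected to `Homeo0 μ` only
at the end. -/
theorem hol_mul (H K : Isotopy μ) (x : X) :
    (H * K).hol c x = H.hol c x * K.hol c (H 1 x) := by
  rw [((H.moves_trajectory x).mul (K.moves_trajectory _)).hol_eq c, hol, hol, ← Pi1.of_trans]
  congr 1
  simp only [Homotopic.Quotient.trans_assoc]
  rw [← Homotopic.Quotient.trans_assoc (c (H 1 x)).symm, Homotopic.Quotient.symm_trans,
    Homotopic.Quotient.refl_trans]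

theorem hol_of_forall {H : Isotopy μ} {x : X} (h : ∀ t, H t x = x) : H.hol c x = 1 := by
  rw [(moves_of_forall h).hol_eq c, Homotopic.Quotient.trans_refl, Homotopic.Quotient.trans_symm]
  rfl

@[simp] theorem hol_one (x : X) : (1 : Isotopy μ).hol c x = 1 := hol_of_forall c fun _ => rfl

theorem SuppIn.hol {H : Isotopy μ} {K : Set X} (h : H.SuppIn K) {x : X} (hx : x ∉ K) :
    H.hol c x = 1 := hol_of_forall c fun t => h t x hx

theorem hol_inv (H : Isotopy μ) (x : X) : (H⁻¹).hol c x = (H.hol c ((H 1).symm x))⁻¹ := by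
  have h := hol_mul c H⁻¹ H x
  rw [inv_mul_cancel, hol_one] at h
  exact eq_inv_of_mul_eq_one_left h.symm

/-- The system of paths `c` runs inside `V` for points of `V`. -/
def _root_.GambaudoGhys.PathSystem.Inside {X : Type*} [TopologicalSpace X] {x₀ : X}
    (c : PathSystem x₀) (V : Set X) : Prop :=
  ∀ x ∈ V, ∃ p : Path x₀ x, (∀ t, p t ∈ V) ∧ c x = Homotopic.Quotient.mk p

/-- The path to `x`, the trajectory and the path to the endpoint all run in `V`, where classes are
determined by endpoints. Isotopies supported in a chart neighbourhood are therefore invisible to the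
holonomy and may be used freely for conjugation. -/
theorem hol_of_inside {V : Set X} (hV : IsSimplyConnected V) (hc : c.Inside V) {H : Isotopy μ}
    {x : X} (h : ∀ t, H t x ∈ V) : H.hol c x = 1 := by
  obtain ⟨p, hp, hpc⟩ := hc x (by simpa using h 0)
  obtain ⟨p', hp', hpc'⟩ := hc (H 1 x) (h 1)
  rw [hol, hpc, hpc', ← Homotopic.Quotient.mk_trans,
    mk_eq_of_isSimplyConnected hV (p.trans (H.isIsotopy.trajectory x)) p'
      (trans_mem hp h) hp', Homotopic.Quotient.trans_symm]
  rfl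

end Isotopy

/-- This auxiliary system need not be measurable. Only its values over `V` matter for integration,
and there its difference from a measurable system has measurable level sets
(`nullMeasurableSet_pathDiff`). -/
theorem exists_pathSystem_inside {X : Type*} [TopologicalSpace X] [PathConnectedSpace X] {x₀ : X}
    {V : Set X} (hV : IsSimplyConnected V) (hx : x₀ ∈ V) :
    ∃ c : PathSystem x₀, c.Inside V := by
  classical
  have h : ∀ x : X, ∃ q : Homotopic.Quotient x₀ x,
      x ∈ V → ∃ p : Path x₀ x, (∀ t, p t ∈ V) ∧ q = Homotopic.Quotient.mk p := by
    intro x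
    by_cases hxV : x ∈ V
    · obtain ⟨p, hp⟩ := exists_path_of_isSimplyConnected hV hx hxV
      exact ⟨Homotopic.Quotient.mk p, fun _ => ⟨p, hp, rfl⟩⟩
    · exact ⟨Homotopic.Quotient.mk (PathConnectedSpace.somePath x₀ x), fun h => absurd h hxV⟩
  choose c hc using h
  exact ⟨c, hc⟩

/-! ### Transport of isotopies through charts -/

section Transport

variable {X Y : Type*} [TopologicalSpace X] [MeasurableSpace X] [BorelSpace X]
  [TopologicalSpace Y] [MeasurableSpace Y] [BorelSpace Y] {μ : Measure X} {ν : Measure Y}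

/-- The chart `j` maps `μ` to `ν`. -/
def MeasureChart (j : OpenPartialHomeomorph X Y) (μ : Measure X) (ν : Measure Y) : Prop :=
  ∀ A ⊆ j.target, MeasurableSet A → μ (j.source ∩ j ⁻¹' A) = ν A

open Classical in
/-- Transport of a compactly supported map through a chart. -/
def transportFun (j : OpenPartialHomeomorph X Y) (f : Y → Y) (x : X) : X :=
  if x ∈ j.source then j.symm (f (j x)) else x

theorem transportFun_of_mem {j : OpenPartialHomeomorph X Y} {f : Y → Y} {x : X}
    (hx : x ∈ j.source) : transportFun j f x = j.symm (f (j x)) := if_pos hx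

theorem transportFun_of_notMem {j : OpenPartialHomeomorph X Y} {f : Y → Y} {x : X}
    (hx : x ∉ j.source) : transportFun j f x = x := if_neg hx

theorem transportFun_symm (j : OpenPartialHomeomorph X Y) {f g : Y → Y}
    (hf : ∀ y ∈ j.target, f y ∈ j.target) (hgf : ∀ y, g (f y) = y) (x : X) :
    transportFun j g (transportFun j f x) = x := by
  by_cases hx : x ∈ j.source
  · have h1 := hf _ (j.map_source hx)
    rw [transportFun_of_mem hx, transportFun_of_mem (j.map_target h1), j.right_inv h1, hgf,
      j.left_inv hx]
  · rw [transportFun_of_notMem hx, transportFun_of_notMem hx]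

/-- Continuity is local on two open sets: the source, and the complement of the image of `K`, where
the map is the identity. The second set is open because a compact subset of a Hausdorff space is
closed. -/
theorem continuous_transportFun [T2Space X] (j : OpenPartialHomeomorph X Y) {T : Type*}
    [TopologicalSpace T] {f : T → Y → Y} (hf : Continuous fun p : T × Y => f p.1 p.2) {K : Set Y}
    (hK : IsCompact K) (hKj : K ⊆ j.target) (hfK : ∀ t, ∀ y ∉ K, f t y = y)
    (hft : ∀ t, ∀ y ∈ j.target, f t y ∈ j.target) :
    Continuous fun p : T × X => transportFun j (f p.1) p.2 := by
  have hC : IsClosed (j.symm '' K) :=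
    (hK.image_of_continuousOn (j.continuousOn_symm.mono hKj)).isClosed
  rw [continuous_iff_continuousAt]
  rintro ⟨t, x⟩
  by_cases hx : x ∈ j.source
  · have h1 : ContinuousAt (fun p : T × X => j.symm (f p.1 (j p.2))) (t, x) := by
      refine ContinuousAt.comp (g := j.symm) (j.continuousAt_symm (hft t _ (j.map_source hx))) ?_
      exact hf.continuousAt.comp (continuousAt_fst.prodMk
        ((j.continuousAt hx).comp_of_eq continuousAt_snd rfl))
    refine h1.congr ?_
    filter_upwards [continuousAt_snd.preimage_mem_nhds (j.open_source.mem_nhds hx)] with p hp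
    exact (transportFun_of_mem hp).symm
  · have hx' : x ∉ j.symm '' K := by
      rintro ⟨y, hy, rfl⟩
      exact hx (j.map_target (hKj hy))
    refine continuousAt_snd.congr ?_
    filter_upwards [continuousAt_snd.preimage_mem_nhds (hC.isOpen_compl.mem_nhds hx')] with p hp
    by_cases hp' : p.2 ∈ j.source
    · rw [transportFun_of_mem hp', hfK, j.left_inv hp']
      exact fun h => hp ⟨_, h, j.left_inv hp'⟩
    · rw [transportFun_of_notMem hp']

theorem measure_preimage_transportFun {j : OpenPartialHomeomorph X Y} (hj : MeasureChart j μ ν)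
    {f : Y ≃ₜ Y} (hf : MeasurePreserving f ν ν) (hft : ∀ y, f y ∈ j.target ↔ y ∈ j.target)
    {A : Set X} (hA : MeasurableSet A) : μ (transportFun j f ⁻¹' A) = μ A := by
  have hs := j.open_source.measurableSet
  have ht := j.open_target.measurableSet
  have hmeas : ∀ B : Set X, MeasurableSet B → MeasurableSet (j.target ∩ j.symm ⁻¹' B) := by
    intro B hB
    have h1 : Measurable (j.target.domRestrict j.symm) :=
      (continuousOn_iff_continuous_domRestrict.1 j.continuousOn_symm).measurable
    have h2 := ht.subtype_image (h1 hB)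
    convert h2 using 1
    ext y
    simp [Set.domRestrict, and_comm]
  have key : ∀ B : Set X, MeasurableSet B → μ (B ∩ j.source) = ν (j.target ∩ j.symm ⁻¹' B) := by
    intro B hB
    rw [← hj _ inter_subset_left (hmeas B hB)]
    congr 1
    ext x
    constructor
    · rintro ⟨h1, h2⟩
      exact ⟨h2, j.map_source h2, by rwa [mem_preimage, j.left_inv h2]⟩
    · rintro ⟨h1, -, h2⟩
      exact ⟨by rwa [mem_preimage, j.left_inv h1] at h2, h1⟩
  have hfm : Measurable f := f.continuous.measurable
  have hC : MeasurableSet (f ⁻¹' (j.target ∩ j.symm ⁻¹' A)) := hfm (hmeas A hA)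
  have h1 : transportFun j f ⁻¹' A ∩ j.source =
      j.source ∩ j ⁻¹' (f ⁻¹' (j.target ∩ j.symm ⁻¹' A)) := by
    ext x
    constructor
    · rintro ⟨h1, h2⟩
      rw [mem_preimage, transportFun_of_mem h2] at h1
      exact ⟨h2, (hft _).2 (j.map_source h2), h1⟩
    · rintro ⟨h1, -, h2⟩
      exact ⟨by rw [mem_preimage, transportFun_of_mem h1]; exact h2, h1⟩
  have h2 : transportFun j f ⁻¹' A \ j.source = A \ j.source := by
    ext x
    constructor
    · rintro ⟨h1, h2⟩
      rw [mem_preimage, transportFun_of_notMem h2] at h1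
      exact ⟨h1, h2⟩
    · rintro ⟨h1, h2⟩
      exact ⟨by rw [mem_preimage, transportFun_of_notMem h2]; exact h1, h2⟩
  rw [← measure_inter_add_sdiff _ hs, ← measure_inter_add_sdiff A hs, h1, h2,
    hj _ (fun y hy => (hft y).1 hy.1) hC,
    hf.measure_preimage (hmeas A hA).nullMeasurableSet, key A hA]

/-- Transport of an isotopy with compact support through a measure preserving chart. -/
def Isotopy.transport [T2Space X] {j : OpenPartialHomeomorph X Y} (hj : MeasureChart j μ ν)
    (H : Isotopy ν) {K : Set Y} (hK : IsCompact K) (hKj : K ⊆ j.target) (hH : H.SuppIn K) :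
    Isotopy μ where
  toFun t :=
    { toFun := transportFun j (H t)
      invFun := transportFun j (H t).symm
      left_inv := transportFun_symm j (fun _ => hH.mem hKj t) (H t).symm_apply_apply
      right_inv := transportFun_symm j (fun _ => hH.inv.mem hKj t) (H t).apply_symm_apply
      continuous_toFun := (continuous_transportFun j H.cont hK hKj hH
        fun t _ => hH.mem hKj t).comp (continuous_const.prodMk continuous_id)
      continuous_invFun := (continuous_transportFun j H.cont_symm hK hKj hH.inv
        fun t _ => hH.inv.mem hKj t).comp (continuous_const.prodMk continuous_id) }
  zero := by
    ext x
    change transportFun j (H 0) x = x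
    by_cases hx : x ∈ j.source
    · rw [transportFun_of_mem hx, H.zero_apply, j.left_inv hx]
    · rw [transportFun_of_notMem hx]
  cont := continuous_transportFun j H.cont hK hKj hH fun t _ => hH.mem hKj t
  cont_symm := continuous_transportFun j H.cont_symm hK hKj hH.inv fun t _ => hH.inv.mem hKj t
  mp t := by
    have hm : Measurable (transportFun j (H t)) :=
      ((continuous_transportFun j H.cont hK hKj hH fun t _ => hH.mem hKj t).comp
        (continuous_const.prodMk continuous_id)).measurable (f := fun x => transportFun j (H t) x)
    refine ⟨hm, ?_⟩
    ext A hA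
    change Measure.map (transportFun j (H t)) μ A = μ A
    rw [Measure.map_apply hm hA]
    exact measure_preimage_transportFun hj (H.mp t) (fun y => hH.mem_iff hKj t) hA

variable [T2Space X] {j : OpenPartialHomeomorph X Y} (hj : MeasureChart j μ ν)
  (H : Isotopy ν) {K : Set Y} (hK : IsCompact K) (hKj : K ⊆ j.target) (hH : H.SuppIn K)

theorem Isotopy.transport_of_mem {x : X} (hx : x ∈ j.source) (t : unitInterval) :
    H.transport hj hK hKj hH t x = j.symm (H t (j x)) := transportFun_of_mem hx

theorem Isotopy.transport_of_notMem {x : X} (hx : x ∉ j.source) (t : unitInterval) :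
    H.transport hj hK hKj hH t x = x := transportFun_of_notMem hx

theorem Isotopy.suppIn_transport {K' : Set Y} (hK' : H.SuppIn K') :
    (H.transport hj hK hKj hH).SuppIn (j.source ∩ j ⁻¹' K') := by
  intro t x hx
  by_cases hxs : x ∈ j.source
  · rw [Isotopy.transport_of_mem _ _ _ _ _ hxs, hK' t _ fun h => hx ⟨hxs, h⟩, j.left_inv hxs]
  · rw [Isotopy.transport_of_notMem _ _ _ _ _ hxs]

end Transport

/-- Conjugation of an isotopy by a homeomorphism which multiplies the measure by a constant. -/
def Isotopy.conj {X Y : Type*} [TopologicalSpace X] [MeasurableSpace X] [BorelSpace X]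
    [TopologicalSpace Y] [MeasurableSpace Y] [BorelSpace Y] {μ : Measure X} {ν : Measure Y}
    (H : Isotopy μ) (Z : X ≃ₜ Y) {a : ENNReal} (ha : a ≠ 0) (ha' : a ≠ ⊤)
    (hZ : Measure.map Z μ = a • ν) : Isotopy ν where
  toFun t := (Z.symm.trans (H t)).trans Z
  zero := by
    ext y
    simp
  cont := Z.continuous.comp (H.cont.comp
    (continuous_fst.prodMk (Z.symm.continuous.comp continuous_snd)))
  cont_symm := Z.continuous.comp (H.cont_symm.comp
    (continuous_fst.prodMk (Z.symm.continuous.comp continuous_snd)))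
  mp t := by
    have hm : Measurable ((Z.symm.trans (H t)).trans Z) := Homeomorph.measurable _
    refine ⟨hm, ?_⟩
    have h1 : Measure.map ((Z.symm.trans (H t)).trans Z) (a • ν) = a • ν := by
      rw [← hZ, Measure.map_map hm Z.measurable]
      have : ((Z.symm.trans (H t)).trans Z) ∘ Z = Z ∘ H t := by
        ext x
        simp
      rw [this, ← Measure.map_map Z.measurable (H t).measurable, (H.mp t).map_eq]
    rw [Measure.map_smul] at h1
    have h2 := congrArg (fun m => a⁻¹ • m) h1
    simpa only [smul_smul, ENNReal.inv_mul_cancel ha ha', one_smul] using h2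

/-! ### Straightening a density along a coordinate direction -/

section Straighten

variable {ι : Type*} [Fintype ι] [DecidableEq ι]

/-- The primitive of `g` along the line through `x` in direction `i`. -/
def linePrimitive (i : ι) (g : (ι → ℝ) → ℝ) (s : ℝ) (x : ι → ℝ) (t : ℝ) : ℝ :=
  s + ∫ u in s..t, g (Function.update x i u)

/-- Replacement of the coordinate `x i` by the primitive of `g` in direction `i`. -/
def straightFun (i : ι) (g : (ι → ℝ) → ℝ) (s : ℝ) (x : ι → ℝ) : ι → ℝ :=
  Function.update x i (linePrimitive i g s x (x i))

variable {i : ι} {g : (ι → ℝ) → ℝ} {s : ℝ}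

theorem linePrimitive_update (x : ι → ℝ) (v t : ℝ) :
    linePrimitive i g s (Function.update x i v) t = linePrimitive i g s x t := by
  simp [linePrimitive]

theorem straightFun_apply_same (x : ι → ℝ) :
    straightFun i g s x i = linePrimitive i g s x (x i) := by simp [straightFun]

theorem straightFun_apply_of_ne (x : ι → ℝ) {k : ι} (hk : k ≠ i) :
    straightFun i g s x k = x k := by simp [straightFun, hk]

theorem continuous_line (hg : Continuous g) (x : ι → ℝ) :
    Continuous fun u : ℝ => g (Function.update x i u) :=
  hg.comp (continuous_const.update i continuous_id)

theorem continuous_linePrimitive (hg : Continuous g) :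
    Continuous fun p : (ι → ℝ) × ℝ => linePrimitive i g s p.1 p.2 := by
  refine continuous_const.add ?_
  refine intervalIntegral.continuous_parametric_intervalIntegral_of_continuous
    (f := fun (p : (ι → ℝ) × ℝ) u => g (Function.update p.1 i u)) ?_ continuous_snd
  exact hg.comp ((continuous_fst.comp continuous_fst).update i continuous_snd)

theorem hasDerivAt_linePrimitive (hg : Continuous g) (x : ι → ℝ) (t : ℝ) :
    HasDerivAt (linePrimitive i g s x) (g (Function.update x i t)) t :=
  ((continuous_line hg x).integral_hasStrictDerivAt s t).hasDerivAt.const_add s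

theorem strictMono_linePrimitive (hg : Continuous g) (hpos : ∀ x, 0 < g x) (x : ι → ℝ) :
    StrictMono (linePrimitive i g s x) :=
  strictMono_of_hasDerivAt_pos (hasDerivAt_linePrimitive hg x) fun _ => hpos _

theorem linePrimitive_sub (hg : Continuous g) (x : ι → ℝ) (a b : ℝ) :
    linePrimitive i g s x b - linePrimitive i g s x a =
      ∫ u in a..b, g (Function.update x i u) := by
  have h := intervalIntegral.integral_interval_sub_left (μ := volume)
    ((continuous_line hg x (i := i)).intervalIntegrable s b)
    ((continuous_line hg x (i := i)).intervalIntegrable s a)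
  unfold linePrimitive
  rw [← h]
  ring

/-- The lower bound `c` makes the primitive grow at least linearly in both directions. -/
theorem surjective_linePrimitive (hg : Continuous g) {c : ℝ} (hc : 0 < c) (hgc : ∀ x, c ≤ g x)
    (x : ι → ℝ) : Function.Surjective (linePrimitive i g s x) := by
  have hlow : ∀ a b, a ≤ b →
      c * (b - a) ≤ linePrimitive i g s x b - linePrimitive i g s x a := by
    intro a b hab
    rw [linePrimitive_sub hg]
    have := intervalIntegral.integral_mono_on hab (f := fun _ => c)
      (μ := volume)
      (g := fun u => g (Function.update x i u)) intervalIntegrable_const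
      ((continuous_line hg x).intervalIntegrable _ _) fun u _ => hgc _
    simpa [mul_comm] using this
  have hcont : Continuous (linePrimitive i g s x) :=
    (continuous_linePrimitive hg).comp (continuous_const.prodMk continuous_id)
  refine hcont.surjective ?_ ?_
  · refine tendsto_atTop_mono' atTop (f₁ := fun b => linePrimitive i g s x 0 + c * b) ?_ ?_
    · filter_upwards [eventually_ge_atTop 0] with b hb
      have := hlow 0 b hb
      linarith
    · exact tendsto_atTop_add_const_left _ _ (tendsto_id.const_mul_atTop hc)
  · refine tendsto_atBot_mono' atBot (f₁ := fun b => linePrimitive i g s x 0 + c * b) ?_ ?_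
    · filter_upwards [eventually_le_atBot 0] with b hb
      have := hlow b 0 hb
      linarith
    · exact tendsto_atBot_add_const_left _ _ (tendsto_id.const_mul_atBot hc)

theorem continuous_straightFun (hg : Continuous g) : Continuous (straightFun i g s) :=
  continuous_id.update i ((continuous_linePrimitive hg).comp
    (continuous_id.prodMk (continuous_apply i)))

/-- The straightening homeomorphism of a continuous density which is bounded below. -/
def straight (i : ι) (g : (ι → ℝ) → ℝ) (s : ℝ) (hg : Continuous g) {c : ℝ} (hc : 0 < c)
    (hgc : ∀ x, c ≤ g x) : (ι → ℝ) ≃ₜ (ι → ℝ) where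
  toFun := straightFun i g s
  invFun y := Function.update y i (surjective_linePrimitive (s := s) hg hc hgc y (y i)).choose
  left_inv x := by
    have h := (surjective_linePrimitive (i := i) (s := s) hg hc hgc (straightFun i g s x)
      (straightFun i g s x i)).choose_spec
    set τ := (surjective_linePrimitive (i := i) (s := s) hg hc hgc (straightFun i g s x)
      (straightFun i g s x i)).choose
    rw [straightFun_apply_same, straightFun, linePrimitive_update] at h
    have h2 := (strictMono_linePrimitive hg (fun x => hc.trans_le (hgc x)) x).injective h
    change Function.update (straightFun i g s x) i τ = x
    rw [h2, straightFun, Function.update_idem, Function.update_eq_self]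
  right_inv y := by
    have h := (surjective_linePrimitive (i := i) (s := s) hg hc hgc y (y i)).choose_spec
    set τ := (surjective_linePrimitive (i := i) (s := s) hg hc hgc y (y i)).choose
    change straightFun i g s (Function.update y i τ) = y
    rw [straightFun, linePrimitive_update, Function.update_idem, Function.update_self, h,
      Function.update_eq_self]
  continuous_toFun := continuous_straightFun hg
  continuous_invFun := by
    refine continuous_id.update i ?_
    set τ : (ι → ℝ) → ℝ := fun y =>
      (surjective_linePrimitive (i := i) (s := s) hg hc hgc y (y i)).choose with hτ
    have hspec : ∀ y, linePrimitive i g s y (τ y) = y i := fun y =>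
      (surjective_linePrimitive (i := i) (s := s) hg hc hgc y (y i)).choose_spec
    have hmono := fun y => strictMono_linePrimitive (i := i) (s := s) hg
      (fun x => hc.trans_le (hgc x)) y
    have hcont : ∀ v, Continuous fun y => linePrimitive i g s y v - y i := fun v =>
      ((continuous_linePrimitive hg).comp (continuous_id.prodMk continuous_const)).sub
        (continuous_apply i)
    -- Continuity of the implicitly defined coordinate: for fixed `a`, the sign of `linePrimitive i
    -- g s y a - y i` is stable under small changes of `y`, and by monotonicity it decides on which
    -- side of `a` the solution `τ y` lies.
    rw [continuous_iff_continuousAt]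
    intro y
    change Tendsto τ (𝓝 y) (𝓝 (τ y))
    refine tendsto_order.2 ⟨fun a ha => ?_, fun a ha => ?_⟩
    · have h1 : linePrimitive i g s y a - y i < 0 := by
        have := hmono y ha
        rw [hspec] at this
        linarith
      filter_upwards [(hcont a).continuousAt.eventually_lt continuousAt_const h1] with z hz
      rw [← (hmono z).lt_iff_lt, hspec]
      linarith
    · have h1 : 0 < linePrimitive i g s y a - y i := by
        have := hmono y ha
        rw [hspec] at this
        linarith
      filter_upwards [continuousAt_const.eventually_lt (hcont a).continuousAt h1] with z hz
      rw [← (hmono z).lt_iff_lt, hspec]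
      linarith

@[simp] theorem coe_straight (hg : Continuous g) {c : ℝ} (hc : 0 < c) (hgc : ∀ x, c ≤ g x) :
    ⇑(straight i g s hg hc hgc) = straightFun i g s := rfl

theorem lintegral_comp_linePrimitive (hg : Continuous g) {c : ℝ} (hc : 0 < c)
    (hgc : ∀ x, c ≤ g x) (x : ι → ℝ) (f : ℝ → ENNReal) :
    ∫⁻ t, ENNReal.ofReal (g (Function.update x i t)) * f (linePrimitive i g s x t) =
      ∫⁻ u, f u := by
  have h := lintegral_image_eq_lintegral_abs_deriv_mul MeasurableSet.univ
    (f := linePrimitive i g s x) (f' := fun t => g (Function.update x i t))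
    (fun t _ => (hasDerivAt_linePrimitive hg x t).hasDerivWithinAt)
    (strictMono_linePrimitive hg (fun x => hc.trans_le (hgc x)) x).injective.injOn f
  rw [image_univ, (surjective_linePrimitive hg hc hgc x).range_eq, setLIntegral_univ,
    setLIntegral_univ] at h
  rw [h]
  simp_rw [abs_of_pos (hc.trans_le (hgc _))]

/-- On each line in direction `i` this is the one-dimensional change of variables with derivative
`g`; the lines are put together by Tonelli. Since nothing is differentiated across the lines, a
merely continuous density suffices. -/
theorem map_straightFun (hg : Continuous g) {c : ℝ} (hc : 0 < c) (hgc : ∀ x, c ≤ g x) :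
    Measure.map (straightFun i g s) (volume.withDensity fun x => ENNReal.ofReal (g x)) =
      volume := by
  have hm := (continuous_straightFun (i := i) (s := s) hg).measurable
  have hgm : Measurable fun x => ENNReal.ofReal (g x) := hg.measurable.ennreal_ofReal
  ext A hA
  have hind : Measurable (A.indicator (1 : (ι → ℝ) → ENNReal)) := measurable_one.indicator hA
  rw [Measure.map_apply hm hA, ← lintegral_indicator_one (hm hA),
    lintegral_withDensity_eq_lintegral_mul _ hgm (measurable_one.indicator (hm hA)),
    ← lintegral_indicator_one hA]
  refine lintegral_eq_of_lmarginal_eq {i} (hgm.mul (measurable_one.indicator (hm hA))) hind ?_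
  rw [lmarginal_singleton, lmarginal_singleton]
  funext x
  rw [← lintegral_comp_linePrimitive (i := i) (s := s) hg hc hgc x
    fun u => A.indicator 1 (Function.update x i u)]
  refine lintegral_congr fun t => ?_
  rw [Pi.mul_apply]
  congr 1
  have : straightFun i g s (Function.update x i t) =
      Function.update x i (linePrimitive i g s x t) := by
    rw [straightFun, linePrimitive_update, Function.update_idem, Function.update_self]
  simp only [indicator, mem_preimage]
  rw [← this]
  rfl

/-- Straightenings of the same density in two directions differ by a volume preserving
homeomorphism. -/
theorem measurePreserving_straight_symm_trans {i j : ι} {s s' : ℝ} (hg : Continuous g) {c : ℝ}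
    (hc : 0 < c) (hgc : ∀ x, c ≤ g x) :
    MeasurePreserving ((straight i g s hg hc hgc).symm.trans (straight j g s' hg hc hgc))
      volume volume := by
  refine ⟨Homeomorph.measurable _, ?_⟩
  conv_lhs => rw [← map_straightFun (i := i) (s := s) hg hc hgc]
  rw [← coe_straight hg hc hgc, Measure.map_map (Homeomorph.measurable _) (Homeomorph.measurable _)]
  have : ((straight i g s hg hc hgc).symm.trans (straight j g s' hg hc hgc)) ∘
      (straight i g s hg hc hgc) = straight j g s' hg hc hgc := by
    ext x : 1
    simp only [Function.comp_apply, Homeomorph.trans_apply, Homeomorph.symm_apply_apply]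
  rw [this]
  exact map_straightFun hg hc hgc

end Straighten

/-! ### Twisted rotations -/

section Twist

variable {ι : Type*} [Fintype ι] [DecidableEq ι]

/-- Rotation by the angle `θ` in the coordinate plane `i, j`. -/
def rot (i j : ι) (θ : Real.Angle) (x : ι → ℝ) : ι → ℝ := fun k =>
  if k = i then θ.cos * x i - θ.sin * x j else if k = j then θ.sin * x i + θ.cos * x j else x k

variable {i j : ι}

@[simp] theorem rot_apply_left (θ : Real.Angle) (x : ι → ℝ) :
    rot i j θ x i = θ.cos * x i - θ.sin * x j := by simp [rot]

theorem rot_apply_right (hij : i ≠ j) (θ : Real.Angle) (x : ι → ℝ) :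
    rot i j θ x j = θ.sin * x i + θ.cos * x j := by simp [rot, hij.symm]

theorem rot_apply_of_ne (θ : Real.Angle) (x : ι → ℝ) {k : ι} (hi : k ≠ i) (hj : k ≠ j) :
    rot i j θ x k = x k := by simp [rot, hi, hj]

theorem rot_add (hij : i ≠ j) (θ θ' : Real.Angle) (x : ι → ℝ) : rot i j (θ + θ') x = rot i j θ (rot i j θ' x) := by
  ext k
  by_cases hi : k = i
  · subst hi
    rw [rot_apply_left, rot_apply_left, rot_apply_left, rot_apply_right hij,
      Real.Angle.cos_add, Real.Angle.sin_add]
    ring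
  · by_cases hj : k = j
    · subst hj
      rw [rot_apply_right hij, rot_apply_right hij, rot_apply_left, rot_apply_right hij,
        Real.Angle.cos_add, Real.Angle.sin_add]
      ring
    · rw [rot_apply_of_ne _ _ hi hj, rot_apply_of_ne _ _ hi hj, rot_apply_of_ne _ _ hi hj]

@[simp] theorem rot_zero (x : ι → ℝ) : rot i j 0 x = x := by
  ext k
  unfold rot
  split_ifs with h1 h2
  · subst h1; simp
  · subst h2; simp
  · rfl

theorem continuous_rot : Continuous fun p : Real.Angle × (ι → ℝ) => rot i j p.1 p.2 := by
  refine continuous_pi fun k => ?_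
  unfold rot
  have h1 := Real.Angle.continuous_cos
  have h2 := Real.Angle.continuous_sin
  split_ifs <;> fun_prop

/-- The sup norm on `ι → ℝ` is not invariant under rotations, so the map is read on
`EuclideanSpace`, where it is a linear isometry and the volume is the same. -/
theorem measurePreserving_rot (hij : i ≠ j) (θ : Real.Angle) : MeasurePreserving (rot i j θ) volume volume := by
  let f : EuclideanSpace ℝ ι →ₗ[ℝ] EuclideanSpace ℝ ι :=
    { toFun := fun x => WithLp.toLp 2 (rot i j θ x.ofLp)
      map_add' := fun x y => by
        ext k
        simp only [rot, PiLp.add_apply]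
        split_ifs <;> ring
      map_smul' := fun r x => by
        ext k
        simp only [rot, PiLp.smul_apply, smul_eq_mul,
          RingHom.id_apply]
        split_ifs <;> ring }
  have hn : ∀ x, ‖f x‖ = ‖x‖ := by
    intro x
    rw [← sq_eq_sq₀ (norm_nonneg _) (norm_nonneg _), EuclideanSpace.norm_sq_eq,
      EuclideanSpace.norm_sq_eq, ← sub_eq_zero, ← Finset.sum_sub_distrib]
    simp only [Real.norm_eq_abs, sq_abs]
    rw [Finset.sum_eq_add i j hij]
    · change rot i j θ x.ofLp i ^ 2 - x.ofLp i ^ 2 + (rot i j θ x.ofLp j ^ 2 - x.ofLp j ^ 2) = 0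
      rw [rot_apply_left, rot_apply_right hij]
      have := Real.Angle.cos_sq_add_sin_sq θ
      linear_combination (x.ofLp i ^ 2 + x.ofLp j ^ 2) * this
    · intro k _ hk
      change rot i j θ x.ofLp k ^ 2 - x.ofLp k ^ 2 = 0
      rw [rot_apply_of_ne _ _ hk.1 hk.2, sub_self]
    · simp
    · simp
  let e : EuclideanSpace ℝ ι ≃ₗᵢ[ℝ] EuclideanSpace ℝ ι :=
    LinearIsometry.toLinearIsometryEquiv ⟨f, hn⟩ rfl
  have h2 := (PiLp.volume_preserving_ofLp ι).comp (e.measurePreserving.comp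
    (PiLp.volume_preserving_toLp ι))
  exact h2

/-- Rotations by an angle which is invariant under rotations preserve the volume. -/
theorem measurePreserving_twist (hij : i ≠ j) {α : (ι → ℝ) → Real.Angle} (hα : Continuous α)
    (hinv : ∀ θ x, α (rot i j θ x) = α x) :
    MeasurePreserving (fun x => rot i j (α x) x) volume volume := by
  have hc : Continuous fun x => rot i j (α x) x := continuous_rot.comp (hα.prodMk continuous_id)
  refine ⟨hc.measurable, ?_⟩
  ext A hA
  rw [Measure.map_apply hc.measurable hA]
  have : Fact (0 < 2 * Real.pi) := ⟨by positivity⟩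
  let ν : Measure (AddCircle (2 * Real.pi)) := volume
  let R : AddCircle (2 * Real.pi) → (ι → ℝ) → (ι → ℝ) := fun θ x => rot i j θ x
  have hR : Continuous fun p : AddCircle (2 * Real.pi) × (ι → ℝ) => R p.1 p.2 := continuous_rot
  let α' : (ι → ℝ) → AddCircle (2 * Real.pi) := α
  have hα' : Continuous α' := hα
  have hν : ν univ ≠ 0 := by
    rw [AddCircle.measure_univ]
    simp [Real.pi_pos]
  have hν' : ν univ ≠ ⊤ := measure_ne_top _ _
  -- Averaging over the circle: the volume of `B` is computed from the measures of the sets of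
  -- angles rotating `x` into `B`. As the twist rotates each orbit rigidly, it shifts these sets of
  -- angles by `α x` and keeps their measure.
  have key : ∀ B : Set (ι → ℝ), MeasurableSet B →
      volume B * ν univ = ∫⁻ x, ν {θ | R θ x ∈ B} := by
    intro B hB
    have hB' : MeasurableSet {p : AddCircle (2 * Real.pi) × (ι → ℝ) | R p.1 p.2 ∈ B} :=
      hR.measurable hB
    have e1 := Measure.prod_apply (μ := ν) (ν := (volume : Measure (ι → ℝ))) hB'
    have e2 := Measure.prod_apply_symm (μ := ν) (ν := (volume : Measure (ι → ℝ))) hB'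
    rw [e1] at e2
    refine Eq.trans ?_ e2
    have : ∀ θ, volume (Prod.mk θ ⁻¹' {p : AddCircle (2 * Real.pi) × (ι → ℝ) | R p.1 p.2 ∈ B}) =
        volume B := fun θ => (measurePreserving_rot hij θ).measure_preimage hB.nullMeasurableSet
    simp_rw [this]
    rw [lintegral_const]
  have h1 := key _ (hc.measurable hA)
  have h2 := key A hA
  have h3 : ∀ x, ν {θ | R θ x ∈ (fun x => rot i j (α x) x) ⁻¹' A} = ν {θ | R θ x ∈ A} := by
    intro x
    have : {θ | R θ x ∈ (fun x => rot i j (α x) x) ⁻¹' A} =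
        (fun θ => α' x + θ) ⁻¹' {θ | R θ x ∈ A} := by
      ext θ
      have e : ∀ θ : Real.Angle, rot i j (α (rot i j θ x)) (rot i j θ x) ∈ A ↔
          rot i j (α x + θ) x ∈ A := fun θ => by rw [hinv, rot_add hij]
      exact e θ
    rw [this]
    exact measure_preimage_add ν _ _
  simp_rw [h3] at h1
  exact (ENNReal.mul_left_inj hν hν').1 (h1.trans h2.symm)

/-- The isotopy which rotates `x` by the angle `t a(x)`. -/
def twist (hij : i ≠ j) {a : (ι → ℝ) → ℝ} (ha : Continuous a) (hinv : ∀ θ x, a (rot i j θ x) = a x) :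
    Isotopy (volume : Measure (ι → ℝ)) where
  toFun t :=
    { toFun := fun x => rot i j ((t * a x : ℝ) : Real.Angle) x
      invFun := fun x => rot i j ((-(t * a x) : ℝ) : Real.Angle) x
      left_inv := fun x => by
        dsimp only
        rw [hinv, ← rot_add hij, ← Real.Angle.coe_add, neg_add_cancel, Real.Angle.coe_zero,
          rot_zero]
      right_inv := fun x => by
        dsimp only
        rw [hinv, ← rot_add hij, ← Real.Angle.coe_add, add_neg_cancel, Real.Angle.coe_zero,
          rot_zero]
      continuous_toFun := continuous_rot.comp
        ((Real.Angle.continuous_coe.comp (by fun_prop)).prodMk continuous_id)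
      continuous_invFun := continuous_rot.comp
        ((Real.Angle.continuous_coe.comp (by fun_prop)).prodMk continuous_id) }
  zero := by
    ext x : 1
    change rot i j (((0 : unitInterval) * a x : ℝ) : Real.Angle) x = x
    simp
  cont := continuous_rot.comp
    ((Real.Angle.continuous_coe.comp (by fun_prop)).prodMk continuous_snd)
  cont_symm := continuous_rot.comp
    ((Real.Angle.continuous_coe.comp (by fun_prop)).prodMk continuous_snd)
  mp t := measurePreserving_twist hij (α := fun x => ((t * a x : ℝ) : Real.Angle))
    (Real.Angle.continuous_coe.comp (by fun_prop)) fun θ x => by rw [hinv]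

theorem twist_apply (hij : i ≠ j) {a : (ι → ℝ) → ℝ} (ha : Continuous a) (hinv : ∀ θ x, a (rot i j θ x) = a x)
    (t : unitInterval) (x : ι → ℝ) :
    twist hij ha hinv t x = rot i j ((t * a x : ℝ) : Real.Angle) x := rfl

end Twist

/-! ### Reflections of boxes -/

section Box

variable {ι : Type*} [Fintype ι] [DecidableEq ι]

/-- The reflection of the coordinates `i, j` about `c`. -/
def flip (i j : ι) (c x : ι → ℝ) : ι → ℝ := fun k => if k = i ∨ k = j then 2 * c k - x k else x k

theorem rot_pi {i j : ι} (x : ι → ℝ) : rot i j Real.pi x = flip i j 0 x := by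
  ext k
  unfold rot flip
  by_cases hi : k = i
  · simp [hi]
  · by_cases hj : k = j
    · subst hj; simp [hi]
    · simp [hi, hj]

/-- A function invariant under rotations of the coordinates `i, j`. -/
def rotNorm (i j : ι) (x : ι → ℝ) : ℝ :=
  ‖fun k => if k = i ∨ k = j then x i ^ 2 + x j ^ 2 else x k‖

theorem continuous_rotNorm (i j : ι) : Continuous (rotNorm i j) := by
  refine continuous_norm.comp (continuous_pi fun k => ?_)
  split_ifs <;> fun_prop

theorem rotNorm_rot {i j : ι} (hij : i ≠ j) (θ : Real.Angle) (x : ι → ℝ) :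
    rotNorm i j (rot i j θ x) = rotNorm i j x := by
  unfold rotNorm
  congr 1
  ext k
  split_ifs with h
  · rw [rot_apply_left, rot_apply_right hij]
    linear_combination (x i ^ 2 + x j ^ 2) * Real.Angle.cos_sq_add_sin_sq θ
  · push Not at h
    exact rot_apply_of_ne _ _ h.1 h.2

/-- The sublevel sets are round discs in the coordinates `i, j` times cubes in the other ones; the
squared radius appears, so the disc has radius `√R`. -/
theorem rotNorm_le_iff {i j : ι} {R : ℝ} (x : ι → ℝ) :
    rotNorm i j x ≤ R ↔ x i ^ 2 + x j ^ 2 ≤ R ∧ ∀ k, k ≠ i → k ≠ j → |x k| ≤ R := by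
  have h0 : 0 ≤ x i ^ 2 + x j ^ 2 := by positivity
  have key : (∀ k, ‖(if k = i ∨ k = j then x i ^ 2 + x j ^ 2 else x k)‖ ≤ R) ↔
      x i ^ 2 + x j ^ 2 ≤ R ∧ ∀ k, k ≠ i → k ≠ j → |x k| ≤ R := by
    constructor
    · intro h
      refine ⟨?_, fun k hi hj => ?_⟩
      · have := h i
        simp only [true_or, if_true, Real.norm_eq_abs, abs_of_nonneg h0] at this
        exact this
      · have := h k
        simpa [hi, hj] using this
    · rintro ⟨h1, h2⟩ k
      split_ifs with h
      · rwa [Real.norm_eq_abs, abs_of_nonneg h0]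
      · push Not at h
        exact h2 k h.1 h.2
  rw [← key]
  by_cases hR : 0 ≤ R
  · exact pi_norm_le_iff_of_nonneg hR
  · constructor
    · intro h
      exact absurd ((norm_nonneg _).trans h) hR
    · intro h
      exact absurd ((norm_nonneg _).trans (h i)) hR

theorem isCompact_rotNorm_le {i j : ι} (R : ℝ) : IsCompact {x | rotNorm i j x ≤ R} := by
  refine Metric.isCompact_of_isClosed_isBounded
    (isClosed_le (continuous_rotNorm i j) continuous_const) ?_
  refine (Metric.isBounded_closedBall (x := (0 : ι → ℝ)) (r := |R| + 1)).subset fun x hx => ?_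
  rw [mem_closedBall_zero_iff, pi_norm_le_iff_of_nonneg (by positivity)]
  obtain ⟨h1, h2⟩ := (rotNorm_le_iff x).1 hx
  have hR := le_abs_self R
  have hR' := abs_nonneg R
  intro k
  by_cases hi : k = i
  · subst hi
    rw [Real.norm_eq_abs]
    refine abs_le_of_sq_le_sq (by nlinarith [sq_nonneg (x j)]) (by positivity)
  · by_cases hj : k = j
    · subst hj
      rw [Real.norm_eq_abs]
      refine abs_le_of_sq_le_sq (by nlinarith [sq_nonneg (x i)]) (by positivity)
    · have := h2 k hi hj
      rw [Real.norm_eq_abs]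
      linarith

/-- The final rotation angle is a function of `rotNorm` alone: `π` up to the level `R₀`, decreasing
to `0` at the level `R₁`. Rotation by `π` is the reflection of the two coordinates. -/
theorem exists_isotopy_rotNorm {i j : ι} (hij : i ≠ j) {R₀ R₁ : ℝ} (hR : R₀ < R₁) :
    ∃ H : Isotopy (volume : Measure (ι → ℝ)), H.SuppIn {x | rotNorm i j x ≤ R₁} ∧
      ∀ x, rotNorm i j x ≤ R₀ → H 1 x = flip i j 0 x := by
  let a : (ι → ℝ) → ℝ := fun x =>
    Real.pi * max 0 (min 1 ((R₁ - rotNorm i j x) / (R₁ - R₀)))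
  have ha : Continuous a := by
    have := continuous_rotNorm i j
    fun_prop
  have hinv : ∀ θ x, a (rot i j θ x) = a x := fun θ x => by
    change Real.pi * _ = Real.pi * _
    rw [rotNorm_rot hij]
  have h1 : 0 < R₁ - R₀ := sub_pos.2 hR
  refine ⟨twist hij ha hinv, fun t x hx => ?_, fun x hx => ?_⟩
  · have : a x = 0 := by
      have : (R₁ - rotNorm i j x) / (R₁ - R₀) ≤ 0 := by
        rw [mem_ofPred_eq, not_le] at hx
        exact div_nonpos_of_nonpos_of_nonneg (by linarith) h1.le
      change Real.pi * _ = 0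
      rw [max_eq_left ((min_le_right _ _).trans this), mul_zero]
    rw [twist_apply, this]
    simp
  · have : a x = Real.pi := by
      have : 1 ≤ (R₁ - rotNorm i j x) / (R₁ - R₀) := by
        rw [le_div_iff₀ h1]
        linarith
      change Real.pi * _ = Real.pi
      rw [min_eq_left this, max_eq_right zero_le_one, mul_one]
    rw [twist_apply, this, ← rot_pi]
    simp

/-! ### Turning a disc into a rectangle -/

/-- The primitive of the truncated half circle. -/
def arcPrimitive (η t : ℝ) : ℝ := ∫ u in (0 : ℝ)..t, max (√(1 - u ^ 2)) η

theorem continuous_arc (η : ℝ) : Continuous fun u : ℝ => max (√(1 - u ^ 2)) η := by fun_prop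

theorem strictMono_arcPrimitive {η : ℝ} (hη : 0 < η) : StrictMono (arcPrimitive η) :=
  strictMono_of_hasDerivAt_pos
    (fun t => ((continuous_arc η).integral_hasStrictDerivAt 0 t).hasDerivAt)
    fun _ => hη.trans_le (le_max_right _ _)

theorem arcPrimitive_neg (η t : ℝ) : arcPrimitive η (-t) = -arcPrimitive η t := by
  unfold arcPrimitive
  have := intervalIntegral.integral_comp_neg (a := 0) (b := t)
    (fun u : ℝ => max (√(1 - u ^ 2)) η)
  simp only [neg_sq, neg_zero] at this
  rw [this, intervalIntegral.integral_symm]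

theorem half_le_arcPrimitive_one (η : ℝ) : 1 / 2 ≤ arcPrimitive η 1 := by
  have h : ∫ u in (0 : ℝ)..1, (1 - u) = 1 / 2 := by
    rw [intervalIntegral.integral_sub (by simp) (by simp)]
    norm_num
  rw [← h]
  refine intervalIntegral.integral_mono_on zero_le_one
    ((continuous_const.sub continuous_id).intervalIntegrable _ _)
    ((continuous_arc η).intervalIntegrable _ _) fun u hu => ?_
  refine le_trans ?_ (le_max_left _ _)
  apply Real.le_sqrt_of_sq_le
  nlinarith [hu.1, hu.2]

/-- Beyond `√(1 - η ^ 2)` the half circle is below the truncation level, so the integrand is the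
constant `η`. -/
theorem arcPrimitive_one_sub_le {η : ℝ} (hη : 0 < η) (hη1 : η ≤ 1) :
    arcPrimitive η 1 - η ≤ arcPrimitive η √(1 - η ^ 2) := by
  set s := √(1 - η ^ 2) with hs
  have hs1 : s ≤ 1 := Real.sqrt_le_one.2 (by nlinarith)
  have hs0 : 0 ≤ s := Real.sqrt_nonneg _
  have hss : s ^ 2 = 1 - η ^ 2 := Real.sq_sqrt (by nlinarith)
  have h1 := intervalIntegral.integral_interval_sub_left (μ := volume)
    ((continuous_arc η).intervalIntegrable 0 1) ((continuous_arc η).intervalIntegrable 0 s)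
  have h2 : ∫ u in s..1, max (√(1 - u ^ 2)) η ≤ ∫ _ in s..1, η := by
    refine intervalIntegral.integral_mono_on hs1 ((continuous_arc η).intervalIntegrable _ _)
      (continuous_const.intervalIntegrable _ _) fun u hu => max_le ?_ le_rfl
    apply Real.sqrt_le_iff.2 ⟨hη.le, ?_⟩
    nlinarith [hu.1]
  rw [intervalIntegral.integral_const, smul_eq_mul] at h2
  have h3 : (1 - s) * η ≤ η := by nlinarith
  unfold arcPrimitive
  linarith

/-- Start from the density `√(1 - x j ^ 2)`, the half width of the disc at height `x j`.
Straightening it in direction `i` maps the square onto the disc, straightening it in direction `j`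
maps the square onto a rectangle. The comparison map preserves volume and carries the twist of the
disc to the rectangle. Truncating the density below by `η` keeps it bounded away from zero. The
density is even in `x j` and independent of `x i`, so both straightenings commute with the
reflection. -/
theorem exists_isotopy_flip_unit {i j : ι} (hij : i ≠ j) {θ : ℝ} (hθ : 0 ≤ θ) (hθ1 : θ < 1) :
    ∃ D > 0, ∃ H : Isotopy (volume : Measure (ι → ℝ)), ∃ K : Set (ι → ℝ), IsCompact K ∧
      (∀ x ∈ K, ∀ k, |x k| < if k = j then D else 1) ∧ H.SuppIn K ∧
      ∀ x : ι → ℝ, (∀ k, |x k| ≤ θ * if k = j then D else 1) → H 1 x = flip i j 0 x := by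
  -- Since `D ≥ 1 / 2`, this choice gives `η ≤ (1 - θ) * D`: the part of the height affected by the
  -- truncation lies outside the smaller box.
  let η : ℝ := (1 - θ) / 2
  have hη : 0 < η := by simp only [η]; linarith
  have hη1 : η ≤ 1 := by simp only [η]; linarith
  let D := arcPrimitive η 1
  have hD : 1 / 2 ≤ D := half_le_arcPrimitive_one η
  let s := √(1 - η ^ 2)
  have hs0 : 0 ≤ s := Real.sqrt_nonneg _
  have hss : s ^ 2 = 1 - η ^ 2 := Real.sq_sqrt (by nlinarith)
  have hDs : θ * D ≤ arcPrimitive η s := by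
    have := arcPrimitive_one_sub_le hη hη1
    have h2 : η ≤ (1 - θ) * D := by simp only [η]; nlinarith
    simp only [D, s] at *
    linarith
  let g : (ι → ℝ) → ℝ := fun x => max (√(1 - x j ^ 2)) η
  have hg : Continuous g := by fun_prop
  have hgη : ∀ x, η ≤ g x := fun x => le_max_right _ _
  let P := straight i g 0 hg hη hgη
  let Q := straight j g 0 hg hη hgη
  have hPi : ∀ p, P p i = p i * g p := by
    intro p
    change straightFun i g 0 p i = _
    rw [straightFun_apply_same, linePrimitive, zero_add]
    have : ∀ u, g (Function.update p i u) = g p := fun u => by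
      simp only [g, Function.update_of_ne hij.symm]
    simp_rw [this]
    rw [intervalIntegral.integral_const, sub_zero, smul_eq_mul]
  have hPk : ∀ p k, k ≠ i → P p k = p k := fun p k hk => straightFun_apply_of_ne p hk
  have hQj : ∀ p, Q p j = arcPrimitive η (p j) := by
    intro p
    change straightFun j g 0 p j = _
    rw [straightFun_apply_same, linePrimitive, zero_add]
    simp only [g, Function.update_self]
    rfl
  have hQk : ∀ p k, k ≠ j → Q p k = p k := fun p k hk => straightFun_apply_of_ne p hk
  have hgflip : ∀ p, g (flip i j 0 p) = g p := by
    intro p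
    simp [g, flip]
  have hPflip : ∀ p, P (flip i j 0 p) = flip i j 0 (P p) := by
    intro p
    ext k
    by_cases hk : k = i
    · subst hk
      rw [hPi, hgflip]
      simp [flip, hPi]
    · rw [hPk _ _ hk]
      simp only [flip, hPk _ _ hk]
  have hQflip : ∀ p, Q (flip i j 0 p) = flip i j 0 (Q p) := by
    intro p
    ext k
    by_cases hk : k = j
    · subst hk
      rw [hQj]
      simp [flip, hQj, arcPrimitive_neg]
    · rw [hQk _ _ hk]
      simp only [flip, hQk _ _ hk]
  -- For `p i ^ 2 ≤ θ ^ 2` and `p j ^ 2 ≤ s ^ 2` the squared radius `p i ^ 2 * (1 - p j ^ 2) + p j ^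
  -- 2` is at most the second entry; the first entry bounds the remaining coordinates.
  let R₀ := max θ (θ ^ 2 + (1 - θ ^ 2) * s ^ 2)
  have hR₀ : R₀ < 1 := by
    refine max_lt hθ1 ?_
    have : θ ^ 2 < 1 := by nlinarith
    rw [hss]
    nlinarith [mul_pos (sub_pos.2 this) (pow_pos hη 2)]
  let R₁ := (R₀ + 1) / 2
  have hR : R₀ < R₁ := by simp only [R₁]; linarith
  have hR1 : R₁ < 1 := by simp only [R₁]; linarith
  obtain ⟨H, hH, hH1⟩ := exists_isotopy_rotNorm (ι := ι) hij hR
  have hmp := measurePreserving_straight_symm_trans (i := i) (j := j) (s := 0) (s' := 0) hg hη hgη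
  let Z : (ι → ℝ) ≃ₜ (ι → ℝ) := P.symm.trans Q
  have hZ : Measure.map Z volume = (1 : ENNReal) • volume := by
    rw [one_smul]
    exact hmp.map_eq
  refine ⟨D, by linarith, H.conj Z one_ne_zero ENNReal.one_ne_top hZ,
    Z '' {x | rotNorm i j x ≤ R₁}, (isCompact_rotNorm_le R₁).image Z.continuous, ?_, ?_, ?_⟩
  · rintro _ ⟨x, hx, rfl⟩ k
    obtain ⟨p, rfl⟩ := P.surjective x
    have hZp : Z (P p) = Q p := by
      simp only [Z, Homeomorph.trans_apply, Homeomorph.symm_apply_apply]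
    obtain ⟨h1, h2⟩ := (rotNorm_le_iff _).1 hx
    rw [hPi, hPk _ _ hij.symm] at h1
    -- A squared radius below one bounds `p j` strictly, and then `p i`, because `g p ^ 2 ≥ 1 - p j
    -- ^ 2` also where the density is truncated.
    have hpj : p j ^ 2 < 1 := by nlinarith [sq_nonneg (p i * g p)]
    rw [hZp]
    split_ifs with hk
    · subst hk
      rw [hQj]
      have h3 := abs_lt_of_sq_lt_sq (a := p k) (b := 1) (by rw [one_pow]; exact hpj) zero_le_one
      rw [abs_lt] at h3 ⊢
      rw [← arcPrimitive_neg]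
      exact ⟨strictMono_arcPrimitive hη h3.1, strictMono_arcPrimitive hη h3.2⟩
    · rw [hQk _ _ hk]
      by_cases hki : k = i
      · subst hki
        have h4 : √(1 - p j ^ 2) ≤ g p := le_max_left _ _
        have h5 : √(1 - p j ^ 2) ^ 2 = 1 - p j ^ 2 := Real.sq_sqrt (by linarith)
        have h6 : 1 - p j ^ 2 ≤ g p ^ 2 := by
          rw [← h5]
          exact pow_le_pow_left₀ (Real.sqrt_nonneg _) h4 2
        have hgp : 0 < g p := hη.trans_le (hgη p)
        refine abs_lt_of_sq_lt_sq ?_ zero_le_one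
        by_contra hcon
        rw [not_lt, one_pow] at hcon
        nlinarith [mul_le_mul_of_nonneg_right hcon (sq_nonneg (g p))]
      · have := h2 k hki hk
        rw [hPk _ _ hki] at this
        linarith
  · intro t y hy
    change Z (H t (Z.symm y)) = y
    rw [hH t, Homeomorph.apply_symm_apply]
    exact fun h => hy ⟨_, h, Z.apply_symm_apply y⟩
  · intro y hy
    obtain ⟨p, rfl⟩ := Q.surjective y
    change Z (H 1 (Z.symm (Q p))) = _
    have hZp : Z.symm (Q p) = P p := by
      simp only [Z, Homeomorph.symm_trans_apply, Homeomorph.symm_apply_apply,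
        Homeomorph.symm_symm]
    have hpj : |p j| ≤ s := by
      have h1 := hy j
      rw [if_pos rfl, hQj] at h1
      have h2 := h1.trans hDs
      rw [abs_le, ← arcPrimitive_neg] at h2
      exact abs_le.2 ⟨(strictMono_arcPrimitive hη).le_iff_le.1 h2.1,
        (strictMono_arcPrimitive hη).le_iff_le.1 h2.2⟩
    have hpj2 : p j ^ 2 ≤ s ^ 2 := sq_le_sq' (abs_le.1 hpj).1 (abs_le.1 hpj).2
    have hgp : g p ^ 2 = 1 - p j ^ 2 := by
      have : η ≤ √(1 - p j ^ 2) := Real.le_sqrt_of_sq_le (by linarith)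
      simp only [g, max_eq_left this]
      exact Real.sq_sqrt (by nlinarith)
    have hpi : p i ^ 2 ≤ θ ^ 2 := by
      have h1 := hy i
      rw [if_neg hij, hQk _ _ hij, mul_one] at h1
      exact sq_le_sq' (abs_le.1 h1).1 (abs_le.1 h1).2
    rw [hZp, hH1]
    · rw [← hPflip]
      simp only [Z, Homeomorph.trans_apply, Homeomorph.symm_apply_apply, hQflip]
    · rw [rotNorm_le_iff]
      refine ⟨?_, fun k hi hj => ?_⟩
      · rw [hPi, hPk _ _ hij.symm, mul_pow, hgp]
        refine le_trans ?_ (le_max_right _ _)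
        have : θ ^ 2 ≤ 1 := by nlinarith
        nlinarith [mul_le_mul_of_nonneg_right hpi (sq_nonneg (g p))]
      · have h1 := hy k
        rw [if_neg hj, hQk _ _ hj, mul_one] at h1
        rw [hPk _ _ hi]
        exact h1.trans (le_max_left _ _)

theorem map_linear_add (A : (ι → ℝ) ≃L[ℝ] (ι → ℝ)) (b : ι → ℝ) :
    ∃ a : ENNReal, a ≠ 0 ∧ a ≠ ⊤ ∧
      Measure.map (A.toHomeomorph.trans (Homeomorph.addRight b)) volume = a • volume := by
  have hdet : LinearMap.det (A : (ι → ℝ) →ₗ[ℝ] (ι → ℝ)) ≠ 0 := A.toLinearEquiv.isUnit_det'.ne_zero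
  refine ⟨ENNReal.ofReal |(LinearMap.det (A : (ι → ℝ) →ₗ[ℝ] (ι → ℝ)))⁻¹|, ?_,
    ENNReal.ofReal_ne_top, ?_⟩
  · simp [hdet]
  · have h1 : ⇑(A.toHomeomorph.trans (Homeomorph.addRight b)) = (fun x => x + b) ∘ A := rfl
    rw [h1, ← Measure.map_map (measurable_add_const b) A.continuous.measurable]
    have h2 := Measure.map_linearMap_addHaar_eq_smul_addHaar (volume : Measure (ι → ℝ)) hdet
    change Measure.map A volume = _ at h2
    rw [h2, Measure.map_smul, (measurePreserving_add_right volume b).map_eq]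

/-- An isotopy supported in a box whose endpoint reflects two coordinates on a smaller box. -/
theorem exists_isotopy_flip {i j : ι} (hij : i ≠ j) (c : ι → ℝ) {d : ι → ℝ} (hd : ∀ k, 0 < d k)
    {θ : ℝ} (hθ : 0 ≤ θ) (hθ1 : θ < 1) :
    ∃ H : Isotopy (volume : Measure (ι → ℝ)), ∃ K : Set (ι → ℝ), IsCompact K ∧
      (∀ x ∈ K, ∀ k, |x k - c k| < d k) ∧ H.SuppIn K ∧
      ∀ x : ι → ℝ, (∀ k, |x k - c k| ≤ θ * d k) → H 1 x = flip i j c x := by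
  obtain ⟨D, hD, H, K, hK, hKD, hH, hH1⟩ := exists_isotopy_flip_unit (ι := ι) hij hθ hθ1
  let e : ι → ℝ := fun k => if k = j then D else 1
  have he : ∀ k, 0 < e k := fun k => by simp only [e]; split_ifs <;> linarith
  let f : ι → ℝ := fun k => d k / e k
  have hf : ∀ k, 0 < f k := fun k => div_pos (hd k) (he k)
  let A : (ι → ℝ) ≃L[ℝ] (ι → ℝ) :=
    { toFun := fun x k => f k * x k
      invFun := fun x k => x k / f k
      left_inv := fun x => by ext k; exact mul_div_cancel_left₀ _ (hf k).ne'
      right_inv := fun x => by ext k; exact mul_div_cancel₀ _ (hf k).ne'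
      map_add' := fun x y => by ext k; exact mul_add _ _ _
      map_smul' := fun r x => by
        ext k
        simp only [Pi.smul_apply, smul_eq_mul, RingHom.id_apply]
        ring
      continuous_toFun := by fun_prop
      continuous_invFun := by
        refine continuous_pi fun k => ?_
        exact (continuous_apply k).div_const _ }
  obtain ⟨a, ha, ha', hZ⟩ := map_linear_add A c
  set Z := A.toHomeomorph.trans (Homeomorph.addRight c)
  have hZk : ∀ x k, Z x k = f k * x k + c k := fun x k => rfl
  have hfe : ∀ k, f k * e k = d k := fun k => div_mul_cancel₀ _ (he k).ne'
  refine ⟨H.conj Z ha ha' hZ, Z '' K, hK.image Z.continuous, ?_, ?_, ?_⟩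
  · rintro _ ⟨x, hx, rfl⟩ k
    rw [hZk, add_sub_cancel_right, abs_mul, abs_of_pos (hf k), ← hfe k]
    exact mul_lt_mul_of_pos_left (hKD x hx k) (hf k)
  · intro t y hy
    change Z (H t (Z.symm y)) = y
    rw [hH t, Homeomorph.apply_symm_apply]
    exact fun h => hy ⟨_, h, Z.apply_symm_apply y⟩
  · intro y hy
    obtain ⟨x, rfl⟩ := Z.surjective y
    change Z (H 1 (Z.symm (Z x))) = _
    rw [Homeomorph.symm_apply_apply, hH1]
    · ext k
      simp only [hZk, flip]
      split_ifs
      · simp only [Pi.zero_apply]; ring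
      · rfl
    · intro k
      have := hy k
      rw [hZk, add_sub_cancel_right, abs_mul, abs_of_pos (hf k), ← hfe k, mul_left_comm] at this
      exact le_of_mul_le_mul_left this (hf k)

end Box

/-! ### Pushing points around -/

section Push

variable {ι : Type*} [Fintype ι] [DecidableEq ι]

/-- Isotopies with arbitrarily small compact support in `V` translate a neighbourhood of `a` by
`b - a`. -/
def PushIn (V : Set (ι → ℝ)) (a b : ι → ℝ) : Prop :=
  ∀ η > (0 : ENNReal), ∃ H : Isotopy (volume : Measure (ι → ℝ)), ∃ K ⊆ V, IsCompact K ∧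
    volume K ≤ η ∧ H.SuppIn K ∧ ∀ᶠ x in 𝓝 a, H 1 x = x + (b - a)

theorem PushIn.refl (V : Set (ι → ℝ)) (a : ι → ℝ) : PushIn V a a := fun η _ =>
  ⟨1, ∅, empty_subset _, isCompact_empty, by simp, Isotopy.suppIn_one _, by simp⟩

theorem PushIn.trans {V : Set (ι → ℝ)} {a b c : ι → ℝ} (h : PushIn V a b) (h' : PushIn V b c) :
    PushIn V a c := by
  intro η hη
  obtain ⟨H, K, hKV, hK, hKη, hH, hH1⟩ := h (η / 2) (ENNReal.half_pos hη.ne')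
  obtain ⟨H', K', hKV', hK', hKη', hH', hH1'⟩ := h' (η / 2) (ENNReal.half_pos hη.ne')
  refine ⟨H * H', K ∪ K', union_subset hKV hKV', hK.union hK', ?_, hH.mul hH', ?_⟩
  · exact (measure_union_le _ _).trans ((add_le_add hKη hKη').trans (ENNReal.add_halves η).le)
  · have hc : Tendsto (fun x : ι → ℝ => x + (b - a)) (𝓝 a) (𝓝 b) := by
      have : Continuous fun x : ι → ℝ => x + (b - a) := by fun_prop
      simpa using this.tendsto a
    filter_upwards [hH1, hc.eventually hH1'] with x hx hx'
    rw [Isotopy.mul_apply, hx, hx']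
    abel

/-- Reflecting first about `a` and then about `a + v / 2` in direction `i` translates by `v` in this
direction; in the auxiliary direction `j` the two centres agree and the reflections cancel. The
boxes may be thin in all directions but `i`, which makes the volume of the support small. -/
theorem exists_isotopy_translate [Nontrivial ι] (a : ι → ℝ) (i : ι) (v : ℝ) {δ : ℝ} (hδ : 0 < δ) :
    ∃ H : Isotopy (volume : Measure (ι → ℝ)), ∃ K, IsCompact K ∧
      (∀ x ∈ K, ∀ k, |x k - a k| ≤ if k = i then 3 * |v| else δ) ∧ H.SuppIn K ∧
      ∀ᶠ x in 𝓝 a, H 1 x = x + Pi.single i v := by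
  rcases eq_or_ne v 0 with rfl | hv
  · exact ⟨1, ∅, isCompact_empty, by simp, Isotopy.suppIn_one _, by simp⟩
  obtain ⟨j, hj⟩ := exists_ne i
  have hv' : 0 < |v| := abs_pos.2 hv
  -- With `θ = 1 / 2` the reflections are exact up to distance `|v|` in direction `i`, which exceeds
  -- the distance `|v| / 2` between the centres. Both boxes stay within `3 * |v|` of `a`.
  let d : ι → ℝ := fun k => if k = i then 2 * |v| else δ
  have hd : ∀ k, 0 < d k := fun k => by simp only [d]; split_ifs <;> linarith
  let c : ι → ℝ := a + Pi.single i (v / 2)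
  obtain ⟨H, K, hK, hKd, hH, hH1⟩ := exists_isotopy_flip hj.symm a hd (θ := 1 / 2)
    (by norm_num) (by norm_num)
  obtain ⟨H', K', hK', hKd', hH', hH1'⟩ := exists_isotopy_flip hj.symm c hd (θ := 1 / 2)
    (by norm_num) (by norm_num)
  have hca : ∀ k, |c k - a k| ≤ if k = i then |v| / 2 else 0 := by
    intro k
    simp only [c, Pi.add_apply, add_sub_cancel_left]
    split_ifs with h
    · subst h
      rw [Pi.single_eq_same, abs_div, abs_two]
    · simp [h]
  have hcont : Continuous (flip i j a) := by
    refine continuous_pi fun k => ?_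
    unfold flip
    split_ifs <;> fun_prop
  have hfa : flip i j a a = a := by
    ext k
    unfold flip
    split_ifs <;> ring
  refine ⟨H * H', K ∪ K', hK.union hK', ?_, hH.mul hH', ?_⟩
  · rintro x (hx | hx) k
    · have := hKd x hx k
      simp only [d] at this
      split_ifs with h
      · rw [if_pos h] at this; linarith
      · rw [if_neg h] at this; linarith
    · have h1 := hKd' x hx k
      have h2 := hca k
      have h3 := abs_sub_le (x k) (c k) (a k)
      simp only [d] at h1
      split_ifs with h
      · rw [if_pos h] at h1 h2; linarith
      · rw [if_neg h] at h1 h2; linarith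
  · have e1 : ∀ᶠ x in 𝓝 a, ∀ k, |x k - a k| ≤ 1 / 2 * d k := by
      refine eventually_all.2 fun k => ?_
      have hc : Continuous fun x : ι → ℝ => |x k - a k| := by fun_prop
      have h0 : |a k - a k| < 1 / 2 * d k := by
        rw [sub_self, abs_zero]; linarith [hd k]
      filter_upwards [hc.continuousAt.eventually_lt continuousAt_const h0] with x hx using hx.le
    have e2 : ∀ᶠ x in 𝓝 a, ∀ k, |x k - c k| ≤ 1 / 2 * d k := by
      refine eventually_all.2 fun k => ?_
      have hc : Continuous fun x : ι → ℝ => |x k - c k| := by fun_prop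
      have h0 : |a k - c k| < 1 / 2 * d k := by
        rw [abs_sub_comm]
        refine (hca k).trans_lt ?_
        simp only [d]
        split_ifs <;> linarith
      filter_upwards [hc.continuousAt.eventually_lt continuousAt_const h0] with x hx using hx.le
    have ht : Tendsto (flip i j a) (𝓝 a) (𝓝 a) := by
      have := hcont.tendsto a
      rwa [hfa] at this
    filter_upwards [e1, ht.eventually e2] with x hx hx'
    rw [Isotopy.mul_apply, hH1 x hx, hH1' _ hx']
    ext k
    simp only [flip, c, Pi.add_apply]
    by_cases hk : k = i
    · subst hk
      simp
      ring
    · by_cases hk' : k = j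
      · subst hk'
        simp [hk]
      · simp [hk, hk']

theorem tendsto_volume_thin {i j : ι} (hij : j ≠ i) (a : ι → ℝ) (w : ℝ) :
    Tendsto (fun δ : ℝ => volume {x : ι → ℝ | ∀ k, |x k - a k| ≤ if k = i then w else δ})
      (𝓝[>] 0) (𝓝 0) := by
  have h : ∀ δ : ℝ, {x : ι → ℝ | ∀ k, |x k - a k| ≤ if k = i then w else δ} =
      Icc (fun k => a k - if k = i then w else δ) (fun k => a k + if k = i then w else δ) := by
    intro δ
    ext x
    simp only [mem_ofPred_eq, mem_Icc, Pi.le_def, ← forall_and, abs_le]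
    refine forall_congr' fun k => ?_
    constructor <;> rintro ⟨h1, h2⟩ <;> constructor <;> linarith
  simp_rw [h, Real.volume_Icc_pi]
  have hc : Tendsto (fun δ : ℝ => ∏ k, ENNReal.ofReal ((a k + if k = i then w else δ) -
      (a k - if k = i then w else δ))) (𝓝 0) (𝓝 (∏ k, ENNReal.ofReal ((a k + if k = i then w else 0) -
      (a k - if k = i then w else 0)))) := by
    refine ENNReal.tendsto_finsetProd_of_ne_top _ (fun k _ => ?_) (fun k _ => ENNReal.ofReal_ne_top)
    refine (ENNReal.continuous_ofReal.tendsto _).comp ?_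
    refine Continuous.tendsto ?_ 0
    split_ifs <;> fun_prop
  rw [Finset.prod_eq_zero (Finset.mem_univ j) (by simp [hij])] at hc
  exact hc.mono_left nhdsWithin_le_nhds

theorem pushIn_add_single [Nontrivial ι] {V : Set (ι → ℝ)} {a : ι → ℝ} {r : ℝ} {i : ι} {v : ℝ}
    (hr : Metric.ball a r ⊆ V) (hv : 3 * |v| < r) : PushIn V a (a + Pi.single i v) := by
  intro η hη
  obtain ⟨j, hj⟩ := exists_ne i
  have hr0 : 0 < r := lt_of_le_of_lt (by positivity) hv
  have e1 := (tendsto_order.1 (tendsto_volume_thin hj a (3 * |v|))).2 η hη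
  have e2 : ∀ᶠ δ in 𝓝[>] (0 : ℝ), δ < r := nhdsWithin_le_nhds (gt_mem_nhds hr0)
  obtain ⟨δ, ⟨h1, h2⟩, h3⟩ := ((e1.and e2).and self_mem_nhdsWithin).exists
  obtain ⟨H, K, hK, hKd, hH, hH1⟩ := exists_isotopy_translate a i v h3
  refine ⟨H, K, fun x hx => hr ?_, hK, (measure_mono fun x hx => hKd x hx).trans h1.le, hH, ?_⟩
  · rw [Metric.mem_ball, dist_pi_lt_iff hr0]
    intro k
    rw [Real.dist_eq]
    refine (hKd x hx k).trans_lt ?_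
    split_ifs
    · exact hv
    · exact h2
  · simpa using hH1

theorem pushIn_of_ball [Nontrivial ι] {V : Set (ι → ℝ)} {x a b : ι → ℝ} {r : ℝ}
    (hr : Metric.ball x (8 * r) ⊆ V) (ha : a ∈ Metric.ball x r) (hb : b ∈ Metric.ball x r) :
    PushIn V a b := by
  have hr0 : 0 < r := lt_of_le_of_lt dist_nonneg ha
  rw [Metric.mem_ball, dist_pi_lt_iff hr0] at ha hb
  have key : ∀ s : Finset ι, PushIn V a (s.piecewise b a) := by
    intro s
    induction s using Finset.induction_on with
    | empty => simpa using PushIn.refl V a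
    | insert k s hk ih =>
      refine ih.trans ?_
      have h1 : (insert k s).piecewise b a =
          s.piecewise b a + Pi.single k (b k - a k) := by
        rw [Finset.piecewise_insert]
        ext l
        by_cases hl : l = k
        · subst hl
          simp [hk]
        · simp [hl]
      rw [h1]
      -- Every intermediate point is within `r` of `x`, so its ball of radius `7 * r` lies in the
      -- ball of radius `8 * r`; a single step is shorter than `2 * r`, and three times its length
      -- is below `7 * r`.
      refine pushIn_add_single (r := 7 * r) ((Metric.ball_subset_ball' ?_).trans hr) ?_
      · have : dist (s.piecewise b a) x < r := by
          rw [dist_pi_lt_iff hr0]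
          intro l
          by_cases hl : l ∈ s
          · simpa [hl] using hb l
          · simpa [hl] using ha l
        linarith
      · have h2 := ha k
        have h3 := hb k
        rw [Real.dist_eq] at h2 h3
        have := abs_sub_le (b k) (x k) (a k)
        rw [abs_sub_comm (x k)] at this
        linarith
  simpa using key Finset.univ

theorem pushIn_of_isPreconnected [Nontrivial ι] {V : Set (ι → ℝ)} (hV : IsOpen V)
    (hc : IsPreconnected V) {a b : ι → ℝ} (ha : a ∈ V) (hb : b ∈ V) : PushIn V a b := by
  refine hc.induction₂' (fun a b => PushIn V a b) (fun x hx => ?_)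
    (fun _ _ _ _ _ _ h h' => h.trans h') ha hb
  obtain ⟨ε, hε, hb⟩ := Metric.isOpen_iff.1 hV x hx
  have h8 : Metric.ball x (8 * (ε / 8)) ⊆ V := by
    rwa [mul_div_cancel₀ _ (by norm_num : (8 : ℝ) ≠ 0)]
  have hx8 : x ∈ Metric.ball x (ε / 8) := Metric.mem_ball_self (by positivity)
  filter_upwards [nhdsWithin_le_nhds (Metric.ball_mem_nhds x (by positivity : 0 < ε / 8))] with y hy
  exact ⟨pushIn_of_ball h8 hx8 hy, pushIn_of_ball h8 hy hx8⟩

end Push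

/-! ### Germs realised by compactly supported isotopies -/

section Germ

variable {ι : Type*} [Fintype ι] [DecidableEq ι]

/-- Near `a`, the map `Y`, translated such that it fixes `a`, is the endpoint of a volume preserving
isotopy with compact support in `V`. -/
def GermIn (V : Set (ι → ℝ)) (Y : (ι → ℝ) → ι → ℝ) (a : ι → ℝ) : Prop :=
  ∃ H : Isotopy (volume : Measure (ι → ℝ)), ∃ K ⊆ V, IsCompact K ∧ H.SuppIn K ∧
    ∀ᶠ x in 𝓝 a, H 1 x = a + (Y x - Y a)

/-- The map `Y` satisfies `GermIn V Y a` for all neighbourhoods `V` of `a`. -/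
def Germ (Y : (ι → ℝ) → ι → ℝ) (a : ι → ℝ) : Prop := ∀ V ∈ 𝓝 a, GermIn V Y a

variable {V V' : Set (ι → ℝ)} {Y Y' : (ι → ℝ) → ι → ℝ} {a b : ι → ℝ}

theorem GermIn.mono (h : GermIn V Y a) (hV : V ⊆ V') : GermIn V' Y a := by
  obtain ⟨H, K, hKV, hK⟩ := h
  exact ⟨H, K, hKV.trans hV, hK⟩

theorem GermIn.congr (h : GermIn V Y a) (hY : ∀ᶠ x in 𝓝 a, Y' x - Y' a = Y x - Y a) :
    GermIn V Y' a := by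
  obtain ⟨H, K, hKV, hK, hH, hH1⟩ := h
  refine ⟨H, K, hKV, hK, hH, ?_⟩
  filter_upwards [hH1, hY] with x h1 h2
  rw [h1, h2]

theorem Germ.congr (h : Germ Y a) (hY : ∀ᶠ x in 𝓝 a, Y' x - Y' a = Y x - Y a) : Germ Y' a :=
  fun V hV => (h V hV).congr hY

theorem Germ.congr' (h : Germ Y a) (hY : Y' =ᶠ[𝓝 a] Y) : Germ Y' a :=
  h.congr (by filter_upwards [hY] with x hx; rw [hx, hY.self_of_nhds])

theorem GermIn.translate {b : ι → ℝ} (h : GermIn V Y b)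
    (hV : ∀ z ∈ V, z + (a - b) ∈ V') : GermIn V' (fun z => Y (z + (b - a))) a := by
  obtain ⟨H, K, hKV, hK, hH, hH1⟩ := h
  let Z : (ι → ℝ) ≃ₜ (ι → ℝ) := Homeomorph.addRight (a - b)
  have hZ : Measure.map Z volume = (1 : ENNReal) • volume := by
    rw [one_smul]
    exact (measurePreserving_add_right volume (a - b)).map_eq
  have hZs : ∀ x, Z.symm x = x + (b - a) := fun x => by
    change x + -(a - b) = _
    abel
  refine ⟨H.conj Z one_ne_zero ENNReal.one_ne_top hZ, Z '' K, ?_, hK.image Z.continuous, ?_, ?_⟩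
  · rintro _ ⟨z, hz, rfl⟩
    exact hV z (hKV hz)
  · intro t y hy
    change Z (H t (Z.symm y)) = y
    rw [hH t, Homeomorph.apply_symm_apply]
    exact fun h => hy ⟨_, h, Z.apply_symm_apply y⟩
  · have ht : Tendsto (fun x : ι → ℝ => x + (b - a)) (𝓝 a) (𝓝 b) := by
      have : Continuous fun x : ι → ℝ => x + (b - a) := by fun_prop
      simpa using this.tendsto a
    filter_upwards [ht.eventually hH1] with x hx
    change H 1 (Z.symm x) + (a - b) = _
    rw [hZs, hx, add_sub_cancel]
    abel

/-- The isotopy for `Y'` lives near `Y a` and has to be translated back to `a`, since `GermIn`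
normalises every germ so as to fix its base point. -/
theorem GermIn.comp (h : GermIn V Y a) (h' : GermIn V' Y' (Y a))
    (hV : ∀ z ∈ V', z + (a - Y a) ∈ V) (hY : ContinuousAt Y a) : GermIn V (Y' ∘ Y) a := by
  obtain ⟨H', K', hKV', hK', hH', hH1'⟩ := h'.translate hV
  obtain ⟨H, K, hKV, hK, hH, hH1⟩ := h
  refine ⟨H * H', K ∪ K', union_subset hKV hKV', hK.union hK', hH.mul hH', ?_⟩
  have ht : Tendsto (fun x => a + (Y x - Y a)) (𝓝 a) (𝓝 a) := by
    have : ContinuousAt (fun x => a + (Y x - Y a)) a := by fun_prop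
    simpa [ContinuousAt] using this
  filter_upwards [hH1, ht.eventually hH1'] with x hx hx'
  rw [Isotopy.mul_apply, hx, hx']
  simp only [Function.comp_apply]
  rw [show a + (Y x - Y a) + (Y a - a) = Y x by abel, add_sub_cancel]

theorem tendsto_add_sub (a b : ι → ℝ) : Tendsto (fun x : ι → ℝ => x + (b - a)) (𝓝 a) (𝓝 b) := by
  have : Continuous fun x : ι → ℝ => x + (b - a) := by fun_prop
  simpa using this.tendsto a

theorem GermIn.comp_germ (h : GermIn V Y a) (hV : V ∈ 𝓝 a) (h' : Germ Y' (Y a))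
    (hY : ContinuousAt Y a) : GermIn V (Y' ∘ Y) a :=
  h.comp (h' _ ((tendsto_add_sub (Y a) a) hV)) (fun _ hz => hz) hY

theorem Germ.comp (h : Germ Y a) (h' : Germ Y' (Y a)) (hY : ContinuousAt Y a) :
    Germ (Y' ∘ Y) a := fun V hV => (h V hV).comp_germ hV h' hY

theorem germ_id (a : ι → ℝ) : Germ (fun x => x) a := fun V _ =>
  ⟨1, ∅, empty_subset _, isCompact_empty, Isotopy.suppIn_one _, by simp⟩

/-- Germs of a volume preserving homeomorphism can be moved to other points. -/
theorem GermIn.transfer [Nontrivial ι] (hV : IsOpen V) (hVc : IsPreconnected V) (ha : a ∈ V)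
    (hb : b ∈ V) {X : (ι → ℝ) ≃ₜ (ι → ℝ)} (hX : MeasurePreserving X volume volume)
    (h : GermIn V X b) : GermIn V X a := by
  -- `P` pushes `X a` to `X b` inside the image of `V`. Conjugated by `X` it is `x ↦ X.symm (X x +
  -- (X b - X a))` near `a`; the isotopy realising `X` at `b` turns this into `b + (X x - X a)`, and
  -- `Q` translates from `b` back to `a`. Only global volume preservation of `X` is used.
  obtain ⟨P, K, hKV, hK, -, hP, hP1⟩ := pushIn_of_isPreconnected (hV.preimage X.symm.continuous)
    (by rw [← X.image_eq_preimage_symm]; exact hVc.image _ X.continuous.continuousOn)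
    (a := X a) (b := X b) (by simpa using ha) (by simpa using hb) 1 one_pos
  obtain ⟨Q, L, hLV, hL, -, hQ, hQ1⟩ := pushIn_of_isPreconnected hV hVc hb ha 1 one_pos
  obtain ⟨H, M, hMV, hM, hH, hH1⟩ := h
  have hZ : Measure.map X.symm volume = (1 : ENNReal) • volume := by
    rw [one_smul]
    exact (MeasurePreserving.symm X.toMeasurableEquiv hX).map_eq
  have hP' : (P.conj X.symm one_ne_zero ENNReal.one_ne_top hZ).SuppIn (X.symm '' K) := by
    intro t y hy
    change X.symm (P t (X y)) = y
    rw [hP t, Homeomorph.symm_apply_apply]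
    exact fun h => hy ⟨_, h, X.symm_apply_apply y⟩
  refine ⟨P.conj X.symm one_ne_zero ENNReal.one_ne_top hZ * (H * Q), X.symm '' K ∪ (M ∪ L),
    union_subset ?_ (union_subset hMV hLV),
    (hK.image X.symm.continuous).union (hM.union hL), hP'.mul (hH.mul hQ), ?_⟩
  · rintro _ ⟨y, hy, rfl⟩
    exact hKV hy
  · have hXt := X.continuous.tendsto a
    have t1 : Tendsto (fun x => X.symm (X x + (X b - X a))) (𝓝 a) (𝓝 b) := by
      have : Continuous fun x => X.symm (X x + (X b - X a)) :=
        X.symm.continuous.comp (X.continuous.add continuous_const)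
      simpa using this.tendsto a
    have t2 : Tendsto (fun x => b + (X x - X a)) (𝓝 a) (𝓝 b) := by
      have : Continuous fun x => b + (X x - X a) :=
        continuous_const.add (X.continuous.sub continuous_const)
      simpa using this.tendsto a
    filter_upwards [hXt.eventually hP1, t1.eventually hH1, t2.eventually hQ1] with x h1 h2 h3
    have e : P.conj X.symm one_ne_zero ENNReal.one_ne_top hZ 1 x = X.symm (P 1 (X x)) := rfl
    rw [Isotopy.mul_apply, Isotopy.mul_apply, e, h1, h2, Homeomorph.apply_symm_apply,
      show b + (X x + (X b - X a) - X b) = b + (X x - X a) by abel, h3]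
    abel

/-! ### Shears -/

/-- The shear in direction `i` by the function `T`. -/
def shear (i : ι) (T : (ι → ℝ) → ℝ) (x : ι → ℝ) : ι → ℝ := x + Pi.single i (T x)

theorem continuous_shear {i : ι} {T : (ι → ℝ) → ℝ} (hT : Continuous T) :
    Continuous (shear i T) := continuous_id.add (continuous_single i |>.comp hT)

theorem update_eq_add_single (x : ι → ℝ) (i : ι) (v : ℝ) :
    Function.update x i v = x + Pi.single i (v - x i) := by
  ext k
  by_cases hk : k = i
  · subst hk; simp
  · simp [hk]

/-- The density `g` is `1` near `a` and near a second point `b`, and perturbed in between.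
Straightening in direction `i` accumulates the perturbation while passing from `b` to `a`, giving
the shear near `a` and the identity near `b`. Composing with the inverse of the straightening in
direction `j`, which is trivial where `w` vanishes, makes the map volume preserving. Then the
trivial germ at `b` is transferred to `a`. -/
theorem germ_shear [Nontrivial ι] {i : ι} {T : (ι → ℝ) → ℝ} (hT : Continuous T)
    (hTi : ∀ x u, T (Function.update x i u) = T x) (a : ι → ℝ) : Germ (shear i T) a := by
  intro V hV
  obtain ⟨j, hj⟩ := exists_ne i
  obtain ⟨r, hr, hrV⟩ := Metric.mem_nhds_iff.1 hV
  let ρ := r / 8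
  have hρ : 0 < ρ := by positivity
  let m₀ := a i - 2 * ρ
  -- A tent of half width `ρ` centred midway between `b i = a i - 4 * ρ` and `a i`; it vanishes
  -- within distance `ρ` of both.
  let w : ℝ → ℝ := fun u => max 0 (ρ - |u - m₀|)
  have hw : Continuous w := by fun_prop
  have hw0 : ∀ u, 0 ≤ w u := fun u => le_max_left _ _
  have hwρ : ∀ u, w u ≤ ρ := fun u => max_le hρ.le (by linarith [abs_nonneg (u - m₀)])
  have hwz : ∀ u, ρ ≤ |u - m₀| → w u = 0 := fun u hu => max_eq_left (by linarith)
  let b : ι → ℝ := Function.update a i (a i - 4 * ρ)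
  have hbi : b i = a i - 4 * ρ := by simp [b]
  let W := ∫ u in b i..a i, w u
  have hW : 0 < W := by
    refine intervalIntegral.integral_pos (by rw [hbi]; linarith) hw.continuousOn
      (fun u _ => hw0 u) ⟨m₀, ⟨by rw [hbi]; simp only [m₀]; linarith, by simp only [m₀]; linarith⟩, ?_⟩
    simp [w, hρ]
  -- Truncating `T - T a` at this height keeps the perturbation below `ρ / W * κ = 1 / 2`. Near `a`
  -- the truncation has no effect.
  let κ := W / (2 * ρ)
  have hκ : 0 < κ := by positivity
  let T' : (ι → ℝ) → ℝ := fun x => max (-κ) (min κ (T x - T a))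
  have hT' : Continuous T' := by fun_prop
  have hT'i : ∀ x u, T' (Function.update x i u) = T' x := fun x u => by simp only [T', hTi]
  have hT'κ : ∀ x, |T' x| ≤ κ := fun x =>
    abs_le.2 ⟨le_max_left _ _, max_le (by linarith) (min_le_left _ _)⟩
  let g : (ι → ℝ) → ℝ := fun x => 1 + w (x i) / W * T' x
  have hg : Continuous g := by fun_prop
  have hg2 : ∀ x, 1 / 2 ≤ g x := by
    intro x
    have h1 : |w (x i) / W * T' x| ≤ ρ / W * κ := by
      rw [abs_mul, abs_of_nonneg (div_nonneg (hw0 _) hW.le)]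
      exact mul_le_mul (div_le_div_of_nonneg_right (hwρ _) hW.le) (hT'κ x) (abs_nonneg _)
        (by positivity)
    have h2 : ρ / W * κ = 1 / 2 := by simp only [κ]; field_simp
    rw [h2] at h1
    have := (abs_le.1 h1).1
    simp only [g]
    linarith
  let P := straight j g (a j) hg one_half_pos hg2
  let Q := straight i g (b i) hg one_half_pos hg2
  let X : (ι → ℝ) ≃ₜ (ι → ℝ) := P.symm.trans Q
  have hX : MeasurePreserving X volume volume :=
    measurePreserving_straight_symm_trans hg one_half_pos hg2
  have hPx : ∀ x, w (x i) = 0 → P x = x := by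
    intro x hx
    change straightFun j g (a j) x = x
    have : ∀ u, g (Function.update x j u) = 1 := fun u => by
      simp [g, hj.symm, hx]
    simp only [straightFun, linePrimitive, this]
    rw [intervalIntegral.integral_const, smul_eq_mul, mul_one, add_sub_cancel,
      Function.update_eq_self]
  have hXQ : ∀ x, w (x i) = 0 → X x = Q x := by
    intro x hx
    have : P.symm x = x := by rw [Homeomorph.symm_apply_eq, hPx x hx]
    simp only [X, Homeomorph.trans_apply, this]
  have hQx : ∀ x, Q x = x + Pi.single i ((∫ u in b i..x i, w u) / W * T' x) := by
    intro x
    have : ∀ u, g (Function.update x i u) = 1 + w u * (T' x / W) := fun u => by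
      simp only [g, Function.update_self, hT'i]
      ring
    change straightFun i g (b i) x = _
    rw [straightFun, update_eq_add_single, linePrimitive]
    simp_rw [this]
    rw [intervalIntegral.integral_add (f := fun _ => (1 : ℝ)) (g := fun u => w u * (T' x / W))
      (continuous_const.intervalIntegrable _ _)
      ((hw.mul continuous_const).intervalIntegrable _ _), intervalIntegral.integral_mul_const,
      intervalIntegral.integral_const, smul_eq_mul]
    congr 2
    ring
  have hconv := convex_ball a r
  have hbV : b ∈ Metric.ball a r := by
    rw [Metric.mem_ball, dist_pi_lt_iff hr]
    intro k
    by_cases hk : k = i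
    · subst hk
      rw [hbi, Real.dist_eq, sub_sub_cancel_left, abs_neg, abs_of_pos (by positivity)]
      simp only [ρ]
      linarith
    · simp [b, hk, hr]
  have hci : ∀ y : ι → ℝ, ∀ᶠ x in 𝓝 y, |x i - y i| < ρ := fun y => by
    have hc : Continuous fun x : ι → ℝ => |x i - y i| := by fun_prop
    exact hc.continuousAt.eventually_lt continuousAt_const (by simpa using hρ)
  have hwint : ∀ c d : ℝ, (∀ u ∈ uIcc c d, w u = 0) → ∫ u in c..d, w u = 0 := by
    intro c d h
    rw [intervalIntegral.integral_congr (g := fun _ => 0) h]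
    simp
  have hb1 : GermIn (Metric.ball a r) X b := by
    refine (germ_id b _ (Metric.isOpen_ball.mem_nhds hbV)).congr ?_
    have key : ∀ᶠ x in 𝓝 b, X x = x := by
      filter_upwards [hci b] with x hx
      have hz : ∀ u, |u - b i| < ρ → w u = 0 := fun u hu => by
        refine hwz u ?_
        rw [hbi] at hu
        have := (abs_lt.1 hu).2
        refine le_trans ?_ (neg_le_abs _)
        simp only [m₀]
        linarith
      rw [hXQ x (hz _ hx), hQx, hwint]
      · simp
      · intro u hu
        refine hz u (lt_of_le_of_lt ?_ hx)
        exact abs_sub_left_of_mem_uIcc hu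
    filter_upwards [key] with x hx
    rw [hx, key.self_of_nhds]
  refine ((hb1.transfer Metric.isOpen_ball hconv.isPreconnected (Metric.mem_ball_self hr) hbV
    hX).mono hrV).congr ?_
  have hTa : ∀ᶠ x in 𝓝 a, |T x - T a| < κ := by
    have hc : Continuous fun x : ι → ℝ => |T x - T a| := by fun_prop
    exact hc.continuousAt.eventually_lt continuousAt_const (by simpa using hκ)
  have key : ∀ᶠ x in 𝓝 a, X x = x + Pi.single i (T x - T a) := by
    filter_upwards [hci a, hTa] with x hx hTx
    have hz : ∀ u, |u - a i| < ρ → w u = 0 := fun u hu => by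
      refine hwz u ?_
      have := (abs_lt.1 hu).1
      refine le_trans ?_ (le_abs_self _)
      simp only [m₀]
      linarith
    have h1 : ∫ u in b i..x i, w u = W := by
      rw [← intervalIntegral.integral_add_adjacent_intervals (b := a i)
        (hw.intervalIntegrable _ _) (hw.intervalIntegrable _ _), hwint (a i), add_zero]
      intro u hu
      exact hz u (lt_of_le_of_lt (abs_sub_left_of_mem_uIcc hu) hx)
    have h2 : T' x = T x - T a := by
      obtain ⟨h3, h4⟩ := abs_lt.1 hTx
      simp only [T']
      rw [min_eq_right h4.le, max_eq_right h3.le]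
    rw [hXQ x (hz _ hx), hQx, h1, h2, div_self hW.ne', one_mul]
  filter_upwards [key] with x hx
  rw [hx, key.self_of_nhds]
  simp only [shear, sub_self, Pi.single_zero, add_zero, Pi.single_sub]
  abel

/-! ### Linear maps -/

/-- The diagonal matrix with entries `c, c⁻¹` is a product of four elementary matrices, that is, of
four linear shears. -/
theorem germ_diag [Nontrivial ι] {i j : ι} (hij : i ≠ j) {c : ℝ} (hc : c ≠ 0) (a : ι → ℝ) :
    Germ (fun x k => (if k = i then c else if k = j then c⁻¹ else 1) * x k) a := by
  let T : ι → ℝ → (ι → ℝ) → ℝ := fun k r x => r * x k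
  have hT : ∀ k r, Continuous (T k r) := fun k r => by fun_prop
  have hTi : ∀ k l, l ≠ k → ∀ r x u, T k r (Function.update x l u) = T k r x :=
    fun k l hl r x u => by simp [T, hl.symm]
  have hs : ∀ k l, l ≠ k → ∀ r a, Germ (shear l (T k r)) a := fun k l hl r a =>
    germ_shear (hT k r) (hTi k l hl r) a
  have hcs : ∀ k l r, Continuous (shear l (T k r)) := fun k l r => continuous_shear (hT k r)
  have h1 := hs i j hij.symm (-(c * (c - 1))) a
  have h2 := h1.comp (hs j i hij (-c⁻¹) _) (hcs _ _ _).continuousAt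
  have h3 := h2.comp (hs i j hij.symm (c - 1) _) ((hcs _ _ _).comp (hcs _ _ _)).continuousAt
  have h4 := h3.comp (hs j i hij 1 _) ((hcs _ _ _).comp ((hcs _ _ _).comp (hcs _ _ _))).continuousAt
  refine h4.congr' (Filter.Eventually.of_forall fun x => ?_)
  ext k
  simp only [Function.comp_apply, shear, T, Pi.add_apply]
  by_cases hk : k = i
  · subst hk
    simp [hij, hij.symm]
    field_simp
    ring
  · by_cases hk' : k = j
    · subst hk'
      simp [hij, hij.symm]
      field_simp
      ring
    · simp [hk, hk']

theorem germ_specialLinearGroup [Nontrivial ι] (A : Matrix.SpecialLinearGroup ι ℝ) :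
    ∀ a, Germ (fun x => A.1.mulVec x) a := by
  refine Matrix.SpecialLinearGroup.diagonal_transvection_induction'
    (fun A => ∀ a, Germ (fun x => A.1.mulVec x) a) A ?_ ?_ ?_
  · intro i j hij c hc a
    refine (germ_diag hij hc a).congr' (Filter.Eventually.of_forall fun x => ?_)
    ext k
    dsimp only
    rw [Matrix.SpecialLinearGroup.diag2n_coe, Matrix.mulVec_diagonal]
  · intro i j hij c a
    refine (germ_shear (i := i) (T := fun x => c * x j) (by fun_prop)
      (fun x u => by simp [hij.symm]) a).congr' (Filter.Eventually.of_forall fun x => ?_)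
    dsimp only
    rw [Matrix.SpecialLinearGroup.transvection_coe, Matrix.add_mulVec,
      Matrix.one_mulVec, Matrix.single_mulVec]
    rfl
  · intro A B hA hB a
    refine ((hB a).comp (hA _) ?_).congr' (Filter.Eventually.of_forall fun x => ?_)
    · exact (continuous_const.matrix_mulVec continuous_id).continuousAt
    · simp [Matrix.mulVec_mulVec]

theorem germ_linear [Nontrivial ι] (A : (ι → ℝ) →L[ℝ] (ι → ℝ)) (hA : A.det = 1) (a : ι → ℝ) :
    Germ A a := by
  have hdet : (LinearMap.toMatrix' (A : (ι → ℝ) →ₗ[ℝ] (ι → ℝ))).det = 1 := by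
    rw [LinearMap.det_toMatrix']
    exact hA
  refine (germ_specialLinearGroup ⟨_, hdet⟩ a).congr' (Filter.Eventually.of_forall fun x => ?_)
  dsimp only
  rw [LinearMap.toMatrix'_mulVec]
  rfl

end Germ

/-! ### Changes of Lebesgue charts -/

section ChartChange

variable {ι : Type*} [Fintype ι] [DecidableEq ι] {i : ι}

/-- Where the densities agree, the two primitives have the same derivative in direction `i`, so
their difference does not depend on the coordinate `i`. Hence local changes of the density, and of
the base points `s`, only cost a shear. -/
theorem exists_shear_straightFun [Nontrivial ι] {g g' : (ι → ℝ) → ℝ} (hg : Continuous g)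
    (hg' : Continuous g') {a : ι → ℝ} (h : ∀ᶠ x in 𝓝 a, g x = g' x) (s s' : ℝ) :
    ∃ S : (ι → ℝ) → ι → ℝ, Continuous S ∧ (∀ x, Germ S x) ∧
      ∀ᶠ x in 𝓝 a, straightFun i g' s' x = S (straightFun i g s x) := by
  let T : (ι → ℝ) → ℝ := fun y => linePrimitive i g' s' y (a i) - linePrimitive i g s y (a i)
  have hT : Continuous T :=
    ((continuous_linePrimitive hg').comp (continuous_id.prodMk continuous_const)).sub
      ((continuous_linePrimitive hg).comp (continuous_id.prodMk continuous_const))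
  have hTi : ∀ x u, T (Function.update x i u) = T x := fun x u => by
    simp only [T, linePrimitive_update]
  refine ⟨shear i T, continuous_shear hT, germ_shear hT hTi, ?_⟩
  obtain ⟨r, hr, hb⟩ := Metric.eventually_nhds_iff_ball.1 h
  filter_upwards [Metric.ball_mem_nhds a hr] with x hx
  have h1 : linePrimitive i g' s' x (x i) - linePrimitive i g' s' x (a i) =
      linePrimitive i g s x (x i) - linePrimitive i g s x (a i) := by
    rw [linePrimitive_sub hg, linePrimitive_sub hg']
    refine intervalIntegral.integral_congr fun u hu => (hb _ ?_).symm
    rw [Metric.mem_ball, dist_pi_lt_iff hr] at hx ⊢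
    intro k
    by_cases hk : k = i
    · subst hk
      rw [Function.update_self, Real.dist_eq]
      exact lt_of_le_of_lt (abs_sub_left_of_mem_uIcc hu) (hx k)
    · rw [Function.update_of_ne hk]
      exact hx k
  have h2 : T (straightFun i g s x) = T x := hTi x _
  rw [shear, h2]
  ext k
  by_cases hk : k = i
  · subst hk
    rw [Pi.add_apply, straightFun_apply_same, straightFun_apply_same, Pi.single_eq_same]
    simp only [T]
    linarith
  · rw [Pi.add_apply, straightFun_apply_of_ne _ hk, straightFun_apply_of_ne _ hk,
      Pi.single_eq_of_ne hk, add_zero]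

/-- The linear map which multiplies the coordinate `i` by `c`. -/
def scaleCoord (i : ι) (c : ℝ) : (ι → ℝ) →L[ℝ] (ι → ℝ) :=
  LinearMap.toContinuousLinearMap (Matrix.toLin' (Matrix.diagonal (Function.update 1 i c)))

theorem scaleCoord_apply (i : ι) (c : ℝ) (x : ι → ℝ) :
    scaleCoord i c x = Function.update x i (c * x i) := by
  ext k
  change (Matrix.diagonal (Function.update (1 : ι → ℝ) i c)).mulVec x k = _
  rw [Matrix.mulVec_diagonal]
  by_cases hk : k = i
  · subst hk; simp
  · simp [hk]

theorem det_scaleCoord (i : ι) (c : ℝ) : (scaleCoord i c).det = c := by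
  change LinearMap.det (Matrix.toLin' (Matrix.diagonal (Function.update (1 : ι → ℝ) i c))) = c
  rw [LinearMap.det_toLin', Matrix.det_diagonal,
    Finset.prod_update_of_mem (Finset.mem_univ i)]
  simp

theorem straightFun_const (i : ι) (c : ℝ) (x : ι → ℝ) :
    straightFun i (fun _ => c) 0 x = scaleCoord i c x := by
  rw [scaleCoord_apply, straightFun, linePrimitive, intervalIntegral.integral_const, smul_eq_mul]
  congr 1
  ring

theorem map_withDensity_homeomorph {Φ : (ι → ℝ) ≃ₜ (ι → ℝ)}
    {Φ' : (ι → ℝ) → (ι → ℝ) →L[ℝ] (ι → ℝ)} (hΦ : ∀ x, HasFDerivAt Φ (Φ' x) x)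
    {ĝ g' : (ι → ℝ) → ℝ} (hĝ : ∀ x, ĝ x = |(Φ' x).det| * g' (Φ x)) :
    Measure.map Φ (volume.withDensity fun x => ENNReal.ofReal (ĝ x)) =
      volume.withDensity fun x => ENNReal.ofReal (g' x) := by
  ext B hB
  have hB' := Φ.continuous.measurable hB
  rw [Measure.map_apply Φ.measurable hB, withDensity_apply _ hB', withDensity_apply _ hB]
  conv_rhs => rw [← image_preimage_eq B Φ.surjective]
  rw [lintegral_image_eq_lintegral_abs_det_fderiv_mul volume hB'
    (fun x _ => (hΦ x).hasFDerivWithinAt) Φ.injective.injOn]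
  refine lintegral_congr fun x => ?_
  rw [hĝ, ENNReal.ofReal_mul (abs_nonneg _)]

/-- A local modification of a `C¹` map to a globally defined homeomorphism close to its
differential. -/
theorem exists_homeomorph_of_contDiffAt [Nontrivial ι] {φ : (ι → ℝ) → ι → ℝ} {a : ι → ℝ}
    (hφ : ContDiffAt ℝ 1 φ a) (hdet : 0 < (fderiv ℝ φ a).det) :
    ∃ R > 0, ∃ η > 0, ∀ r > 0, r < R → ∃ Φ : (ι → ℝ) ≃ₜ (ι → ℝ), ContDiff ℝ 1 Φ ∧
      (∀ x, η ≤ (fderiv ℝ Φ x).det) ∧ (∀ᶠ x in 𝓝 a, Φ x = φ x) ∧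
      ∀ x, 2 * r < dist x a → Φ x = φ a + fderiv ℝ φ a (x - a) := by
  set A := fderiv ℝ φ a with hA
  let Ae : (ι → ℝ) ≃L[ℝ] (ι → ℝ) := A.toContinuousLinearEquivOfDetNeZero hdet.ne'
  have hAe : (Ae : (ι → ℝ) →L[ℝ] (ι → ℝ)) = A := A.coe_toContinuousLinearEquivOfDetNeZero _
  let χ : ContDiffBump (0 : ι → ℝ) := ⟨1, 2, one_pos, one_lt_two⟩
  obtain ⟨C₀, hC₀⟩ : ∃ C, ∀ x, ‖fderiv ℝ χ x‖ ≤ C :=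
    ((χ.contDiff (n := 1)).continuous_fderiv (by simp)).bounded_above_of_compact_support
      (χ.hasCompactSupport.fderiv (𝕜 := ℝ))
  have hC₀0 : 0 ≤ C₀ := (norm_nonneg _).trans (hC₀ 0)
  obtain ⟨δ, hδ, hdetδ⟩ : ∃ δ > 0, ∀ B : (ι → ℝ) →L[ℝ] (ι → ℝ), ‖B - A‖ < δ →
      A.det / 2 < B.det := by
    have h1 : ∀ᶠ B in 𝓝 A, A.det / 2 < ContinuousLinearMap.det B :=
      ContinuousLinearMap.continuous_det.continuousAt.eventually_const_lt (by
        change A.det / 2 < A.det; linarith)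
    obtain ⟨δ, hδ, h⟩ := Metric.eventually_nhds_iff.1 h1
    exact ⟨δ, hδ, fun B hB => h (by rwa [dist_eq_norm])⟩
  have hN : 0 < ‖(Ae.symm : (ι → ℝ) →L[ℝ] (ι → ℝ))‖₊ := Ae.nnnorm_symm_pos
  set N := ‖(Ae.symm : (ι → ℝ) →L[ℝ] (ι → ℝ))‖₊
  -- A perturbation of the linear map `A` with Lipschitz constant below `N⁻¹` is a homeomorphism;
  -- below `δ` its derivative keeps at least half of the determinant.
  let κ : NNReal := min (δ / 2).toNNReal (N⁻¹ / 2)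
  have hκ0 : 0 < κ := lt_min (Real.toNNReal_pos.2 (by positivity)) (by positivity)
  have hκδ : (κ : ℝ) < δ := by
    have : (κ : ℝ) ≤ δ / 2 :=
      (NNReal.coe_le_coe.2 (min_le_left _ _)).trans (Real.coe_toNNReal _ (by positivity)).le
    linarith
  have hκN : κ < N⁻¹ := (min_le_right _ _).trans_lt (NNReal.half_lt_self (by positivity))
  -- The cut-off remainder `χ (l x) • E x` has derivative at most `ε` from `E`, plus `C₀ / r` times
  -- `‖E x‖ ≤ ε * (2 * r)` from the cut-off. The radius cancels, so the bounds are uniform in `r`.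
  let ε : ℝ := κ / (1 + 2 * C₀)
  have hε : 0 < ε := div_pos (by exact_mod_cast hκ0) (by positivity)
  have hεκ : ε * (1 + 2 * C₀) = κ := div_mul_cancel₀ _ (by positivity)
  obtain ⟨R, hR, hRφ⟩ : ∃ R > 0, ∀ x ∈ Metric.ball a R,
      ContDiffAt ℝ 1 φ x ∧ ‖fderiv ℝ φ x - A‖ ≤ ε := by
    refine Metric.eventually_nhds_iff_ball.1 ((hφ.eventually (by simp)).and ?_)
    have hc : ContinuousAt (fun x => ‖fderiv ℝ φ x - A‖) a :=
      ((hφ.continuousAt_fderiv (by simp)).sub continuousAt_const).norm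
    exact (hc.eventually_lt continuousAt_const (by simpa [← hA] using hε)).mono fun _ h => h.le
  refine ⟨R / 2, by positivity, A.det / 2, by positivity, fun r hr hrR => ?_⟩
  let E : (ι → ℝ) → ι → ℝ := fun x => φ x - φ a - A (x - a)
  have hE : ∀ x ∈ Metric.ball a R, HasFDerivAt E (fderiv ℝ φ x - A) x := by
    intro x hx
    have h1 := ((hRφ x hx).1.differentiableAt (by simp)).hasFDerivAt
    have h2 : HasFDerivAt (fun x => A (x - a)) A x := by
      have := A.hasFDerivAt.comp x ((hasFDerivAt_id (𝕜 := ℝ) x).sub_const a)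
      simpa using this
    exact (h1.sub_const _).sub h2
  have hEc : ∀ x ∈ Metric.ball a R, ContDiffAt ℝ 1 E x := by
    intro x hx
    exact ((hRφ x hx).1.sub contDiffAt_const).sub
      (A.contDiff.comp (contDiff_id.sub contDiff_const)).contDiffAt
  have hEb : ∀ x ∈ Metric.ball a R, ‖E x‖ ≤ ε * ‖x - a‖ := by
    intro x hx
    have := (convex_ball a R).norm_image_sub_le_of_norm_hasFDerivWithin_le (f := E) (C := ε)
      (fun y hy => (hE y hy).hasFDerivWithinAt) (fun y hy => (hRφ y hy).2)
      (Metric.mem_ball_self hR) hx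
    simpa [E] using this
  let l : (ι → ℝ) → ι → ℝ := fun x => r⁻¹ • (x - a)
  have hl : ∀ x, HasFDerivAt l (r⁻¹ • ContinuousLinearMap.id ℝ (ι → ℝ)) x := fun x => by
    have := ((hasFDerivAt_id (𝕜 := ℝ) x).sub_const a).const_smul r⁻¹
    exact this
  have hln : ∀ x, ‖l x‖ = dist x a / r := fun x => by
    simp only [l]
    rw [norm_smul, norm_inv, Real.norm_eq_abs, abs_of_pos hr, dist_eq_norm]
    ring
  let F : (ι → ℝ) → ι → ℝ := fun x => χ (l x) • E x
  have hFz : ∀ x, 2 * r < dist x a → F x = 0 := by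
    intro x hx
    have : χ (l x) = 0 := χ.zero_of_le_dist (by
      rw [dist_zero_right, hln, le_div_iff₀ hr]
      exact hx.le)
    simp only [F, this, zero_smul]
  have hFz' : ∀ x, 2 * r < dist x a → F =ᶠ[𝓝 x] fun _ => 0 := by
    intro x hx
    have hc : Continuous fun y => dist y a := by fun_prop
    filter_upwards [hc.continuousAt.eventually_const_lt hx] with y hy using hFz y hy
  have hF1 : ∀ x, ContDiffAt ℝ 1 F x := by
    intro x
    rcases lt_or_ge (2 * r) (dist x a) with hx | hx
    · exact contDiffAt_const.congr_of_eventuallyEq (hFz' x hx)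
    · have h1 : ContDiffAt ℝ 1 l x := ((contDiff_id.sub contDiff_const).const_smul r⁻¹).contDiffAt
      have h2 : ContDiffAt ℝ 1 (fun x => χ (l x)) x := χ.contDiff.contDiffAt.comp x h1
      exact h2.smul (hEc x (by rw [Metric.mem_ball]; linarith))
  have hFd : ∀ x, ‖fderiv ℝ F x‖ ≤ κ := by
    intro x
    rcases lt_or_ge (2 * r) (dist x a) with hx | hx
    · rw [(hFz' x hx).fderiv_eq, fderiv_fun_const]
      simp
    · have hxR : x ∈ Metric.ball a R := by rw [Metric.mem_ball]; linarith
      have h1 : HasFDerivAt (fun x => χ (l x))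
          ((fderiv ℝ χ (l x)).comp (r⁻¹ • ContinuousLinearMap.id ℝ (ι → ℝ))) x :=
        ((χ.contDiff (n := 1)).differentiable (by simp) (l x)).hasFDerivAt.comp x (hl x)
      have h2 := h1.smul (hE x hxR)
      rw [show fderiv ℝ F x = _ from h2.fderiv]
      have e1 : ‖χ (l x) • (fderiv ℝ φ x - A)‖ ≤ ε := by
        rw [norm_smul, Real.norm_eq_abs, abs_of_nonneg (χ.nonneg)]
        exact (mul_le_of_le_one_left (norm_nonneg _) χ.le_one).trans (hRφ x hxR).2
      have e2 : ‖((fderiv ℝ χ (l x)).comp (r⁻¹ • ContinuousLinearMap.id ℝ (ι → ℝ))).smulRight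
          (E x)‖ ≤ 2 * C₀ * ε := by
        rw [ContinuousLinearMap.norm_smulRight_apply, ContinuousLinearMap.comp_smul,
          ContinuousLinearMap.comp_id, norm_smul, norm_inv, Real.norm_eq_abs, abs_of_pos hr]
        have h3 : ‖E x‖ ≤ ε * (2 * r) := (hEb x hxR).trans
          (mul_le_mul_of_nonneg_left (by rwa [← dist_eq_norm]) hε.le)
        calc r⁻¹ * ‖fderiv ℝ χ (l x)‖ * ‖E x‖ ≤ r⁻¹ * C₀ * (ε * (2 * r)) :=
              mul_le_mul (mul_le_mul_of_nonneg_left (hC₀ _) (by positivity)) h3 (norm_nonneg _)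
                (by positivity)
          _ = 2 * C₀ * ε := by field_simp
      calc _ ≤ ε + 2 * C₀ * ε := (norm_add_le _ _).trans (add_le_add e1 e2)
        _ = κ := by rw [← hεκ]; ring
  have hFdiff : Differentiable ℝ F := fun x => (hF1 x).differentiableAt (by simp)
  have hFL : LipschitzWith κ F := lipschitzWith_of_nnnorm_fderiv_le hFdiff fun x => hFd x
  let f : (ι → ℝ) → ι → ℝ := fun x => φ a + A (x - a) + F x
  have hf : ApproximatesLinearOn f (Ae : (ι → ℝ) →L[ℝ] (ι → ℝ)) univ κ := by
    intro x _ y _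
    have : f x - f y - (Ae : (ι → ℝ) →L[ℝ] (ι → ℝ)) (x - y) = F x - F y := by
      rw [hAe]
      simp only [f, map_sub]
      abel
    rw [this, ← dist_eq_norm, ← dist_eq_norm]
    exact hFL.dist_le_mul x y
  have hfd : ∀ x, HasFDerivAt f (A + fderiv ℝ F x) x := by
    intro x
    have h2 : HasFDerivAt (fun x => A (x - a)) A x := by
      have := A.hasFDerivAt.comp x ((hasFDerivAt_id (𝕜 := ℝ) x).sub_const a)
      simpa using this
    exact (h2.const_add _).add (hFdiff x).hasFDerivAt
  refine ⟨hf.toHomeomorph f (Or.inr hκN), ?_, fun x => ?_, ?_, fun x hx => ?_⟩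
  · change ContDiff ℝ 1 f
    exact (contDiff_const.add (A.contDiff.comp (contDiff_id.sub contDiff_const))).add
      (contDiff_iff_contDiffAt.2 hF1)
  · change A.det / 2 ≤ (fderiv ℝ f x).det
    rw [(hfd x).fderiv]
    refine (hdetδ _ ?_).le
    rw [add_sub_cancel_left]
    exact (hFd x).trans_lt hκδ
  · change ∀ᶠ x in 𝓝 a, f x = φ x
    filter_upwards [Metric.ball_mem_nhds a hr] with x hx
    have : χ (l x) = 1 := χ.one_of_mem_closedBall (by
      rw [mem_closedBall_zero_iff, hln]
      exact (div_le_one hr).2 (le_of_lt hx))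
    simp only [f, F, this, one_smul, E]
    abel
  · change f x = _
    simp only [f, hFz x hx, add_zero]

end ChartChange

/-! ### Germs of orientation preserving changes of coordinates -/

section ChartChange

variable {ι : Type*} [Fintype ι] [DecidableEq ι] {i : ι}

/-- In Lebesgue charts obtained by straightening densities, an orientation preserving `C¹` change of
coordinates is near each point the endpoint of an isotopy supported near that point. -/
theorem germ_chart_change [Nontrivial ι] {g g' : (ι → ℝ) → ℝ} (hg : Continuous g)
    {c c' : ℝ} (hc : 0 < c) (hgc : ∀ x, c ≤ g x) (hg' : Continuous g') (hc' : 0 < c')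
    (hgc' : ∀ x, c' ≤ g' x) {s s' : ℝ} {φ : (ι → ℝ) → ι → ℝ} {a : ι → ℝ}
    (hφ : ContDiffAt ℝ 1 φ a) (hdet : 0 < (fderiv ℝ φ a).det)
    (hgg : ∀ᶠ x in 𝓝 a, g x = g' (φ x) * |(fderiv ℝ φ x).det|) :
    Germ (fun y => straightFun i g' s' (φ ((straight i g s hg hc hgc).symm y)))
      (straightFun i g s a) := by
  obtain ⟨j, hji⟩ := exists_ne i
  obtain ⟨R, hR, η, hη, hΦ⟩ := exists_homeomorph_of_contDiffAt hφ hdet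
  set A := fderiv ℝ φ a with hA
  set y₀ := straightFun i g s a with hy₀
  intro V hV
  obtain ⟨R₁, hR₁, hR₁V⟩ := Metric.mem_nhds_iff.1 ((tendsto_add_sub a y₀) hV)
  let r := min (R / 2) (R₁ / 4)
  have hr : 0 < r := lt_min (by positivity) (by positivity)
  have hrR : r < R := (min_le_left _ _).trans_lt (by linarith)
  have hrR₁ : 4 * r ≤ R₁ := by have : r ≤ R₁ / 4 := min_le_right _ _; linarith
  obtain ⟨Φ, hΦ1, hΦη, hΦa, hΦb⟩ := hΦ r hr hrR
  -- At distance `3 * r` the modified map `Φ` is already affine, and `b` is still in the ball of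
  -- radius `4 * r`. Moving in a direction other than `i` keeps `b` on the hyperplane through `a`
  -- which is fixed by the straightening `P` based at `a i`.
  let b : ι → ℝ := a + Pi.single j (3 * r)
  have hbi : b i = a i := by simp [b, hji.symm]
  have hab : dist b a = 3 * r := by
    simp only [b, dist_eq_norm, add_sub_cancel_left]
    rw [Pi.norm_single, Real.norm_eq_abs, abs_of_pos (by positivity)]
  have hba : b ≠ a := by
    intro h
    rw [h, dist_self] at hab
    linarith
  have hΦd : ∀ x, HasFDerivAt Φ (fderiv ℝ Φ x) x := fun x =>
    (hΦ1.differentiable (by simp) x).hasFDerivAt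
  have hdpos : ∀ x, |(fderiv ℝ Φ x).det| = (fderiv ℝ Φ x).det := fun x =>
    abs_of_pos (hη.trans_le (hΦη x))
  have hΦb' : ∀ᶠ x in 𝓝 b, 2 * r < dist x a := by
    have hcd : Continuous fun y => dist y a := by fun_prop
    exact hcd.continuousAt.eventually_const_lt
      (by change 2 * r < dist b a; rw [hab]; linarith)
  have hΦbd : ∀ᶠ x in 𝓝 b, fderiv ℝ Φ x = A := by
    filter_upwards [hΦb'.eventually_nhds] with x hx
    have h1 : (Φ : (ι → ℝ) → ι → ℝ) =ᶠ[𝓝 x] fun x => φ a + A (x - a) := by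
      filter_upwards [hx] with y hy using hΦb y hy
    have h2 : HasFDerivAt (fun x => φ a + A (x - a)) A x := by
      have := (A.hasFDerivAt.comp x ((hasFDerivAt_id (𝕜 := ℝ) x).sub_const a)).const_add (φ a)
      simpa using this
    rw [h1.fderiv_eq, h2.fderiv]
  have hΦad : ∀ᶠ x in 𝓝 a, fderiv ℝ Φ x = fderiv ℝ φ x := by
    filter_upwards [hΦa.eventually_nhds] with x hx
    exact Filter.EventuallyEq.fderiv_eq hx
  -- the modified densities
  let D := dist (Φ b) (φ a)
  have hD : 0 < D := by
    rw [dist_pos, ← hΦa.self_of_nhds]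
    exact fun h => hba (Φ.injective h)
  -- Equal to `1` within `D / 3` of `φ a` and to `0` beyond `2 * D / 3`, hence near `Φ b`. So `ĝ'`
  -- is `g'` near `φ a` and constant near `Φ b`, and the pulled back density `ĝ` is `g` near `a` and
  -- constant near `b`.
  let θ : (ι → ℝ) → ℝ := fun z => max 0 (min 1 (2 - 3 * dist z (φ a) / D))
  have hθ : Continuous θ := by fun_prop
  have hθ0 : ∀ z, 0 ≤ θ z := fun z => le_max_left _ _
  have hθ1 : ∀ z, θ z ≤ 1 := fun z => max_le zero_le_one (min_le_left _ _)
  let k := g' (φ a)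
  have hk : c' ≤ k := hgc' _
  have hk0 : 0 < k := hc'.trans_le hk
  let ĝ' : (ι → ℝ) → ℝ := fun z => k + θ z * (g' z - k)
  have hĝ' : Continuous ĝ' := by fun_prop
  have hĝc' : ∀ z, c' ≤ ĝ' z := fun z => by
    have := hgc' z
    have h0 := hθ0 z
    have h1 := hθ1 z
    simp only [ĝ']
    nlinarith [mul_nonneg h0 (sub_nonneg.2 this), mul_nonneg (sub_nonneg.2 h1) (sub_nonneg.2 hk)]
  have hĝ'a : ∀ᶠ z in 𝓝 (φ a), ĝ' z = g' z := by
    have hcd : Continuous fun z => dist z (φ a) := by fun_prop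
    filter_upwards [hcd.continuousAt.eventually_lt continuousAt_const
      (by rw [dist_self]; positivity : dist (φ a) (φ a) < D / 3)] with z hz
    have : θ z = 1 := by
      have : 1 ≤ 2 - 3 * dist z (φ a) / D := by
        have : 3 * dist z (φ a) / D ≤ 1 := (div_le_one hD).2 (by linarith)
        linarith
      simp only [θ]
      rw [min_eq_left this, max_eq_right zero_le_one]
    simp only [ĝ', this]
    ring
  have hĝ'b : ∀ᶠ z in 𝓝 (Φ b), ĝ' z = k := by
    have hcd : Continuous fun z => dist z (φ a) := by fun_prop
    filter_upwards [hcd.continuousAt.eventually_const_lt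
      (by change 2 * D / 3 < D; linarith : 2 * D / 3 < dist (Φ b) (φ a))] with z hz
    have : θ z = 0 := by
      have : 2 - 3 * dist z (φ a) / D ≤ 0 := by
        have : 2 ≤ 3 * dist z (φ a) / D := (le_div_iff₀ hD).2 (by linarith)
        linarith
      simp only [θ]
      exact max_eq_left ((min_le_right _ _).trans this)
    simp only [ĝ', this]
    ring
  let ĝ : (ι → ℝ) → ℝ := fun x => |(fderiv ℝ Φ x).det| * ĝ' (Φ x)
  have hĝ : Continuous ĝ :=
    (ContinuousLinearMap.continuous_det.comp (hΦ1.continuous_fderiv (by simp))).abs.mul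
      (hĝ'.comp Φ.continuous)
  have hηc : 0 < η * c' := by positivity
  have hĝc : ∀ x, η * c' ≤ ĝ x := fun x => by
    simp only [ĝ, hdpos]
    exact mul_le_mul (hΦη x) (hĝc' _) hc'.le (hη.le.trans (hΦη x))
  have hĝa : ∀ᶠ x in 𝓝 a, g x = ĝ x := by
    have ht : Tendsto Φ (𝓝 a) (𝓝 (φ a)) := by
      have := Φ.continuous.tendsto a
      rwa [hΦa.self_of_nhds] at this
    filter_upwards [hgg, hΦa, hΦad, ht.eventually hĝ'a] with x h1 h2 h3 h4
    simp only [ĝ]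
    rw [h4, h3, h1, h2, mul_comm]
  have hĝb : ∀ᶠ x in 𝓝 b, ĝ x = A.det * k := by
    filter_upwards [hΦbd, (Φ.continuous.tendsto b).eventually hĝ'b] with x h1 h2
    simp only [ĝ]
    rw [hdpos, h1, h2]
  -- the comparison homeomorphism
  let P := straight i ĝ (a i) hĝ hηc hĝc
  let Q := straight i ĝ' 0 hĝ' hc' hĝc'
  let X : (ι → ℝ) ≃ₜ (ι → ℝ) := P.symm.trans (Φ.trans Q)
  have hXP : ∀ x, X (P x) = Q (Φ x) := fun x => by
    simp only [X, Homeomorph.trans_apply, Homeomorph.symm_apply_apply]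
  have hX : MeasurePreserving X volume volume := by
    refine ⟨X.measurable, ?_⟩
    have e1 : Measure.map P (volume.withDensity fun x => ENNReal.ofReal (ĝ x)) = volume :=
      map_straightFun hĝ hηc hĝc
    have e2 := map_withDensity_homeomorph (Φ := Φ) hΦd (ĝ := ĝ) (g' := ĝ') fun x => rfl
    have e3 : Measure.map Q (volume.withDensity fun x => ENNReal.ofReal (ĝ' x)) = volume :=
      map_straightFun hĝ' hc' hĝc'
    conv_lhs => rw [← e1]
    rw [Measure.map_map X.measurable P.measurable]
    have : X ∘ P = Q ∘ Φ := funext hXP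
    rw [this, ← Measure.map_map Q.measurable Φ.measurable, e2, e3]
  have hPa : P a = a := by
    change straightFun i ĝ (a i) a = a
    simp [straightFun, linePrimitive]
  have hPb : P b = b := by
    change straightFun i ĝ (a i) b = b
    rw [straightFun, linePrimitive, hbi, intervalIntegral.integral_same, add_zero, ← hbi,
      Function.update_eq_self]
  -- Near `b` the densities are constant and `Φ` is affine, so `X` is a linear map followed by a
  -- translation, between two shears. The linear map is `A` rescaled in coordinate `i` on both
  -- sides, which makes its determinant one.
  have hXb : Germ X b := by
    obtain ⟨S₁, hS₁, hS₁g, hS₁e⟩ := exists_shear_straightFun (i := i) hĝ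
      (continuous_const (y := A.det * k)) hĝb (a i) 0
    obtain ⟨S₂, hS₂, hS₂g, hS₂e⟩ := exists_shear_straightFun (i := i)
      (continuous_const (y := k)) hĝ' (a := Φ b)
      (by filter_upwards [hĝ'b] with z hz; exact hz.symm) 0 0
    have hAk : A.det * k ≠ 0 := by positivity
    let M : (ι → ℝ) →L[ℝ] (ι → ℝ) :=
      (scaleCoord i k).comp (A.comp (scaleCoord i (A.det * k)⁻¹))
    have hM : M.det = 1 := by
      change LinearMap.det (((scaleCoord i k : (ι → ℝ) →L[ℝ] (ι → ℝ)) : (ι → ℝ) →ₗ[ℝ] (ι → ℝ)) ∘ₗ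
        ((A : (ι → ℝ) →ₗ[ℝ] (ι → ℝ)) ∘ₗ
        ((scaleCoord i (A.det * k)⁻¹ : (ι → ℝ) →L[ℝ] (ι → ℝ)) : (ι → ℝ) →ₗ[ℝ] (ι → ℝ)))) = 1
      rw [LinearMap.det_comp, LinearMap.det_comp]
      change (scaleCoord i k).det * (A.det * (scaleCoord i (A.det * k)⁻¹).det) = 1
      rw [det_scaleCoord, det_scaleCoord]
      field_simp
    have hMs : ∀ x, M (scaleCoord i (A.det * k) x) = scaleCoord i k (A x) := by
      intro x
      change scaleCoord i k (A (scaleCoord i _ (scaleCoord i _ x))) = _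
      congr 2
      simp only [scaleCoord_apply, Function.update_self, Function.update_idem]
      rw [inv_mul_cancel_left₀ hAk, Function.update_eq_self]
    let τ := scaleCoord i k (φ a - A a)
    have g1 := (hS₁g b).comp (Y' := fun y => M y + τ)
      ((germ_linear M hM _).congr (by simp)) hS₁.continuousAt
    have g2 := g1.comp (hS₂g _) (by fun_prop)
    refine g2.congr' ?_
    have ht : Tendsto P.symm (𝓝 b) (𝓝 b) := by
      have := P.symm.continuous.tendsto b
      rwa [show P.symm b = b by rw [Homeomorph.symm_apply_eq, hPb]] at this
    filter_upwards [ht.eventually hS₁e, ht.eventually ((Φ.continuous.tendsto b).eventually hS₂e),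
      ht.eventually hΦb'] with y h1 h2 h3
    obtain ⟨x, rfl⟩ := P.surjective y
    rw [Homeomorph.symm_apply_apply] at h1 h2 h3
    rw [hXP]
    change straightFun i ĝ' 0 (Φ x) = S₂ (M (S₁ (straightFun i ĝ (a i) x)) + τ)
    rw [h2, ← h1, straightFun_const, straightFun_const, hMs, hΦb x h3, ← map_add]
    congr 2
    rw [map_sub]
    abel
  have hball : b ∈ Metric.ball a (4 * r) := by rw [Metric.mem_ball, hab]; linarith
  have hXa : GermIn (Metric.ball a (4 * r)) X a :=
    (hXb _ (Metric.isOpen_ball.mem_nhds hball)).transfer Metric.isOpen_ball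
      (convex_ball a (4 * r)).isPreconnected (Metric.mem_ball_self (by positivity)) hball hX
  -- The germ of `X` is now available at `a`, where the modified data coincide with the original
  -- ones; two shears replace the auxiliary straightenings by those of `g` and `g'`.
  obtain ⟨S₃, hS₃, hS₃g, hS₃e⟩ := exists_shear_straightFun (i := i) hg hĝ hĝa s (a i)
  obtain ⟨S₄, hS₄, hS₄g, hS₄e⟩ := exists_shear_straightFun (i := i) hĝ' hg' hĝ'a 0 s'
  have hS₃y : S₃ y₀ = a := by rw [hy₀, ← hS₃e.self_of_nhds]; exact hPa
  have g1 : GermIn V (X ∘ S₃) y₀ := (hS₃g y₀ V hV).comp (by rw [hS₃y]; exact hXa)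
    (fun z hz => by
      rw [hS₃y]
      exact hR₁V (Metric.ball_subset_ball hrR₁ hz)) hS₃.continuousAt
  have g2 := g1.comp_germ hV (hS₄g _) (X.continuous.comp hS₃).continuousAt
  have key : (fun y => straightFun i g' s' (φ ((straight i g s hg hc hgc).symm y))) =ᶠ[𝓝 y₀]
      S₄ ∘ (X ∘ S₃) := by
    have ht : Tendsto (straight i g s hg hc hgc).symm (𝓝 y₀) (𝓝 a) := by
      have := (straight i g s hg hc hgc).symm.continuous.tendsto y₀
      rwa [show (straight i g s hg hc hgc).symm y₀ = a by
        rw [Homeomorph.symm_apply_eq]; rfl] at this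
    have hφc : Tendsto φ (𝓝 a) (𝓝 (φ a)) := hφ.continuousAt
    filter_upwards [ht.eventually hS₃e, ht.eventually (hφc.eventually hS₄e), ht.eventually hΦa]
      with y h1 h2 h3
    obtain ⟨x, rfl⟩ := (straight i g s hg hc hgc).surjective y
    rw [Homeomorph.symm_apply_apply] at h1 h2 h3
    rw [Homeomorph.symm_apply_apply, h2]
    simp only [Function.comp_apply]
    change S₄ (Q (φ x)) = S₄ (X (S₃ (straightFun i g s x)))
    rw [← h1]
    change _ = S₄ (X (P x))
    rw [hXP, h3]
  refine g2.congr ?_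
  have key0 := key.self_of_nhds
  dsimp only at key0
  filter_upwards [key] with y hy
  rw [hy, key0]

end ChartChange

/-! ### Coefficients of volume forms -/

section Coefficient

variable {m : ℕ} {H : Type*} [TopologicalSpace H]
  {I : ModelWithCorners ℝ (EuclideanSpace ℝ (Fin m)) H}
  {M : Type*} [TopologicalSpace M] [ChartedSpace H M]

/-- The coefficient of a form after a linear change of the frame. -/
theorem alternating_comp_single (f : (EuclideanSpace ℝ (Fin m)) [⋀^Fin m]→ₗ[ℝ] ℝ)
    (T : EuclideanSpace ℝ (Fin m) →L[ℝ] EuclideanSpace ℝ (Fin m)) :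
    f (fun j => T (EuclideanSpace.single j (1 : ℝ))) =
      T.det * f fun j => EuclideanSpace.single j (1 : ℝ) := by
  let e := (EuclideanSpace.basisFun (Fin m) ℝ).toBasis
  have he : ⇑e = fun j => EuclideanSpace.single j (1 : ℝ) := by
    ext1 j
    simp [e]
  have h := f.eq_smul_basis_det e
  have h2 := e.det_comp (T : EuclideanSpace ℝ (Fin m) →ₗ[ℝ] EuclideanSpace ℝ (Fin m)) e
  rw [e.det_self, mul_one] at h2
  calc f (fun j => T (EuclideanSpace.single j (1 : ℝ)))
      = f ((T : EuclideanSpace ℝ (Fin m) →ₗ[ℝ] EuclideanSpace ℝ (Fin m)) ∘ e) := by rw [he]; rfl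
    _ = f e * e.det ((T : EuclideanSpace ℝ (Fin m) →ₗ[ℝ] EuclideanSpace ℝ (Fin m)) ∘ e) := by
        conv_lhs => rw [h]
        rfl
    _ = _ := by
        rw [h2, mul_comm, he]

variable [IsManifold I ∞ M]

theorem isManifold_one : IsManifold I 1 M := IsManifold.of_le (n := ∞) (by simp)

/-- The derivative of the inverse chart is invertible, so a form vanishing on the coordinate frame
would vanish identically. This also holds at boundary points, with the derivative taken within the
range of the model. -/
theorem VolumeForm.chartCoefficient_ne_zero (Ω : VolumeForm I M) {x : M}
    {y : EuclideanSpace ℝ (Fin m)} (hy : y ∈ (extChartAt I x).target) :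
    chartCoefficient Ω.form x y ≠ 0 := by
  have := isManifold_one (I := I) (M := M)
  obtain ⟨B, hB⟩ := isInvertible_mfderivWithin_extChartAt_symm hy
  intro h0
  let p := (extChartAt I x).symm y
  let f : (EuclideanSpace ℝ (Fin m)) [⋀^Fin m]→ₗ[ℝ] ℝ := Ω.form p
  let B' : EuclideanSpace ℝ (Fin m) →L[ℝ] EuclideanSpace ℝ (Fin m) :=
    mfderivWithin 𝓘(ℝ, EuclideanSpace ℝ (Fin m)) I (extChartAt I x).symm (range I) y
  let Bi : EuclideanSpace ℝ (Fin m) → EuclideanSpace ℝ (Fin m) := fun v => B.symm v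
  have hBi : ∀ v, B' (Bi v) = v := fun v => by
    have h1 := B.apply_symm_apply v
    have h2 := congrArg (fun T => T (B.symm v)) hB
    exact h2.symm.trans h1
  have h1 : f.compLinearMap (B' : EuclideanSpace ℝ (Fin m) →ₗ[ℝ] EuclideanSpace ℝ (Fin m)) = 0 := by
    rw [← AlternatingMap.map_basis_eq_zero_iff (EuclideanSpace.basisFun (Fin m) ℝ).toBasis]
    rw [← h0]
    simp only [AlternatingMap.compLinearMap_apply, OrthonormalBasis.coe_toBasis,
      EuclideanSpace.basisFun_apply]
    rfl
  refine Ω.ne_zero p (AlternatingMap.ext fun v => ?_)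
  let v' : Fin m → EuclideanSpace ℝ (Fin m) := v
  have h2 := congrArg (fun f => f fun j => Bi (v' j)) h1
  have h3 : (fun j => B' (Bi (v' j))) = v' := funext fun j => hBi (v' j)
  change f (fun j => B' (Bi (v' j))) = 0 at h2
  rw [h3] at h2
  exact h2

/-- Chain rule for the inverse charts, followed by the determinant rule for top forms. The
derivative within `range I` makes the formula valid at boundary points, where the one-dimensional
case needs it. -/
theorem VolumeForm.chartCoefficient_change (Ω : VolumeForm I M) {x x' : M}
    {y : EuclideanSpace ℝ (Fin m)} (hy : y ∈ (extChartAt I x).target)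
    (hy' : (extChartAt I x).symm y ∈ (extChartAt I x').source) :
    chartCoefficient Ω.form x y =
      (fderivWithin ℝ (extChartAt I x' ∘ (extChartAt I x).symm) (range I) y).det *
        chartCoefficient Ω.form x' (extChartAt I x' ((extChartAt I x).symm y)) := by
  have := isManifold_one (I := I) (M := M)
  set τ := extChartAt I x' ∘ (extChartAt I x).symm with hτ
  have hyτ : τ y ∈ (extChartAt I x').target := (extChartAt I x').map_source hy'
  have hyr : y ∈ range I := extChartAt_target_subset_range x hy
  have hs : y ∈ ((extChartAt I x).symm ≫ extChartAt I x').source := ⟨hy, hy'⟩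
  have hτd : ContDiffWithinAt ℝ ∞ τ (range I) y := contDiffWithinAt_ext_coord_change x' x hs
  have hc : ContinuousWithinAt (extChartAt I x).symm (range I) y :=
    (continuousAt_extChartAt_symm'' hy).continuousWithinAt
  have hev : (extChartAt I x).symm =ᶠ[𝓝[range I] y] (extChartAt I x').symm ∘ τ := by
    filter_upwards [hc.preimage_mem_nhdsWithin ((isOpen_extChartAt_source x').mem_nhds hy')]
      with z hz
    exact ((extChartAt I x').left_inv hz).symm
  have hp : (extChartAt I x).symm y = (extChartAt I x').symm (τ y) :=
    ((extChartAt I x').left_inv hy').symm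
  have hderiv : mfderivWithin 𝓘(ℝ, EuclideanSpace ℝ (Fin m)) I (extChartAt I x).symm (range I) y =
      (mfderivWithin 𝓘(ℝ, EuclideanSpace ℝ (Fin m)) I (extChartAt I x').symm (range I) (τ y)).comp
        (mfderivWithin 𝓘(ℝ, EuclideanSpace ℝ (Fin m)) 𝓘(ℝ, EuclideanSpace ℝ (Fin m)) τ
          (range I) y) := by
    refine (hev.mfderivWithin_eq hp).trans ?_
    refine mfderivWithin_comp y (mdifferentiableWithinAt_extChartAt_symm hyτ)
      (hτd.differentiableWithinAt (by simp)).mdifferentiableWithinAt ?_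
      (I.uniqueMDiffOn y hyr)
    intro z _
    exact mem_range_self _
  let f : M → (EuclideanSpace ℝ (Fin m)) [⋀^Fin m]→ₗ[ℝ] ℝ := Ω.form
  let B : EuclideanSpace ℝ (Fin m) →L[ℝ] EuclideanSpace ℝ (Fin m) :=
    mfderivWithin 𝓘(ℝ, EuclideanSpace ℝ (Fin m)) I (extChartAt I x').symm (range I) (τ y)
  have e1 : chartCoefficient Ω.form x y =
      f ((extChartAt I x).symm y) fun j => B (fderivWithin ℝ τ (range I) y
        (EuclideanSpace.single j (1 : ℝ))) := by
    have hT : (mfderivWithin 𝓘(ℝ, EuclideanSpace ℝ (Fin m)) 𝓘(ℝ, EuclideanSpace ℝ (Fin m)) τ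
        (range I) y : EuclideanSpace ℝ (Fin m) →L[ℝ] EuclideanSpace ℝ (Fin m)) =
        fderivWithin ℝ τ (range I) y := mfderivWithin_eq_fderivWithin
    rw [chartCoefficient, hderiv, ← hT]
    rfl
  have e2 : chartCoefficient Ω.form x' (τ y) = f ((extChartAt I x').symm (τ y)) fun j =>
    B (EuclideanSpace.single j (1 : ℝ)) := rfl
  rw [e1]
  change _ = _ * chartCoefficient Ω.form x' (τ y)
  rw [e2, ← hp]
  exact alternating_comp_single ((f ((extChartAt I x).symm y)).compLinearMap
    (B : EuclideanSpace ℝ (Fin m) →ₗ[ℝ] EuclideanSpace ℝ (Fin m))) _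

end Coefficient

/-! ### Lebesgue charts -/

/-- A simply connected open set with a measure preserving chart of a dense open subset of full
measure. -/
structure LebesgueChart {X : Type*} [TopologicalSpace X] [MeasurableSpace X] (μ : Measure X)
    (ι : Type*) [Fintype ι] where
  /-- The simply connected open set. -/
  nhd : Set X
  isOpen_nhd : IsOpen nhd
  isSimplyConnected_nhd : IsSimplyConnected nhd
  /-- The measure preserving chart. -/
  chart : OpenPartialHomeomorph X (ι → ℝ)
  source_subset : chart.source ⊆ nhd
  subset_closure : nhd ⊆ closure chart.source
  measureChart : MeasureChart chart μ volume
  isPreconnected_target : IsPreconnected chart.target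
  /-- A coordinate whose superlevel sets are connected. -/
  dir : ι
  isPreconnected_above : ∀ c : ℝ, IsPreconnected {y ∈ chart.target | c < y dir}

/-! ### Small coordinate balls, also at boundary points -/

section CoordinateBall

variable {m : ℕ} {H : Type*} [TopologicalSpace H]
  (I : ModelWithCorners ℝ (EuclideanSpace ℝ (Fin m)) H)
  {M : Type*} [TopologicalSpace M] [ChartedSpace H M]

/-- The part of a coordinate ball in the manifold. -/
def coordNhd (x : M) (r : ℝ) : Set M :=
  (extChartAt I x).source ∩ extChartAt I x ⁻¹' Metric.ball (extChartAt I x x) r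

/-- The interior part of a coordinate ball. -/
def coordInt (x : M) (r : ℝ) : Set M :=
  (extChartAt I x).source ∩
    extChartAt I x ⁻¹' (Metric.ball (extChartAt I x x) r ∩ interior (range I))

variable {I} {x : M} {r : ℝ}

theorem isOpen_coordNhd : IsOpen (coordNhd I x r) :=
  isOpen_extChartAt_preimage' x Metric.isOpen_ball

theorem isOpen_coordInt : IsOpen (coordInt I x r) :=
  isOpen_extChartAt_preimage' x (Metric.isOpen_ball.inter isOpen_interior)

theorem coordInt_subset : coordInt I x r ⊆ coordNhd I x r := fun _ hz => ⟨hz.1, hz.2.1⟩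

theorem mem_coordNhd (hr : 0 < r) : x ∈ coordNhd I x r :=
  ⟨mem_extChartAt_source x, Metric.mem_ball_self hr⟩

theorem isSimplyConnected_coordNhd (hr : 0 < r)
    (h : Metric.closedBall (extChartAt I x x) r ∩ range I ⊆ (extChartAt I x).target) :
    IsSimplyConnected (coordNhd I x r) := by
  let φ := extChartAt I x
  let A := Metric.ball (φ x) r ∩ range I
  have hA : Convex ℝ A := (convex_ball _ _).inter I.convex_range
  have hAne : A.Nonempty := ⟨φ x, Metric.mem_ball_self hr, mem_range_self _⟩
  have hAt : A ⊆ φ.target := fun y hy => h ⟨Metric.ball_subset_closedBall hy.1, hy.2⟩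
  have hVA : ∀ y ∈ coordNhd I x r, φ y ∈ A := fun y hy => ⟨hy.2, mem_range_self _⟩
  have hAV : ∀ z ∈ A, φ.symm z ∈ coordNhd I x r := fun z hz =>
    ⟨φ.map_target (hAt hz), by
      change φ (φ.symm z) ∈ Metric.ball (φ x) r
      rw [φ.right_inv (hAt hz)]; exact hz.1⟩
  let e : coordNhd I x r ≃ₜ A :=
    { toFun := fun y => ⟨φ y.1, hVA _ y.2⟩
      invFun := fun z => ⟨φ.symm z.1, hAV _ z.2⟩
      left_inv := fun y => Subtype.ext (φ.left_inv y.2.1)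
      right_inv := fun z => Subtype.ext (φ.right_inv (hAt z.2))
      continuous_toFun := ((continuousOn_extChartAt x).comp_continuous continuous_subtype_val
        fun y => y.2.1).subtype_mk _
      continuous_invFun := ((continuousOn_extChartAt_symm x).comp_continuous
        continuous_subtype_val fun z => hAt z.2).subtype_mk _ }
  have : ContractibleSpace A := hA.contractibleSpace hAne
  have : ContractibleSpace (coordNhd I x r) := e.contractibleSpace
  exact SimplyConnectedSpace.ofContractible _

/-- The range of a model with corners is contained in the closure of its interior, so boundary
points are limits of interior points of the same ball. -/
theorem coordNhd_subset_closure : coordNhd I x r ⊆ closure (coordInt I x r) := by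
  intro z hz
  rw [mem_closure_iff]
  intro W hW hzW
  let φ := extChartAt I x
  have hzt : φ z ∈ φ.target := φ.map_source hz.1
  have h1 : φ.symm ⁻¹' W ∩ φ.target ∩ Metric.ball (φ x) r ∈ 𝓝[range I] (φ z) := by
    refine inter_mem (inter_mem ?_ (extChartAt_target_mem_nhdsWithin' hz.1))
      (nhdsWithin_le_nhds (Metric.isOpen_ball.mem_nhds hz.2))
    refine (continuousAt_extChartAt_symm'' hzt).continuousWithinAt.preimage_mem_nhdsWithin ?_
    rw [φ.left_inv hz.1]
    exact hW.mem_nhds hzW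
  obtain ⟨O, hO, hzO, hOs⟩ := mem_nhdsWithin.1 h1
  have h2 := I.range_subset_closure_interior (mem_range_self (chartAt H x z))
  obtain ⟨y, hyO, hyi⟩ := mem_closure_iff.1 h2 O hO hzO
  obtain ⟨⟨hyW, hyt⟩, hyb⟩ := hOs ⟨hyO, interior_subset hyi⟩
  refine ⟨φ.symm y, hyW, φ.map_target hyt, ?_⟩
  change φ (φ.symm y) ∈ Metric.ball (φ x) r ∩ interior (range I)
  rw [φ.right_inv hyt]
  exact ⟨hyb, hyi⟩

/-- In coordinates the difference lies in the frontier of a convex set, which has Lebesgue measure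
zero. Thus the bounding sphere and the boundary of the manifold may be ignored. -/
theorem measure_closedBall_diff_coordInt [T2Space M] [MeasurableSpace M] [BorelSpace M]
    {Ω : VolumeForm I M} {μ : Measure M} (hμ : Ω.Induces μ) (hr : 0 < r)
    (h : Metric.closedBall (extChartAt I x x) r ∩ range I ⊆ (extChartAt I x).target) :
    μ ((extChartAt I x).symm '' (Metric.closedBall (extChartAt I x x) r ∩ range I) \
      coordInt I x r) = 0 := by
  let φ := extChartAt I x
  set Q := Metric.closedBall (φ x) r ∩ range I with hQ
  have hQc : IsCompact Q := (isCompact_closedBall _ _).inter_right I.isClosed_range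
  have hB : IsCompact (φ.symm '' Q) :=
    hQc.image_of_continuousOn ((continuousOn_extChartAt_symm x).mono h)
  have hBs : φ.symm '' Q ⊆ φ.source := by
    rintro _ ⟨y, hy, rfl⟩
    exact φ.map_target (h hy)
  rw [hμ x _ (sdiff_subset.trans hBs) (hB.isClosed.measurableSet.diff isOpen_coordInt.measurableSet)]
  refine setLIntegral_measure_zero _ _ (measure_mono_null ?_
    (((convex_closedBall (φ x) r).inter I.convex_range).addHaar_frontier volume))
  rintro _ ⟨_, ⟨⟨y, hy, rfl⟩, hz⟩, rfl⟩
  rw [φ.right_inv (h hy), frontier]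
  refine ⟨subset_closure hy, fun hi => hz ?_⟩
  rw [interior_inter, interior_closedBall _ hr.ne'] at hi
  refine ⟨φ.map_target (h hy), ?_⟩
  change φ (φ.symm y) ∈ Metric.ball (φ x) r ∩ interior (range I)
  rw [φ.right_inv (h hy)]
  exact hi

/-- Existence of small coordinate balls. -/
theorem exists_coordNhd (x : M) {U : Set M} (hU : U ∈ 𝓝 x) : ∃ r > 0,
    Metric.closedBall (extChartAt I x x) r ∩ range I ⊆ (extChartAt I x).target ∧
    (extChartAt I x).symm '' (Metric.closedBall (extChartAt I x x) r ∩ range I) ⊆ U := by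
  let φ := extChartAt I x
  have h1 : φ.target ∈ 𝓝[range I] (φ x) := extChartAt_target_mem_nhdsWithin x
  have h2 : φ.symm ⁻¹' U ∈ 𝓝[range I] (φ x) := by
    refine (continuousAt_extChartAt_symm x).continuousWithinAt.preimage_mem_nhdsWithin ?_
    rw [extChartAt_to_inv x]
    exact hU
  obtain ⟨r, hr, hrs⟩ := Metric.mem_nhdsWithin_iff.1 (inter_mem h1 h2)
  have h3 : Metric.closedBall (φ x) (r / 2) ∩ range I ⊆ Metric.ball (φ x) r ∩ range I :=
    inter_subset_inter_left _ (Metric.closedBall_subset_ball (by linarith))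
  refine ⟨r / 2, by positivity, fun y hy => (hrs (h3 hy)).1, ?_⟩
  rintro _ ⟨y, hy, rfl⟩
  exact (hrs (h3 hy)).2

theorem coordNhd_subset : coordNhd I x r ⊆ (extChartAt I x).symm ''
    (Metric.closedBall (extChartAt I x x) r ∩ range I) := fun z hz =>
  ⟨extChartAt I x z, ⟨Metric.ball_subset_closedBall hz.2, mem_range_self _⟩,
    (extChartAt I x).left_inv hz.1⟩

end CoordinateBall

/-! ### Construction and compatibility of Lebesgue charts -/

section LebesgueChart

variable {m : ℕ} {H : Type*} [TopologicalSpace H]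
  {I : ModelWithCorners ℝ (EuclideanSpace ℝ (Fin m)) H}
  {M : Type*} [TopologicalSpace M] [ChartedSpace H M] [MeasurableSpace M]

/-- The chart is obtained from a chart of the manifold by a reflection and the straightening of the
density of the volume form, such that it preserves the orientation. -/
def IsStraightening (Ω : VolumeForm I M) (k : Fin m) (j : OpenPartialHomeomorph M (Fin m → ℝ)) :
    Prop :=
  ∃ (x : M) (g : (Fin m → ℝ) → ℝ) (c σ : ℝ), Continuous g ∧ 0 < c ∧ (∀ y, c ≤ g y) ∧ σ * σ = 1 ∧
    ∀ z ∈ j.source, z ∈ (extChartAt I x).source ∧ extChartAt I x z ∈ interior (range I) ∧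
      j z = straightFun k g 0 (scaleCoord k σ (extChartAt I x z).ofLp) ∧
      g (scaleCoord k σ (extChartAt I x z).ofLp) =
        |chartCoefficient Ω.form x (extChartAt I x z)| ∧
      0 < σ * chartCoefficient Ω.form x (extChartAt I x z)

theorem scaleCoord_scaleCoord {ι : Type*} [Fintype ι] [DecidableEq ι] (k : ι) {σ : ℝ}
    (hσ : σ * σ = 1) (y : ι → ℝ) : scaleCoord k σ (scaleCoord k σ y) = y := by
  simp only [scaleCoord_apply, Function.update_self, Function.update_idem]
  rw [← mul_assoc, hσ, one_mul, Function.update_eq_self]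

theorem measurePreserving_scaleCoord {ι : Type*} [Fintype ι] [DecidableEq ι] (k : ι) {σ : ℝ}
    (hσ : σ * σ = 1) : MeasurePreserving (scaleCoord k σ) volume volume := by
  refine ⟨(scaleCoord k σ).continuous.measurable, ?_⟩
  have hdet : LinearMap.det (scaleCoord k σ : (ι → ℝ) →ₗ[ℝ] (ι → ℝ)) = σ := det_scaleCoord k σ
  have hσ0 : σ ≠ 0 := left_ne_zero_of_mul (hσ ▸ one_ne_zero)
  have h := Measure.map_linearMap_addHaar_eq_smul_addHaar (volume : Measure (ι → ℝ))
    (f := (scaleCoord k σ : (ι → ℝ) →ₗ[ℝ] (ι → ℝ))) (by rw [hdet]; exact hσ0)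
  have h1 : |σ⁻¹| = 1 := by
    rcases mul_self_eq_one_iff.1 hσ with rfl | rfl <;> norm_num
  rw [hdet, h1, ENNReal.ofReal_one, one_smul] at h
  exact h

theorem exists_sign {α : Type*} [TopologicalSpace α] {s : Set α} (hs : IsPreconnected s)
    {f : α → ℝ} (hf : ContinuousOn f s) (h0 : ∀ y ∈ s, f y ≠ 0) :
    ∃ σ : ℝ, σ * σ = 1 ∧ ∀ y ∈ s, 0 < σ * f y := by
  by_cases hpos : ∀ y ∈ s, 0 < f y
  · exact ⟨1, one_mul 1, fun y hy => by simpa using hpos y hy⟩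
  · push Not at hpos
    obtain ⟨y₀, hy₀, h⟩ := hpos
    refine ⟨-1, by norm_num, fun y hy => ?_⟩
    by_contra hc
    have hy2 : 0 ≤ f y := by linarith
    obtain ⟨w, hw, hw0⟩ := (hs.image f hf).ordConnected.out ⟨y₀, hy₀, rfl⟩ ⟨y, hy, rfl⟩ ⟨h, hy2⟩
    exact h0 w hw hw0

theorem measurableSet_source_inter_preimage {X Y : Type*} [TopologicalSpace X] [MeasurableSpace X]
    [BorelSpace X] [TopologicalSpace Y] [MeasurableSpace Y] [BorelSpace Y]
    (j : OpenPartialHomeomorph X Y) {A : Set Y} (hA : MeasurableSet A) :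
    MeasurableSet (j.source ∩ j ⁻¹' A) := by
  have h1 : Measurable (j.source.domRestrict j) :=
    (continuousOn_iff_continuous_domRestrict.1 j.continuousOn).measurable
  have h2 := j.open_source.measurableSet.subtype_image (h1 hA)
  convert h2 using 1
  ext y
  simp [Set.domRestrict, and_comm]

omit [MeasurableSpace M] in
theorem ball_inter_interior_subset {x : M} {r : ℝ}
    (h : Metric.closedBall (extChartAt I x x) r ∩ range I ⊆ (extChartAt I x).target) :
    Metric.ball (extChartAt I x x) r ∩ interior (range I) ⊆ (extChartAt I x).target :=
  fun _ hy => h ⟨Metric.ball_subset_closedBall hy.1, interior_subset hy.2⟩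

omit [MeasurableSpace M] in
/-- The chart of the interior part of a coordinate ball composed with a homeomorphism. -/
def coordChart (x : M) (r : ℝ)
    (h : Metric.closedBall (extChartAt I x x) r ∩ range I ⊆ (extChartAt I x).target)
    (Θ : EuclideanSpace ℝ (Fin m) ≃ₜ (Fin m → ℝ)) : OpenPartialHomeomorph M (Fin m → ℝ) where
  toFun z := Θ (extChartAt I x z)
  invFun y := (extChartAt I x).symm (Θ.symm y)
  source := coordInt I x r
  target := Θ '' (Metric.ball (extChartAt I x x) r ∩ interior (range I))
  map_source' z hz := ⟨extChartAt I x z, hz.2, rfl⟩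
  map_target' := by
    rintro _ ⟨y, hy, rfl⟩
    have hyt := ball_inter_interior_subset h hy
    rw [Homeomorph.symm_apply_apply]
    refine ⟨(extChartAt I x).map_target hyt, ?_⟩
    rw [mem_preimage, (extChartAt I x).right_inv hyt]
    exact hy
  left_inv' z hz := by
    rw [Homeomorph.symm_apply_apply]
    exact (extChartAt I x).left_inv hz.1
  right_inv' := by
    rintro _ ⟨y, hy, rfl⟩
    rw [Homeomorph.symm_apply_apply, (extChartAt I x).right_inv (ball_inter_interior_subset h hy)]
  open_source := isOpen_coordInt
  open_target := Θ.isOpenMap _ (Metric.isOpen_ball.inter isOpen_interior)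
  continuousOn_toFun := Θ.continuous.comp_continuousOn
    ((continuousOn_extChartAt x).mono fun z hz => hz.1)
  continuousOn_invFun := by
    refine (continuousOn_extChartAt_symm x).comp Θ.symm.continuous.continuousOn ?_
    rintro _ ⟨y, hy, rfl⟩
    rw [Homeomorph.symm_apply_apply]
    exact ball_inter_interior_subset h hy

theorem measureChart_coordChart [BorelSpace M] {Ω : VolumeForm I M} {μ : Measure M}
    (hμ : Ω.Induces μ) {x : M} {r : ℝ}
    (h : Metric.closedBall (extChartAt I x x) r ∩ range I ⊆ (extChartAt I x).target)
    {Θ : EuclideanSpace ℝ (Fin m) ≃ₜ (Fin m → ℝ)}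
    (hΘ : ∀ A : Set (Fin m → ℝ), MeasurableSet A →
      Θ ⁻¹' A ⊆ Metric.ball (extChartAt I x x) r ∩ interior (range I) →
      ∫⁻ y in Θ ⁻¹' A, ENNReal.ofReal |chartCoefficient Ω.form x y| = volume A) :
    MeasureChart (coordChart x r h Θ) μ volume := by
  intro A hA hAm
  have hAO : Θ ⁻¹' A ⊆ Metric.ball (extChartAt I x x) r ∩ interior (range I) := by
    intro y hy
    obtain ⟨y', hy', hyy⟩ := hA hy
    rwa [← Θ.injective hyy]
  have hm := measurableSet_source_inter_preimage (coordChart x r h Θ) hAm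
  have him : extChartAt I x '' ((coordChart x r h Θ).source ∩ coordChart x r h Θ ⁻¹' A) =
      Θ ⁻¹' A := by
    ext y
    constructor
    · rintro ⟨z, ⟨hz, hz2⟩, rfl⟩
      exact hz2
    · intro hy
      have hyO := hAO hy
      have e1 := (extChartAt I x).right_inv (ball_inter_interior_subset h hyO)
      refine ⟨(extChartAt I x).symm y, ⟨⟨(extChartAt I x).map_target
        (ball_inter_interior_subset h hyO), ?_⟩, ?_⟩, e1⟩
      · rw [mem_preimage, e1]
        exact hyO
      · change Θ (extChartAt I x ((extChartAt I x).symm y)) ∈ A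
        rw [e1]
        exact hy
  rw [hμ x _ (fun z hz => hz.1.1) hm, him, hΘ A hAm hAO]

variable [IsManifold I ∞ M] [T2Space M] [BorelSpace M]

/-- On the compact ball the coefficient of the form is bounded away from zero; its absolute value
extends to a global density, which is then straightened in direction `k`. Straightening does not
change the other coordinates, so superlevel sets of one of them are images of convex sets and hence
connected. -/
theorem exists_lebesgueChart [Nontrivial (Fin m)] {Ω : VolumeForm I M} {μ : Measure M}
    (hμ : Ω.Induces μ)
    (k : Fin m) (x : M) {r : ℝ} (hr : 0 < r)
    (h : Metric.closedBall (extChartAt I x x) r ∩ range I ⊆ (extChartAt I x).target) :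
    ∃ C : LebesgueChart μ (Fin m), IsStraightening Ω k C.chart ∧ C.nhd = coordNhd I x r ∧
      C.chart.source = coordInt I x r := by
  let φ := extChartAt I x
  let Q := Metric.closedBall (φ x) r ∩ range I
  have hQc : IsCompact Q := (isCompact_closedBall _ _).inter_right I.isClosed_range
  have hQne : Q.Nonempty := ⟨φ x, Metric.mem_closedBall_self hr.le, mem_range_self _⟩
  let O := Metric.ball (φ x) r ∩ interior (range I)
  have hOQ : O ⊆ Q := fun y hy => ⟨Metric.ball_subset_closedBall hy.1, interior_subset hy.2⟩
  have hOt : O ⊆ φ.target := hOQ.trans h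
  have hOo : IsOpen O := Metric.isOpen_ball.inter isOpen_interior
  have hOc : Convex ℝ O := (convex_ball _ _).inter I.convex_range.interior
  have hcoef : ContinuousOn (chartCoefficient Ω.form x) φ.target := (Ω.smooth x).continuousOn
  have hcoef0 : ∀ y ∈ φ.target, chartCoefficient Ω.form x y ≠ 0 := fun y hy =>
    Ω.chartCoefficient_ne_zero hy
  obtain ⟨y₀, hy₀, hmin⟩ := hQc.exists_isMinOn hQne (hcoef.abs.mono h)
  let c := |chartCoefficient Ω.form x y₀|
  have hc : 0 < c := abs_pos.2 (hcoef0 y₀ (h hy₀))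
  -- Reflecting coordinate `k` by this sign makes the form positive in every chart, so all
  -- transition maps get positive determinant. The form thus orients the manifold, without any
  -- further hypothesis.
  obtain ⟨σ, hσ, hσpos⟩ := exists_sign hOc.isPreconnected (hcoef.mono hOt)
    fun y hy => hcoef0 y (hOt hy)
  obtain ⟨G, hG⟩ := ContinuousMap.exists_restrict_eq (Y := ℝ) hQc.isClosed
    ⟨_, continuousOn_iff_continuous_domRestrict.1 (hcoef.abs.mono h)⟩
  have hGQ : ∀ y ∈ Q, G y = |chartCoefficient Ω.form x y| := fun y hy =>
    congrArg (fun f : C(Q, ℝ) => f ⟨y, hy⟩) hG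
  let e : EuclideanSpace ℝ (Fin m) ≃L[ℝ] (Fin m → ℝ) := EuclideanSpace.equiv (Fin m) ℝ
  have hemp : MeasurePreserving e volume volume := PiLp.volume_preserving_ofLp (Fin m)
  let ρ : (Fin m → ℝ) ≃ₜ (Fin m → ℝ) :=
    { toFun := scaleCoord k σ
      invFun := scaleCoord k σ
      left_inv := scaleCoord_scaleCoord k hσ
      right_inv := scaleCoord_scaleCoord k hσ
      continuous_toFun := (scaleCoord k σ).continuous
      continuous_invFun := (scaleCoord k σ).continuous }
  have hρmp : MeasurePreserving ρ volume volume := measurePreserving_scaleCoord k hσ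
  let θ : EuclideanSpace ℝ (Fin m) ≃ₜ (Fin m → ℝ) := e.toHomeomorph.trans ρ
  have hθmp : MeasurePreserving θ volume volume := hρmp.comp hemp
  let g : (Fin m → ℝ) → ℝ := fun y => max c (G (θ.symm y))
  have hg : Continuous g := continuous_const.max (G.continuous.comp θ.symm.continuous)
  have hgc : ∀ y, c ≤ g y := fun y => le_max_left _ _
  have hgQ : ∀ y ∈ Q, g (θ y) = |chartCoefficient Ω.form x y| := fun y hy => by
    simp only [g, Homeomorph.symm_apply_apply, hGQ y hy]
    exact max_eq_right (hmin hy)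
  let P := straight k g 0 hg hc hgc
  let Θ := θ.trans P
  have hconv : ∀ T : Set (EuclideanSpace ℝ (Fin m)), Convex ℝ T → IsPreconnected (Θ '' T) :=
    fun T hT => hT.isPreconnected.image _ Θ.continuous.continuousOn
  have hj : MeasureChart (coordChart x r h Θ) μ volume := by
    refine measureChart_coordChart hμ h fun A hAm hAO => ?_
    have hAm' : MeasurableSet (Θ ⁻¹' A) := Θ.continuous.measurable hAm
    have e1 : ∫⁻ y in Θ ⁻¹' A, ENNReal.ofReal |chartCoefficient Ω.form x y| =
        ∫⁻ y in θ ⁻¹' (P ⁻¹' A), ENNReal.ofReal (g (θ y)) := by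
      refine setLIntegral_congr_fun hAm' fun y hy => ?_
      rw [hgQ y (hOQ (hAO hy))]
    have hPA : MeasurableSet (P ⁻¹' A) := P.continuous.measurable hAm
    rw [e1, hθmp.setLIntegral_comp_preimage hPA (f := fun y => ENNReal.ofReal (g y))
      hg.measurable.ennreal_ofReal, ← withDensity_apply _ hPA,
      ← Measure.map_apply P.measurable hAm]
    congr 1
    exact map_straightFun hg hc hgc
  obtain ⟨d, hd⟩ := exists_ne k
  refine ⟨⟨coordNhd I x r, isOpen_coordNhd, isSimplyConnected_coordNhd hr h,
    coordChart x r h Θ, coordInt_subset,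
    coordNhd_subset_closure, hj, hconv O hOc, d, fun a => ?_⟩, ⟨x, g, c, σ, hg, hc, hgc, hσ, ?_⟩,
    rfl, rfl⟩
  · have hΘd : ∀ y, Θ y d = y d := by
      intro y
      change straightFun k g 0 (scaleCoord k σ (e y)) d = _
      rw [straightFun_apply_of_ne _ hd, scaleCoord_apply, Function.update_of_ne hd]
      rfl
    have : {y ∈ (coordChart x r h Θ).target | a < y d} = Θ '' (O ∩ {y | a < y d}) := by
      ext y
      constructor
      · rintro ⟨⟨y', hy', rfl⟩, h2⟩
        have h2' : a < Θ y' d := h2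
        rw [hΘd] at h2'
        exact ⟨y', ⟨hy', h2'⟩, rfl⟩
      · rintro ⟨y', ⟨hy', h2⟩, rfl⟩
        refine ⟨⟨y', hy', rfl⟩, ?_⟩
        rw [hΘd]
        exact h2
    rw [this]
    refine hconv _ (hOc.inter ?_)
    exact (convex_Ioi a).is_linear_preimage (f := fun y : EuclideanSpace ℝ (Fin m) => y d)
      ⟨fun _ _ => rfl, fun _ _ => rfl⟩
  · intro z hz
    exact ⟨hz.1, hz.2.2, rfl, hgQ _ (hOQ hz.2), hσpos _ hz.2⟩

omit [MeasurableSpace M] [T2Space M] [BorelSpace M] in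
-- The normalisation of the signs makes the determinant of the coordinate change positive, and the
-- transformation rule of the coefficients is the relation between the densities required by
-- `germ_chart_change`.
theorem germ_of_isStraightening [Nontrivial (Fin m)] {Ω : VolumeForm I M} {k : Fin m}
    {j j' : OpenPartialHomeomorph M (Fin m → ℝ)}
    (hj : IsStraightening Ω k j) (hj' : IsStraightening Ω k j') {z : M} (hz : z ∈ j.source)
    (hz' : z ∈ j'.source) : Germ (fun y => j' (j.symm y)) (j z) := by
  obtain ⟨x, g, c, σ, hg, hc, hgc, hσ, hjs⟩ := hj
  obtain ⟨x', g', c', σ', hg', hc', hgc', hσ', hjs'⟩ := hj'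
  let φ := extChartAt I x
  let φ' := extChartAt I x'
  let e : EuclideanSpace ℝ (Fin m) ≃L[ℝ] (Fin m → ℝ) := EuclideanSpace.equiv (Fin m) ℝ
  let τ := φ' ∘ φ.symm
  let Φ : (Fin m → ℝ) → Fin m → ℝ := fun y => scaleCoord k σ' (e (τ (e.symm (scaleCoord k σ y))))
  let a := scaleCoord k σ (e (φ z))
  let P := straight k g 0 hg hc hgc
  have hinv : ∀ y, e.symm (scaleCoord k σ (scaleCoord k σ (e y))) = y := fun y => by
    rw [scaleCoord_scaleCoord k hσ, e.symm_apply_apply]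
  have hjz : ∀ w ∈ j.source, j w = P (scaleCoord k σ (e (φ w))) := fun w hw => (hjs w hw).2.2.1
  have hja : j z = P a := hjz z hz
  have hτ : ∀ w ∈ j.source ∩ j'.source, ContDiffAt ℝ 1 τ (φ w) ∧
      chartCoefficient Ω.form x (φ w) =
        (fderiv ℝ τ (φ w)).det * chartCoefficient Ω.form x' (φ' w) ∧ τ (φ w) = φ' w := by
    rintro w ⟨hw, hw'⟩
    obtain ⟨h1, h2, -⟩ := hjs w hw
    obtain ⟨h1', h2', -⟩ := hjs' w hw'
    have hl : φ.symm (φ w) = w := φ.left_inv h1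
    have hs : φ w ∈ (φ.symm ≫ φ').source := ⟨φ.map_source h1, by
      change φ.symm (φ w) ∈ φ'.source
      rw [hl]; exact h1'⟩
    have hn : range I ∈ 𝓝 (φ w) := mem_interior_iff_mem_nhds.1 h2
    have hd : ContDiffWithinAt ℝ ∞ τ (range I) (φ w) := contDiffWithinAt_ext_coord_change x' x hs
    refine ⟨(hd.contDiffAt hn).of_le (by simp), ?_, congrArg φ' hl⟩
    have := Ω.chartCoefficient_change hs.1 hs.2
    rw [fderivWithin_of_mem_nhds hn] at this
    rw [this]
    change _ * chartCoefficient Ω.form x' (φ' (φ.symm (φ w))) = _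
    rw [hl]
  have hΦw : ∀ w ∈ j.source ∩ j'.source,
      Φ (scaleCoord k σ (e (φ w))) = scaleCoord k σ' (e (φ' w)) := fun w hw => by
    simp only [Φ, hinv, (hτ w hw).2.2]
  have hΦd : ∀ w ∈ j.source ∩ j'.source, ContDiffAt ℝ 1 Φ (scaleCoord k σ (e (φ w))) ∧
      (fderiv ℝ Φ (scaleCoord k σ (e (φ w)))).det = σ * σ' * (fderiv ℝ τ (φ w)).det := by
    intro w hw
    have h1 := (hτ w hw).1
    let S : (Fin m → ℝ) →L[ℝ] EuclideanSpace ℝ (Fin m) :=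
      (e.symm : (Fin m → ℝ) →L[ℝ] EuclideanSpace ℝ (Fin m)).comp (scaleCoord k σ)
    let S' : EuclideanSpace ℝ (Fin m) →L[ℝ] (Fin m → ℝ) :=
      (scaleCoord k σ').comp (e : EuclideanSpace ℝ (Fin m) →L[ℝ] (Fin m → ℝ))
    have hS : S (scaleCoord k σ (e (φ w))) = φ w := hinv _
    have h1' : ContDiffAt ℝ 1 τ (S (scaleCoord k σ (e (φ w)))) := by rwa [hS]
    have hΦ : Φ = S' ∘ τ ∘ S := rfl
    refine ⟨hΦ ▸ S'.contDiff.contDiffAt.comp _ (h1'.comp _ S.contDiff.contDiffAt), ?_⟩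
    have h2 : HasFDerivAt Φ (S'.comp ((fderiv ℝ τ (φ w)).comp S)) (scaleCoord k σ (e (φ w))) := by
      have h3 := (h1'.differentiableAt (by simp)).hasFDerivAt
      have h4 := S'.hasFDerivAt.comp _ (h3.comp _ S.hasFDerivAt)
      rwa [hS] at h4
    rw [h2.fderiv]
    have h5 : ((S'.comp ((fderiv ℝ τ (φ w)).comp S)) : (Fin m → ℝ) →L[ℝ] (Fin m → ℝ)).det =
        LinearMap.det ((scaleCoord k σ' : (Fin m → ℝ) →ₗ[ℝ] (Fin m → ℝ)) ∘ₗ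
          ((e.toLinearEquiv : EuclideanSpace ℝ (Fin m) →ₗ[ℝ] (Fin m → ℝ)) ∘ₗ
            (fderiv ℝ τ (φ w) : EuclideanSpace ℝ (Fin m) →ₗ[ℝ] EuclideanSpace ℝ (Fin m)) ∘ₗ
            (e.toLinearEquiv.symm : (Fin m → ℝ) →ₗ[ℝ] EuclideanSpace ℝ (Fin m))) ∘ₗ
          (scaleCoord k σ : (Fin m → ℝ) →ₗ[ℝ] (Fin m → ℝ))) := rfl
    rw [h5, LinearMap.det_comp, LinearMap.det_comp, LinearMap.det_conj]
    change (scaleCoord k σ').det * ((fderiv ℝ τ (φ w)).det * (scaleCoord k σ).det) = _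
    rw [det_scaleCoord, det_scaleCoord]
    ring
  have hopen : ∀ᶠ y in 𝓝 a, ∃ w ∈ j.source ∩ j'.source, y = scaleCoord k σ (e (φ w)) := by
    have h1 : ∀ᶠ y in 𝓝 (j z), y ∈ j.target ∧ j.symm y ∈ j'.source := by
      refine Filter.Eventually.and (j.open_target.mem_nhds (j.map_source hz)) ?_
      have := j.continuousAt_symm (j.map_source hz)
      refine this.preimage_mem_nhds (j'.open_source.mem_nhds ?_)
      rwa [j.left_inv hz]
    have h2 : Tendsto P (𝓝 a) (𝓝 (j z)) := by
      have := P.continuous.tendsto a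
      rwa [← hja] at this
    filter_upwards [h2.eventually h1] with y hy
    refine ⟨j.symm (P y), ⟨j.map_target hy.1, hy.2⟩, ?_⟩
    have h3 := hjz _ (j.map_target hy.1)
    rw [j.right_inv hy.1] at h3
    exact P.injective h3
  have hzz : z ∈ j.source ∩ j'.source := ⟨hz, hz'⟩
  have hgerm := germ_chart_change (i := k) (s := 0) (s' := 0) hg hc hgc hg' hc' hgc'
    (hΦd z hzz).1 ?_ ?_
  · change Germ _ (P a) at hgerm
    rw [hja]
    refine hgerm.congr' ?_
    have ht : Tendsto P.symm (𝓝 (P a)) (𝓝 a) := by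
      have := P.symm.continuous.tendsto (P a)
      rwa [P.symm_apply_apply] at this
    filter_upwards [ht.eventually hopen] with y hy
    obtain ⟨w, hw, hyw⟩ := hy
    have e1 : y = j w := by
      rw [hjz w hw.1, ← hyw, P.apply_symm_apply]
    have e2 : P.symm y = scaleCoord k σ (e (φ w)) := hyw
    change j' (j.symm y) = straightFun k g' 0 (Φ (P.symm y))
    rw [e2, hΦw w hw, e1, j.left_inv hw.1]
    exact (hjs' w hw.2).2.2.1
  · rw [(hΦd z hzz).2]
    have h1 := (hjs z hz).2.2.2.2
    have h2 := (hjs' z hz').2.2.2.2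
    have h3 := (hτ z hzz).2.1
    change 0 < σ * chartCoefficient Ω.form x (φ z) at h1
    change 0 < σ' * chartCoefficient Ω.form x' (φ' z) at h2
    rw [h3] at h1
    have h4 := mul_pos h1 h2
    by_contra hcon
    have h5 := mul_nonpos_of_nonpos_of_nonneg (not_lt.1 hcon)
      (sq_nonneg (chartCoefficient Ω.form x' (φ' z)))
    refine absurd h4 (not_lt.2 (le_of_eq_of_le ?_ h5))
    ring
  · filter_upwards [hopen] with y hy
    obtain ⟨w, hw, rfl⟩ := hy
    have h1 := (hjs w hw.1).2.2.2.1
    have h2 := (hjs' w hw.2).2.2.2.1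
    have h3 := (hτ w hw).2.1
    change g (scaleCoord k σ (e (φ w))) = |chartCoefficient Ω.form x (φ w)| at h1
    change g' (scaleCoord k σ' (e (φ' w))) = |chartCoefficient Ω.form x' (φ' w)| at h2
    rw [hΦw w hw, h1, h2, (hΦd w hw).2, h3, abs_mul, abs_mul (σ * σ')]
    have h4 : |σ * σ'| = 1 := by
      have : (σ * σ') * (σ * σ') = 1 := by rw [mul_mul_mul_comm, hσ, hσ', one_mul]
      rcases mul_self_eq_one_iff.1 this with h | h <;> rw [h] <;> norm_num
    rw [h4, one_mul, mul_comm]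

end LebesgueChart

/-! ### Moving points of Lebesgue charts along paths -/

section Reach

variable {X : Type*} [TopologicalSpace X] [T2Space X] [MeasurableSpace X] [BorelSpace X]
  {μ : Measure X} {ι : Type*} [Fintype ι] [DecidableEq ι]

/-- The charts cover the space by arbitrarily small sets and the transition maps are near each point
endpoints of isotopies. -/
structure IsLebesgueAtlas (𝒜 : Set (LebesgueChart μ ι)) : Prop where
  exists_mem : ∀ x, ∀ W ∈ 𝓝 x, ∃ C ∈ 𝒜, x ∈ C.nhd ∧ C.nhd ⊆ W
  germ : ∀ C ∈ 𝒜, ∀ C' ∈ 𝒜, ∀ z ∈ C.chart.source, z ∈ C'.chart.source →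
    Germ (fun y => C'.chart (C.chart.symm y)) (C.chart z)

/-- Isotopies of the chart can be realised in the space. -/
theorem LebesgueChart.exists_transport (C : LebesgueChart μ ι)
    (H : Isotopy (volume : Measure (ι → ℝ))) {K : Set (ι → ℝ)} (hK : IsCompact K)
    (hKC : K ⊆ C.chart.target) (hH : H.SuppIn K) :
    ∃ Ψ : Isotopy μ, (∀ K' ⊆ K, H.SuppIn K' → Ψ.SuppIn (C.chart.symm '' K')) ∧
      ∀ z ∈ C.chart.source, ∀ t, Ψ t z ∈ C.chart.source ∧ C.chart (Ψ t z) = H t (C.chart z) := by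
  refine ⟨H.transport C.measureChart hK hKC hH, fun K' hK' h' => ?_, fun z hz t => ?_⟩
  · refine (Isotopy.suppIn_transport _ _ _ _ _ h').mono ?_
    rintro z ⟨hz, hz'⟩
    exact ⟨_, hz', C.chart.left_inv hz⟩
  · have h1 := hH.mem hKC t (C.chart.map_source hz)
    rw [Isotopy.transport_of_mem _ _ _ _ _ hz]
    exact ⟨C.chart.map_target h1, C.chart.right_inv h1⟩

theorem LebesgueChart.isCompact_image (C : LebesgueChart μ ι) {K : Set (ι → ℝ)} (hK : IsCompact K)
    (hKC : K ⊆ C.chart.target) : IsCompact (C.chart.symm '' K) :=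
  hK.image_of_continuousOn (C.chart.continuousOn_symm.mono hKC)

theorem LebesgueChart.measure_image (C : LebesgueChart μ ι) {A : Set (ι → ℝ)}
    (hA : MeasurableSet A) (hAC : A ⊆ C.chart.target) : μ (C.chart.symm '' A) = volume A := by
  rw [← C.measureChart A hAC hA]
  congr 1
  ext z
  constructor
  · rintro ⟨y, hy, rfl⟩
    exact ⟨C.chart.map_target (hAC hy), by rwa [mem_preimage, C.chart.right_inv (hAC hy)]⟩
  · rintro ⟨hz, hz'⟩
    exact ⟨_, hz', C.chart.left_inv hz⟩

theorem Isotopy.moves_of_isSimplyConnected {V : Set X} (hV : IsSimplyConnected V) {H : Isotopy μ}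
    {x y : X} (hH : ∀ t, H t x ∈ V) (h1 : H 1 x = y) (p : Path x y) (hp : ∀ t, p t ∈ V) :
    H.Moves (Homotopic.Quotient.mk p) := by
  subst h1
  rw [mk_eq_of_isSimplyConnected hV p (H.isIsotopy.trajectory x) hp hH]
  exact H.moves_trajectory x

/-- Isotopies with arbitrarily small compact support move `z` to `z'` in the class `q`, and are
translations in the charts near these points. -/
def Reach (C C' : LebesgueChart μ ι) {z z' : X} (q : Homotopic.Quotient z z') : Prop :=
  ∀ η > (0 : ENNReal), ∃ Ψ : Isotopy μ, ∃ K, IsCompact K ∧ μ K ≤ η ∧ Ψ.SuppIn K ∧ Ψ.Moves q ∧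
    ∀ᶠ y in 𝓝 z, C'.chart (Ψ 1 y) = C'.chart z' + (C.chart y - C.chart z)

theorem Isotopy.tendsto_one (Ψ : Isotopy μ) {z z' : X} {q : Homotopic.Quotient z z'}
    (h : Ψ.Moves q) : Tendsto (Ψ 1) (𝓝 z) (𝓝 z') := by
  have := (Ψ 1).continuous.tendsto z
  rwa [h.apply_one] at this

theorem Reach.trans {C C' C'' : LebesgueChart μ ι} {z z' z'' : X} {q : Homotopic.Quotient z z'}
    {q' : Homotopic.Quotient z' z''} (h : Reach C C' q) (h' : Reach C' C'' q') :
    Reach C C'' (q.trans q') := by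
  intro η hη
  obtain ⟨Ψ, K, hK, hKη, hΨ, hq, hc⟩ := h (η / 2) (ENNReal.half_pos hη.ne')
  obtain ⟨Ψ', K', hK', hKη', hΨ', hq', hc'⟩ := h' (η / 2) (ENNReal.half_pos hη.ne')
  refine ⟨Ψ * Ψ', K ∪ K', hK.union hK', (measure_union_le _ _).trans
    ((add_le_add hKη hKη').trans (ENNReal.add_halves η).le), hΨ.mul hΨ', hq.mul hq', ?_⟩
  filter_upwards [hc, (Ψ.tendsto_one hq).eventually hc'] with y h1 h2
  rw [Isotopy.mul_apply, h2, h1, add_sub_cancel_left]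

/-- The push takes place in the chart, so the trajectory stays in the simply connected set `C.nhd`
and its class is that of any path there with the same endpoints. -/
theorem Reach.of_inside [Nontrivial ι] {C : LebesgueChart μ ι} {z z' : X} (hz : z ∈ C.chart.source)
    (hz' : z' ∈ C.chart.source) (p : Path z z') (hp : ∀ t, p t ∈ C.nhd) :
    Reach C C (Homotopic.Quotient.mk p) := by
  intro η hη
  obtain ⟨H, K, hKC, hK, hKη, hH, hH1⟩ := pushIn_of_isPreconnected C.chart.open_target
    C.isPreconnected_target (C.chart.map_source hz) (C.chart.map_source hz') η hη
  obtain ⟨Ψ, hΨ, hΨC⟩ := C.exists_transport H hK hKC hH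
  have h1 : ∀ᶠ y in 𝓝 z, Ψ 1 y ∈ C.chart.source ∧
      C.chart (Ψ 1 y) = C.chart z' + (C.chart y - C.chart z) := by
    filter_upwards [C.chart.open_source.mem_nhds hz, (C.chart.continuousAt hz).eventually hH1]
      with y hy hy1
    refine ⟨(hΨC y hy 1).1, ?_⟩
    rw [(hΨC y hy 1).2, hy1]
    abel
  refine ⟨Ψ, _, C.isCompact_image hK hKC, ?_, hΨ K subset_rfl hH,
    Isotopy.moves_of_isSimplyConnected C.isSimplyConnected_nhd
      (fun t => C.source_subset (hΨC z hz t).1) ?_ p hp, h1.mono fun y hy => hy.2⟩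
  · rwa [C.measure_image hK.measurableSet hKC]
  · have h2 := h1.self_of_nhds
    rw [sub_self, add_zero] at h2
    exact C.chart.injOn h2.1 hz' h2.2

theorem exists_nhds_volume_le (a : ι → ℝ) [Nonempty ι] {η : ENNReal} (hη : 0 < η) :
    ∃ V ∈ 𝓝 a, volume V ≤ η := by
  obtain ⟨U, hU, hUo, hη⟩ := Set.exists_isOpen_lt_of_lt (μ := (volume : Measure (ι → ℝ))) {a} η
    (by rwa [measure_singleton])
  exact ⟨U, hUo.mem_nhds (hU rfl), hη.le⟩

/-- The transition from `C'` to `C` is realised, up to translation, by an isotopy of the chart `C'`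
near `z`. Reading the result in `C'` makes it a translation with respect to the coordinates of `C`:
the distortion of the chart change has been undone. -/
theorem Reach.of_change [Nontrivial ι] {𝒜 : Set (LebesgueChart μ ι)} (h𝒜 : IsLebesgueAtlas 𝒜)
    {C C' : LebesgueChart μ ι} (hC : C ∈ 𝒜) (hC' : C' ∈ 𝒜) {z : X} (hz : z ∈ C.chart.source)
    (hz' : z ∈ C'.chart.source) : Reach C C' (Homotopic.Quotient.refl z) := by
  intro η hη
  obtain ⟨V, hV, hVη⟩ := exists_nhds_volume_le (C'.chart z) hη
  obtain ⟨H, K, hKV, hK, hH, hH1⟩ := h𝒜.germ C' hC' C hC z hz' hz _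
    (inter_mem (C'.chart.open_target.mem_nhds (C'.chart.map_source hz')) hV)
  have hKC : K ⊆ C'.chart.target := hKV.trans inter_subset_left
  obtain ⟨Ψ, hΨ, hΨC⟩ := C'.exists_transport H hK hKC hH
  have h1 : ∀ᶠ y in 𝓝 z, Ψ 1 y ∈ C'.chart.source ∧
      C'.chart (Ψ 1 y) = C'.chart z + (C.chart y - C.chart z) := by
    filter_upwards [C'.chart.open_source.mem_nhds hz', (C'.chart.continuousAt hz').eventually hH1]
      with y hy hy1
    refine ⟨(hΨC y hy 1).1, ?_⟩
    rw [(hΨC y hy 1).2, hy1, C'.chart.left_inv hy, C'.chart.left_inv hz']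
  refine ⟨Ψ, _, C'.isCompact_image hK hKC, ?_, hΨ K subset_rfl hH,
    Isotopy.moves_of_isSimplyConnected C'.isSimplyConnected_nhd
      (fun t => C'.source_subset (hΨC z hz' t).1) ?_ (Path.refl z)
      (fun _ => C'.source_subset hz'), h1.mono fun y hy => hy.2⟩
  · rw [C'.measure_image hK.measurableSet hKC]
    exact (measure_mono (hKV.trans inter_subset_right)).trans hVη
  · have h2 := h1.self_of_nhds
    rw [sub_self, add_zero] at h2
    exact C'.chart.injOn h2.1 hz' h2.2

theorem quotient_cancel {x y z w : X} (r : Homotopic.Quotient x y) (e : Homotopic.Quotient y z)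
    (r' : Homotopic.Quotient y w) : (r.trans e).trans (e.symm.trans r') = r.trans r' := by
  rw [Homotopic.Quotient.trans_assoc, ← Homotopic.Quotient.trans_assoc e,
    Homotopic.Quotient.trans_symm, Homotopic.Quotient.refl_trans]

/-- The junction `w` may lie on the boundary, outside the domains of both charts. Density of the
domains provides a nearby point `w₂` in both of them, and the detour `e` cancels in the homotopy
class. -/
theorem Reach.step [Nontrivial ι] {𝒜 : Set (LebesgueChart μ ι)} (h𝒜 : IsLebesgueAtlas 𝒜)
    {C C' : LebesgueChart μ ι} (hC : C ∈ 𝒜) (hC' : C' ∈ 𝒜) {z w z' : X} (hz : z ∈ C.chart.source)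
    (hz' : z' ∈ C'.chart.source) (r : Path z w) (hr : ∀ t, r t ∈ C.nhd) (r' : Path w z')
    (hr' : ∀ t, r' t ∈ C'.nhd) :
    Reach C C' ((Homotopic.Quotient.mk r).trans (Homotopic.Quotient.mk r')) := by
  have hw : w ∈ C.nhd := by simpa using hr 1
  have hw' : w ∈ C'.nhd := by simpa using hr' 0
  obtain ⟨D, hD, hwD, hDs⟩ := h𝒜.exists_mem w (C.nhd ∩ C'.nhd)
    ((C.isOpen_nhd.inter C'.isOpen_nhd).mem_nhds ⟨hw, hw'⟩)
  obtain ⟨w₁, hw₁D, hw₁C⟩ := mem_closure_iff.1 (C.subset_closure hw) _ D.isOpen_nhd hwD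
  obtain ⟨w₂, ⟨hw₂D, hw₂C⟩, hw₂C'⟩ := mem_closure_iff.1 (C'.subset_closure (hDs hw₁D).2) _
    (D.isOpen_nhd.inter C.chart.open_source) ⟨hw₁D, hw₁C⟩
  obtain ⟨e, he⟩ := exists_path_of_isSimplyConnected D.isSimplyConnected_nhd hwD hw₂D
  have h1 := Reach.of_inside hz hw₂C (r.trans e) (trans_mem hr fun t => (hDs (he t)).1)
  have h2 := Reach.of_change h𝒜 hC hC' hw₂C hw₂C'
  have h3 := Reach.of_inside hw₂C' hz' (e.symm.trans r')
    (trans_mem (fun t => (hDs (he _)).2) hr')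
  have h4 := (h1.trans h2).trans h3
  rwa [Homotopic.Quotient.trans_refl, Homotopic.Quotient.mk_trans, Homotopic.Quotient.mk_trans,
    Homotopic.Quotient.mk_symm, quotient_cancel] at h4

theorem Reach.of_path_aux [Nontrivial ι] {𝒜 : Set (LebesgueChart μ ι)} (h𝒜 : IsLebesgueAtlas 𝒜)
    {C₀ C₁ : LebesgueChart μ ι} (hC₀ : C₀ ∈ 𝒜) (hC₁ : C₁ ∈ 𝒜) {a b : X} (p : Path a b)
    (h0 : p 0 ∈ C₀.chart.source) (h1 : p 1 ∈ C₁.chart.source) :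
    Reach C₀ C₁ (Homotopic.Quotient.mk (p.subpath 0 1)) := by
  -- Since `p t` need not lie in the domain of any chart, the property concerns all nearby points
  -- `z` of chart domains, joined to `p t` inside the neighbourhood. It is locally constant in `t`.
  let T : unitInterval → Prop := fun t => ∀ C ∈ 𝒜, ∀ z ∈ C.chart.source, ∀ r : Path (p t) z,
    (∀ u, r u ∈ C.nhd) →
      Reach C₀ C ((Homotopic.Quotient.mk (p.subpath 0 t)).trans (Homotopic.Quotient.mk r))
  have hsub : ∀ t t', Homotopic.Quotient.mk (p.subpath 0 t') =
      (Homotopic.Quotient.mk (p.subpath 0 t)).trans (Homotopic.Quotient.mk (p.subpath t t')) := by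
    intro t t'
    rw [← Homotopic.Quotient.mk_trans]
    exact (Homotopic.Quotient.eq.2 ⟨Path.Homotopy.subpathTransSubpath p 0 t t'⟩).symm
  have hstep : ∀ C ∈ 𝒜, ∀ t t' : unitInterval, (∀ u ∈ uIcc t t', p u ∈ C.nhd) → T t → T t' := by
    intro C hC t t' hu hT C' hC' z' hz' r' hr'
    have hpt : p t ∈ C.nhd := hu t left_mem_uIcc
    obtain ⟨z, -, hz⟩ := mem_closure_iff.1 (C.subset_closure hpt) univ isOpen_univ (mem_univ _)
    obtain ⟨r, hr⟩ := exists_path_of_isSimplyConnected C.isSimplyConnected_nhd hpt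
      (C.source_subset hz)
    have h1 := hT C hC z hz r hr
    have hs : ∀ u, p.subpath t t' u ∈ C.nhd := by
      intro u
      have : p.subpath t t' u ∈ range (p.subpath t t') := mem_range_self u
      rw [Path.range_subpath] at this
      obtain ⟨v, hv, hv'⟩ := this
      rw [← hv']
      exact hu v hv
    have h2 := Reach.step h𝒜 hC hC' hz hz' (r.symm.trans (p.subpath t t'))
      (trans_mem (fun u => hr _) hs) r' hr'
    have h3 := h1.trans h2
    rw [Homotopic.Quotient.mk_trans, Homotopic.Quotient.mk_symm, Homotopic.Quotient.trans_assoc _ _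
      (Homotopic.Quotient.mk r'), quotient_cancel, ← Homotopic.Quotient.trans_assoc, ← hsub] at h3
    exact h3
  have hloc : IsLocallyConstant T := by
    rw [IsLocallyConstant.iff_eventually_eq]
    intro t
    obtain ⟨C, hC, htC, -⟩ := h𝒜.exists_mem (p t) univ univ_mem
    have hn : p ⁻¹' C.nhd ∈ 𝓝 t := p.continuous.continuousAt (C.isOpen_nhd.mem_nhds htC)
    obtain ⟨ε, hε, hb⟩ := Metric.mem_nhds_iff.1 hn
    filter_upwards [Metric.ball_mem_nhds t hε] with t' ht'
    have hu : ∀ u ∈ uIcc t t', p u ∈ C.nhd := fun u hu => hb <| by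
      rw [Metric.mem_ball, Subtype.dist_eq, Real.dist_eq] at ht' ⊢
      have h1 : (u : ℝ) ∈ uIcc (t : ℝ) t' := by
        rcases le_total t t' with h | h
        · rw [uIcc_of_le h] at hu
          rw [uIcc_of_le (show (t : ℝ) ≤ t' from h)]
          exact hu
        · rw [uIcc_of_ge h] at hu
          rw [uIcc_of_ge (show (t' : ℝ) ≤ t from h)]
          exact hu
      exact (abs_sub_left_of_mem_uIcc h1).trans_lt ht'
    exact propext ⟨hstep C hC t' t fun u hu' => hu u (by rwa [uIcc_comm]), hstep C hC t t' hu⟩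
  have hT0 : T 0 := by
    intro C hC z hz r hr
    have hrefl : p.subpath 0 0 = Path.refl (p 0) := by
      ext u
      simp
    rw [hrefl]
    exact Reach.step h𝒜 hC₀ hC h0 hz (Path.refl _) (fun _ => C₀.source_subset h0) r hr
  have hT1 : T 1 := by
    have := hloc.apply_eq_of_isPreconnected isPreconnected_univ (mem_univ 0) (mem_univ 1)
    rwa [← this]
  have := hT1 C₁ hC₁ _ h1 (Path.refl _) fun _ => C₁.source_subset h1
  rwa [Homotopic.Quotient.mk_refl, Homotopic.Quotient.trans_refl] at this

theorem Reach.of_class [Nontrivial ι] {𝒜 : Set (LebesgueChart μ ι)} (h𝒜 : IsLebesgueAtlas 𝒜)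
    {C₀ C₁ : LebesgueChart μ ι} (hC₀ : C₀ ∈ 𝒜) (hC₁ : C₁ ∈ 𝒜) {a b : X}
    (ha : a ∈ C₀.chart.source) (hb : b ∈ C₁.chart.source) (q : Homotopic.Quotient a b) :
    Reach C₀ C₁ q := by
  obtain ⟨p, rfl⟩ := Homotopic.Quotient.mk_surjective q
  have key : ∀ (u v : X) (hu : u = a) (hv : v = b),
      Reach C₀ C₁ (Homotopic.Quotient.mk (p.cast hu hv)) →
      Reach C₀ C₁ (Homotopic.Quotient.mk p) := by
    rintro u v rfl rfl h
    exact h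
  refine key (p 0) (p 1) p.source p.target ?_
  have : p.cast p.source p.target = p.subpath 0 1 := by
    ext u
    simp
  rw [this]
  exact Reach.of_path_aux h𝒜 hC₀ hC₁ p (by simpa using ha) (by simpa using hb)

/-- Every element of the fundamental group is the holonomy near a point of an isotopy with small
compact support which fixes the points near that point. -/
theorem exists_isotopy_hol [Nontrivial ι] {𝒜 : Set (LebesgueChart μ ι)} (h𝒜 : IsLebesgueAtlas 𝒜)
    {C : LebesgueChart μ ι} (hC : C ∈ 𝒜) {x₀ : X} {c : PathSystem x₀} (hc : c.Inside C.nhd) {z : X}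
    (hz : z ∈ C.chart.source) (g : Pi1 X x₀) {η : ENNReal} (hη : 0 < η) :
    ∃ Ψ : Isotopy μ, ∃ K, IsCompact K ∧ μ K ≤ η ∧ Ψ.SuppIn K ∧
      ∀ᶠ y in 𝓝 z, Ψ 1 y = y ∧ Ψ.hol c y = g := by
  obtain ⟨g, rfl⟩ := Pi1.of_surjective g
  let q : Homotopic.Quotient z z := ((c z).symm.trans g).trans (c z)
  -- Starting and ending in the same chart at the same point, the translation is the identity near
  -- `z`. The conjugation by `c z` in `q` makes the holonomy at `z` equal to `g`.
  obtain ⟨Ψ, K, hK, hKη, hΨ, hq, hΨ1⟩ := Reach.of_class h𝒜 hC hC hz hz q η hη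
  refine ⟨Ψ, K, hK, hKη, hΨ, ?_⟩
  have hzn : z ∈ C.nhd := C.source_subset hz
  have hfix : ∀ᶠ y in 𝓝 z, Ψ 1 y = y := by
    filter_upwards [hΨ1, C.chart.open_source.mem_nhds hz,
      (Ψ.tendsto_one hq).eventually (C.chart.open_source.mem_nhds hz)] with y h1 h2 h3
    refine C.chart.injOn h3 h2 ?_
    rw [h1, add_sub_cancel]
  obtain ⟨D, hD, hzD, hDs⟩ := h𝒜.exists_mem z _ (inter_mem hfix (C.isOpen_nhd.mem_nhds hzn))
  filter_upwards [D.isOpen_nhd.mem_nhds hzD] with y hy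
  have hyC : y ∈ C.nhd := (hDs hy).2
  refine ⟨(hDs hy).1, ?_⟩
  obtain ⟨e, he⟩ := exists_path_of_isSimplyConnected D.isSimplyConnected_nhd hzD hy
  -- A short path from `z` to `y` consists of fixed points, so the trajectory of `y` is that of `z`
  -- conjugated by this path, and the holonomy at `y` is again `g`.
  have h1 := hq.square e e fun t => (hDs (he t)).1.symm
  obtain ⟨p, hp, hpc⟩ := hc z hzn
  obtain ⟨p', hp', hpc'⟩ := hc y hyC
  have h2 : c y = (c z).trans (Homotopic.Quotient.mk e) := by
    rw [hpc, hpc', ← Homotopic.Quotient.mk_trans]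
    exact mk_eq_of_isSimplyConnected C.isSimplyConnected_nhd _ _ hp'
      (trans_mem hp fun t => (hDs (he t)).2)
  have h3 : (c y).trans (((Homotopic.Quotient.mk e).symm.trans q).trans (Homotopic.Quotient.mk e)) =
      g.trans (c y) := by
    rw [h2, Homotopic.Quotient.trans_assoc _ q, quotient_cancel]
    simp only [q]
    rw [Homotopic.Quotient.trans_assoc (c z).symm, Homotopic.Quotient.trans_assoc (c z).symm,
      ← Homotopic.Quotient.trans_assoc (c z), Homotopic.Quotient.trans_symm,
      Homotopic.Quotient.refl_trans, Homotopic.Quotient.trans_assoc]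
  rw [h1.hol_eq c, h3, Homotopic.Quotient.trans_assoc, Homotopic.Quotient.trans_symm,
    Homotopic.Quotient.trans_refl]

end Reach

/-! ### Boxes and coverings by cubes -/

section CoordinateBox

variable {ι : Type*} [Fintype ι]

/-- The closed box with centre `c` and half side lengths `d`. -/
def cbox (c d : ι → ℝ) : Set (ι → ℝ) := {x | ∀ k, |x k - c k| ≤ d k}

theorem cbox_eq_Icc (c d : ι → ℝ) : cbox c d = Icc (c - d) (c + d) := by
  ext x
  simp only [cbox, mem_ofPred_eq, mem_Icc, Pi.le_def, ← forall_and, abs_le, Pi.sub_apply,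
    Pi.add_apply]
  refine forall_congr' fun k => ?_
  constructor <;> rintro ⟨h1, h2⟩ <;> constructor <;> linarith

theorem isCompact_cbox (c d : ι → ℝ) : IsCompact (cbox c d) := by
  rw [cbox_eq_Icc]
  exact isCompact_Icc

theorem volume_cbox (c d : ι → ℝ) : volume (cbox c d) = ∏ k, ENNReal.ofReal (2 * d k) := by
  rw [cbox_eq_Icc, Real.volume_Icc_pi]
  refine Finset.prod_congr rfl fun k _ => ?_
  congr 1
  simp only [Pi.add_apply, Pi.sub_apply]
  ring

theorem closedBall_eq_cbox (y : ι → ℝ) {R : ℝ} (hR : 0 ≤ R) :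
    Metric.closedBall y R = cbox y fun _ => R := by
  ext x
  simp [cbox, dist_pi_le_iff hR, Real.dist_eq]

theorem exists_volume_cbox_diff_le (c d : ι → ℝ) (hd : ∀ k, 0 ≤ d k) {ε : ENNReal} (hε : 0 < ε) :
    ∃ θ : ℝ, 0 ≤ θ ∧ θ < 1 ∧ volume (cbox c d \ cbox c (fun k => θ * d k)) ≤ ε := by
  have h : Tendsto (fun θ : ℝ => volume (cbox c d) - volume (cbox c fun k => θ * d k)) (𝓝 1)
      (𝓝 (volume (cbox c d) - volume (cbox c d))) := by
    have hv : volume (cbox c d) ≠ ⊤ := (isCompact_cbox c d).measure_lt_top.ne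
    refine ENNReal.Tendsto.sub tendsto_const_nhds ?_ (Or.inl hv)
    simp only [volume_cbox]
    refine ENNReal.tendsto_finsetProd_of_ne_top _ (fun k _ => ?_) (fun k _ => ENNReal.ofReal_ne_top)
    have : Continuous fun θ : ℝ => ENNReal.ofReal (2 * (θ * d k)) :=
      ENNReal.continuous_ofReal.comp (by fun_prop)
    simpa using this.tendsto 1
  rw [tsub_self] at h
  have h1 : ∀ᶠ θ : ℝ in 𝓝[<] 1, volume (cbox c d) - volume (cbox c fun k => θ * d k) ≤ ε ∧
      0 < θ ∧ θ < 1 :=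
    ((h.eventually (ge_mem_nhds hε)).filter_mono nhdsWithin_le_nhds).and
      (((lt_mem_nhds one_pos).filter_mono nhdsWithin_le_nhds).and self_mem_nhdsWithin)
  obtain ⟨θ, hθ, h0, hlt⟩ := h1.exists
  refine ⟨θ, h0.le, hlt, ?_⟩
  have hsub : cbox c (fun k => θ * d k) ⊆ cbox c d := fun x hx k =>
    (hx k).trans (mul_le_of_le_one_left (hd k) hlt.le)
  rwa [measure_sdiff hsub
    (isCompact_cbox _ _).measurableSet.nullMeasurableSet (isCompact_cbox _ _).measure_lt_top.ne]

theorem exists_volume_slab_le (y : ι → ℝ) (R : ℝ) (b : ι) {ε : ENNReal} (hε : 0 < ε) :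
    ∃ l > 0, volume {x ∈ cbox y fun _ => R | x b ≤ y b - R + l} ≤ ε := by
  classical
  let c : ℝ → ι → ℝ := fun l => Function.update y b (y b - R + l / 2)
  let d : ℝ → ι → ℝ := fun l => Function.update (fun _ => R) b (l / 2)
  have hc : Tendsto (fun l : ℝ => volume (cbox (c l) (d l))) (𝓝 0) (𝓝 0) := by
    have h : Tendsto (fun l : ℝ => ∏ k, ENNReal.ofReal (2 * d l k)) (𝓝 0)
        (𝓝 (∏ k, ENNReal.ofReal (2 * d 0 k))) := by
      refine ENNReal.tendsto_finsetProd_of_ne_top _ (fun k _ => ?_)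
        (fun k _ => ENNReal.ofReal_ne_top)
      refine Continuous.tendsto (ENNReal.continuous_ofReal.comp (continuous_const.mul ?_)) 0
      by_cases hk : k = b
      · subst hk
        simp only [d, Function.update_self]
        fun_prop
      · simp only [d, Function.update_of_ne hk]
        fun_prop
    rw [Finset.prod_eq_zero (Finset.mem_univ b) (by simp [d])] at h
    simpa only [volume_cbox] using h
  obtain ⟨l, hl, hl0⟩ := (((hc.eventually (ge_mem_nhds hε)).filter_mono
    (nhdsWithin_le_nhds (s := Ioi 0))).and self_mem_nhdsWithin).exists
  refine ⟨l, hl0, (measure_mono ?_).trans hl⟩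
  rintro x ⟨hx, hxb⟩ k
  by_cases hk : k = b
  · subst hk
    have := (abs_le.1 (hx k)).1
    simp only [c, d, Function.update_self, abs_le]
    constructor <;> linarith
  · simp only [c, d, Function.update_of_ne hk]
    exact hx k

/-- An open set of finite volume is filled, up to small volume, by finitely many disjoint cubes. -/
theorem exists_finset_cbox {U : Set (ι → ℝ)} (hU : IsOpen U) (hUv : volume U ≠ ⊤) {R : ℝ}
    (hR : 0 < R) {ε : ENNReal} (hε : 0 < ε) :
    ∃ (s : Finset (ι → ℝ)) (r : (ι → ℝ) → ℝ), (∀ x ∈ s, 0 < r x ∧ r x < R) ∧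
      (∀ x ∈ s, cbox x (fun _ => r x) ⊆ U) ∧
      (s : Set (ι → ℝ)).PairwiseDisjoint (fun x => cbox x fun _ => r x) ∧
      volume (U \ ⋃ x ∈ s, cbox x fun _ => r x) ≤ ε := by
  obtain ⟨t, r, htc, htU, htr, htv, htd⟩ := Besicovitch.exists_disjoint_closedBall_covering_ae
    volume (fun x => {ρ | Metric.closedBall x ρ ⊆ U}) U (fun x hx δ hδ => by
      obtain ⟨ρ, hρ, hρU⟩ := Metric.isOpen_iff.1 hU x hx
      have h1 := lt_min hρ hδ
      refine ⟨min ρ δ / 2, (Metric.closedBall_subset_ball ?_).trans hρU, by positivity, ?_⟩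
      · linarith [min_le_left ρ δ]
      · linarith [min_le_right ρ δ]) (fun _ => R) fun _ _ => hR
  have heq : ∀ x ∈ t, Metric.closedBall x (r x) = cbox x fun _ => r x := fun x hx =>
    closedBall_eq_cbox x (htr x hx).2.1.le
  have : Countable t := htc
  -- The covering theorem gives countably many cubes covering almost everything; continuity from
  -- above along finite subfamilies makes finitely many suffice.
  have hdir : ⨅ s : Finset t, volume (U \ ⋃ x ∈ s, cbox (x : ι → ℝ) fun _ => r x) = 0 := by
    rw [← Directed.measure_iInter]
    · rw [← htv]
      congr 1
      ext x
      simp only [mem_iInter, Set.mem_sdiff, mem_iUnion, not_exists]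
      constructor
      · intro h
        refine ⟨(h ∅).1, fun y hy hxy => ?_⟩
        rw [heq y hy] at hxy
        exact (h {⟨y, hy⟩}).2 ⟨y, hy⟩ (Finset.mem_singleton_self _) hxy
      · intro h s
        refine ⟨h.1, fun y hy hxy => h.2 y y.2 ?_⟩
        rwa [heq y y.2]
    · intro s
      exact (hU.measurableSet.diff (Finset.measurableSet_biUnion _ fun x _ =>
        (isCompact_cbox _ _).measurableSet)).nullMeasurableSet
    · intro s s'
      classical
      refine ⟨s ∪ s', sdiff_subset_sdiff_right ?_, sdiff_subset_sdiff_right ?_⟩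
      · exact biUnion_subset_biUnion_left fun x hx => Finset.mem_union_left _ hx
      · exact biUnion_subset_biUnion_left fun x hx => Finset.mem_union_right _ hx
    · exact ⟨∅, ((measure_mono sdiff_subset).trans_lt hUv.lt_top).ne⟩
  obtain ⟨s, hs⟩ := iInf_lt_iff.1 (hdir.trans_lt hε)
  refine ⟨s.map (Function.Embedding.subtype _), r, ?_, ?_, ?_, ?_⟩
  · simp only [Finset.mem_map, Function.Embedding.coe_subtype]
    rintro _ ⟨x, -, rfl⟩
    exact (htr x x.2).2
  · simp only [Finset.mem_map, Function.Embedding.coe_subtype]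
    rintro _ ⟨x, -, rfl⟩
    rw [← heq x x.2]
    exact (htr x x.2).1
  · simp only [Finset.coe_map, Function.Embedding.coe_subtype]
    rintro _ ⟨x, -, rfl⟩ _ ⟨y, -, rfl⟩ hxy
    have := htd x.2 y.2 hxy
    simp only [Function.onFun] at this ⊢
    rwa [heq x x.2, heq y y.2] at this
  · refine le_trans (le_of_eq ?_) hs.le
    congr 2
    ext x
    simp

theorem flip_mem_cbox_iff [DecidableEq ι] {i j : ι} {c u u' : ι → ℝ} {ρ : ι → ℝ}
    (h : ∀ k, u' k = flip i j c u k) (x : ι → ℝ) : flip i j c x ∈ cbox u' ρ ↔ x ∈ cbox u ρ := by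
  refine forall_congr' fun k => ?_
  rw [h k]
  unfold flip
  split_ifs
  · rw [show 2 * c k - x k - (2 * c k - u k) = -(x k - u k) by ring, abs_neg]
  · rfl

end CoordinateBox

/-! ### Isotopies with prescribed holonomy off small sets -/

section Realises

variable {X : Type*} [TopologicalSpace X] [MeasurableSpace X] [BorelSpace X]
  {μ : Measure X} {x₀ : X} {c : PathSystem x₀}

/-- Outside of arbitrarily small sets there are isotopies which fix the points of `W` and have
the holonomy `φ` at these points. -/
def RealisesOn (μ : Measure X) (c : PathSystem x₀) (W : Set X) (φ : X → Pi1 X x₀) : Prop :=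
  ∀ ε > (0 : ENNReal), ∃ F : Isotopy μ, ∃ E, μ E ≤ ε ∧
    ∀ x ∈ W, x ∉ E → F 1 x = x ∧ F.hol c x = φ x

theorem Isotopy.measure_preimage (F : Isotopy μ) (t : unitInterval) (E : Set X) :
    μ (F t ⁻¹' E) = μ E :=
  (F.mp t).measure_preimage_emb (F t).measurableEmbedding E

theorem ennreal_union_le {E E' : Set X} {ε : ENNReal} (h : μ E ≤ ε / 2) (h' : μ E' ≤ ε / 2) :
    μ (E ∪ E') ≤ ε :=
  (measure_union_le _ _).trans ((add_le_add h h').trans (ENNReal.add_halves ε).le)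

theorem RealisesOn.one (W : Set X) : RealisesOn μ c W 1 := fun _ _ =>
  ⟨1, ∅, by simp, fun x _ _ => ⟨rfl, Isotopy.hol_one c x⟩⟩

theorem RealisesOn.mul {W : Set X} {φ φ' : X → Pi1 X x₀} (h : RealisesOn μ c W φ)
    (h' : RealisesOn μ c W φ') : RealisesOn μ c W (φ * φ') := by
  intro ε hε
  obtain ⟨F, E, hE, hF⟩ := h (ε / 2) (ENNReal.half_pos hε.ne')
  obtain ⟨F', E', hE', hF'⟩ := h' (ε / 2) (ENNReal.half_pos hε.ne')
  refine ⟨F * F', E ∪ E', ennreal_union_le hE hE', fun x hxW hx => ?_⟩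
  rw [mem_union, not_or] at hx
  obtain ⟨h1, h2⟩ := hF x hxW hx.1
  obtain ⟨h3, h4⟩ := hF' x hxW hx.2
  rw [Isotopy.mul_apply, Isotopy.hol_mul, h1, h2, h3, h4]
  exact ⟨rfl, rfl⟩

/-- Realisability is closed under approximation in measure. -/
theorem RealisesOn.of_approx {W : Set X} {φ : X → Pi1 X x₀}
    (h : ∀ ε > (0 : ENNReal), ∃ φ' : X → Pi1 X x₀, RealisesOn μ c W φ' ∧
      μ {x ∈ W | φ' x ≠ φ x} ≤ ε) : RealisesOn μ c W φ := by
  intro ε hε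
  obtain ⟨φ', h', hφ⟩ := h (ε / 2) (ENNReal.half_pos hε.ne')
  obtain ⟨F, E, hE, hF⟩ := h' (ε / 2) (ENNReal.half_pos hε.ne')
  refine ⟨F, E ∪ {x ∈ W | φ' x ≠ φ x}, ennreal_union_le hE hφ, fun x hxW hx => ?_⟩
  rw [mem_union, not_or] at hx
  obtain ⟨h1, h2⟩ := hF x hxW hx.1
  refine ⟨h1, h2.trans ?_⟩
  by_contra hne
  exact hx.2 ⟨hxW, hne⟩

/-- A conjugating isotopy with trivial holonomy transports the function `φ` by its endpoint. Its
choice may depend on the permitted error, as the reflections are exact only on most of a box. -/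
theorem RealisesOn.conj {W W' : Set X} {φ φ' : X → Pi1 X x₀} (h : RealisesOn μ c W φ)
    (hs : ∀ ε > (0 : ENNReal), ∃ s : Isotopy μ, ∃ E, μ E ≤ ε ∧ (∀ x, s.hol c x = 1) ∧
      ∀ x ∈ W', x ∉ E → s 1 x ∈ W ∧ φ (s 1 x) = φ' x) : RealisesOn μ c W' φ' := by
  intro ε hε
  obtain ⟨F, E, hE, hF⟩ := h (ε / 2) (ENNReal.half_pos hε.ne')
  obtain ⟨s, E', hE', hs1, hs⟩ := hs (ε / 2) (ENNReal.half_pos hε.ne')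
  refine ⟨s * F * s⁻¹, s 1 ⁻¹' E ∪ E', ennreal_union_le (by rwa [s.measure_preimage]) hE',
    fun x hxW hx => ?_⟩
  rw [mem_union, not_or] at hx
  obtain ⟨h3, h4⟩ := hs x hxW hx.2
  obtain ⟨h1, h2⟩ := hF _ h3 hx.1
  have h5 : (s⁻¹ : Isotopy μ) 1 (s 1 x) = x := (s 1).symm_apply_apply x
  rw [Isotopy.mul_apply, Isotopy.hol_mul, Isotopy.hol_mul, Isotopy.mul_apply, h1, h2, h5,
    Isotopy.hol_inv, hs1, hs1, h4, one_mul, inv_one, mul_one]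
  exact ⟨rfl, rfl⟩

/-- The commutator with isotopies supported in the set `W` where the holonomy is known. -/
theorem RealisesOn.commutator {W : Set X} {φ φ' : X → Pi1 X x₀}
    (h : RealisesOn μ c W φ)
    (hs : ∀ ε > (0 : ENNReal), ∃ s : Isotopy μ, ∃ E, μ E ≤ ε ∧ (∀ x, s.hol c x = 1) ∧
      s.SuppIn W ∧ (∀ x ∈ W, x ∉ E → φ x * (φ (s 1 x))⁻¹ = φ' x)) (hφ : ∀ x ∉ W, φ' x = 1) :
    RealisesOn μ c univ φ' := by
  intro ε hε
  have hε2 := ENNReal.half_pos hε.ne'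
  have hε4 := ENNReal.half_pos hε2.ne'
  obtain ⟨F, E, hE, hF⟩ := h _ hε4
  obtain ⟨s, E', hE', hs1, hsW, hs⟩ := hs _ hε4
  refine ⟨F * s * F⁻¹ * s⁻¹, (E ∪ E') ∪ (s 1 ⁻¹' E ∪ F 1 ⁻¹' E),
    ennreal_union_le (ennreal_union_le hE hE')
      (ennreal_union_le (by rwa [s.measure_preimage]) (by rwa [F.measure_preimage])),
    fun x _ hx => ?_⟩
  simp only [mem_union, not_or, mem_preimage] at hx
  obtain ⟨⟨hx1, hx2⟩, hx3, hx4⟩ := hx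
  have hinv : ∀ (G : Isotopy μ) y, (G⁻¹ : Isotopy μ) 1 (G 1 y) = y := fun G y =>
    (G 1).symm_apply_apply y
  have hsymm : ∀ (G : Isotopy μ) y z, G 1 y = z → (G 1).symm z = y := fun G y z h => by
    rw [← h]
    exact (G 1).symm_apply_apply y
  have key : ∀ z y w, F 1 x = z → s 1 z = w → F 1 y = w → s 1 x = y →
      (F * s * F⁻¹ * s⁻¹) 1 x = x ∧
      (F * s * F⁻¹ * s⁻¹).hol c x = F.hol c x * (F.hol c y)⁻¹ := by
    intro z y w hz hw hy hxy
    have e1 : (F⁻¹ : Isotopy μ) 1 w = y := by rw [← hy]; exact hinv F y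
    have e2 : (s⁻¹ : Isotopy μ) 1 y = x := by rw [← hxy]; exact hinv s x
    simp only [Isotopy.mul_apply, Isotopy.hol_mul, Isotopy.hol_inv, hs1, hz, hw, e1, e2,
      hsymm F y w hy, mul_one, inv_one, true_and]
  by_cases hxW : x ∈ W
  · obtain ⟨h1, h2⟩ := hF x hxW hx1
    have hsx : s 1 x ∈ W := hsW.mem subset_rfl 1 hxW
    obtain ⟨h3, h4⟩ := hF _ hsx hx3
    obtain ⟨h5, h6⟩ := key x (s 1 x) (s 1 x) h1 rfl h3 rfl
    exact ⟨h5, by rw [h6, h2, h4, hs x hxW hx2]⟩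
  · have hFx : F 1 x ∉ W := by
      intro hFx
      have h1 := (hF _ hFx hx4).1
      exact hxW ((F 1).injective h1 ▸ hFx)
    obtain ⟨h5, h6⟩ := key (F 1 x) x (F 1 x) rfl (hsW 1 _ hFx) rfl (hsW 1 _ hxW)
    exact ⟨h5, by rw [h6, mul_inv_cancel, hφ x hxW]⟩

/-- Functions which are constant on disjoint sets can be realised simultaneously. -/
theorem RealisesOn.finset {W D : Set X} {g : Pi1 X x₀} {α : Type*} (s : Finset α)
    (A : α → Set X) (hA : (s : Set α).PairwiseDisjoint A)
    (h : ∀ i ∈ s, ∃ φ, RealisesOn μ c W φ ∧ (∀ x ∈ A i, x ∉ D → φ x = g) ∧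
      ∀ x ∉ A i, x ∉ D → φ x = 1) :
    ∃ φ, RealisesOn μ c W φ ∧ (∀ i ∈ s, ∀ x ∈ A i, x ∉ D → φ x = g) ∧
      ∀ x, (∀ i ∈ s, x ∉ A i) → x ∉ D → φ x = 1 := by
  classical
  induction s using Finset.induction_on with
  | empty => exact ⟨1, .one W, by simp, fun _ _ _ => rfl⟩
  | insert i s his ih =>
    obtain ⟨φ, h1, h2, h3⟩ := ih (hA.subset (by simp))
      fun j hj => h j (Finset.mem_insert_of_mem hj)
    obtain ⟨φ', h1', h2', h3'⟩ := h i (Finset.mem_insert_self _ _)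
    refine ⟨φ * φ', h1.mul h1', fun j hj x hx hxD => ?_, fun x hx hxD => ?_⟩
    · rw [Pi.mul_apply]
      rcases Finset.mem_insert.1 hj with rfl | hj
      · rw [h2' x hx hxD, h3 x (fun l hl hxl => ?_) hxD, one_mul]
        exact Set.disjoint_left.1 (hA (x := j) (y := l) (by simp) (by simp [hl])
          (fun h => his (h ▸ hl))) hx hxl
      · rw [h2 j hj x hx hxD, h3' x (fun hxi => ?_) hxD, mul_one]
        exact Set.disjoint_left.1 (hA (x := i) (y := j) (by simp) (by simp [hj])
          (fun h => his (h ▸ hj))) hxi hx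
    · rw [Pi.mul_apply, h3 x (fun j hj => hx j (Finset.mem_insert_of_mem hj)) hxD,
        h3' x (hx i (Finset.mem_insert_self _ _)) hxD, mul_one]

end Realises

/-! ### Filling cubes -/

section Cubes

variable {X : Type*} [TopologicalSpace X] [T2Space X] [MeasurableSpace X] [BorelSpace X]
  {μ : Measure X} {x₀ : X} {c : PathSystem x₀} {ι : Type*} [Fintype ι] [DecidableEq ι]

theorem Isotopy.SuppIn.hol_eq_one {V K : Set X} (hV : IsSimplyConnected V) (hc : c.Inside V)
    {H : Isotopy μ} (hH : H.SuppIn K) (hK : K ⊆ V) (x : X) : H.hol c x = 1 := by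
  by_cases hx : x ∈ V
  · exact Isotopy.hol_of_inside c hV hc fun t => hH.mem hK t hx
  · exact hH.hol c fun h => hx (hK h)

/-- The part of the domain of a chart with coordinates in `A`. -/
def LebesgueChart.pre (C : LebesgueChart μ ι) (A : Set (ι → ℝ)) : Set X :=
  C.chart.source ∩ C.chart ⁻¹' A

variable {C : LebesgueChart μ ι}

theorem LebesgueChart.image_subset_pre {A : Set (ι → ℝ)} (hA : A ⊆ C.chart.target) :
    C.chart.symm '' A ⊆ C.pre A := by
  rintro _ ⟨y, hy, rfl⟩
  exact ⟨C.chart.map_target (hA hy), by rwa [mem_preimage, C.chart.right_inv (hA hy)]⟩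

theorem LebesgueChart.measure_pre {A : Set (ι → ℝ)} (hA : A ⊆ C.chart.target)
    (hAm : MeasurableSet A) : μ (C.pre A) = volume A := C.measureChart A hA hAm

/-- Isotopies which reflect two coordinates on most of a box. -/
theorem LebesgueChart.exists_swap (hc : c.Inside C.nhd) {k j : ι} (hkj : k ≠ j) {a d : ι → ℝ}
    (hd : ∀ l, 0 < d l) (hT : cbox a d ⊆ C.chart.target) {ε : ENNReal} (hε : 0 < ε) :
    ∃ s : Isotopy μ, ∃ E, μ E ≤ ε ∧ (∀ x, s.hol c x = 1) ∧ s.SuppIn (C.pre (cbox a d)) ∧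
      ∀ x ∈ C.pre (cbox a d), x ∉ E →
        s 1 x ∈ C.chart.source ∧ C.chart (s 1 x) = flip k j a (C.chart x) := by
  obtain ⟨θ, h0, h1, hθ⟩ := exists_volume_cbox_diff_le a d (fun l => (hd l).le) hε
  obtain ⟨H, K, hK, hKd, hH, hH1⟩ := exists_isotopy_flip hkj a hd h0 h1
  have hKT : K ⊆ cbox a d := fun x hx l => (hKd x hx l).le
  obtain ⟨s, hs, hsC⟩ := C.exists_transport H hK (hKT.trans hT) hH
  have hsupp : s.SuppIn (C.pre (cbox a d)) := (hs K subset_rfl hH).mono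
    ((image_mono hKT).trans (image_subset_pre hT))
  refine ⟨s, C.pre (cbox a d \ cbox a fun l => θ * d l), ?_,
    hsupp.hol_eq_one C.isSimplyConnected_nhd hc (inter_subset_left.trans C.source_subset), hsupp,
    fun x hx hxE => ⟨(hsC x hx.1 1).1, ?_⟩⟩
  · rwa [measure_pre (sdiff_subset.trans hT)
      ((isCompact_cbox _ _).measurableSet.diff (isCompact_cbox _ _).measurableSet)]
  · rw [(hsC x hx.1 1).2, hH1]
    by_contra hne
    exact hxE ⟨hx.1, hx.2, hne⟩

theorem mulIndicator_const_congr {α β G : Type*} [Group G] {A : Set α} {B : Set β} {g : G} {x : α}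
    {y : β} (h : x ∈ A ↔ y ∈ B) :
    A.mulIndicator (fun _ => g) x = B.mulIndicator (fun _ => g) y := by
  classical
  simp only [mulIndicator_apply, h]

/-- The function with value `g` on a cube, `g⁻¹` on another cube and `1` elsewhere. -/
def pairFun (C : LebesgueChart μ ι) (g : Pi1 X x₀) (ρ : ℝ) (u p : ι → ℝ) (x : X) : Pi1 X x₀ :=
  (C.pre (cbox u fun _ => ρ)).mulIndicator (fun _ => g) x *
    ((C.pre (cbox p fun _ => ρ)).mulIndicator (fun _ => g) x)⁻¹

theorem pairFun_congr {g : Pi1 X x₀} {ρ : ℝ} {u u' p p' : ι → ℝ} {x x' : X}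
    (h : x ∈ C.pre (cbox u fun _ => ρ) ↔ x' ∈ C.pre (cbox u' fun _ => ρ))
    (h' : x ∈ C.pre (cbox p fun _ => ρ) ↔ x' ∈ C.pre (cbox p' fun _ => ρ)) :
    pairFun C g ρ u p x = pairFun C g ρ u' p' x' := by
  rw [pairFun, pairFun, mulIndicator_const_congr h, mulIndicator_const_congr h']

/-- From an isotopy with holonomy `g` above a cube one obtains isotopies with holonomy `g` on a
small cube inside it, up to small sets. -/
theorem realisesOn_top (hc : c.Inside C.nhd) {a b : ι} (hab : a ≠ b) (g : Pi1 X x₀) {y : ι → ℝ}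
    {R t ρ : ℝ} (hρ : 0 < ρ) (hρt : ρ < t)
    (ht : cbox (Function.update y a (y a + R)) (fun _ => 2 * t) ⊆ C.chart.target)
    {ψ : Isotopy μ}
    (hψ : ∀ x ∈ C.pre (cbox (Function.update y a (y a + R + t)) fun _ => ρ),
      ψ 1 x = x ∧ ψ.hol c x = g)
    (hψ1 : ∀ x ∈ C.pre (cbox y fun _ => R), ψ 1 x = x ∧ ψ.hol c x = 1) :
    RealisesOn μ c (C.pre (cbox y fun _ => R))
      ((C.pre (cbox (Function.update y a (y a + R - ρ)) fun _ => ρ)).mulIndicator fun _ => g) := by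
  set u := Function.update y a (y a + R - ρ) with hu
  set v := Function.update y a (y a + R + t) with hv
  have hdisj : ∀ x ∈ C.pre (cbox y fun _ => R), x ∉ C.pre (cbox v fun _ => ρ) := by
    intro x hx hx'
    have h1 := abs_le.1 (hx.2 a)
    have h2 := abs_le.1 (hx'.2 a)
    simp only [hv, Function.update_self] at h2
    linarith [h1.2, h2.1]
  have h0 : RealisesOn μ c (C.pre (cbox y fun _ => R) ∪ C.pre (cbox v fun _ => ρ))
      ((C.pre (cbox v fun _ => ρ)).mulIndicator fun _ => g) := by
    refine fun ε hε => ⟨ψ, ∅, by simp, fun x hx _ => ?_⟩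
    rcases hx with hx | hx
    · rw [mulIndicator_of_notMem (hdisj x hx)]
      exact hψ1 x hx
    · rw [mulIndicator_of_mem hx]
      exact hψ x hx
  -- The box with centre `e` and half sides `d` is the hull of the cube about `u`, just below the
  -- top face, and the cube about `v` above it; reflection about `e` exchanges the two.
  let e := Function.update y a (y a + R + (t - ρ) / 2)
  let d := Function.update (fun _ => ρ) a ((t + 3 * ρ) / 2)
  have hd : ∀ l, 0 < d l := by
    intro l
    by_cases hl : l = a
    · subst hl; simp only [d, Function.update_self]; linarith
    · simp only [d, Function.update_of_ne hl]; exact hρ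
  have hbox : cbox e d ⊆ C.chart.target := by
    refine fun x hx => ht fun l => ?_
    have h1 := hx l
    by_cases hl : l = a
    · subst hl
      simp only [e, d, Function.update_self, abs_le] at h1 ⊢
      constructor <;> linarith [h1.1, h1.2]
    · simp only [e, d, Function.update_of_ne hl] at h1 ⊢
      linarith
  have huv : ∀ k, v k = flip a b e u k := by
    intro k
    by_cases hk : k = a
    · subst hk
      simp only [flip, e, hu, hv, Function.update_self, true_or, if_true]
      ring
    · simp only [flip, e, hu, hv, Function.update_of_ne hk]
      split_ifs <;> ring
  refine h0.conj fun ε hε => ?_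
  obtain ⟨s, E, hE, hs1, hsupp, hs⟩ := C.exists_swap hc hab hd hbox hε
  refine ⟨s, E, hE, hs1, fun x hx hxE => ?_⟩
  by_cases hxe : x ∈ C.pre (cbox e d)
  · obtain ⟨h1, h2⟩ := hs x hxe hxE
    have h3 : C.chart x ∈ cbox u fun _ => ρ := by
      intro l
      have h4 := hx.2 l
      have h5 := hxe.2 l
      by_cases hl : l = a
      · subst hl
        simp only [e, d, hu, Function.update_self, abs_le] at h4 h5 ⊢
        constructor <;> linarith [h5.1, h4.2]
      · simp only [e, d, hu, Function.update_of_ne hl] at h5 ⊢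
        exact h5
    have h4 : s 1 x ∈ C.pre (cbox v fun _ => ρ) :=
      ⟨h1, by rw [mem_preimage, h2]; exact (flip_mem_cbox_iff huv _).2 h3⟩
    refine ⟨Or.inr h4, ?_⟩
    have h5 : x ∈ C.pre (cbox u fun _ => ρ) := ⟨hxe.1, h3⟩
    rw [mulIndicator_of_mem h4, mulIndicator_of_mem h5]
  · rw [hsupp 1 x hxe]
    refine ⟨Or.inl hx, ?_⟩
    rw [mulIndicator_of_notMem (hdisj x hx), mulIndicator_of_notMem]
    rintro ⟨h1, h2⟩
    refine hxe ⟨h1, fun l => ?_⟩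
    have h3 := h2 l
    by_cases hl : l = a
    · subst hl
      simp only [e, d, hu, Function.update_self, abs_le] at h3 ⊢
      constructor <;> linarith [h3.1, h3.2]
    · simp only [e, d, hu, Function.update_of_ne hl] at h3 ⊢
      exact h3

/-- The commutator with a reflection exchanging two small cubes. -/
theorem realisesOn_pairFun (hc : c.Inside C.nhd) {a b : ι} (hab : a ≠ b) {g : Pi1 X x₀}
    {y : ι → ℝ} {R ρ : ℝ} (hρ : 0 < ρ) (hT : cbox y (fun _ => R) ⊆ C.chart.target)
    {u : ι → ℝ} (hu : ∀ l, |u l - y l| ≤ R - ρ)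
    (h : RealisesOn μ c (C.pre (cbox y fun _ => R))
      ((C.pre (cbox u fun _ => ρ)).mulIndicator fun _ => g)) :
    RealisesOn μ c univ (pairFun C g ρ u (Function.update u b (y b - R + ρ))) := by
  set p := Function.update u b (y b - R + ρ) with hp
  let e := Function.update u b ((u b + (y b - R + ρ)) / 2)
  let d := Function.update (fun _ => ρ) b ((u b - (y b - R + ρ)) / 2 + ρ)
  have hub : 0 ≤ u b - (y b - R + ρ) := by linarith [(abs_le.1 (hu b)).1]
  have hd : ∀ l, 0 < d l := by
    intro l
    by_cases hl : l = b
    · subst hl; simp only [d, Function.update_self]; linarith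
    · simp only [d, Function.update_of_ne hl]; exact hρ
  have hbox : cbox e d ⊆ cbox y fun _ => R := by
    intro x hx l
    have h1 := abs_le.1 (hx l)
    have h2 := abs_le.1 (hu l)
    rw [abs_le]
    by_cases hl : l = b
    · subst hl
      simp only [e, d, Function.update_self] at h1
      constructor <;> linarith [h1.1, h1.2, h2.1, h2.2]
    · simp only [e, d, Function.update_of_ne hl] at h1
      constructor <;> linarith [h1.1, h1.2, h2.1, h2.2]
  have hue : cbox u (fun _ => ρ) ⊆ cbox e d := by
    intro x hx l
    have h1 := hx l
    by_cases hl : l = b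
    · subst hl
      simp only [e, d, Function.update_self, abs_le] at h1 ⊢
      constructor <;> linarith [h1.1, h1.2]
    · simp only [e, d, Function.update_of_ne hl]
      exact h1
  have hpe : cbox p (fun _ => ρ) ⊆ cbox e d := by
    intro x hx l
    have h1 := hx l
    by_cases hl : l = b
    · subst hl
      simp only [e, d, hp, Function.update_self, abs_le] at h1 ⊢
      constructor <;> linarith [h1.1, h1.2]
    · simp only [e, d, hp, Function.update_of_ne hl] at h1 ⊢
      exact h1
  have hpu : ∀ k, u k = flip b a e p k := by
    intro k
    by_cases hk : k = b
    · subst hk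
      simp only [flip, e, hp, Function.update_self, true_or, if_true]
      ring
    · simp only [flip, e, hp, Function.update_of_ne hk]
      split_ifs <;> ring
  have hpre : ∀ {A B : Set (ι → ℝ)}, A ⊆ B → C.pre A ⊆ C.pre B := fun hAB =>
    inter_subset_inter_right _ (preimage_mono hAB)
  refine h.commutator (fun ε hε => ?_) fun x hx => ?_
  · obtain ⟨s, E, hE, hs1, hsupp, hs⟩ := C.exists_swap hc hab.symm hd (hbox.trans hT) hε
    refine ⟨s, E, hE, hs1, hsupp.mono (hpre hbox), fun x hx hxE => ?_⟩
    rw [pairFun]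
    by_cases hxe : x ∈ C.pre (cbox e d)
    · obtain ⟨h1, h2⟩ := hs x hxe hxE
      congr 2
      refine mulIndicator_const_congr ?_
      have h3 := flip_mem_cbox_iff (ρ := fun _ => ρ) hpu (C.chart x)
      rw [← h2] at h3
      exact ⟨fun h => ⟨hx.1, h3.1 h.2⟩, fun h => ⟨h1, h3.2 h.2⟩⟩
    · rw [hsupp 1 x hxe, mulIndicator_of_notMem fun h => hxe (hpre hue h),
        mulIndicator_of_notMem fun h => hxe (hpre hpe h)]
  · have hx' : x ∉ C.pre (cbox e d) := fun h => hx (hpre hbox h)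
    rw [pairFun, mulIndicator_of_notMem fun h => hx' (hpre hue h),
      mulIndicator_of_notMem fun h => hx' (hpre hpe h), inv_one, mul_one]

/-- Moving the first cube in the direction of a coordinate axis, away from the second cube. -/
theorem RealisesOn.move [Nontrivial ι] (hc : c.Inside C.nhd) {g : Pi1 X x₀} {y : ι → ℝ}
    {R ρ : ℝ} (hρ : 0 < ρ) (hT : cbox y (fun _ => R) ⊆ C.chart.target) {b : ι} {u p : ι → ℝ}
    (hu : ∀ l, |u l - y l| ≤ R - ρ) (hub : p b + 2 * ρ < u b) (k : ι) (v : ℝ)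
    (hv : |v - y k| ≤ R - ρ) (hvb : k = b → p b + 2 * ρ < v)
    (h : RealisesOn μ c univ (pairFun C g ρ u p)) :
    RealisesOn μ c univ (pairFun C g ρ (Function.update u k v) p) := by
  obtain ⟨j, hj⟩ := exists_ne k
  set u' := Function.update u k v with hu'
  let e := Function.update u k ((u k + v) / 2)
  let d := Function.update (fun _ => ρ) k (|u k - v| / 2 + ρ)
  have hd : ∀ l, 0 < d l := by
    intro l
    by_cases hl : l = k
    · subst hl; simp only [d, Function.update_self]; positivity
    · simp only [d, Function.update_of_ne hl]; exact hρ
  have hbox : cbox e d ⊆ cbox y fun _ => R := by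
    intro x hx l
    have h1 := abs_le.1 (hx l)
    have h2 := abs_le.1 (hu l)
    rw [abs_le]
    by_cases hl : l = k
    · subst hl
      have h3 := abs_le.1 hv
      simp only [e, d, Function.update_self] at h1
      rcases abs_cases (u l - v) with ⟨h4, -⟩ | ⟨h4, -⟩ <;> rw [h4] at h1 <;>
        constructor <;> linarith [h1.1, h1.2, h2.1, h2.2, h3.1, h3.2]
    · simp only [e, d, Function.update_of_ne hl] at h1
      constructor <;> linarith [h1.1, h1.2, h2.1, h2.2]
  have hue : cbox u (fun _ => ρ) ⊆ cbox e d := by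
    intro x hx l
    have h1 := hx l
    by_cases hl : l = k
    · subst hl
      simp only [e, d, Function.update_self, abs_le] at h1 ⊢
      constructor <;> linarith [h1.1, h1.2, le_abs_self (u l - v), neg_abs_le (u l - v)]
    · simp only [e, d, Function.update_of_ne hl]
      exact h1
  have hue' : cbox u' (fun _ => ρ) ⊆ cbox e d := by
    intro x hx l
    have h1 := hx l
    by_cases hl : l = k
    · subst hl
      simp only [e, d, hu', Function.update_self, abs_le] at h1 ⊢
      constructor <;> linarith [h1.1, h1.2, le_abs_self (u l - v), neg_abs_le (u l - v)]
    · simp only [e, d, hu', Function.update_of_ne hl] at h1 ⊢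
      exact h1
  have hpe : ∀ x ∈ cbox e d, x ∉ cbox p fun _ => ρ := by
    intro x hx hxp
    have h1 := abs_le.1 (hx b)
    have h2 := abs_le.1 (hxp b)
    by_cases hb : b = k
    · subst hb
      have h3 := hvb rfl
      simp only [e, d, Function.update_self] at h1
      rcases abs_cases (u b - v) with ⟨h4, -⟩ | ⟨h4, -⟩ <;> rw [h4] at h1 <;>
        linarith [h1.1, h2.2]
    · simp only [e, d, Function.update_of_ne hb] at h1
      linarith [h1.1, h2.2]
  have huu : ∀ l, u l = flip k j e u' l := by
    intro l
    by_cases hl : l = k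
    · subst hl
      simp only [flip, e, hu', Function.update_self, true_or, if_true]
      ring
    · simp only [flip, e, hu', Function.update_of_ne hl]
      split_ifs <;> ring
  have hee : ∀ l, e l = flip k j e e l := by
    intro l
    unfold flip
    split_ifs <;> ring
  have hpre : ∀ {A B : Set (ι → ℝ)}, A ⊆ B → C.pre A ⊆ C.pre B := fun hAB =>
    inter_subset_inter_right _ (preimage_mono hAB)
  refine h.conj fun ε hε => ?_
  obtain ⟨s, E, hE, hs1, hsupp, hs⟩ := C.exists_swap hc hj.symm hd (hbox.trans hT) hε
  refine ⟨s, E, hE, hs1, fun x _ hxE => ⟨mem_univ _, ?_⟩⟩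
  by_cases hxe : x ∈ C.pre (cbox e d)
  · obtain ⟨h1, h2⟩ := hs x hxe hxE
    have h3 := flip_mem_cbox_iff (ρ := fun _ => ρ) huu (C.chart x)
    have h4 := (flip_mem_cbox_iff (ρ := d) hee (C.chart x)).2 hxe.2
    rw [← h2] at h3 h4
    refine pairFun_congr ⟨fun h => ⟨hxe.1, h3.1 h.2⟩, fun h => ⟨h1, h3.2 h.2⟩⟩
      ⟨fun h => absurd h.2 (hpe _ h4), fun h => absurd h.2 (hpe _ hxe.2)⟩
  · rw [hsupp 1 x hxe]
    exact pairFun_congr ⟨fun h => absurd (hpre hue h) hxe, fun h => absurd (hpre hue' h) hxe⟩ Iff.rfl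

/-- The coordinates are changed one at a time. Only coordinate `b` separates the moving cube from
the fixed one, and its old and new values both do so; the order is therefore irrelevant. -/
theorem RealisesOn.move_to [Nontrivial ι] (hc : c.Inside C.nhd) {g : Pi1 X x₀} {y : ι → ℝ}
    {R ρ : ℝ} (hρ : 0 < ρ) (hT : cbox y (fun _ => R) ⊆ C.chart.target) {b : ι} {u u' p : ι → ℝ}
    (hu : ∀ l, |u l - y l| ≤ R - ρ) (hub : p b + 2 * ρ < u b)
    (hu' : ∀ l, |u' l - y l| ≤ R - ρ) (hub' : p b + 2 * ρ < u' b)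
    (h : RealisesOn μ c univ (pairFun C g ρ u p)) :
    RealisesOn μ c univ (pairFun C g ρ u' p) := by
  have key : ∀ s : Finset ι,
      RealisesOn μ c univ (pairFun C g ρ (fun l => if l ∈ s then u' l else u l) p) := by
    intro s
    induction s using Finset.induction_on with
    | empty => simpa using h
    | insert k s hk ih =>
      have := ih.move (b := b) hc hρ hT (fun l => ?_) ?_ k (u' k) (hu' k) (fun hkb => hkb ▸ hub')
      · convert this using 2
        ext l
        by_cases hl : l = k
        · subst hl; simp
        · simp [hl]
      · split_ifs
        exacts [hu' l, hu l]
      · split_ifs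
        exacts [hub', hub]
  simpa using key Finset.univ

/-- Isotopies which have the holonomy `g` above a cube yield isotopies with holonomy `g` on
the cube and trivial holonomy elsewhere, up to small sets. -/
theorem realisesOn_cube [Nontrivial ι] (hc : c.Inside C.nhd) {a b : ι} (hab : a ≠ b)
    (g : Pi1 X x₀) {y : ι → ℝ} {R t r : ℝ} (hR : 0 < R) (ht0 : 0 < t) (hr : 0 < r)
    (hT : cbox y (fun _ => R) ⊆ C.chart.target)
    (ht : cbox (Function.update y a (y a + R)) (fun _ => 2 * t) ⊆ C.chart.target)
    {ψ : Isotopy μ}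
    (hψ : ∀ x ∈ C.pre (cbox (Function.update y a (y a + R + t)) fun _ => r),
      ψ 1 x = x ∧ ψ.hol c x = g)
    (hψ1 : ∀ x ∈ C.pre (cbox y fun _ => R), ψ 1 x = x ∧ ψ.hol c x = 1) :
    RealisesOn μ c univ ((C.pre (cbox y fun _ => R)).mulIndicator fun _ => g) := by
  have hpre : ∀ {A B : Set (ι → ℝ)}, A ⊆ B → C.pre A ⊆ C.pre B := fun hAB =>
    inter_subset_inter_right _ (preimage_mono hAB)
  refine .of_approx fun ε hε => ?_
  obtain ⟨l, hl, hlv⟩ := exists_volume_slab_le y R b (ENNReal.half_pos hε.ne')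
  set D : Set (ι → ℝ) := {x ∈ cbox y fun _ => R | x b ≤ y b - R + l} with hD
  let U : Set (ι → ℝ) := Metric.ball y R ∩ {x | y b - R + l < x b}
  have hUy : ∀ x ∈ U, ∀ k, |x k - y k| < R := fun x hx k => by
    have := (dist_pi_lt_iff hR).1 hx.1 k
    rwa [Real.dist_eq] at this
  have hUc : U ⊆ cbox y fun _ => R := fun x hx k => (hUy x hx k).le
  have hUo : IsOpen U := Metric.isOpen_ball.inter (isOpen_lt continuous_const (continuous_apply b))
  have hUv : volume U ≠ ⊤ :=
    ((measure_mono hUc).trans_lt (isCompact_cbox _ _).measure_lt_top).ne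
  -- The bounds on the radii: `r` keeps the small cube where `ψ` is known, `t` leaves room above the
  -- top face, `R / 3` separates the starting cube from the one at the bottom, and `l / 2` puts the
  -- bottom cube into the slab.
  obtain ⟨s, ρ, hρ, hsU, hsd, hsv⟩ := exists_finset_cbox hUo hUv
    (lt_min (lt_min hr ht0) (lt_min (div_pos hR three_pos) (half_pos hl)))
    (ENNReal.half_pos hε.ne')
  have hcube : ∀ u ∈ s, ∃ φ, RealisesOn μ c univ φ ∧
      (∀ x ∈ C.pre (cbox u fun _ => ρ u), x ∉ C.pre D → φ x = g) ∧
      ∀ x ∉ C.pre (cbox u fun _ => ρ u), x ∉ C.pre D → φ x = 1 := by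
    intro u hu
    obtain ⟨h0, h1⟩ := hρ u hu
    simp only [lt_min_iff] at h1
    obtain ⟨⟨h1, h2⟩, h3, h4⟩ := h1
    set ρ := ρ u
    have hmem : ∀ k σ, |σ| ≤ ρ → Function.update u k (u k + σ) ∈ U := by
      intro k σ hσ
      refine hsU u hu fun j => ?_
      by_cases hj : j = k
      · subst hj
        rwa [Function.update_self, add_sub_cancel_left]
      · rw [Function.update_of_ne hj, sub_self, abs_zero]
        exact h0.le
    have hu1 : ∀ k, |u k - y k| ≤ R - ρ := by
      intro k
      have e1 := abs_lt.1 (hUy _ (hmem k ρ (abs_of_pos h0).le) k)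
      have e2 := abs_lt.1 (hUy _ (hmem k (-ρ) (by rw [abs_neg, abs_of_pos h0])) k)
      rw [Function.update_self] at e1 e2
      rw [abs_le]
      constructor <;> linarith [e1.2, e2.1]
    have hu2 : y b - R + l < u b - ρ := by
      have e2 := (hmem b (-ρ) (by rw [abs_neg, abs_of_pos h0])).2
      rwa [mem_ofPred_eq, Function.update_self] at e2
    set v := Function.update y a (y a + R - ρ) with hv
    have hvb : v b = y b := Function.update_of_ne hab.symm _ _
    have hv1 : ∀ k, |v k - y k| ≤ R - ρ := by
      intro k
      by_cases hk : k = a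
      · subst hk
        rw [hv, Function.update_self, abs_le]
        constructor <;> linarith
      · rw [hv, Function.update_of_ne hk, sub_self, abs_zero]
        linarith
    -- All cubes carrying `g⁻¹` touch the same face and lie in the slab `D` discarded from the
    -- outset, so their overlaps for different `u` do no harm.
    set p := Function.update v b (y b - R + ρ) with hp
    have hpb : p b = y b - R + ρ := Function.update_self ..
    have h5 : RealisesOn μ c univ (pairFun C g ρ u p) :=
      (realisesOn_pairFun hc hab h0 hT hv1 (realisesOn_top hc hab g h0 h2 ht
        (fun x hx => hψ x ⟨hx.1, fun k => (hx.2 k).trans h1.le⟩) hψ1)).move_to (b := b)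
        hc h0 hT hv1 (by rw [hpb, hvb]; linarith) hu1 (by rw [hpb]; linarith)
    have hpD : C.pre (cbox p fun _ => ρ) ⊆ C.pre D := by
      refine hpre fun x hx => ⟨fun k => ?_, ?_⟩
      · have e1 := abs_le.1 (hx k)
        have e2 := abs_le.1 (hv1 k)
        by_cases hk : k = b
        · subst hk
          rw [hpb] at e1
          rw [abs_le]
          constructor <;> linarith [e1.1, e1.2]
        · rw [hp, Function.update_of_ne hk] at e1
          rw [abs_le]
          constructor <;> linarith [e1.1, e1.2, e2.1, e2.2]
      · have e1 := abs_le.1 (hx b)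
        rw [hpb] at e1
        linarith [e1.2]
    refine ⟨_, h5, fun x hx hxD => ?_, fun x hx hxD => ?_⟩
    · rw [pairFun, mulIndicator_of_mem hx, mulIndicator_of_notMem fun h => hxD (hpD h), inv_one,
        mul_one]
    · rw [pairFun, mulIndicator_of_notMem hx, mulIndicator_of_notMem fun h => hxD (hpD h), inv_one,
        mul_one]
  obtain ⟨φ, hφ, hφ1, hφ2⟩ := RealisesOn.finset (W := univ) (D := C.pre D) (g := g) s
    (fun u => C.pre (cbox u fun _ => ρ u)) (fun u hu v hv huv =>
      disjoint_left.2 fun x hx hx' => disjoint_left.1 (hsd hu hv huv) hx.2 hx'.2) hcube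
  refine ⟨φ, hφ, ?_⟩
  set V : Set (ι → ℝ) := U \ ⋃ x ∈ s, cbox x fun _ => ρ x with hV
  have hVm : MeasurableSet V := hUo.measurableSet.diff (Finset.measurableSet_biUnion _ fun x _ =>
    (isCompact_cbox _ _).measurableSet)
  have hDm : MeasurableSet D := (isCompact_cbox _ _).measurableSet.inter
    (measurableSet_le (measurable_pi_apply b) measurable_const)
  have hST : Metric.sphere y R ⊆ C.chart.target := by
    refine Subset.trans ?_ hT
    rw [← closedBall_eq_cbox y hR.le]
    exact Metric.sphere_subset_closedBall
  have hS : μ (C.pre (Metric.sphere y R)) = 0 := by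
    rw [C.measure_pre hST Metric.isClosed_sphere.measurableSet]
    exact Measure.addHaar_sphere_of_ne_zero _ _ hR.ne'
  refine (measure_mono (t := (C.pre V ∪ C.pre D) ∪ C.pre (Metric.sphere y R)) ?_).trans
    ((measure_union_le _ _).trans ?_)
  · rintro x ⟨-, hx⟩
    by_contra hnot
    simp only [mem_union, not_or] at hnot
    obtain ⟨⟨n1, n2⟩, n3⟩ := hnot
    refine hx ?_
    by_cases hxs : ∃ u ∈ s, x ∈ C.pre (cbox u fun _ => ρ u)
    · obtain ⟨u, hu, hxu⟩ := hxs
      rw [hφ1 u hu x hxu n2, mulIndicator_of_mem (hpre ((hsU u hu).trans hUc) hxu)]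
    · push Not at hxs
      rw [hφ2 x hxs n2, mulIndicator_of_notMem]
      intro hxy
      have hxb : C.chart x ∈ Metric.ball y R := by
        have h6 : C.chart x ∈ Metric.closedBall y R := by
          rw [closedBall_eq_cbox y hR.le]
          exact hxy.2
        exact lt_of_le_of_ne h6 fun h => n3 ⟨hxy.1, h⟩
      have hxU : C.chart x ∈ U := ⟨hxb, not_le.1 fun h => n2 ⟨hxy.1, hxy.2, h⟩⟩
      refine n1 ⟨hxy.1, hxU, fun h => ?_⟩
      obtain ⟨u, hu, hxu⟩ := mem_iUnion₂.1 h
      exact hxs u hu ⟨hxy.1, hxu⟩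
  · rw [hS, add_zero]
    refine ennreal_union_le ?_ ?_
    · rwa [C.measure_pre ((sdiff_subset.trans hUc).trans hT) hVm]
    · rwa [C.measure_pre (fun x hx => hT hx.1) hDm]

/-- An open set contains no point of maximal coordinate `a`, so its parts above rational levels
still exceeded on `T` decrease to the empty set; finite volume gives convergence to zero. -/
theorem exists_volume_above_le {T : Set (ι → ℝ)} (hT : IsOpen T) (hTne : T.Nonempty)
    (hTv : volume T ≠ ⊤) (a : ι) {ε : ENNReal} (hε : 0 < ε) :
    ∃ z ∈ T, volume {x ∈ T | z a ≤ x a} ≤ ε := by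
  have hex : ∀ x ∈ T, ∃ q : ℚ, x a < q ∧ ∃ z ∈ T, (q : ℝ) < z a := by
    intro x hx
    obtain ⟨δ, hδ, hδT⟩ := Metric.isOpen_iff.1 hT x hx
    obtain ⟨q, hq1, hq2⟩ := exists_rat_btwn (show x a < x a + δ / 2 by linarith)
    refine ⟨q, hq1, Function.update x a (x a + δ / 2), hδT ?_, by rwa [Function.update_self]⟩
    rw [Metric.mem_ball, dist_pi_lt_iff hδ]
    intro k
    by_cases hk : k = a
    · subst hk
      rw [Function.update_self, Real.dist_eq, add_sub_cancel_left, abs_of_pos (half_pos hδ)]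
      exact half_lt_self hδ
    · rwa [Function.update_of_ne hk, dist_self]
  let Q := {q : ℚ // ∃ z ∈ T, (q : ℝ) < z a}
  let S : Q → Set (ι → ℝ) := fun q => T ∩ {x | (q.1 : ℝ) < x a}
  have h0 : ⨅ q, volume (S q) = 0 := by
    rw [← Directed.measure_iInter]
    · rw [← measure_empty (μ := (volume : Measure (ι → ℝ)))]
      congr 1
      rw [eq_empty_iff_forall_notMem]
      intro x hx
      rw [mem_iInter] at hx
      obtain ⟨x', hx'⟩ := hTne
      obtain ⟨q', -, hq'⟩ := hex x' hx'
      obtain ⟨q, hq1, hq2⟩ := hex x (hx ⟨q', hq'⟩).1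
      exact lt_asymm hq1 (hx ⟨q, hq2⟩).2
    · intro q
      exact (hT.inter (isOpen_lt continuous_const (continuous_apply a))).measurableSet.nullMeasurableSet
    · intro q q'
      rcases le_total q.1 q'.1 with h | h
      · exact ⟨q', inter_subset_inter_right _ fun x hx =>
          lt_of_le_of_lt (Rat.cast_le.2 h) (id hx : _ < x a), subset_rfl⟩
      · exact ⟨q, subset_rfl, inter_subset_inter_right _ fun x hx =>
          lt_of_le_of_lt (Rat.cast_le.2 h) (id hx : _ < x a)⟩
    · obtain ⟨x', hx'⟩ := hTne
      obtain ⟨q', -, hq'⟩ := hex x' hx'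
      exact ⟨⟨q', hq'⟩, ((measure_mono inter_subset_left).trans_lt hTv.lt_top).ne⟩
  obtain ⟨q, hq⟩ := iInf_lt_iff.1 (h0.trans_lt hε)
  obtain ⟨z, hz, hqz⟩ := q.2
  exact ⟨z, hz, (measure_mono (t := S q) fun x hx => ⟨hx.1, hqz.trans_le hx.2⟩).trans hq.le⟩

/-- Every element of the fundamental group is the holonomy on the domain of a chart, up to small
sets, of isotopies which are trivial elsewhere. -/
theorem realisesOn_source [Nontrivial ι] [IsFiniteMeasure μ] {𝒜 : Set (LebesgueChart μ ι)}
    (h𝒜 : IsLebesgueAtlas 𝒜) (hC : C ∈ 𝒜) (hc : c.Inside C.nhd) (g : Pi1 X x₀) :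
    RealisesOn μ c univ (C.chart.source.mulIndicator fun _ => g) := by
  rcases C.chart.target.eq_empty_or_nonempty with hem | hne
  · have hs : C.chart.source = ∅ := by
      rw [eq_empty_iff_forall_notMem] at hem ⊢
      exact fun x hx => hem _ (C.chart.map_source hx)
    rw [hs, mulIndicator_empty]
    exact .one univ
  have hTv : volume C.chart.target ≠ ⊤ := by
    rw [← C.measure_pre subset_rfl C.chart.open_target.measurableSet]
    exact measure_ne_top _ _
  set a := C.dir with ha
  obtain ⟨b, hba⟩ := exists_ne a
  refine .of_approx fun ε hε => ?_
  have hε2 := ENNReal.half_pos hε.ne'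
  have hε4 := ENNReal.half_pos hε2.ne'
  obtain ⟨z, hz, hzv⟩ := exists_volume_above_le C.chart.open_target hne hTv a hε4
  obtain ⟨Ψ, K, hK, hKμ, hΨ, hΨz⟩ := exists_isotopy_hol h𝒜 hC hc (C.chart.map_target hz) g hε4
  -- The cubes avoid the support `K` of the isotopy with holonomy `g` near `z` and stay below the
  -- level of `z`. What is left out, `K` and the part above `z`, has small measure.
  let U : Set (ι → ℝ) := C.chart.target ∩ C.chart.symm ⁻¹' Kᶜ ∩ {y | y a < z a}
  have hUo : IsOpen U := (C.chart.continuousOn_symm.isOpen_inter_preimage C.chart.open_target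
    hK.isClosed.isOpen_compl).inter (isOpen_lt (continuous_apply a) continuous_const)
  have hUT : U ⊆ C.chart.target := fun x hx => hx.1.1
  obtain ⟨s, R, hR, hsU, hsd, hsv⟩ := exists_finset_cbox hUo
    ((measure_mono hUT).trans_lt hTv.lt_top).ne one_pos hε2
  have hcube : ∀ u ∈ s, ∃ φ, RealisesOn μ c univ φ ∧
      (∀ x ∈ C.pre (cbox u fun _ => R u), x ∉ (∅ : Set X) → φ x = g) ∧
      ∀ x ∉ C.pre (cbox u fun _ => R u), x ∉ (∅ : Set X) → φ x = 1 := by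
    intro u hu
    have hR0 := (hR u hu).1
    have huU := hsU u hu
    set R := R u
    set w := Function.update u a (u a + R) with hw
    have hwu : w ∈ U := by
      refine huU fun k => ?_
      by_cases hk : k = a
      · subst hk
        rw [hw, Function.update_self, add_sub_cancel_left, abs_of_pos hR0]
      · rw [hw, Function.update_of_ne hk, sub_self, abs_zero]
        exact hR0.le
    obtain ⟨δ, hδ, hδT⟩ := Metric.isOpen_iff.1 C.chart.open_target w (hUT hwu)
    have hwT : cbox w (fun _ => 2 * (δ / 4)) ⊆ C.chart.target := by
      rw [← closedBall_eq_cbox w (by positivity)]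
      exact (Metric.closedBall_subset_ball (by linarith)).trans hδT
    set v := Function.update u a (u a + R + δ / 4) with hv
    have hvT : v ∈ C.chart.target := by
      refine hwT fun k => ?_
      by_cases hk : k = a
      · subst hk
        rw [hw, hv, Function.update_self, Function.update_self, add_sub_cancel_left, abs_of_pos] <;>
          linarith
      · rw [hw, hv, Function.update_of_ne hk, Function.update_of_ne hk, sub_self, abs_zero]
        positivity
    have hva : u a + R < v a := by
      rw [hv, Function.update_self]
      linarith
    have hza : u a + R < z a := by
      have := hwu.2
      rwa [mem_ofPred_eq, hw, Function.update_self] at this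
    -- A push from just above the cube to `z`, through the connected part of the chart above the
    -- cube. Conjugating `Ψ` by it gives holonomy `g` near `v` and leaves the cube itself pointwise
    -- fixed at all times.
    obtain ⟨H, K₂, hK₂, hK₂c, -, hH, hH1⟩ := pushIn_of_isPreconnected
      (V := {y ∈ C.chart.target | u a + R < y a})
      (C.chart.open_target.inter (isOpen_lt continuous_const (continuous_apply a)))
      (C.isPreconnected_above _) ⟨hvT, hva⟩ ⟨hz, hza⟩ 1 one_pos
    have hK₂T : K₂ ⊆ C.chart.target := fun y hy => (hK₂ hy).1
    obtain ⟨Φ, hΦ, hΦC⟩ := C.exists_transport H hK₂c hK₂T hH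
    have hΦs := hΦ K₂ subset_rfl hH
    have hΦ1 : ∀ x, Φ.hol c x = 1 := hΦs.hol_eq_one C.isSimplyConnected_nhd hc
      ((C.image_subset_pre hK₂T).trans (inter_subset_left.trans C.source_subset))
    have hΦv : Φ 1 (C.chart.symm v) = C.chart.symm z := by
      obtain ⟨e1, e2⟩ := hΦC _ (C.chart.map_target hvT) 1
      have e3 := hH1.self_of_nhds
      rw [add_sub_cancel] at e3
      refine C.chart.injOn e1 (C.chart.map_target hz) ?_
      rw [e2, C.chart.right_inv hvT, e3, C.chart.right_inv hz]
    have hnear : ∀ᶠ y in 𝓝 v, Ψ 1 (Φ 1 (C.chart.symm y)) = Φ 1 (C.chart.symm y) ∧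
        Ψ.hol c (Φ 1 (C.chart.symm y)) = g := by
      have e1 : ContinuousAt (fun y => Φ 1 (C.chart.symm y)) v :=
        (Φ 1).continuous.continuousAt.comp (C.chart.continuousAt_symm hvT)
      rw [ContinuousAt, hΦv] at e1
      exact e1.eventually hΨz
    obtain ⟨r, hr, hrv⟩ := Metric.nhds_basis_closedBall.eventually_iff.1 hnear
    have hinv : ∀ x, (Φ⁻¹ : Isotopy μ) 1 (Φ 1 x) = x := fun x => (Φ 1).symm_apply_apply x
    refine ⟨_, realisesOn_cube (ψ := Φ * Ψ * Φ⁻¹) hc hba.symm g hR0 (by positivity) hr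
      (huU.trans hUT) hwT (fun x hx => ?_) (fun x hx => ?_), fun x hx _ => mulIndicator_of_mem hx _,
      fun x hx _ => mulIndicator_of_notMem hx _⟩
    · have hxv : C.chart x ∈ Metric.closedBall v r := by
        rw [closedBall_eq_cbox v hr.le]
        exact hx.2
      obtain ⟨e1, e2⟩ := hrv hxv
      rw [C.chart.left_inv hx.1] at e1 e2
      rw [Isotopy.mul_apply, Isotopy.mul_apply, Isotopy.hol_mul, Isotopy.hol_mul,
        Isotopy.mul_apply, e1, e2, hinv, Isotopy.hol_inv, hΦ1, hΦ1, one_mul, inv_one, mul_one]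
      exact ⟨rfl, rfl⟩
    · have e1 : x ∉ C.chart.symm '' K₂ := by
        rintro ⟨y, hy, rfl⟩
        have e2 := hx.2 a
        rw [C.chart.right_inv (hK₂T hy)] at e2
        linarith [(abs_le.1 e2).2, (hK₂ hy).2]
      have e2 : x ∉ K := by
        have e3 := (huU hx.2).1.2
        rwa [mem_preimage, C.chart.left_inv hx.1] at e3
      have e3 : ∀ t, (Φ * Ψ * Φ⁻¹) t x = x := by
        intro t
        rw [Isotopy.mul_apply, Isotopy.mul_apply, hΦs t x e1, hΨ t x e2]
        exact hΦs.inv t x e1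
      exact ⟨e3 1, Isotopy.hol_of_forall c e3⟩
  obtain ⟨φ, hφ, hφ1, hφ2⟩ := RealisesOn.finset (W := univ) (D := ∅) (g := g) s
    (fun u => C.pre (cbox u fun _ => R u)) (fun u hu v hv huv =>
      disjoint_left.2 fun x hx hx' => disjoint_left.1 (hsd hu hv huv) hx.2 hx'.2) hcube
  refine ⟨φ, hφ, ?_⟩
  refine (measure_mono (t := C.pre (U \ ⋃ x ∈ s, cbox x fun _ => R x) ∪
    (C.pre {x ∈ C.chart.target | z a ≤ x a} ∪ K)) ?_).trans
    (ennreal_union_le ?_ (ennreal_union_le ?_ hKμ))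
  · rintro x ⟨-, hx⟩
    by_contra hnot
    simp only [mem_union, not_or] at hnot
    obtain ⟨n1, n2, n3⟩ := hnot
    refine hx ?_
    by_cases hxs : ∃ u ∈ s, x ∈ C.pre (cbox u fun _ => R u)
    · obtain ⟨u, hu, hxu⟩ := hxs
      rw [hφ1 u hu x hxu (notMem_empty x), mulIndicator_of_mem hxu.1]
    · push Not at hxs
      rw [hφ2 x hxs (notMem_empty x), mulIndicator_of_notMem]
      intro hxC
      have hxT := C.chart.map_source hxC
      refine n1 ⟨hxC, ⟨⟨hxT, ?_⟩, not_le.1 fun h => n2 ⟨hxC, hxT, h⟩⟩, fun h => ?_⟩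
      · rwa [mem_preimage, C.chart.left_inv hxC]
      · obtain ⟨u, hu, hxu⟩ := mem_iUnion₂.1 h
        exact hxs u hu ⟨hxC, hxu⟩
  · rwa [C.measure_pre (sdiff_subset.trans hUT) (hUo.measurableSet.diff
      (Finset.measurableSet_biUnion _ fun x _ => (isCompact_cbox _ _).measurableSet))]
  · rwa [C.measure_pre (A := {x ∈ C.chart.target | z a ≤ x a}) (fun x hx => hx.1)
      (C.chart.open_target.measurableSet.inter
        (measurableSet_le measurable_const (measurable_pi_apply a)))]

end Cubes

/-! ### Homotopies of bounded cochains -/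

section Prism

variable {G : Type*} [Group G]

/-- Omit the `i`-th entry of a sequence. -/
def omitAt (i : ℕ) (w : ℕ → G) : ℕ → G := fun m => if m < i then w m else w (m + 1)

/-- Repeat the `k`-th entry of a sequence and multiply all later entries by `h`. -/
def splitAt (h : G) (k : ℕ) (w : ℕ → G) : ℕ → G := fun m => if m ≤ k then w m else w (m - 1) * h

/-- Multiply all entries of a sequence from the `k`-th one on by `h`. -/
def mulFrom (h : G) (k : ℕ) (w : ℕ → G) : ℕ → G := fun m => if m < k then w m else w m * h

theorem omitAt_splitAt_of_lt (h : G) {i k : ℕ} (hik : i < k + 1) (w : ℕ → G) :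
    omitAt i (splitAt h (k + 1) w) = splitAt h k (omitAt i w) := by
  ext m
  simp only [omitAt, splitAt]
  split_ifs <;> first | omega | rfl | skip
  rw [show m + 1 - 1 = m - 1 + 1 by omega]

theorem omitAt_splitAt_of_gt (h : G) {i k : ℕ} (hik : k < i) (w : ℕ → G) :
    omitAt (i + 1) (splitAt h k w) = splitAt h k (omitAt i w) := by
  ext m
  simp only [omitAt, splitAt]
  split_ifs <;> first | omega | rfl | skip
  rw [show m + 1 - 1 = m - 1 + 1 by omega]

theorem omitAt_splitAt_self (h : G) (k : ℕ) (w : ℕ → G) :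
    omitAt k (splitAt h k w) = mulFrom h k w := by
  ext m
  simp only [omitAt, splitAt, mulFrom]
  split_ifs <;> first | omega | rfl

theorem omitAt_splitAt_succ (h : G) (k : ℕ) (w : ℕ → G) :
    omitAt (k + 1) (splitAt h k w) = mulFrom h (k + 1) w := by
  ext m
  simp only [omitAt, splitAt, mulFrom]
  split_ifs <;> first | omega | rfl

/-- The combinatorial identity behind the prism operator. -/
theorem prism_identity (A : (ℕ → G) → ℝ) {n : ℕ}
    (hA : ∀ w, ∑ i ∈ Finset.range (n + 2), (-1 : ℝ) ^ i * A (omitAt i w) = 0) (h : G) (w : ℕ → G) :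
    ∑ l ∈ Finset.range (n + 1), (-1 : ℝ) ^ l *
        ∑ j ∈ Finset.range n, (-1 : ℝ) ^ j * A (splitAt h j (omitAt l w)) =
      A (mulFrom h 0 w) - A (mulFrom h (n + 1) w) := by
  let t : ℕ → ℕ → ℝ := fun k i => (-1) ^ (k + i) * A (omitAt i (splitAt h k w))
  let s : ℕ → ℕ → ℝ := fun j l => (-1) ^ (l + j) * A (splitAt h j (omitAt l w))
  have ht : ∀ k, ∑ i ∈ Finset.range (n + 2), t k i = 0 := by
    intro k
    have := congrArg (fun z => (-1 : ℝ) ^ k * z) (hA (splitAt h k w))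
    simp only [Finset.mul_sum, mul_zero] at this
    rw [← this]
    refine Finset.sum_congr rfl fun i _ => ?_
    simp only [t, pow_add, mul_assoc]
  have ht' : ∀ k ∈ Finset.range (n + 1), ∑ i ∈ Finset.range k, t k i +
      (A (mulFrom h k w) - A (mulFrom h (k + 1) w)) +
      ∑ l ∈ Finset.Ico (k + 1) (n + 1), t k (l + 1) = 0 := by
    intro k hk
    have hk' := Finset.mem_range.1 hk
    rw [← ht k, ← Finset.sum_range_add_sum_Ico (t k) (show k + 2 ≤ n + 2 by omega),
      Finset.sum_range_succ, Finset.sum_range_succ, Finset.sum_Ico_add' (t k) (k + 1) (n + 1) 1]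
    have e1 : t k k = A (mulFrom h k w) := by
      simp only [t, omitAt_splitAt_self, ← two_mul, pow_mul]
      norm_num
    have e2 : t k (k + 1) = -A (mulFrom h (k + 1) w) := by
      simp only [t, omitAt_splitAt_succ]
      rw [show k + (k + 1) = 2 * k + 1 by ring, pow_succ, pow_mul]
      norm_num
    rw [e1, e2]
    ring
  have h1 := Finset.sum_eq_zero ht'
  rw [Finset.sum_add_distrib, Finset.sum_add_distrib,
    Finset.sum_range_sub' (fun k => A (mulFrom h k w))] at h1
  have h2 : ∑ k ∈ Finset.range (n + 1), ∑ i ∈ Finset.range k, t k i =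
      -∑ j ∈ Finset.range n, ∑ l ∈ Finset.range (j + 1), s j l := by
    rw [Finset.sum_range_succ', Finset.range_zero, Finset.sum_empty, add_zero,
      ← Finset.sum_neg_distrib]
    refine Finset.sum_congr rfl fun j _ => ?_
    rw [← Finset.sum_neg_distrib]
    refine Finset.sum_congr rfl fun l hl => ?_
    simp only [t, s]
    rw [omitAt_splitAt_of_lt h (Finset.mem_range.1 hl)]
    ring
  have h3 : ∑ k ∈ Finset.range (n + 1), ∑ l ∈ Finset.Ico (k + 1) (n + 1), t k (l + 1) =
      -∑ j ∈ Finset.range n, ∑ l ∈ Finset.Ico (j + 1) (n + 1), s j l := by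
    rw [Finset.sum_range_succ, Finset.Ico_self, Finset.sum_empty, add_zero,
      ← Finset.sum_neg_distrib]
    refine Finset.sum_congr rfl fun j _ => ?_
    rw [← Finset.sum_neg_distrib]
    refine Finset.sum_congr rfl fun l hl => ?_
    simp only [t, s]
    rw [omitAt_splitAt_of_gt h (Finset.mem_Ico.1 hl).1]
    ring
  have h4 : ∑ l ∈ Finset.range (n + 1), (-1 : ℝ) ^ l *
        ∑ j ∈ Finset.range n, (-1 : ℝ) ^ j * A (splitAt h j (omitAt l w)) =
      ∑ j ∈ Finset.range n, ∑ l ∈ Finset.range (j + 1), s j l +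
        ∑ j ∈ Finset.range n, ∑ l ∈ Finset.Ico (j + 1) (n + 1), s j l := by
    rw [← Finset.sum_add_distrib]
    simp only [Finset.mul_sum]
    rw [Finset.sum_comm]
    refine Finset.sum_congr rfl fun j hj => ?_
    rw [Finset.sum_range_add_sum_Ico _ (by have := Finset.mem_range.1 hj; omega)]
    refine Finset.sum_congr rfl fun l _ => ?_
    simp only [s]
    ring
  rw [h4]
  linarith

/-! ### Cochains on infinite sequences and the prism operator -/

/-- A finite sequence, continued by `1`. -/
def extendSeq {n : ℕ} (g : Fin n → G) (m : ℕ) : G := if h : m < n then g ⟨m, h⟩ else 1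

theorem extendSeq_apply {n : ℕ} (g : Fin n → G) (j : Fin n) : extendSeq g j = g j := by
  simp [extendSeq]

theorem omitAt_extendSeq {n : ℕ} (g : Fin (n + 1) → G) (i : Fin (n + 1)) (j : Fin n) :
    omitAt i (extendSeq g) j = g (i.succAbove j) := by
  rw [← extendSeq_apply g (i.succAbove j)]
  unfold omitAt
  split_ifs with h
  · rw [Fin.succAbove_of_castSucc_lt i j (by simpa [Fin.lt_def] using h)]
    rfl
  · rw [Fin.succAbove_of_le_castSucc i j (by simpa [Fin.le_def] using h)]
    rfl

/-- Extend `c` to infinite sequences. -/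
def evalSeq {n : ℕ} (c : Cochain G n) (w : ℕ → G) : ℝ := c fun j => w j

theorem coboundary_apply {n : ℕ} (c : Cochain G n) (g : Fin (n + 2) → G) :
    coboundary G n c g = ∑ i : Fin (n + 2), (-1 : ℝ) ^ (i : ℕ) * c (fun j => g (i.succAbove j)) :=
  rfl

theorem coboundary_eq_sum_range {n : ℕ} (c : Cochain G n) (w : ℕ → G) :
    coboundary G n c (fun j => w j) =
      ∑ i ∈ Finset.range (n + 2), (-1 : ℝ) ^ i * evalSeq c (omitAt i w) := by
  rw [← Fin.sum_univ_eq_sum_range (fun i => (-1 : ℝ) ^ i * evalSeq c (omitAt i w)),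
    coboundary_apply]
  refine Finset.sum_congr rfl fun i _ => ?_
  congr 2
  ext j
  unfold omitAt
  split_ifs with h
  · rw [Fin.succAbove_of_castSucc_lt i j (by simpa [Fin.lt_def] using h)]
    rfl
  · rw [Fin.succAbove_of_le_castSucc i j (by simpa [Fin.le_def] using h)]
    rfl

theorem omitAt_omitAt {i j : ℕ} (hij : i ≤ j) (w : ℕ → G) :
    omitAt j (omitAt i w) = omitAt i (omitAt (j + 1) w) := by
  ext m
  simp only [omitAt]
  split_ifs <;> first | omega | rfl

theorem coboundary_coboundary {n : ℕ} (c : Cochain G n) :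
    coboundary G (n + 1) (coboundary G n c) = 0 := by
  refine Cochain.ext (funext fun g => ?_)
  let s : ℕ → ℕ → ℝ := fun i j => (-1) ^ (i + j) * evalSeq c (omitAt j (omitAt i (extendSeq g)))
  have hg : g = fun j : Fin (n + 3) => extendSeq g j := funext fun j => (extendSeq_apply g j).symm
  have h1 : coboundary G (n + 1) (coboundary G n c) g =
      ∑ i ∈ Finset.range (n + 3), ∑ j ∈ Finset.range (n + 2), s i j := by
    conv_lhs => rw [hg]
    rw [coboundary_eq_sum_range]
    refine Finset.sum_congr rfl fun i _ => ?_
    rw [evalSeq, coboundary_eq_sum_range, Finset.mul_sum]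
    refine Finset.sum_congr rfl fun j _ => ?_
    simp only [s, pow_add, mul_assoc]
  have h2 : ∑ i ∈ Finset.range (n + 3), ∑ j ∈ Finset.range (n + 2), s i j =
      ∑ i ∈ Finset.range (n + 3), ∑ j ∈ Finset.range i, s i j +
        ∑ i ∈ Finset.range (n + 3), ∑ j ∈ Finset.Ico i (n + 2), s i j := by
    rw [← Finset.sum_add_distrib]
    refine Finset.sum_congr rfl fun i hi => (Finset.sum_range_add_sum_Ico _ ?_).symm
    have := Finset.mem_range.1 hi
    omega
  have h3 : ∑ i ∈ Finset.range (n + 3), ∑ j ∈ Finset.range i, s i j =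
      ∑ j ∈ Finset.range (n + 2), ∑ i ∈ Finset.range (j + 1), s (j + 1) i := by
    rw [Finset.sum_range_succ', Finset.range_zero, Finset.sum_empty, add_zero]
  have h4 : ∑ i ∈ Finset.range (n + 3), ∑ j ∈ Finset.Ico i (n + 2), s i j =
      ∑ j ∈ Finset.range (n + 2), ∑ i ∈ Finset.range (j + 1), s i j := by
    rw [Finset.sum_range_succ, Finset.Ico_self, Finset.sum_empty, add_zero]
    simp only [Finset.range_eq_Ico]
    exact Finset.sum_Ico_Ico_comm 0 (n + 2) s
  change coboundary G (n + 1) (coboundary G n c) g = 0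
  rw [h1, h2, h3, h4, ← Finset.sum_add_distrib]
  refine Finset.sum_eq_zero fun j _ => ?_
  rw [← Finset.sum_add_distrib]
  refine Finset.sum_eq_zero fun i hi => ?_
  simp only [s]
  rw [omitAt_omitAt (Nat.lt_succ_iff.1 (Finset.mem_range.1 hi))]
  ring

theorem _root_.BoundedCohomology.Cochain.abs_le_supNorm {n : ℕ} (c : Cochain G n) (g : Fin (n + 1) → G) :
    |c g| ≤ c.supNorm := by
  obtain ⟨K, hK⟩ := c.bounded
  exact le_ciSup (f := fun g => |c g|) ⟨K, by rintro _ ⟨g, rfl⟩; exact hK g⟩ g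

/-- The prism operator between right multiplication by `h` and the identity. -/
def prism (h : G) {n : ℕ} (c : Cochain G (n + 1)) : Cochain G n where
  toFun g := ∑ j ∈ Finset.range (n + 1), (-1 : ℝ) ^ j * evalSeq c (splitAt h j (extendSeq g))
  bounded := by
    refine ⟨∑ j ∈ Finset.range (n + 1), c.supNorm, fun g => (Finset.abs_sum_le_sum_abs _ _).trans
      (Finset.sum_le_sum fun j _ => ?_)⟩
    rw [abs_mul, abs_pow, abs_neg, abs_one, one_pow, one_mul]
    exact c.abs_le_supNorm _
  invariant k g := by
    refine Finset.sum_congr rfl fun j hj => ?_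
    congr 1
    refine Eq.trans ?_ (c.invariant k _)
    unfold evalSeq
    congr 1
    ext m
    have hj' := Finset.mem_range.1 hj
    have hm := m.2
    simp only [splitAt, extendSeq]
    split_ifs <;> first | omega | rfl | rw [mul_assoc]

theorem abs_prism_le (h : G) {n : ℕ} (c : Cochain G (n + 1)) (g : Fin (n + 1) → G) :
    |prism h c g| ≤ (n + 1) * c.supNorm := by
  have h1 : ∑ j ∈ Finset.range (n + 1), c.supNorm = (n + 1) * c.supNorm := by simp
  rw [← h1]
  change |∑ j ∈ Finset.range (n + 1), (-1 : ℝ) ^ j * evalSeq c (splitAt h j (extendSeq g))| ≤ _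
  refine (Finset.abs_sum_le_sum_abs _ _).trans (Finset.sum_le_sum fun j _ => ?_)
  rw [abs_mul, abs_pow, abs_neg, abs_one, one_pow, one_mul]
  exact c.abs_le_supNorm _

/-- The prism identity is applied to the sequence continued by `1`. The continuation is immaterial:
each term evaluates the cochain only on entries within the original range. -/
theorem coboundary_prism (h : G) {n : ℕ} {c : Cochain G (n + 1)} (hc : coboundary G (n + 1) c = 0)
    (g : Fin (n + 2) → G) : coboundary G n (prism h c) g = c (fun j => g j * h) - c g := by
  have h1 := prism_identity (evalSeq c) (n := n + 1)
    (fun w => by rw [← coboundary_eq_sum_range, hc]; rfl) h (extendSeq g)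
  have h2 : evalSeq c (mulFrom h 0 (extendSeq g)) = c fun j => g j * h := by
    unfold evalSeq
    congr 1
    ext j
    simp [mulFrom, extendSeq_apply]
  have h3 : evalSeq c (mulFrom h (n + 2) (extendSeq g)) = c g := by
    unfold evalSeq
    congr 1
    ext j
    simp [mulFrom, extendSeq_apply]
  rw [h2, h3] at h1
  rw [← h1, ← Fin.sum_univ_eq_sum_range (fun l => (-1 : ℝ) ^ l *
    ∑ j ∈ Finset.range (n + 1), (-1 : ℝ) ^ j * evalSeq c (splitAt h j (omitAt l (extendSeq g)))),
    coboundary_apply]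
  refine Finset.sum_congr rfl fun i _ => ?_
  congr 1
  change ∑ j ∈ Finset.range (n + 1), (-1 : ℝ) ^ j *
    evalSeq c (splitAt h j (extendSeq fun j => g (i.succAbove j))) = _
  refine Finset.sum_congr rfl fun j hj => ?_
  congr 1
  unfold evalSeq
  congr 1
  ext m
  have hj' := Finset.mem_range.1 hj
  have hm := m.2
  have e : ∀ l (hl : l < n + 1), extendSeq (fun j => g (i.succAbove j)) l =
      omitAt i (extendSeq g) l := by
    intro l hl
    exact (extendSeq_apply (fun j => g (i.succAbove j)) ⟨l, hl⟩).trans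
      (omitAt_extendSeq g i ⟨l, hl⟩).symm
  simp only [splitAt]
  split_ifs with hmj
  · exact e m (by omega)
  · rw [e (m - 1) (by omega)]

/-- Constant cochains. -/
def constCochain (G : Type*) [Group G] (n : ℕ) (K : ℝ) : Cochain G n :=
  ⟨fun _ => K, ⟨|K|, fun _ => le_rfl⟩, fun _ _ => rfl⟩

theorem coboundary_constCochain (n : ℕ) (K : ℝ) (g : Fin (n + 2) → G) :
    coboundary G n (constCochain G n K) g = if Even n then 0 else K := by
  change ∑ i : Fin (n + 2), (-1 : ℝ) ^ (i : ℕ) * K = _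
  rw [← Finset.sum_mul, Fin.sum_univ_eq_sum_range (fun i => (-1 : ℝ) ^ i), neg_one_geom_sum]
  by_cases h : Even n
  · rw [if_pos (by simpa [Nat.even_add] using h), if_pos h, zero_mul]
  · rw [if_neg (by simpa [Nat.even_add] using h), if_neg h, one_mul]

/-- The constant cochain whose value is that of a cocycle on a constant tuple is a coboundary. -/
theorem exists_coboundary_eq_const {n : ℕ} {c : Cochain G (n + 1)}
    (hc : coboundary G (n + 1) c = 0) {G' : Type*} [Group G'] (r : ℝ) :
    ∃ b : Cochain G' n, coboundary G' n b = constCochain G' (n + 1) (r * c 1) := by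
  -- For even `n` the cocycle condition on a constant tuple is an alternating sum of an odd number
  -- of equal terms, so the value `c 1` vanishes. For odd `n` the constant is the coboundary of the
  -- same constant one degree lower.
  by_cases h : Even n
  · refine ⟨0, ?_⟩
    have h1 : coboundary G (n + 1) c (fun _ => 1) = 0 := by rw [hc]; rfl
    have h2 : coboundary G (n + 1) c (fun _ => 1) =
        coboundary G (n + 1) (constCochain G (n + 1) (c 1)) (fun _ => 1) := rfl
    rw [h2, coboundary_constCochain, if_neg (by simpa [Nat.even_add_one] using h)] at h1
    rw [h1, mul_zero, map_zero]
    rfl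
  · refine ⟨constCochain G' n (r * c 1), Cochain.ext (funext fun g => ?_)⟩
    rw [coboundary_constCochain, if_neg h]
    rfl

end Prism

/-! ### The estimate in bounded cohomology -/

section Estimate

variable {X : Type*} [TopologicalSpace X] [MeasurableSpace X] [BorelSpace X]
  {μ : Measure X} {x₀ : X}

/-- The endpoint of an isotopy, as a homomorphism. -/
def Isotopy.toHomeo0Hom (μ : Measure X) : Isotopy μ →* Homeo0 μ where
  toFun := Isotopy.toHomeo0
  map_one' := rfl
  map_mul' _ _ := rfl

/-- Trivial centre enters here: the isotopy chosen in the definition of `cocycleGamma` may be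
replaced by the one that was constructed. -/
theorem cocycleGamma_toHomeo0 (hZ : Subgroup.center (Pi1 X x₀) = ⊥) (S : PathSystem x₀)
    (H : Isotopy μ) (x : X) : cocycleGamma S H.toHomeo0 x = H.hol S x := by
  have h := IsIsotopy.trajectory_unique hZ S (f := H 1) H.toHomeo0.isIsotopy H.isIsotopy x
  exact congrArg (fun q => Pi1.of (((S x).trans q).trans (S (H 1 x)).symm)) h

/-- The difference of two systems of paths. -/
def pathDiff (S c : PathSystem x₀) (x : X) : Pi1 X x₀ := Pi1.of ((S x).trans (c x).symm)

theorem Isotopy.hol_eq_conj (S c : PathSystem x₀) {H : Isotopy μ} {x : X} (hx : H 1 x = x) :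
    H.hol S x = pathDiff S c x * H.hol c x * (pathDiff S c x)⁻¹ := by
  obtain ⟨q, hq⟩ := H.exists_moves hx
  rw [hq.hol_eq S, hq.hol_eq c, pathDiff, ← Pi1.of_symm, ← Pi1.of_trans, ← Pi1.of_trans]
  congr 1
  have h : ((S x).trans (c x).symm).symm = (c x).trans (S x).symm := by
    obtain ⟨p, hp⟩ := Homotopic.Quotient.mk_surjective (S x)
    obtain ⟨p', hp'⟩ := Homotopic.Quotient.mk_surjective (c x)
    rw [← hp, ← hp', ← Homotopic.Quotient.mk_symm, ← Homotopic.Quotient.mk_symm,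
      ← Homotopic.Quotient.mk_trans, ← Homotopic.Quotient.mk_trans, ← Homotopic.Quotient.mk_symm,
      Path.trans_symm, Path.symm_symm]
  rw [h]
  simp only [Homotopic.Quotient.trans_assoc]
  rw [← Homotopic.Quotient.trans_assoc (c x).symm, Homotopic.Quotient.symm_trans,
    Homotopic.Quotient.refl_trans, ← Homotopic.Quotient.trans_assoc (c x).symm,
    Homotopic.Quotient.symm_trans, Homotopic.Quotient.refl_trans]

/-- Over `V` the difference equals the class `q` exactly where `S` takes values in the sheet of the
universal cover through `q`, because `c` runs inside `V`. -/
theorem nullMeasurableSet_pathDiff {S c : PathSystem x₀} (hS : S.IsMeasurable μ) {V : Set X}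
    (hVo : IsOpen V) (hV : IsSimplyConnected V) (hx₀ : x₀ ∈ V) (hc : c.Inside V) (g : Pi1 X x₀) :
    NullMeasurableSet (V ∩ {x | pathDiff S c x = g}) μ := by
  obtain ⟨q, rfl⟩ := Pi1.of_surjective g
  have h := hS V hVo x₀ hx₀ q
  rw [image_range_inter_sheet] at h
  refine (congrArg (fun A => NullMeasurableSet A μ) ?_).mpr h
  ext x
  constructor
  · rintro ⟨hx, hq⟩
    obtain ⟨p, hp, hpc⟩ := hc x hx
    refine ⟨p, hp, ?_⟩
    rw [← Pi1.of_injective hq, ← hpc, Homotopic.Quotient.trans_assoc, Homotopic.Quotient.symm_trans,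
      Homotopic.Quotient.trans_refl]
  · rintro ⟨p, hp, hpS⟩
    have hx : x ∈ V := by simpa using hp 1
    obtain ⟨p', hp', hpc⟩ := hc x hx
    refine ⟨hx, ?_⟩
    change Pi1.of _ = _
    rw [hpS, hpc, mk_eq_of_isSimplyConnected hV p p' hp hp', Homotopic.Quotient.trans_assoc,
      Homotopic.Quotient.trans_symm, Homotopic.Quotient.trans_refl]

theorem integrableOn_pathDiff [IsFiniteMeasure μ] [Countable (Pi1 X x₀)] {S c : PathSystem x₀}
    (hS : S.IsMeasurable μ) {V : Set X}
    (hVo : IsOpen V) (hV : IsSimplyConnected V) (hx₀ : x₀ ∈ V) (hc : c.Inside V)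
    {A : Set X} (hA : A ⊆ V) {f : Pi1 X x₀ → ℝ} {K : ℝ} (hf : ∀ g, |f g| ≤ K) :
    IntegrableOn (fun x => f (pathDiff S c x)) A μ := by
  refine IntegrableOn.mono_set ?_ hA
  refine Integrable.of_bound (C := K) ?_ (Eventually.of_forall fun x =>
    (Real.norm_eq_abs _).trans_le (hf _))
  have hU : (⋃ g : Pi1 X x₀, V ∩ {x | pathDiff S c x = g}) = V := by
    ext x
    simp
  suffices h : AEStronglyMeasurable (fun x => f (pathDiff S c x))
      (μ.restrict (⋃ g : Pi1 X x₀, V ∩ {x | pathDiff S c x = g})) by rwa [hU] at h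
  rw [aestronglyMeasurable_iUnion_iff]
  intro g
  refine AEStronglyMeasurable.congr (f := fun _ => f g) aestronglyMeasurable_const ?_
  filter_upwards [ae_restrict_mem₀ (nullMeasurableSet_pathDiff hS hVo hV hx₀ hc g)] with x hx
  rw [show _ = g from hx.2]

/-- Off a small set the holonomies of a suitable homomorphism from a free group into the group of
isotopies are those of `i` on `B`, and trivial elsewhere. -/
theorem exists_hom_hol {F : Type*} [Group F] [IsFreeGroup F] [Countable F]
    {c : PathSystem x₀} {B : Set X} (hB : ∀ g, RealisesOn μ c univ (B.mulIndicator fun _ => g))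
    (i : F →* Pi1 X x₀) {ε : ENNReal} (hε : 0 < ε) :
    ∃ Θ : F →* Isotopy μ, ∃ E, MeasurableSet E ∧ μ E ≤ ε ∧
      ∀ x ∉ E, ∀ w, Θ w 1 x = x ∧ (Θ w).hol c x = B.mulIndicator (fun _ => i w) x := by
  have : Countable (IsFreeGroup.Generators F) := by
    refine Function.Injective.countable (f := fun k =>
      (IsFreeGroup.toFreeGroup F).symm (FreeGroup.of k)) ?_
    exact (IsFreeGroup.toFreeGroup F).symm.injective.comp FreeGroup.of_injective
  obtain ⟨δ, hδ, hδε⟩ := ENNReal.exists_pos_sum_of_countable' hε.ne' (IsFreeGroup.Generators F)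
  choose Φ E hE hΦ using fun k : IsFreeGroup.Generators F =>
    hB (i ((IsFreeGroup.toFreeGroup F).symm (FreeGroup.of k))) (δ k) (hδ k)
  let Θ : FreeGroup (IsFreeGroup.Generators F) →* Isotopy μ := FreeGroup.lift Φ
  -- One exceptional set for the whole group: a point outside the error sets of the generators is
  -- fixed by all of them and their inverses, so it never enters an error set under any word.
  refine ⟨Θ.comp (IsFreeGroup.toFreeGroup F).toMonoidHom, toMeasurable μ (⋃ k, E k),
    measurableSet_toMeasurable _ _, ?_, fun x hx w => ?_⟩
  · rw [measure_toMeasurable]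
    exact (measure_iUnion_le _).trans ((ENNReal.tsum_le_tsum hE).trans hδε.le)
  · have hxE : ∀ k, x ∉ E k := fun k h =>
      hx (subset_toMeasurable _ _ (mem_iUnion.2 ⟨k, h⟩))
    let j : FreeGroup (IsFreeGroup.Generators F) →* Pi1 X x₀ :=
      i.comp (IsFreeGroup.toFreeGroup F).symm.toMonoidHom
    have key : ∀ v, Θ v 1 x = x ∧ (Θ v).hol c x = B.mulIndicator (fun _ => j v) x := by
      have hmul : ∀ u v, B.mulIndicator (fun _ => j (u * v)) x =
          B.mulIndicator (fun _ => j u) x * B.mulIndicator (fun _ => j v) x := by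
        intro u v
        by_cases hxB : x ∈ B <;> simp [hxB]
      intro v
      induction v using FreeGroup.induction_on with
      | C1 =>
        rw [map_one, map_one]
        simp
      | of k =>
        have : Θ (FreeGroup.of k) = Φ k := FreeGroup.lift_apply_of
        rw [this]
        exact hΦ k x (mem_univ x) (hxE k)
      | inv_of k h =>
        have e1 : (Θ (FreeGroup.of k) 1).symm x = x := (Θ (FreeGroup.of k) 1).symm_apply_eq.2 h.1.symm
        rw [map_inv, Isotopy.inv_apply, Isotopy.hol_inv, e1, h.2]
        refine ⟨rfl, ?_⟩
        by_cases hxB : x ∈ B <;> simp [hxB]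
      | mul u v hu hv =>
        rw [map_mul, Isotopy.mul_apply, Isotopy.hol_mul, hu.1, hu.2, hv.1, hv.2, hmul]
        exact ⟨rfl, rfl⟩
    have h := key (IsFreeGroup.toFreeGroup F w)
    have e : j (IsFreeGroup.toFreeGroup F w) = i w := by simp [j]
    rw [e] at h
    exact h

variable [SecondCountableTopology X] [IsFiniteMeasure μ]

theorem coboundary_gammaCochain (hX : LocallySimplyConnected X)
    (hZ : Subgroup.center (Pi1 X x₀) = ⊥) {S : PathSystem x₀} (hS : S.IsMeasurable μ) (n : ℕ)
    (a : Cochain (Pi1 X x₀) n) :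
    coboundary (Homeo0 μ) n (gammaCochain hX hZ hS n a) =
      gammaCochain hX hZ hS (n + 1) (coboundary (Pi1 X x₀) n a) :=
  Cochain.ext <| funext fun f => by
    change ∑ i : Fin (n + 2), (-1 : ℝ) ^ (i : ℕ) *
        ∫ x, a (fun j => cocycleGamma S (f (i.succAbove j)) x) ∂μ =
      ∫ x, ∑ i : Fin (n + 2), (-1 : ℝ) ^ (i : ℕ) *
        a (fun j => cocycleGamma S (f (i.succAbove j)) x) ∂μ
    rw [integral_finsetSum _ fun i _ =>
      (integrable_cocycleGamma hX hS a fun j => f (i.succAbove j)).const_mul _]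
    exact Finset.sum_congr rfl fun i _ => (integral_const_mul _ _).symm

/-- Cohomologous cocycles give bounds for the seminorm of a class. -/
theorem seminorm_le_of_coboundary {G : Type*} [Group G] {n : ℕ} (t : Cocycle G (n + 1))
    (b : Cochain G n) {K : ℝ} (hK : ∀ g, |t.1 g - coboundary G n b g| ≤ K) :
    (Hb.mk t).seminorm ≤ K := by
  let r : Cocycle G (n + 1) := t - ⟨coboundary G n b, coboundary_coboundary b⟩
  have hr : Hb.mk r = Hb.mk t := by
    rw [Submodule.Quotient.eq]
    refine ⟨-b, ?_⟩
    rw [map_neg]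
    simp [r]
  have hs : (Hb.mk t).seminorm ≤ r.1.supNorm := by
    refine csInf_le ⟨0, ?_⟩ ⟨r, hr, rfl⟩
    rintro _ ⟨c, -, rfl⟩
    exact Real.iSup_nonneg fun g => abs_nonneg _
  refine hs.trans (ciSup_le fun g => ?_)
  have hg : r.1 g = t.1 g - coboundary G n b g := by
    change t.1 g + -1 * coboundary G n b g = _
    ring
  rw [hg]
  exact hK g

/-- The pull-back of `Γ_b` under a suitable homomorphism from a free group is close to a multiple
of the pull-back under `i`. -/
theorem exists_hom_seminorm_le (hX : LocallySimplyConnected X)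
    (hZ : Subgroup.center (Pi1 X x₀) = ⊥) {S : PathSystem x₀} (hS : S.IsMeasurable μ)
    {F : Type*} [Group F] [IsFreeGroup F] (i : F →* Pi1 X x₀) (hi : Function.Injective i)
    {c : PathSystem x₀} {V B : Set X} (hVo : IsOpen V) (hV : IsSimplyConnected V) (hx₀ : x₀ ∈ V)
    (hc : c.Inside V) (hBV : B ⊆ V) (hBm : MeasurableSet B)
    (hB : ∀ g, RealisesOn μ c univ (B.mulIndicator fun _ => g)) {ε : ℝ} (hε : 0 < ε) :
    ∃ ρ : F →* Homeo0 μ, ∀ n ≥ 1, ∀ C : Hb n (Pi1 X x₀),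
      (Hb.pullback ρ n (gammaB hX hZ hS n C) - μ.real B • Hb.pullback i n C).seminorm ≤
        ε * C.seminorm := by
  have hcount : Countable (Pi1 X x₀) := by
    have := countable_quotient hX x₀ x₀
    exact Pi1.of_surjective.countable
  have : Countable F := hi.countable
  obtain ⟨Θ, E, hEm, hE, hΘ⟩ := exists_hom_hol hB i
    (ENNReal.ofReal_pos.2 (half_pos hε) : 0 < ENNReal.ofReal (ε / 2))
  have hEr : μ.real E ≤ ε / 2 := ENNReal.toReal_le_of_le_ofReal (half_pos hε).le hE
  let ρ : F →* Homeo0 μ := (Isotopy.toHomeo0Hom μ).comp Θ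
  -- Endpoints fix these points, so passing from `c` to `S` conjugates the holonomy by an element
  -- which does not depend on `w`.
  have hγ : ∀ x ∉ E, ∀ w, cocycleGamma S (ρ w) x =
      pathDiff S c x * B.mulIndicator (fun _ => i w) x * (pathDiff S c x)⁻¹ := by
    intro x hx w
    have h1 : cocycleGamma S (ρ w) x = (Θ w).hol S x := cocycleGamma_toHomeo0 hZ S (Θ w) x
    rw [h1, Isotopy.hol_eq_conj S c (hΘ x hx w).1, (hΘ x hx w).2]
  refine ⟨ρ, fun n hn C => ?_⟩
  obtain ⟨n, rfl⟩ : ∃ k, n = k + 1 := ⟨n - 1, by omega⟩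
  have key : ∀ a : Cocycle (Pi1 X x₀) (n + 1), Hb.mk a = C →
      (Hb.pullback ρ (n + 1) (gammaB hX hZ hS (n + 1) C) -
        μ.real B • Hb.pullback i (n + 1) C).seminorm ≤ ε * a.1.supNorm := by
    rintro ⟨a, ha⟩ rfl
    have ha' : coboundary _ (n + 1) a = 0 := ha
    let t : Cochain F (n + 1) := Cochain.pullback ρ (n + 1) (gammaCochain hX hZ hS (n + 1) a) -
      μ.real B • Cochain.pullback i (n + 1) a
    have ht : t ∈ Cocycle F (n + 1) := by
      have e1 : coboundary F (n + 1) (Cochain.pullback ρ (n + 1)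
          (gammaCochain hX hZ hS (n + 1) a)) = Cochain.pullback ρ (n + 2)
          (coboundary _ (n + 1) (gammaCochain hX hZ hS (n + 1) a)) := rfl
      have e2 : coboundary F (n + 1) (Cochain.pullback i (n + 1) a) =
          Cochain.pullback i (n + 2) (coboundary _ (n + 1) a) := rfl
      rw [LinearMap.mem_ker, map_sub, map_smul, e1, e2, coboundary_gammaCochain, ha', map_zero,
        map_zero, map_zero, smul_zero, sub_zero]
    have hβ : ∀ w : Fin (n + 1) → F, IntegrableOn
        (fun x => prism (pathDiff S c x)⁻¹ a fun j => i (w j)) (B \ E) μ := fun w =>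
      integrableOn_pathDiff (f := fun g => prism g⁻¹ a fun j => i (w j)) hS hVo hV hx₀ hc
        (sdiff_subset.trans hBV) fun g => abs_prism_le _ a _
    -- The integral over `B \ E` of the prism for right multiplication by `(pathDiff S c x)⁻¹`. It
    -- is bounded because the prism bound does not involve the multiplier, and it accounts for the
    -- conjugation.
    let b₁ : Cochain F n :=
      { toFun := fun w => ∫ x in B \ E, prism (pathDiff S c x)⁻¹ a (fun j => i (w j)) ∂μ
        bounded := ⟨(n + 1) * a.supNorm * μ.real (B \ E), fun w =>
          norm_setIntegral_le_of_norm_le_const (measure_lt_top _ _) fun x _ =>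
            (Real.norm_eq_abs _).trans_le (abs_prism_le _ a _)⟩
        invariant := fun h w => by
          simp only [map_mul]
          refine integral_congr_ae (Eventually.of_forall fun x => ?_)
          exact (prism (pathDiff S c x)⁻¹ a).invariant (i h) fun j => i (w j) }
    obtain ⟨b₂, hb₂⟩ := exists_coboundary_eq_const ha' (G' := F) (μ.real (Eᶜ \ B))
    refine seminorm_le_of_coboundary ⟨t, ht⟩ (b₁ + b₂) fun w => ?_
    set f : X → ℝ := fun x => a fun j => cocycleGamma S (ρ (w j)) x with hf
    have hfi : Integrable f μ := integrable_cocycleGamma hX hS a fun j => ρ (w j)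
    have htw : t w = ∫ x, f x ∂μ - μ.real B * a fun j => i (w j) := by
      change ∫ x, f x ∂μ + -1 * (μ.real B * a fun j => i (w j)) = _
      ring
    have hD : ∫ x in B \ E, f x ∂μ =
        coboundary F n b₁ w + μ.real (B \ E) * a fun j => i (w j) := by
      have e1 : ∀ x ∈ B \ E, f x =
          (∑ l : Fin (n + 2), (-1 : ℝ) ^ (l : ℕ) *
            prism (pathDiff S c x)⁻¹ a (fun j => i (w (l.succAbove j)))) +
            a fun j => i (w j) := by
        intro x hx
        have e2 := coboundary_prism (pathDiff S c x)⁻¹ ha' fun j => i (w j)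
        rw [coboundary_apply] at e2
        rw [e2, sub_add_cancel]
        simp only [hf, hγ x hx.2, mulIndicator_of_mem hx.1, mul_assoc]
        exact a.invariant _ _
      rw [setIntegral_congr_fun (hBm.diff hEm) e1, integral_add
        (integrable_finsetSum _ fun l _ => (hβ fun j => w (l.succAbove j)).const_mul _)
        (integrable_const _), integral_finsetSum _ fun l _ =>
        (hβ fun j => w (l.succAbove j)).const_mul _, setIntegral_const, smul_eq_mul]
      congr 1
      exact Finset.sum_congr rfl fun l _ => integral_const_mul _ _
    have hR : ∫ x in Eᶜ \ B, f x ∂μ = coboundary F n b₂ w := by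
      have e1 : ∀ x ∈ Eᶜ \ B, f x = a 1 := by
        intro x hx
        simp only [hf, hγ x hx.1, mulIndicator_of_notMem hx.2, mul_one, mul_inv_cancel]
        rfl
      rw [setIntegral_congr_fun (hEm.compl.diff hBm) e1, setIntegral_const, smul_eq_mul, hb₂]
      rfl
    have hsplit : ∫ x, f x ∂μ = ∫ x in E, f x ∂μ + (∫ x in B \ E, f x ∂μ +
        ∫ x in Eᶜ \ B, f x ∂μ) := by
      have e1 := integral_inter_add_sdiff (s := Eᶜ) hBm hfi.integrableOn
      rw [inter_comm, ← sdiff_eq] at e1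
      rw [e1, integral_add_compl hEm hfi]
    have hBE : μ.real B = μ.real (B ∩ E) + μ.real (B \ E) :=
      (measureReal_inter_add_sdiff hEm).symm
    -- After subtracting the coboundary of `b₁ + b₂`, only the integral over `E` and the missing
    -- part of `B` inside `E` remain. Each is at most `μ.real E * a.supNorm`, which explains the
    -- choice `ε / 2` above.
    have hfin : t w - coboundary F n (b₁ + b₂) w =
        ∫ x in E, f x ∂μ - μ.real (B ∩ E) * a fun j => i (w j) := by
      rw [map_add, Cochain.add_apply, htw, hsplit, hD, hR, hBE]
      ring
    have hnn : 0 ≤ a.supNorm := (abs_nonneg _).trans (a.abs_le_supNorm 1)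
    have h1 : |∫ x in E, f x ∂μ| ≤ a.supNorm * μ.real E :=
      norm_setIntegral_le_of_norm_le_const (measure_lt_top _ _) fun x _ =>
        (Real.norm_eq_abs _).trans_le (a.abs_le_supNorm _)
    have h2 : |μ.real (B ∩ E) * a fun j => i (w j)| ≤ μ.real E * a.supNorm := by
      rw [abs_mul, abs_of_nonneg measureReal_nonneg]
      exact mul_le_mul (measureReal_mono inter_subset_right) (a.abs_le_supNorm _) (abs_nonneg _)
        measureReal_nonneg
    change |t w - coboundary F n (b₁ + b₂) w| ≤ _
    rw [hfin]
    refine (abs_sub _ _).trans ((add_le_add h1 h2).trans ?_)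
    change a.supNorm * μ.real E + μ.real E * a.supNorm ≤ ε * a.supNorm
    nlinarith
  -- `ρ` was chosen before the class and its cocycle, so the estimate holds for all representatives
  -- and one may pass to the infimum.
  rw [← div_le_iff₀' hε]
  refine le_csInf ?_ ?_
  · obtain ⟨a, rfl⟩ := Submodule.Quotient.mk_surjective _ C
    exact ⟨_, a, rfl, rfl⟩
  · rintro _ ⟨a, hav, rfl⟩
    rw [div_le_iff₀' hε]
    exact key a hav

end Estimate

/-! ### One-dimensional translation structures -/

section Translation

variable {X : Type*} [TopologicalSpace X]

/-- A simply connected open set with a coordinate taking values in an interval. -/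
structure TranslationChart (X : Type*) [TopologicalSpace X] where
  /-- The simply connected open set. -/
  nhd : Set X
  isOpen_nhd : IsOpen nhd
  isSimplyConnected_nhd : IsSimplyConnected nhd
  /-- The coordinate. -/
  coord : X → ℝ
  /-- The inverse of the coordinate. -/
  inv : ℝ → X
  continuousOn_inv : ContinuousOn inv (coord '' nhd)
  inv_coord : ∀ z ∈ nhd, inv (coord z) = z
  ordConnected : (coord '' nhd).OrdConnected

/-- The charts cover the space and differ locally by translations. -/
structure IsTranslationAtlas (𝒯 : Set (TranslationChart X)) : Prop where
  exists_mem : ∀ x, ∃ C ∈ 𝒯, x ∈ C.nhd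
  compat : ∀ C ∈ 𝒯, ∀ C' ∈ 𝒯, ∀ z ∈ C.nhd, z ∈ C'.nhd →
    ∀ᶠ y in 𝓝 z, C.coord y - C.coord z = C'.coord y - C'.coord z

/-- A curve which is parametrised by the coordinates of the charts. -/
def UnitSpeed (𝒯 : Set (TranslationChart X)) (E : ℝ → X) (J : Set ℝ) : Prop :=
  ContinuousOn E J ∧ ∀ s ∈ J, ∀ C ∈ 𝒯, E s ∈ C.nhd →
    ∀ᶠ t in 𝓝[J] s, C.coord (E t) = C.coord (E s) + (t - s)

variable {𝒯 : Set (TranslationChart X)}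

theorem UnitSpeed.mono {E : ℝ → X} {J J' : Set ℝ} (h : UnitSpeed 𝒯 E J) (hJ : J' ⊆ J) :
    UnitSpeed 𝒯 E J' :=
  ⟨h.1.mono hJ, fun s hs C hC hE => (h.2 s (hJ hs) C hC hE).filter_mono (nhdsWithin_mono _ hJ)⟩

theorem UnitSpeed.congr {E E' : ℝ → X} {J : Set ℝ} (h : UnitSpeed 𝒯 E J) (hE : EqOn E' E J) :
    UnitSpeed 𝒯 E' J := by
  refine ⟨h.1.congr hE, fun s hs C hC hs' => ?_⟩
  rw [hE hs] at hs' ⊢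
  filter_upwards [h.2 s hs C hC hs', self_mem_nhdsWithin] with t ht htJ
  rw [hE htJ, ht]

theorem UnitSpeed.union {E : ℝ → X} {J J' : Set ℝ} (h : UnitSpeed 𝒯 E J) (h' : UnitSpeed 𝒯 E J')
    (hJ : IsClosed J) (hJ' : IsClosed J') : UnitSpeed 𝒯 E (J ∪ J') := by
  refine ⟨h.1.union_of_isClosed h'.1 hJ hJ', fun s _ C hC hE => ?_⟩
  rw [nhdsWithin_union, eventually_sup]
  constructor
  · by_cases hs : s ∈ J
    · exact h.2 s hs C hC hE
    · rw [← hJ.closure_eq, notMem_closure_iff_nhdsWithin_eq_bot] at hs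
      rw [hs]
      exact eventually_bot
  · by_cases hs : s ∈ J'
    · exact h'.2 s hs C hC hE
    · rw [← hJ'.closure_eq, notMem_closure_iff_nhdsWithin_eq_bot] at hs
      rw [hs]
      exact eventually_bot

/-- Agreement at a parameter is open, since a coordinate determines the point and both curves
advance it equally, and closed by the Hausdorff property. -/
theorem UnitSpeed.eqOn [T2Space X] (h𝒯 : IsTranslationAtlas 𝒯) {E E' : ℝ → X} {J : Set ℝ}
    (h : UnitSpeed 𝒯 E J) (h' : UnitSpeed 𝒯 E' J) (hJ : IsPreconnected J) {s₀ : ℝ} (hs₀ : s₀ ∈ J)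
    (h0 : E s₀ = E' s₀) : EqOn E E' J := by
  have hev : ∀ s ∈ J, ∀ᶠ t in 𝓝[J] s, (E t = E' t) = (E s = E' s) := by
    intro s hs
    by_cases heq : E s = E' s
    · obtain ⟨C, hC, hsC⟩ := h𝒯.exists_mem (E s)
      filter_upwards [h.2 s hs C hC hsC, h'.2 s hs C hC (heq ▸ hsC),
        (h.1 s hs).eventually (C.isOpen_nhd.mem_nhds hsC),
        (h'.1 s hs).eventually (C.isOpen_nhd.mem_nhds (heq ▸ hsC))] with t h1 h2 h3 h4
      refine propext ⟨fun _ => heq, fun _ => ?_⟩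
      rw [← C.inv_coord _ h3, ← C.inv_coord _ h4, h1, h2, heq]
    · filter_upwards [((h.1 s hs).prodMk (h'.1 s hs)).eventually
        ((isClosed_diagonal (X := X)).isOpen_compl.mem_nhds heq)] with t ht
      exact propext ⟨fun h => absurd h ht, fun h => absurd h heq⟩
  have := isPreconnected_iff_preconnectedSpace.1 hJ
  have hloc : IsLocallyConstant fun t : J => E t = E' t := by
    rw [IsLocallyConstant.iff_eventually_eq]
    intro s
    have := hev s s.2
    rwa [nhdsWithin_eq_map_subtype_coe s.2, eventually_map] at this
  intro s hs
  have h1 := hloc.apply_eq_of_preconnectedSpace ⟨s, hs⟩ ⟨s₀, hs₀⟩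
  exact h1.mpr h0

/-- Paths which lift to paths with the same endpoints in an interval are homotopic. -/
theorem mk_eq_of_lift {E : ℝ → X} {J : Set ℝ} (hJ : Convex ℝ J) (hE : ContinuousOn E J) {a b : ℝ}
    (d d' : Path a b) (hd : ∀ t, d t ∈ J) (hd' : ∀ t, d' t ∈ J) {x y : X} (p p' : Path x y)
    (hp : ∀ t, p t = E (d t)) (hp' : ∀ t, p' t = E (d' t)) :
    Homotopic.Quotient.mk p = Homotopic.Quotient.mk p' := by
  obtain rfl : x = E a := by simpa using hp 0
  obtain rfl : y = E b := by simpa using hp 1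
  have ha : a ∈ J := by simpa using hd 0
  have hb : b ∈ J := by simpa using hd 1
  have : ContractibleSpace J := hJ.contractibleSpace ⟨a, ha⟩
  let r : Path (⟨a, ha⟩ : J) ⟨b, hb⟩ :=
    { toFun := fun t => ⟨d t, hd t⟩, source' := by simp, target' := by simp }
  let r' : Path (⟨a, ha⟩ : J) ⟨b, hb⟩ :=
    { toFun := fun t => ⟨d' t, hd' t⟩, source' := by simp, target' := by simp }
  let f : C(J, X) := ⟨J.domRestrict E, continuousOn_iff_continuous_domRestrict.1 hE⟩
  have h1 := (SimplyConnectedSpace.paths_homotopic r r').map f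
  have e1 : r.map f.continuous = p := by
    ext t
    exact (hp t).symm
  have e2 : r'.map f.continuous = p' := by
    ext t
    exact (hp' t).symm
  rw [e1, e2] at h1
  exact Homotopic.Quotient.eq.2 h1

/-- The class `q` is represented by a path on a curve of unit speed, from parameter `0` to `s`. -/
def Develops (𝒯 : Set (TranslationChart X)) {x₀ x : X} (q : Homotopic.Quotient x₀ x) (s : ℝ) :
    Prop :=
  ∃ (l r : ℝ) (E : ℝ → X) (d : Path 0 s) (p : Path x₀ x), UnitSpeed 𝒯 E (Icc l r) ∧
    (∀ t, d t ∈ Icc l r) ∧ (∀ t, p t = E (d t)) ∧ q = Homotopic.Quotient.mk p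

/-- Two curves of unit speed through `x₀` agree on the intersection of their intervals, which
contains the segment from `0` to `s`. Both classes are represented by the image of this segment,
intervals being contractible. -/
theorem Develops.unique [T2Space X] (h𝒯 : IsTranslationAtlas 𝒯) {x₀ x : X}
    {q q' : Homotopic.Quotient x₀ x} {s : ℝ} (h : Develops 𝒯 q s) (h' : Develops 𝒯 q' s) :
    q = q' := by
  obtain ⟨l, r, E, d, p, hE, hd, hp, rfl⟩ := h
  obtain ⟨l', r', E', d', p', hE', hd', hp', rfl⟩ := h'
  have m0 : (0 : ℝ) ∈ Icc l r ∩ Icc l' r' := ⟨by simpa using hd 0, by simpa using hd' 0⟩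
  have m1 : s ∈ Icc l r ∩ Icc l' r' := ⟨by simpa using hd 1, by simpa using hd' 1⟩
  have hconv : Convex ℝ (Icc l r ∩ Icc l' r') := (convex_Icc l r).inter (convex_Icc l' r')
  have e0 : E 0 = x₀ := by simpa using (hp 0).symm
  have e1 : E s = x := by simpa using (hp 1).symm
  have e0' : E' 0 = x₀ := by simpa using (hp' 0).symm
  have heq := (hE.mono inter_subset_left).eqOn h𝒯 (hE'.mono inter_subset_right)
    hconv.isPreconnected m0 (e0.trans e0'.symm)
  let L : Path 0 s := { toFun := fun t => t * s, source' := by simp, target' := by simp }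
  have hL : ∀ t, L t ∈ Icc l r ∩ Icc l' r' := fun t => by
    have := hconv.smul_mem_of_zero_mem m0 m1 t.2
    rwa [smul_eq_mul] at this
  let pL : Path x₀ x :=
    { toFun := fun t => E (L t)
      continuous_toFun := hE.1.comp_continuous L.continuous fun t => (hL t).1
      source' := by simpa using e0
      target' := by simpa using e1 }
  rw [mk_eq_of_lift (convex_Icc l r) hE.1 d L hd (fun t => (hL t).1) p pL hp fun _ => rfl]
  exact mk_eq_of_lift (convex_Icc l' r') hE'.1 L d' (fun t => (hL t).2) hd' pL p'
    (fun t => heq (hL t)) hp'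

theorem Develops.refl (x₀ : X) :
    Develops 𝒯 (Homotopic.Quotient.refl x₀) 0 := by
  refine ⟨0, 0, fun _ => x₀, Path.refl 0, Path.refl x₀, ⟨continuousOn_const, fun s hs C hC hx => ?_⟩,
    fun t => by simp, fun t => rfl, rfl⟩
  filter_upwards [self_mem_nhdsWithin] with t ht
  rw [Icc_self] at hs ht
  rw [hs, ht, sub_self, add_zero]

theorem TranslationChart.unitSpeed_inv (h𝒯 : IsTranslationAtlas 𝒯) {C : TranslationChart X}
    (hC : C ∈ 𝒯) {J : Set ℝ} {k : ℝ} (hJ : ∀ t ∈ J, k + t ∈ C.coord '' C.nhd) :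
    UnitSpeed 𝒯 (fun t => C.inv (k + t)) J := by
  have hcont : ContinuousOn (fun t => C.inv (k + t)) J :=
    C.continuousOn_inv.comp (by fun_prop) hJ
  have hmem : ∀ t ∈ J, C.inv (k + t) ∈ C.nhd ∧ C.coord (C.inv (k + t)) = k + t := by
    intro t ht
    obtain ⟨z, hz, hzt⟩ := hJ t ht
    rw [← hzt, C.inv_coord z hz]
    exact ⟨hz, rfl⟩
  refine ⟨hcont, fun s hs C' hC' hs' => ?_⟩
  filter_upwards [(hcont s hs).eventually (h𝒯.compat C hC C' hC' _ (hmem s hs).1 hs'),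
    self_mem_nhdsWithin] with t ht htJ
  rw [(hmem s hs).2, (hmem t htJ).2] at ht
  linarith

/-- The curve is continued by the inverse coordinate of the chart. The new parameter may fall back
into the old interval; there the continuation agrees with the old curve by uniqueness, so the two
can be glued. -/
theorem Develops.step [T2Space X] (h𝒯 : IsTranslationAtlas 𝒯) {C : TranslationChart X}
    (hC : C ∈ 𝒯) {x₀ x y : X} (ρ : Path x y) (hρ : ∀ t, ρ t ∈ C.nhd)
    {q : Homotopic.Quotient x₀ x} {s : ℝ} (h : Develops 𝒯 q s) :
    Develops 𝒯 (q.trans (Homotopic.Quotient.mk ρ)) (s + (C.coord y - C.coord x)) := by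
  classical
  obtain ⟨l, r, E, d, p, hE, hd, hp, rfl⟩ := h
  set s' := s + (C.coord y - C.coord x) with hs'
  have hx : x ∈ C.nhd := by simpa using hρ 0
  have hy : y ∈ C.nhd := by simpa using hρ 1
  have hs : s ∈ Icc l r := by simpa using hd 1
  let k := C.coord x - s
  have hJ : ∀ t ∈ uIcc s s', k + t ∈ C.coord '' C.nhd := by
    intro t ht
    refine C.ordConnected.uIcc_subset ⟨x, hx, rfl⟩ ⟨y, hy, rfl⟩ ?_
    have e : C.coord y = k + s' := by simp only [k, hs']; ring
    have e' : C.coord x = k + s := by simp only [k]; ring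
    rw [e, e', ← Set.image_const_add_uIcc]
    exact ⟨t, ht, rfl⟩
  have hE₁ := C.unitSpeed_inv h𝒯 hC hJ
  set E₁ : ℝ → X := fun t => C.inv (k + t) with hE₁d
  have h1s : E₁ s = x := by
    simp only [hE₁d, k, sub_add_cancel]
    exact C.inv_coord x hx
  have h1s' : E₁ s' = y := by
    simp only [hE₁d, k, hs']
    rw [show C.coord x - s + (s + (C.coord y - C.coord x)) = C.coord y by ring]
    exact C.inv_coord y hy
  have hEs : E s = x := by simpa using (hp 1).symm
  have heq : EqOn E E₁ (Icc l r ∩ uIcc s s') :=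
    (hE.mono inter_subset_left).eqOn h𝒯 (hE₁.mono inter_subset_right)
      ((convex_Icc l r).inter (convex_uIcc s s')).isPreconnected ⟨hs, left_mem_uIcc⟩
      (hEs.trans h1s.symm)
  let E₂ : ℝ → X := (uIcc s s').piecewise E₁ E
  have h2 : EqOn E₂ E (Icc l r) := by
    intro t ht
    by_cases htJ : t ∈ uIcc s s'
    · simp only [E₂, piecewise_eq_of_mem _ _ _ htJ]
      exact (heq ⟨ht, htJ⟩).symm
    · simp only [E₂, piecewise_eq_of_notMem _ _ _ htJ]
  have h2' : EqOn E₂ E₁ (uIcc s s') := fun t ht => piecewise_eq_of_mem _ _ _ ht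
  have hE₂ := (hE.congr h2).union (hE₁.congr h2') isClosed_Icc isClosed_Icc
  have hunion : Icc l r ∪ uIcc s s' = Icc (min l (min s s')) (max r (max s s')) :=
    Icc_union_Icc' (inf_le_left.trans hs.2) (hs.1.trans le_sup_left)
  let e : Path s s' :=
    { toFun := fun t => s + t * (s' - s)
      source' := by simp
      target' := by simp }
  have he : ∀ t, e t ∈ uIcc s s' := by
    intro t
    have := (convex_uIcc s s').add_smul_sub_mem left_mem_uIcc right_mem_uIcc t.2
    rwa [smul_eq_mul] at this
  let σ : Path x y :=
    { toFun := fun t => E₁ (e t)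
      continuous_toFun := hE₁.1.comp_continuous e.continuous he
      source' := by simpa using h1s
      target' := by simpa using h1s' }
  have hσ : ∀ t, σ t ∈ C.nhd := by
    intro t
    obtain ⟨z, hz, hzt⟩ := hJ _ (he t)
    change C.inv (k + e t) ∈ C.nhd
    rw [← hzt, C.inv_coord z hz]
    exact hz
  refine ⟨_, _, E₂, d.trans e, p.trans σ, hunion ▸ hE₂, fun t => ?_, fun t => ?_, ?_⟩
  · rw [← hunion]
    have h3 : d.trans e t ∈ range (d.trans e) := mem_range_self t
    rw [Path.trans_range] at h3
    rcases h3 with ⟨u, hu⟩ | ⟨u, hu⟩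
    · exact Or.inl (hu ▸ hd u)
    · exact Or.inr (hu ▸ he u)
  · rw [Path.trans_apply, Path.trans_apply]
    split_ifs
    · rw [h2 (hd _), hp]
    · rw [h2' (he _)]
      rfl
  · rw [mk_eq_of_isSimplyConnected C.isSimplyConnected_nhd ρ σ hρ hσ,
      Homotopic.Quotient.mk_trans]

/-- Along a path the parameter changes by an amount depending only on the path. -/
theorem exists_increment [T2Space X] (h𝒯 : IsTranslationAtlas 𝒯) (x₀ : X) {a b : X} (p : Path a b) :
    ∃ σ : ℝ, ∀ (q : Homotopic.Quotient x₀ a) (s : ℝ), Develops 𝒯 q s →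
      Develops 𝒯 (q.trans (Homotopic.Quotient.mk p)) (s + σ) := by
  have key : ∀ (u v : X) (hu : u = a) (hv : v = b), (∃ σ : ℝ, ∀ (q : Homotopic.Quotient x₀ u)
      (s : ℝ), Develops 𝒯 q s →
        Develops 𝒯 (q.trans (Homotopic.Quotient.mk (p.cast hu hv))) (s + σ)) →
      ∃ σ : ℝ, ∀ (q : Homotopic.Quotient x₀ a) (s : ℝ), Develops 𝒯 q s →
        Develops 𝒯 (q.trans (Homotopic.Quotient.mk p)) (s + σ) := by
    rintro u v rfl rfl h
    exact h
  refine key (p 0) (p 1) p.source p.target ?_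
  have hcast : p.cast p.source p.target = p.subpath 0 1 := by
    ext u
    simp
  rw [hcast]
  let T : unitInterval → Prop := fun t => ∃ σ : ℝ, ∀ (q : Homotopic.Quotient x₀ (p 0)) (s : ℝ),
    Develops 𝒯 q s → Develops 𝒯 (q.trans (Homotopic.Quotient.mk (p.subpath 0 t))) (s + σ)
  have hsub : ∀ t t', Homotopic.Quotient.mk (p.subpath 0 t') =
      (Homotopic.Quotient.mk (p.subpath 0 t)).trans (Homotopic.Quotient.mk (p.subpath t t')) := by
    intro t t'
    rw [← Homotopic.Quotient.mk_trans]
    exact (Homotopic.Quotient.eq.2 ⟨Path.Homotopy.subpathTransSubpath p 0 t t'⟩).symm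
  have hstep : ∀ C ∈ 𝒯, ∀ t t' : unitInterval, (∀ u ∈ uIcc t t', p u ∈ C.nhd) → T t → T t' := by
    rintro C hC t t' hu ⟨σ, hσ⟩
    have hs : ∀ u, p.subpath t t' u ∈ C.nhd := by
      intro u
      have : p.subpath t t' u ∈ range (p.subpath t t') := mem_range_self u
      rw [Path.range_subpath] at this
      obtain ⟨v, hv, hv'⟩ := this
      rw [← hv']
      exact hu v hv
    refine ⟨σ + (C.coord (p t') - C.coord (p t)), fun q s h => ?_⟩
    rw [hsub t t', ← Homotopic.Quotient.trans_assoc, ← add_assoc]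
    exact (hσ q s h).step h𝒯 hC _ hs
  have hloc : IsLocallyConstant T := by
    rw [IsLocallyConstant.iff_eventually_eq]
    intro t
    obtain ⟨C, hC, htC⟩ := h𝒯.exists_mem (p t)
    have hn : p ⁻¹' C.nhd ∈ 𝓝 t := p.continuous.continuousAt (C.isOpen_nhd.mem_nhds htC)
    obtain ⟨ε, hε, hb⟩ := Metric.mem_nhds_iff.1 hn
    filter_upwards [Metric.ball_mem_nhds t hε] with t' ht'
    have hu : ∀ u ∈ uIcc t t', p u ∈ C.nhd := fun u hu => hb <| by
      rw [Metric.mem_ball, Subtype.dist_eq, Real.dist_eq] at ht' ⊢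
      have h1 : (u : ℝ) ∈ uIcc (t : ℝ) t' := by
        rcases le_total t t' with h | h
        · rw [uIcc_of_le h] at hu
          rw [uIcc_of_le (show (t : ℝ) ≤ t' from h)]
          exact hu
        · rw [uIcc_of_ge h] at hu
          rw [uIcc_of_ge (show (t' : ℝ) ≤ t from h)]
          exact hu
      exact (abs_sub_left_of_mem_uIcc h1).trans_lt ht'
    exact propext ⟨hstep C hC t' t fun u hu' => hu u (by rwa [uIcc_comm]), hstep C hC t t' hu⟩
  have hT0 : T 0 := by
    refine ⟨0, fun q s h => ?_⟩
    have hrefl : p.subpath 0 0 = Path.refl (p 0) := by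
      ext u
      simp
    rwa [hrefl, Homotopic.Quotient.mk_refl, Homotopic.Quotient.trans_refl, add_zero]
  have hT1 : T 1 := by
    have := hloc.apply_eq_of_isPreconnected isPreconnected_univ (mem_univ 0) (mem_univ 1)
    rwa [← this]
  exact hT1

/-- The fundamental group of a space with a translation structure is commutative. -/
theorem pi1_comm_of_translationAtlas [T2Space X] (h𝒯 : IsTranslationAtlas 𝒯) {x₀ : X}
    (g h : Pi1 X x₀) : g * h = h * g := by
  obtain ⟨q, rfl⟩ := Pi1.of_surjective g
  obtain ⟨q', rfl⟩ := Pi1.of_surjective h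
  obtain ⟨p, rfl⟩ := Homotopic.Quotient.mk_surjective q
  obtain ⟨p', rfl⟩ := Homotopic.Quotient.mk_surjective q'
  obtain ⟨σ, hσ⟩ := exists_increment h𝒯 x₀ p
  obtain ⟨σ', hσ'⟩ := exists_increment h𝒯 x₀ p'
  have h0 := Develops.refl (𝒯 := 𝒯) x₀
  -- The increment depends only on the path, not on the class before it. So both products develop to
  -- the parameter `σ + σ'` and coincide by uniqueness.
  have h1 := hσ' _ _ (hσ _ _ h0)
  have h2 := hσ _ _ (hσ' _ _ h0)
  rw [Homotopic.Quotient.refl_trans] at h1 h2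
  rw [add_right_comm] at h2
  rw [← Pi1.of_trans, ← Pi1.of_trans, h1.unique h𝒯 h2]

end Translation

/-! ### Manifolds of dimension at most one -/

section LowDimension

theorem pi1_comm_of_subsingleton {X : Type*} [TopologicalSpace X] [Subsingleton X] {x₀ : X}
    (g h : Pi1 X x₀) : g * h = h * g := by
  have key : ∀ g : Pi1 X x₀, g = 1 := by
    intro g
    obtain ⟨q, rfl⟩ := Pi1.of_surjective g
    obtain ⟨p, rfl⟩ := Homotopic.Quotient.mk_surjective q
    obtain rfl : p = Path.refl x₀ := by
      ext t
      exact Subsingleton.elim _ _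
    rfl
  rw [key g, key h]

theorem subsingleton_of_dim_zero {H : Type*} [TopologicalSpace H]
    (I : ModelWithCorners ℝ (EuclideanSpace ℝ (Fin 0)) H)
    (M : Type*) [TopologicalSpace M] [ChartedSpace H M] [ConnectedSpace M] : Subsingleton M := by
  have : Subsingleton H := I.injective.subsingleton
  have hd : DiscreteTopology M := by
    refine discreteTopology_iff_isOpen_singleton.2 fun x => ?_
    have h : (chartAt H x).source = {x} := by
      refine Subset.antisymm (fun y hy => ?_) (singleton_subset_iff.2 (mem_chart_source H x))
      exact (chartAt H x).injOn hy (mem_chart_source H x) (Subsingleton.elim _ _)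
    rw [← h]
    exact (chartAt H x).open_source
  exact PreconnectedSpace.trivial_of_discrete

variable {H : Type*} [TopologicalSpace H] {I : ModelWithCorners ℝ (EuclideanSpace ℝ (Fin 1)) H}
  {M : Type*} [TopologicalSpace M] [ChartedSpace H M]

/-- The coordinate of the chart is locally a primitive of the volume form. -/
def IsPrimitive (Ω : VolumeForm I M) (C : TranslationChart M) : Prop :=
  ∃ (x : M) (P : EuclideanSpace ℝ (Fin 1) → ℝ), C.nhd ⊆ (extChartAt I x).source ∧
    ∀ z ∈ C.nhd, C.coord z = P (extChartAt I x z) ∧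
      HasFDerivAt P (chartCoefficient Ω.form x (extChartAt I x z) •
        (EuclideanSpace.proj 0 : EuclideanSpace ℝ (Fin 1) →L[ℝ] ℝ)) (extChartAt I x z)

theorem det_mul_apply_zero (T : EuclideanSpace ℝ (Fin 1) →L[ℝ] EuclideanSpace ℝ (Fin 1))
    (v : EuclideanSpace ℝ (Fin 1)) : T v 0 = T.det * v 0 := by
  have h := alternating_comp_single
    (((EuclideanSpace.proj 0 : EuclideanSpace ℝ (Fin 1) →L[ℝ] ℝ) :
      EuclideanSpace ℝ (Fin 1) →ₗ[ℝ] ℝ).compAlternatingMap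
        (AlternatingMap.ofSubsingleton ℝ _ _ (0 : Fin 1) LinearMap.id)) T
  have hv : v = v 0 • EuclideanSpace.single (0 : Fin 1) (1 : ℝ) := by
    ext i
    rw [Subsingleton.elim i 0]
    simp
  have h1 : T (EuclideanSpace.single (0 : Fin 1) (1 : ℝ)) 0 = T.det := by
    simpa using h
  conv_lhs => rw [hv]
  rw [map_smul, PiLp.smul_apply, h1, smul_eq_mul, mul_comm]

variable [IsManifold I ∞ M]

/-- In a common coordinate both functions are primitives of the same form, so their difference has
zero derivative on a convex set. The set is a ball intersected with the range of the model, which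
covers endpoints of the manifold. -/
theorem IsPrimitive.compat {Ω : VolumeForm I M} {C C' : TranslationChart M}
    (hC : IsPrimitive Ω C) (hC' : IsPrimitive Ω C') {z : M} (hz : z ∈ C.nhd) (hz' : z ∈ C'.nhd) :
    ∀ᶠ y in 𝓝 z, C.coord y - C.coord z = C'.coord y - C'.coord z := by
  obtain ⟨x, P, hs, hP⟩ := hC
  obtain ⟨x', P', hs', hP'⟩ := hC'
  let φ := extChartAt I x
  let φ' := extChartAt I x'
  let τ := φ' ∘ φ.symm
  have hsz : φ.source ∈ 𝓝 z := extChartAt_source_mem_nhds' (hs hz)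
  have h1 : φ.target ∩ φ.symm ⁻¹' (C.nhd ∩ C'.nhd) ∈ 𝓝[range I] (φ z) := by
    refine inter_mem (extChartAt_target_mem_nhdsWithin' (hs hz)) ?_
    refine (continuousAt_extChartAt_symm' (hs hz)).continuousWithinAt.preimage_mem_nhdsWithin ?_
    rw [φ.left_inv (hs hz)]
    exact (C.isOpen_nhd.inter C'.isOpen_nhd).mem_nhds ⟨hz, hz'⟩
  obtain ⟨ρ, hρ, hball⟩ := Metric.mem_nhdsWithin_iff.1 h1
  let A := Metric.ball (φ z) ρ ∩ range I
  have hA : Convex ℝ A := (convex_ball _ _).inter I.convex_range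
  have hd : ∀ y ∈ A, HasFDerivWithinAt (fun y => P' (τ y) - P y)
      (0 : EuclideanSpace ℝ (Fin 1) →L[ℝ] ℝ) A y := by
    intro y hy
    obtain ⟨hyt, hyC, hyC'⟩ := hball hy
    have e1 : φ (φ.symm y) = y := φ.right_inv hyt
    have hτ : HasFDerivWithinAt τ (fderivWithin ℝ τ (range I) y) A y :=
      (((contDiffWithinAt_ext_coord_change x' x (y := y) ⟨hyt, hs' hyC'⟩ :
        ContDiffWithinAt ℝ ∞ τ (range I) y).differentiableWithinAt
          (by simp)).hasFDerivWithinAt).mono inter_subset_right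
    have hPy := (hP _ hyC).2
    have hPy' := (hP' _ hyC').2
    change HasFDerivAt P (chartCoefficient Ω.form x (φ (φ.symm y)) • _) (φ (φ.symm y)) at hPy
    change HasFDerivAt P' (chartCoefficient Ω.form x' (τ y) • _) (τ y) at hPy'
    rw [e1] at hPy
    have h2 := (hPy'.comp_hasFDerivWithinAt y hτ).sub hPy.hasFDerivWithinAt
    refine h2.congr_fderiv ?_
    ext v
    have h3 := Ω.chartCoefficient_change hyt (hs' hyC')
    have h4 := det_mul_apply_zero (fderivWithin ℝ τ (range I) y) v
    change chartCoefficient Ω.form x' (τ y) * (fderivWithin ℝ τ (range I) y) v 0 -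
      chartCoefficient Ω.form x y * v 0 = 0
    rw [h3, h4]
    change _ - (fderivWithin ℝ τ (range I) y).det * chartCoefficient Ω.form x' (τ y) * v 0 = 0
    ring
  have hcont : φ ⁻¹' Metric.ball (φ z) ρ ∈ 𝓝 z :=
    (continuousAt_extChartAt' (hs hz)).preimage_mem_nhds (Metric.ball_mem_nhds _ hρ)
  filter_upwards [hcont, hsz, C.isOpen_nhd.mem_nhds hz, C'.isOpen_nhd.mem_nhds hz']
    with y hy hys hyC hyC'
  have h5 := Convex.norm_image_sub_le_of_norm_hasFDerivWithin_le hd (C := 0) (fun _ _ => by simp) hA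
    (x := φ z) (y := φ y) ⟨Metric.mem_ball_self hρ, mem_range_self _⟩ ⟨hy, mem_range_self _⟩
  rw [zero_mul, norm_le_zero_iff] at h5
  have e1 : τ (φ y) = φ' y := congrArg φ' (φ.left_inv hys)
  have e2 : τ (φ z) = φ' z := congrArg φ' (φ.left_inv (hs hz))
  rw [e1, e2] at h5
  rw [(hP y hyC).1, (hP z hz).1, (hP' y hyC').1, (hP' z hz').1]
  change P (φ y) - P (φ z) = P' (φ' y) - P' (φ' z)
  linarith

/-- The density on a small ball is extended to the line and integrated; multiplying by the sign `σ`
turns the primitive of the absolute value into one of the signed coefficient. Boundary points are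
kept, because here the charts must cover everything. -/
theorem exists_isPrimitive (Ω : VolumeForm I M) (x : M) :
    ∃ C : TranslationChart M, IsPrimitive Ω C ∧ x ∈ C.nhd := by
  obtain ⟨r, hr, h, -⟩ := exists_coordNhd (I := I) x univ_mem
  let φ := extChartAt I x
  let Q := Metric.closedBall (φ x) r ∩ range I
  have hQc : IsCompact Q := (isCompact_closedBall _ _).inter_right I.isClosed_range
  have hQne : Q.Nonempty := ⟨φ x, Metric.mem_closedBall_self hr.le, mem_range_self _⟩
  have hQconv : Convex ℝ Q := (convex_closedBall _ _).inter I.convex_range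
  have hcoef : ContinuousOn (chartCoefficient Ω.form x) φ.target := (Ω.smooth x).continuousOn
  have hcoef0 : ∀ y ∈ φ.target, chartCoefficient Ω.form x y ≠ 0 := fun y hy =>
    Ω.chartCoefficient_ne_zero hy
  obtain ⟨y₀, hy₀, hmin⟩ := hQc.exists_isMinOn hQne (hcoef.abs.mono h)
  let c := |chartCoefficient Ω.form x y₀|
  have hc : 0 < c := abs_pos.2 (hcoef0 y₀ (h hy₀))
  obtain ⟨σ, hσ, hσpos⟩ := exists_sign hQconv.isPreconnected (hcoef.mono h)
    fun y hy => hcoef0 y (h hy)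
  have hσ0 : σ ≠ 0 := left_ne_zero_of_mul (hσ ▸ one_ne_zero)
  obtain ⟨G, hG⟩ := ContinuousMap.exists_restrict_eq (Y := ℝ) hQc.isClosed
    ⟨_, continuousOn_iff_continuous_domRestrict.1 (hcoef.abs.mono h)⟩
  have hGQ : ∀ y ∈ Q, G y = |chartCoefficient Ω.form x y| := fun y hy =>
    congrArg (fun f : C(Q, ℝ) => f ⟨y, hy⟩) hG
  let e : EuclideanSpace ℝ (Fin 1) ≃L[ℝ] (Fin 1 → ℝ) := EuclideanSpace.equiv (Fin 1) ℝ
  let g : (Fin 1 → ℝ) → ℝ := fun y => max c (G (e.symm y))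
  have hg : Continuous g := continuous_const.max (G.continuous.comp e.symm.continuous)
  have hgc : ∀ y, c ≤ g y := fun y => le_max_left _ _
  have hgQ : ∀ y ∈ Q, g (e y) = |chartCoefficient Ω.form x y| := fun y hy => by
    simp only [g, ContinuousLinearEquiv.symm_apply_apply, hGQ y hy]
    exact max_eq_right (hmin hy)
  let Θ : EuclideanSpace ℝ (Fin 1) ≃ₜ ℝ := ((e.toHomeomorph.trans (straight 0 g 0 hg hc hgc)).trans
    (Homeomorph.funUnique (Fin 1) ℝ)).trans (Homeomorph.mulLeft₀ σ hσ0)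
  have hu : ∀ (w : Fin 1 → ℝ) (y : EuclideanSpace ℝ (Fin 1)), Function.update w 0 (y 0) = e y := by
    intro w y
    ext i
    rw [Subsingleton.elim i 0, Function.update_self]
    rfl
  have hΘ : ∀ y, Θ y = σ * linePrimitive 0 g 0 0 (y 0) := by
    intro y
    change σ * straightFun 0 g 0 (e y) 0 = _
    rw [straightFun_apply_same, ← hu 0 y, linePrimitive_update, Function.update_self]
  have hΘd : ∀ y, HasFDerivAt Θ ((σ * g (e y)) •
      (EuclideanSpace.proj 0 : EuclideanSpace ℝ (Fin 1) →L[ℝ] ℝ)) y := by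
    intro y
    have h1 := (hasDerivAt_linePrimitive (i := 0) (s := 0) hg 0 (y 0)).comp_hasFDerivAt y
      (EuclideanSpace.proj 0 : EuclideanSpace ℝ (Fin 1) →L[ℝ] ℝ).hasFDerivAt
    rw [hu] at h1
    have h2 := h1.const_mul σ
    rw [smul_smul] at h2
    exact h2.congr_of_eventuallyEq (Eventually.of_forall hΘ)
  have hV : ∀ w ∈ coordNhd I x r, φ w ∈ Q := fun w hw =>
    ⟨Metric.ball_subset_closedBall hw.2, mem_range_self _⟩
  have hcont : ContinuousOn (fun w => Θ (φ w)) (coordNhd I x r) :=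
    Θ.continuous.comp_continuousOn ((continuousOn_extChartAt x).mono fun w hw => hw.1)
  have hsc := isSimplyConnected_coordNhd hr h
  refine ⟨⟨coordNhd I x r, isOpen_coordNhd, hsc, fun w => Θ (φ w), fun t => φ.symm (Θ.symm t),
    ?_, fun w hw => ?_, ?_⟩, ⟨x, Θ, fun w hw => hw.1, fun w hw => ⟨rfl, ?_⟩⟩,
    mem_coordNhd hr⟩
  · refine (continuousOn_extChartAt_symm x).comp Θ.symm.continuous.continuousOn ?_
    rintro _ ⟨w, hw, rfl⟩
    simp only [Homeomorph.symm_apply_apply]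
    exact h (hV w hw)
  · rw [Homeomorph.symm_apply_apply]
    exact φ.left_inv hw.1
  · exact (hsc.isPathConnected.isConnected.isPreconnected.image _ hcont).ordConnected
  · have h1 := hΘd (φ w)
    rw [hgQ _ (hV w hw)] at h1
    have h2 := hσpos _ (hV w hw)
    have h3 : σ * |chartCoefficient Ω.form x (φ w)| = chartCoefficient Ω.form x (φ w) := by
      rcases mul_self_eq_one_iff.1 hσ with rfl | rfl
      · rw [one_mul] at h2 ⊢
        exact abs_of_pos h2
      · rw [abs_of_neg (by linarith)]
        ring
    rw [h3] at h1
    exact h1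

theorem pi1_comm_of_dim_one [T2Space M] (Ω : VolumeForm I M) {x₀ : M} (g h : Pi1 M x₀) :
    g * h = h * g :=
  pi1_comm_of_translationAtlas (𝒯 := {C | IsPrimitive Ω C})
    ⟨exists_isPrimitive Ω, fun _ hC _ hC' _ hz hz' => hC.compat hC' hz hz'⟩ g h

end LowDimension

/-! ### The atlas of Lebesgue charts of a manifold -/

section Main

variable {m : ℕ} {H : Type*} [TopologicalSpace H]
  {I : ModelWithCorners ℝ (EuclideanSpace ℝ (Fin m)) H}
  {M : Type*} [TopologicalSpace M] [ChartedSpace H M] [IsManifold I ∞ M]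
  [T2Space M] [MeasurableSpace M] [BorelSpace M]

theorem isLebesgueAtlas_straightening [Nontrivial (Fin m)] {Ω : VolumeForm I M} {μ : Measure M}
    (hμ : Ω.Induces μ) (k : Fin m) :
    IsLebesgueAtlas {C : LebesgueChart μ (Fin m) | IsStraightening Ω k C.chart} where
  exists_mem x W hW := by
    obtain ⟨r, hr, h, hrW⟩ := exists_coordNhd (I := I) x hW
    obtain ⟨C, hC, hn, -⟩ := exists_lebesgueChart hμ k x hr h
    refine ⟨C, hC, ?_, ?_⟩
    · rw [hn]
      exact mem_coordNhd hr
    · rw [hn]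
      exact coordNhd_subset.trans hrW
  germ _ hC _ hC' _ hz hz' := germ_of_isStraightening hC hC' hz hz'

theorem pathConnectedSpace_of_pathSystem {X : Type*} [TopologicalSpace X] {x₀ : X}
    (S : PathSystem x₀) : PathConnectedSpace X := by
  have h : ∀ x, Joined x₀ x := fun x => by
    obtain ⟨p, -⟩ := Homotopic.Quotient.mk_surjective (S x)
    exact ⟨p⟩
  exact ⟨⟨x₀⟩, fun x y => (h x).symm.trans (h y)⟩

theorem isClosedCoordinateBall_extChartAt {x : M} {r : ℝ} (hr : 0 < r)
    (h : Metric.closedBall (extChartAt I x x) r ∩ range I ⊆ (extChartAt I x).target) :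
    IsClosedCoordinateBall I x
      ((extChartAt I x).symm '' (Metric.closedBall (extChartAt I x x) r ∩ range I)) :=
  ⟨chartAt H x, IsManifold.chart_mem_maximalAtlas x, mem_chart_source H x, r, hr, h, rfl⟩

theorem exists_ball_hom_seminorm_le [SecondCountableTopology M] [Nontrivial (Fin m)]
    {Ω : VolumeForm I M} {μ : Measure M} (hμ : Ω.Induces μ) [IsFiniteMeasure μ]
    {x₀ : M} (hZ : Subgroup.center (Pi1 M x₀) = ⊥)
    {S : PathSystem x₀} (hS : S.IsMeasurable μ)
    {F : Type*} [Group F] [IsFreeGroup F] (i : F →* Pi1 M x₀) (hi : Function.Injective i)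
    {U : Set M} (hU : U ∈ 𝓝 x₀) :
    ∃ B ⊆ U, IsClosedCoordinateBall I x₀ B ∧
      ∀ ε > 0, ∃ ρ : F →* Homeo0 μ, ∀ n ≥ 1, ∀ C : Hb n (Pi1 M x₀),
        (Hb.pullback ρ n (gammaB (locallySimplyConnected_of_manifold I M) hZ hS n C) -
          μ.real B • Hb.pullback i n C).seminorm ≤ ε * C.seminorm := by
  obtain ⟨r, hr, h, hrU⟩ := exists_coordNhd (I := I) x₀ hU
  refine ⟨_, hrU, isClosedCoordinateBall_extChartAt hr h, fun ε hε => ?_⟩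
  obtain ⟨k, -, -⟩ := exists_pair_ne (Fin m)
  obtain ⟨C, hC, hn, hs⟩ := exists_lebesgueChart hμ k x₀ hr h
  have hx₀ : x₀ ∈ C.nhd := by
    rw [hn]
    exact mem_coordNhd hr
  have := pathConnectedSpace_of_pathSystem S
  obtain ⟨c, hc⟩ := exists_pathSystem_inside C.isSimplyConnected_nhd hx₀
  -- The construction is carried out on the domain of the Lebesgue chart, which differs from the
  -- closed ball by a null set.
  have hB : μ.real ((extChartAt I x₀).symm '' (Metric.closedBall (extChartAt I x₀ x₀) r ∩
      range I)) = μ.real C.chart.source := by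
    rw [hs]
    refine congrArg ENNReal.toReal (le_antisymm ?_
      (measure_mono (coordInt_subset.trans coordNhd_subset)))
    refine (measure_mono (subset_sdiff_union _ (coordInt I x₀ r))).trans ((measure_union_le _ _).trans ?_)
    rw [measure_closedBall_diff_coordInt hμ hr h, zero_add]
  rw [hB]
  exact exists_hom_seminorm_le _ hZ hS i hi C.isOpen_nhd C.isSimplyConnected_nhd hx₀ hc
    C.source_subset C.chart.open_source.measurableSet
    (realisesOn_source (isLebesgueAtlas_straightening hμ k) hC hc) hε

end Main

end GambaudoGhys

end

/-! ### The theorem, by dimension -/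

theorem lemma5p1 {m : ℕ} {H : Type*} [TopologicalSpace H]
    (I : ModelWithCorners ℝ (EuclideanSpace ℝ (Fin m)) H)
    {M : Type*} [TopologicalSpace M] [ChartedSpace H M] [IsManifold I ∞ M]
    [T2Space M] [SecondCountableTopology M] [ConnectedSpace M]
    [MeasurableSpace M] [BorelSpace M]
    (Ω : VolumeForm I M) (μ : Measure M) (hμ : Ω.Induces μ) [IsFiniteMeasure μ]
    (x₀ : M) (hZ : Subgroup.center (Pi1 M x₀) = ⊥)
    (S : PathSystem x₀) (hS : S.IsMeasurable μ)
    {F : Type*} [Group F] [IsFreeGroup F] (hF : ¬ ∀ a b : F, a * b = b * a)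
    (i : F →* Pi1 M x₀) (hi : Function.Injective i)
    (U : Set M) (hU : U ∈ 𝓝 x₀) :
    ∃ B ⊆ U, IsClosedCoordinateBall I x₀ B ∧
      ∀ ε > 0, ∃ ρ : F →* Homeo0 μ, ∀ n ≥ 1, ∀ C : Hb n (Pi1 M x₀),
        (Hb.pullback ρ n (gammaB (locallySimplyConnected_of_manifold I M) hZ hS n C) -
          μ.real B • Hb.pullback i n C).seminorm ≤ ε * C.seminorm := by
  rcases Nat.lt_or_ge 1 m with hm | hm
  · have : Nontrivial (Fin m) := Fin.nontrivial_iff_two_le.2 hm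
    exact exists_ball_hom_seminorm_le hμ hZ hS i hi hU
  -- In dimension at most one the fundamental group is commutative, so it cannot contain a
  -- non-abelian group.
  · have hcomm : ∀ g h : Pi1 M x₀, g * h = h * g := by
      obtain rfl | rfl := Nat.le_one_iff_eq_zero_or_eq_one.1 hm
      · have := subsingleton_of_dim_zero I M
        exact pi1_comm_of_subsingleton
      · exact pi1_comm_of_dim_one Ω
    exact absurd (fun a b => hi (by rw [map_mul, map_mul, hcomm])) hF
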